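/- **Setting.** Let $\Omega=(a,b)$ with $a<b$, $T>0$, and let $k\ge 1$ be an integer. Let $(u,q,p)$ be a solution of the linear problem ($F=0$) $$q-u_x=0,\quad p-q_x=0,\quad u_t+p_x=f\quad\text{in }\Omega\times(0,T],$$ with $u=u_0$ at $t=0$, $u=u_D$ on $\{a,b\}$, $q=q_N$ at $b$, where $f(t)\in L^2(\Omega)$ for $t\in(0,T]$. For a mesh $a=x_0<x_1<\dots<x_N=b$ put $I_i=(x_{i-1},x_i)$, $h=\max_i(x_i-x_{i-1})$, $\mathcal T_h=\{I_i\}$, and let $W_h^k$ be the space of functions that are polynomials of degree at most $k$ on each $I_i$; $H^{k+1}(\mathcal T_h)$ is the broken Sobolev space. On $\partial I_i=\{x_{i-1}^+,x_i^-\}$ let $n(x_{i-1}^+)=-1$, $n(x_i^-)=1$; put $(\varphi,v)=\sum_i\int_{I_i}\varphi v$ and $\langle\varphi,vn\rangle=\sum_i\big[(\varphi v)(x_i^-)-(\varphi v)(x_{i-1}^+)\big]$, and let $\|\cdot\|$ be the $L^2(\Omega)$ norm. A stabilization function consists of real values $\tau_{qu}^+,\tau_{pu}^+$ at the points $x_{i-1}^+$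 and $\tau_{qu}^-,\tau_{qp}^-$ at the points $x_i^-$, independent of $t$. **HDG method.** The approximation consists of $u_h,q_h,p_h\in W_h^k$, values $\widehat u_h$ at $x_0,\dots,x_N$ with $\widehat u_h=u_D$ at $a$ and $b$, and values $\widehat p_h^{\,-}$ at $x_1,\dots,x_N$, all depending on $t\in[0,T]$, with $u_h$ differentiable in $t$ on $[0,T]$, such that for $t\in(0,T]$ $$\begin{aligned}(q_h,v)+(u_h,v_x)-\langle\widehat u_h,vn\rangle&=0,\\(p_h,z)+(q_h,z_x)-\langle\widehat q_h,zn\rangle&=0,\\((u_h)_t,w)-(p_h,w_x)+\langle\widehat p_h,wn\rangle&=(f,w),\\\langle\widehat q_h,\mu n\rangle=q_N\,\mu(b),\qquad\langle\widehat p_h,\chi n\rangle&=0\end{aligned}$$ for all $v,z,w\in W_h^k$ and all functions $\mu,\chi$ on $\{x_0,\dots,x_N\}$ with $\mu(a)=0$, $\chi(a)=\chi(b)=0$, where $$\begin{aligned}\widehat p_h^{\,+}&=p_h^++\tau_{pu}^+(\widehat u_h-u_h^+)n^+,\qquad \widehat q_h^{\,+}=q_h^++\tau_{qu}^+(\widehat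 u_h-u_h^+)n^+,\\ \widehat q_h^{\,-}&=q_h^-+\tau_{qu}^-(\widehat u_h-u_h^-)n^-+\tau_{qp}^-(\widehat p_h^{\,-}-p_h^-)n^-.\end{aligned}$$ At $t=0$ the approximation solves the same equations with the third one replaced by $(u_h,w)-(p_h,w_x)+\langle\widehat p_h,wn\rangle=(u_0+(u_0)_{xxx},w)$. **Projection.** $\Pi(u,q,p)=(\Pi u,\Pi q,\Pi p)\in(W_h^k)^3$ is defined on each $I_i$, with $\delta_\omega=\omega-\Pi\omega$, by: $\delta_u,\delta_q,\delta_p$ are $L^2(I_i)$-orthogonal to polynomials of degree at most $k-1$; $\delta_p-\tau_{pu}^+\delta_un=0$ and $\delta_q-\tau_{qu}^+\delta_un=0$ at $x_{i-1}^+$; $\delta_q-\tau_{qu}^-\delta_un-\tau_{qp}^-\delta_pn=0$ at $x_i^-$. Put $\epsilon_\omega=\Pi\omega-\omega_h$ for $\omega=u,q,p$. **Theorem.** Let $0<m\le M$. There are constants $C>0$ and $h_0>0$, independent of the mesh and of the stabilization function (they may depend on $k,a,b,T,m,M$, on the data and on the solution $(u,q,p)$), such that the following holds for every mesh with $h\le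 h_0$. Suppose that $$(u,q,p)\in W^{2,\infty}((0,T];H^{k+1}(\mathcal T_h))\times W^{1,\infty}((0,T];H^{k+1}(\mathcal T_h))\times W^{1,\infty}((0,T];H^{k+1}(\mathcal T_h)),$$ and that the values of the stabilization function satisfy $m\le\tau_{qu}^-\le M$ and $$\tau_{qu}^->0,\quad \tau_{qu}^-\tau_{qp}^-=1,\quad \tau_{qu}^+\in[0,1],\quad \tau_{pu}^+\in\Big[-1-\sqrt{1-(\tau_{qu}^+)^2},\ -\tfrac12-\tfrac12(\tau_{qu}^+)^2\Big].$$ Then the projection $\Pi(u,q,p)(t)$ exists and is unique for every $t\in[0,T]$, $\Pi u$ is differentiable in $t$ on $[0,T]$, and every HDG approximation as above satisfies $$\|\epsilon_u(t)\|+\|\epsilon_q(t)\|+\|\epsilon_p(t)\|+\|(\epsilon_u)_t(t)\|\le C\,h^{k+1}\qquad\text{for }0\le t\le T.$$ (For constant values of the stabilization function one takes $m=M=\tau_{qu}^-$.) -/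

import Mathlib

open MeasureTheory Set Polynomial
open scoped ContDiff ENNReal

noncomputable section

namespace KdVHDG

/-! ### Sobolev spaces in space and in time -/

/-- `w` is the weak derivative of `v` on the open set `D ⊆ ℝ`. -/
def HasWeakDerivOn (D : Set ℝ) (v w : ℝ → ℝ) : Prop :=
  ∀ φ : ℝ → ℝ, ContDiff ℝ ∞ φ → HasCompactSupport φ → tsupport φ ⊆ D →
    ∫ x in D, v x * deriv φ x = -∫ x in D, w x * φ x

/-- Tuples of `m + 1` functions of `L²(D)`, with the Hilbert norm. -/
abbrev L2Tuple (m : ℕ) (D : Set ℝ) : Type :=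
  PiLp 2 (fun _ : Fin (m + 1) => Lp ℝ 2 (volume.restrict D))

theorem integrable_mul_test {D : Set ℝ} (v : Lp ℝ 2 (volume.restrict D)) {φ : ℝ → ℝ}
    (hφ : Continuous φ) (hs : HasCompactSupport φ) :
    Integrable (fun x => v x * φ x) (volume.restrict D) :=
  (Lp.memLp v).integrable_mul
    ((hφ.memLp_of_hasCompactSupport (p := 2) (μ := volume) hs).restrict D)

/-- The Sobolev space `H^m(D)` of an open set `D ⊆ ℝ`: an element is a function `v 0` of `L²(D)`
together with its weak derivatives `v 1, …, v m`, all in `L²(D)`. The norm inherited from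
`L2Tuple` is the usual one, `‖v‖² = ∑ j ≤ m, ‖v^(j)‖²`. -/
def sobolevSubmodule (m : ℕ) (D : Set ℝ) : Submodule ℝ (L2Tuple m D) where
  carrier := {v | ∀ j : Fin m, HasWeakDerivOn D (v j.castSucc) (v j.succ)}
  zero_mem' := by
    intro j φ _ _ _
    have h0 : ∀ i, (((0 : L2Tuple m D) i : Lp ℝ 2 (volume.restrict D)) : ℝ → ℝ)
        =ᵐ[volume.restrict D] 0 := fun i => Lp.coeFn_zero ℝ 2 _
    have e1 : ∫ x in D, ((0 : L2Tuple m D) j.castSucc) x * deriv φ x = 0 :=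
      integral_eq_zero_of_ae (by filter_upwards [h0 j.castSucc] with x hx; rw [hx]; simp)
    have e2 : ∫ x in D, ((0 : L2Tuple m D) j.succ) x * φ x = 0 :=
      integral_eq_zero_of_ae (by filter_upwards [h0 j.succ] with x hx; rw [hx]; simp)
    rw [e1, e2, neg_zero]
  add_mem' := by
    intro v w hv hw j φ h1 h2 h3
    have hadd : ∀ (i : Fin (m + 1)) (ψ : ℝ → ℝ), Continuous ψ → HasCompactSupport ψ →
        ∫ x in D, ((v + w) i) x * ψ x = (∫ x in D, v i x * ψ x) + ∫ x in D, w i x * ψ x := by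
      intro i ψ c s
      rw [← integral_add (integrable_mul_test (v i) c s) (integrable_mul_test (w i) c s)]
      refine integral_congr_ae ?_
      filter_upwards [Lp.coeFn_add (v i) (w i)] with x hx
      rw [PiLp.add_apply, hx, Pi.add_apply, add_mul]
    rw [hadd _ _ (h1.continuous_deriv (by simp)) h2.deriv, hadd _ _ h1.continuous h2,
      hv j φ h1 h2 h3, hw j φ h1 h2 h3]
    ring
  smul_mem' := by
    intro c v hv j φ h1 h2 h3
    have hsm : ∀ (i : Fin (m + 1)) (ψ : ℝ → ℝ),
        ∫ x in D, ((c • v) i) x * ψ x = c * ∫ x in D, v i x * ψ x := by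
      intro i ψ
      rw [← integral_const_mul]
      refine integral_congr_ae ?_
      filter_upwards [Lp.coeFn_smul c (v i)] with x hx
      rw [PiLp.smul_apply, hx, Pi.smul_apply, smul_eq_mul, mul_assoc]
    rw [hsm, hsm, hv j φ h1 h2 h3]
    ring

/-- The Sobolev space `H^m(D)` as a normed space. -/
abbrev SobolevH (m : ℕ) (D : Set ℝ) : Type := sobolevSubmodule m D

theorem continuous_integral_mul_test {m : ℕ} {D : Set ℝ} (i : Fin (m + 1)) {ψ : ℝ → ℝ}
    (c : Continuous ψ) (s : HasCompactSupport ψ) :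
    Continuous fun v : L2Tuple m D => ∫ x in D, v i x * ψ x := by
  have hψ := (c.memLp_of_hasCompactSupport (p := 2) (μ := volume) s).restrict D
  have h : (fun v : L2Tuple m D => ∫ x in D, v i x * ψ x)
      = fun v : L2Tuple m D => inner ℝ (v i) hψ.toLp := by
    funext v
    rw [L2.inner_def]
    refine integral_congr_ae ?_
    filter_upwards [hψ.coeFn_toLp] with x hx
    simp [hx, mul_comm]
  rw [h]
  exact (PiLp.continuous_apply 2 _ i).inner continuous_const

instance (m : ℕ) (D : Set ℝ) : CompleteSpace (SobolevH m D) := by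
  have hc : IsClosed ((sobolevSubmodule m D : Submodule ℝ (L2Tuple m D)) : Set (L2Tuple m D)) := by
    have e : ((sobolevSubmodule m D : Submodule ℝ (L2Tuple m D)) : Set (L2Tuple m D))
        = {v | ∀ j : Fin m, HasWeakDerivOn D (v j.castSucc) (v j.succ)} := rfl
    rw [e]
    simp only [HasWeakDerivOn, ofPred_forall]
    refine isClosed_iInter fun j => isClosed_iInter fun φ => isClosed_iInter fun h1 =>
      isClosed_iInter fun h2 => isClosed_iInter fun _ => isClosed_eq ?_ ?_
    · exact continuous_integral_mul_test _ (h1.continuous_deriv (by simp)) h2.deriv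
    · exact (continuous_integral_mul_test _ h1.continuous h2).neg
  exact hc.completeSpace_coe

/-- `V ∈ W^{r,∞}((0,T]; X)` for a Banach space `X` and `r ≥ 1`: `V` has time derivatives
`G 0 = V, G 1, …, G r` that belong to `L^∞(0,T; X)`, each of `G 0, …, G (r-1)` being the
(Bochner) indefinite integral of the next one. `V` is the continuous representative
on `[0,T]`. -/
def MemWInfty {X : Type*} [NormedAddCommGroup X] [NormedSpace ℝ X]
    (r : ℕ) (T : ℝ) (V : ℝ → X) : Prop :=
  ∃ G : ℕ → ℝ → X,
    (∀ t ∈ Icc 0 T, G 0 t = V t) ∧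
    (∀ j ≤ r, MemLp (G j) ∞ (volume.restrict (Ioc 0 T))) ∧
    ∀ j < r, ∀ t ∈ Icc 0 T, G j t = G j 0 + ∫ s in (0 : ℝ)..t, G (j + 1) s

/-- The function `(t, x) ↦ v t x` belongs to `W^{r,∞}((0,T]; H^m(D))`. -/
def MemWInftySobolev (r : ℕ) (T : ℝ) (m : ℕ) (D : Set ℝ) (v : ℝ → ℝ → ℝ) : Prop :=
  ∃ V : ℝ → SobolevH m D, MemWInfty r T V ∧
    ∀ t ∈ Icc 0 T, ((V t : L2Tuple m D) 0 : ℝ → ℝ) =ᵐ[volume.restrict D] v t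

/-! ### Meshes and piecewise polynomials -/

/-- A mesh `a = x_0 < x_1 < ⋯ < x_N = b`; the element with index `i : Fin N` is the interval
from `node i.castSucc` to `node i.succ`. -/
structure Mesh (a b : ℝ) where
  N : ℕ
  node : Fin (N + 1) → ℝ
  strictMono : StrictMono node
  node_zero : node 0 = a
  node_last : node (Fin.last N) = b

namespace Mesh

variable {a b : ℝ} (M : Mesh a b)

/-- Left end point of an element. -/
def xl (i : Fin M.N) : ℝ := M.node i.castSucc

/-- Right end point of an element. -/
def xr (i : Fin M.N) : ℝ := M.node i.succ

/-- The mesh size `h = max_i h_i`. -/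
def size : ℝ := ⨆ i : Fin M.N, (M.xr i - M.xl i)

/-- The union of the open elements. `H^m` of this set is the broken Sobolev space
`H^m(𝒯_h)`. -/
def elements : Set ℝ := ⋃ i : Fin M.N, Ioo (M.xl i) (M.xr i)

/-- Families of polynomials, one for each element. -/
abbrev PW : Type := Fin M.N → ℝ[X]

/-- The finite element space `W_h^k`. -/
def W (k : ℕ) : Set M.PW := {w | ∀ i, w i ∈ degreeLE ℝ k}

/-- The `L²(Ω)` norm of a piecewise polynomial. -/
def norm (w : M.PW) : ℝ :=
  Real.sqrt (∑ i, ∫ x in (M.xl i)..(M.xr i), (w i).eval x ^ 2)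

/-- `(φ, w)` for a function `φ` and a piecewise polynomial `w`. -/
def pairFun (φ : ℝ → ℝ) (w : M.PW) : ℝ :=
  ∑ i, ∫ x in (M.xl i)..(M.xr i), φ x * (w i).eval x

/-- `(v, w)` for piecewise polynomials. -/
def pair (v w : M.PW) : ℝ :=
  ∑ i, ∫ x in (M.xl i)..(M.xr i), (v i).eval x * (w i).eval x

/-- `⟨ζ, η n⟩`, where `ζm i, ηm i` are the values at `x_i^-` (right end of the element, `n = 1`)
and `ζp i, ηp i` the values at `x_{i-1}^+` (left end of the element, `n = -1`). -/
def bdry (ζm ζp ηm ηp : Fin M.N → ℝ) : ℝ :=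
  ∑ i, (ζm i * ηm i * 1 + ζp i * ηp i * (-1))

/-- The element-wise derivative of a piecewise polynomial. -/
def dx (w : M.PW) : M.PW := fun i => derivative (w i)

/-- The traces `w(x_i^-)`. -/
def trm (w : M.PW) : Fin M.N → ℝ := fun i => (w i).eval (M.xr i)

/-- The traces `w(x_{i-1}^+)`. -/
def trp (w : M.PW) : Fin M.N → ℝ := fun i => (w i).eval (M.xl i)

end Mesh

/-! ### The HDG method (with `F = 0`) -/

/-- The components of the stabilization function: `τ_qu⁺, τ_pu⁺` at the left end and
`τ_qu⁻, τ_qp⁻` at the right end of each of `N` elements. -/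
structure Stabilization (N : ℕ) where
  quP : Fin N → ℝ
  puP : Fin N → ℝ
  quM : Fin N → ℝ
  qpM : Fin N → ℝ

/-- The condition on the stabilization function in the error estimate. -/
def Stabilization.Admissible {N : ℕ} (τ : Stabilization N) : Prop :=
  ∀ i, 0 < τ.quM i ∧ τ.quM i * τ.qpM i = 1 ∧ τ.quP i ∈ Icc (0 : ℝ) 1 ∧
    τ.puP i ∈ Icc (-1 - Real.sqrt (1 - τ.quP i ^ 2)) (-(1 / 2) - 1 / 2 * τ.quP i ^ 2)

/-- The unknowns `(u_h, q_h, p_h, û_h, p̂_h⁻)`; `phat i` is the value of `p̂_h⁻` at the right end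
of the element `i`. -/
structure State {a b : ℝ} (M : Mesh a b) where
  u : M.PW
  q : M.PW
  p : M.PW
  uhat : Fin (M.N + 1) → ℝ
  phat : Fin M.N → ℝ

namespace State

variable {a b : ℝ} {M : Mesh a b} (τ : Stabilization M.N) (s : State M)

/-- The numerical trace `p̂_h⁺`. -/
def phatP (i : Fin M.N) : ℝ :=
  M.trp s.p i + τ.puP i * (s.uhat i.castSucc - M.trp s.u i) * (-1)

/-- The numerical trace `q̂_h⁺`. -/
def qhatP (i : Fin M.N) : ℝ :=
  M.trp s.q i + τ.quP i * (s.uhat i.castSucc - M.trp s.u i) * (-1)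

/-- The numerical trace `q̂_h⁻`. -/
def qhatM (i : Fin M.N) : ℝ :=
  M.trm s.q i + τ.quM i * (s.uhat i.succ - M.trm s.u i) * 1
    + τ.qpM i * (s.phat i - M.trm s.p i) * 1

end State

/-- The HDG equations, with boundary values `ua = u_D(a)`, `ub = u_D(b)`, `qN` at `b`:
`(q,v) + (u,v_x) - ⟨û,vn⟩ = 0`, `(p,z) + (q,z_x) - ⟨q̂,zn⟩ = 0`,
`(ψ,w) - (p,w_x) + ⟨p̂,wn⟩ = (F,w)`, `⟨q̂,μn⟩ = q_N μ(b)`, `⟨p̂,χn⟩ = 0`.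
The time-dependent method has `ψ = ∂_t u_h` and `F = f(t)`, the stationary one for
`v + v_xxx = g` has `ψ = u_h` and `F = g`. The functions `μ` of the nodes other than `a` are
extended by zero to `a`. -/
structure HDGEquations {a b : ℝ} (M : Mesh a b) (k : ℕ) (τ : Stabilization M.N)
    (ua ub qN : ℝ) (F : ℝ → ℝ) (ψ : M.PW) (s : State M) : Prop where
  mem_u : s.u ∈ M.W k
  mem_q : s.q ∈ M.W k
  mem_p : s.p ∈ M.W k
  uhat_left : s.uhat 0 = ua
  uhat_right : s.uhat (Fin.last M.N) = ub
  eq_q : ∀ v ∈ M.W k, M.pair s.q v + M.pair s.u (M.dx v)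
    - M.bdry (fun i => s.uhat i.succ) (fun i => s.uhat i.castSucc) (M.trm v) (M.trp v) = 0
  eq_p : ∀ z ∈ M.W k, M.pair s.p z + M.pair s.q (M.dx z)
    - M.bdry (s.qhatM τ) (s.qhatP τ) (M.trm z) (M.trp z) = 0
  eq_u : ∀ w ∈ M.W k, M.pair ψ w - M.pair s.p (M.dx w)
    + M.bdry s.phat (s.phatP τ) (M.trm w) (M.trp w) = M.pairFun F w
  trans_q : ∀ μ : Fin (M.N + 1) → ℝ, μ 0 = 0 →
    M.bdry (s.qhatM τ) (s.qhatP τ) (fun i => μ i.succ) (fun i => μ i.castSucc)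
      = qN * μ (Fin.last M.N)
  trans_p : ∀ χ : Fin (M.N + 1) → ℝ, χ 0 = 0 → χ (Fin.last M.N) = 0 →
    M.bdry s.phat (s.phatP τ) (fun i => χ i.succ) (fun i => χ i.castSucc) = 0

/-- `w'` is the time derivative on `[0,T]` of the time-dependent piecewise polynomial `w`. -/
def HasTimeDeriv {a b : ℝ} (M : Mesh a b) (T : ℝ) (w w' : ℝ → M.PW) : Prop :=
  ∀ t ∈ Icc 0 T, ∀ i n,
    HasDerivWithinAt (fun s => (w s i).coeff n) ((w' t i).coeff n) (Icc 0 T) t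

/-- `s` is the semi-discrete HDG approximation on `[0,T]`, with `uht = ∂_t u_h`. Its value at
`t = 0` is the HDG approximation of the stationary problem `v + v_xxx = g` with
`g = u0 + (u0)_xxx`. -/
structure IsHDGSolution {a b : ℝ} (M : Mesh a b) (k : ℕ) (τ : Stabilization M.N) (T : ℝ)
    (f : ℝ → ℝ → ℝ) (u0 : ℝ → ℝ) (uDa uDb qN : ℝ → ℝ)
    (s : ℝ → State M) (uht : ℝ → M.PW) : Prop where
  hasTimeDeriv : HasTimeDeriv M T (fun t => (s t).u) uht
  evolution : ∀ t ∈ Ioc 0 T, HDGEquations M k τ (uDa t) (uDb t) (qN t) (f t) (uht t) (s t)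
  initial : HDGEquations M k τ (uDa 0) (uDb 0) (qN 0)
    (fun x => u0 x + iteratedDeriv 3 u0 x) (s 0).u (s 0)

/-! ### The exact solution -/

/-- `(u, q, p)` solves `q = u_x`, `p = q_x`, `u_t + p_x = f` in `(a,b) × (0,T]`, with `u = u0` at
`t = 0`, `u = u_D` at `a` and `b`, and `q = q_N` at `b`; `ut` is the time derivative of `u`. The
third equation holds almost everywhere in `x`, for the absolutely continuous function `p t`,
which is its integrated form below. -/
structure IsExactSolution (a b T : ℝ) (f : ℝ → ℝ → ℝ) (u0 : ℝ → ℝ) (uDa uDb qN : ℝ → ℝ)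
    (u q p ut : ℝ → ℝ → ℝ) : Prop where
  f_mem : ∀ t ∈ Ioc 0 T, MemLp (f t) 2 (volume.restrict (Ioo a b))
  eq_q : ∀ t ∈ Icc 0 T, ∀ x ∈ Icc a b, HasDerivWithinAt (u t) (q t x) (Icc a b) x
  eq_p : ∀ t ∈ Icc 0 T, ∀ x ∈ Icc a b, HasDerivWithinAt (q t) (p t x) (Icc a b) x
  time_deriv : ∀ t ∈ Icc 0 T, ∀ x ∈ Icc a b,
    HasDerivWithinAt (fun s => u s x) (ut t x) (Icc 0 T) t
  eq_u : ∀ t ∈ Ioc 0 T, ∀ x ∈ Icc a b, p t x = p t a + ∫ y in a..x, (f t y - ut t y)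
  initial : ∀ x ∈ Icc a b, u 0 x = u0 x
  bdry_a : ∀ t ∈ Icc 0 T, u t a = uDa t
  bdry_b : ∀ t ∈ Icc 0 T, u t b = uDb t
  bdry_q : ∀ t ∈ Icc 0 T, q t b = qN t

/-! ### The projection -/

/-- `(Pu, Pq, Pp) ∈ P_k × P_k × P_k` is the projection of `(u, q, p)` on every element: the
differences `δ_ω = ω - Pω` are orthogonal to polynomials of degree at most `k - 1`, and satisfy
`δ_p - τ_pu⁺ δ_u n = 0` and `δ_q - τ_qu⁺ δ_u n = 0` at the left end (`n = -1`), and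
`δ_q - τ_qu⁻ δ_u n - τ_qp⁻ δ_p n = 0` at the right end (`n = 1`). -/
structure IsProjection {a b : ℝ} (M : Mesh a b) (k : ℕ) (τ : Stabilization M.N)
    (u q p : ℝ → ℝ) (Pu Pq Pp : M.PW) : Prop where
  mem_u : Pu ∈ M.W k
  mem_q : Pq ∈ M.W k
  mem_p : Pp ∈ M.W k
  orth_u : ∀ i, ∀ v ∈ degreeLT ℝ k,
    ∫ x in (M.xl i)..(M.xr i), (u x - (Pu i).eval x) * v.eval x = 0
  orth_q : ∀ i, ∀ z ∈ degreeLT ℝ k,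
    ∫ x in (M.xl i)..(M.xr i), (q x - (Pq i).eval x) * z.eval x = 0
  orth_p : ∀ i, ∀ w ∈ degreeLT ℝ k,
    ∫ x in (M.xl i)..(M.xr i), (p x - (Pp i).eval x) * w.eval x = 0
  left_p : ∀ i, (p (M.xl i) - M.trp Pp i) - τ.puP i * (u (M.xl i) - M.trp Pu i) * (-1) = 0
  left_q : ∀ i, (q (M.xl i) - M.trp Pq i) - τ.quP i * (u (M.xl i) - M.trp Pu i) * (-1) = 0
  right_q : ∀ i, (q (M.xr i) - M.trm Pq i) - τ.quM i * (u (M.xr i) - M.trm Pu i) * 1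
    - τ.qpM i * (p (M.xr i) - M.trm Pp i) * 1 = 0

end KdVHDG

end

/-! ### Polynomial integrals and Legendre polynomials on an interval. -/

noncomputable section

namespace KdVHDG

/-! ### Integration of polynomials over an interval -/

/-! Compare the discrete solution with the element-wise `L²` projection of the exact one.
Orthogonality leaves no residual in the volume equations; what remains are residuals `α`, `β`, `γ`
in the three flux relations of each element, of size `h^(k+1/2)` in `ℓ²` over the elements
(`InSob.sum_resid_sq_le`, `RegSol.errFlow`). The projection `Π` differs from the `L²` projection by
multiples of the Legendre polynomial `L_k`. Subtracting such multiples (`IsSys.shift`) moves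
residuals from the fluxes into terms `cq L_k`, `cp L_k` of the first two equations. Removing all
three flux residuals is a 3×3 system with determinant `relRate ≥ 1/2`, which gives existence and
uniqueness of `Π`. An `L²` norm on the elements gains `√h` over `ℓ²`, hence the order `h^(k+1)`.

At a fixed time the energy identity controls the jumps: at the right end because `τ_qu⁻ τ_qp⁻ = 1`
makes the cross term of a square cancel, at the left end by the upper bound on `τ_pu⁺`. With two
further products of the equations, `static_le` bounds `q` and `p` by `u`, its time derivative and
the residuals. Hence it suffices to bound the time derivative of the error in `u`; the error itself
follows by integration in time from its initial value.

No second time derivative of the discrete solution is assumed, so difference quotients in time are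
estimated, uniformly in the step (`quot_le`). They solve the same error equations. The plain energy
does not control `q` and `p`, against which the residuals are tested. The energy with weight `x + c`
does better: as in Kato smoothing for KdV it yields `(3/2)‖q‖²`, and large `c` makes the jump
dissipation dominate all other quadratic jump terms (`weighted_le`). Two obstacles remain.

Shifting the quotients to the projection would bring in the time derivative of its coefficients,
that is, second time derivatives of `q` and `p`. Instead the coefficient of `L_k` in `u` relaxes
towards its stationary value at rate of order `1/h`. Then `α` and `γ` vanish, `β` is proportional to
`h` times the velocity of the coefficient, and the singular velocity term cancels the `β` term in
the left dissipation, by the moment identities against `L_k` and `L_(k-1)`.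

The residual `cq` is tested against `p`, which is not dissipated. The third equation tested with
`L_(k-1)` trades this moment of `p` for a time derivative, which is taken into the energy. The price
is a time derivative of `cq` with a factor `h`. This involves `α` only, hence `u` and `q = u_x`; the
factor `h` pays for the lost derivative in space, and here `u ∈ W^{2,∞}` in time enters.

At time zero the discrete problem is stationary. Its energy bounds the initial error (`init_le`),
and comparing times `0` and `s` bounds the initial time derivative (`norm_w_le`). Gronwall's
inequality and the limit of vanishing step finish the discrete estimate. The constants do not depend
on the mesh, because weak derivatives with respect to two meshes agree almost everywhere
(`InSob.transfer`). -/

/-- The integral of a polynomial over `[l, r]`, as a linear functional. -/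
def itg (l r : ℝ) : ℝ[X] →ₗ[ℝ] ℝ where
  toFun p := ∫ x in l..r, p.eval x
  map_add' p q := by
    simp only [eval_add]
    exact intervalIntegral.integral_add (p.continuous.intervalIntegrable _ _)
      (q.continuous.intervalIntegrable _ _)
  map_smul' c p := by simp [eval_smul, intervalIntegral.integral_const_mul]

theorem itg_apply (l r : ℝ) (p : ℝ[X]) : itg l r p = ∫ x in l..r, p.eval x := rfl

theorem itg_derivative (l r : ℝ) (p : ℝ[X]) :
    itg l r (derivative p) = p.eval r - p.eval l :=
  intervalIntegral.integral_eq_sub_of_hasDerivAt (fun x _ => p.hasDerivAt x)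
    ((derivative p).continuous.intervalIntegrable _ _)

theorem itg_C_mul (l r c : ℝ) (p : ℝ[X]) : itg l r (C c * p) = c * itg l r p := by
  rw [← smul_eq_C_mul, map_smul, smul_eq_mul]

theorem itg_nonneg {l r : ℝ} (h : l ≤ r) {p : ℝ[X]} (hp : ∀ x ∈ Icc l r, 0 ≤ p.eval x) :
    0 ≤ itg l r p := intervalIntegral.integral_nonneg h hp

theorem itg_mul_self_nonneg {l r : ℝ} (h : l ≤ r) (p : ℝ[X]) : 0 ≤ itg l r (p * p) :=
  itg_nonneg h fun x _ => by rw [eval_mul]; exact mul_self_nonneg _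

theorem itg_mono {l r : ℝ} (h : l ≤ r) {p q : ℝ[X]} (hp : ∀ x ∈ Icc l r, p.eval x ≤ q.eval x) :
    itg l r p ≤ itg l r q := by
  have := itg_nonneg h (p := q - p) fun x hx => by rw [eval_sub]; linarith [hp x hx]
  rw [map_sub] at this; linarith

/-- The Cauchy–Schwarz inequality for polynomials. -/
theorem itg_mul_sq_le {l r : ℝ} (h : l ≤ r) (p q : ℝ[X]) :
    itg l r (p * q) ^ 2 ≤ itg l r (p * p) * itg l r (q * q) := by
  have key : ∀ t : ℝ, 0 ≤ itg l r (q * q) * (t * t) + (2 * itg l r (p * q)) * t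
      + itg l r (p * p) := by
    intro t
    have := itg_mul_self_nonneg h (p + C t * q)
    have e : (p + C t * q) * (p + C t * q)
        = p * p + C (2 * t) * (p * q) + C (t * t) * (q * q) := by
      simp only [C_mul, map_ofNat]; ring
    rw [e, map_add, map_add, itg_C_mul, itg_C_mul] at this
    linarith
  have := discrim_le_zero key
  unfold discrim at this
  nlinarith

theorem abs_itg_mul_le {l r : ℝ} (h : l ≤ r) (p q : ℝ[X]) :
    |itg l r (p * q)| ≤ Real.sqrt (itg l r (p * p)) * Real.sqrt (itg l r (q * q)) := by
  rw [← Real.sqrt_mul (itg_mul_self_nonneg h p)]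
  exact Real.abs_le_sqrt (itg_mul_sq_le h p q)

theorem itg_mul_self_pos {l r : ℝ} (h : l < r) {p : ℝ[X]} (hp : p ≠ 0) :
    0 < itg l r (p * p) := by
  rw [itg_apply]
  refine intervalIntegral.integral_pos h (p * p).continuous.continuousOn
    (fun x _ => by rw [eval_mul]; exact mul_self_nonneg _) ?_
  by_contra hcon
  push Not at hcon
  apply hp
  refine eq_zero_of_infinite_isRoot p ((Icc_infinite h).mono fun x hx => ?_)
  have := hcon x hx
  rw [eval_mul] at this
  exact mul_self_eq_zero.1 (le_antisymm this (mul_self_nonneg _))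

theorem mem_degreeLE_iff {n : ℕ} {p : ℝ[X]} : p ∈ degreeLE ℝ n ↔ p.natDegree ≤ n := by
  rw [mem_degreeLE, natDegree_le_iff_degree_le]

theorem mem_degreeLT_iff {n : ℕ} {p : ℝ[X]} : p ∈ degreeLT ℝ (n + 1) ↔ p.natDegree ≤ n := by
  rw [mem_degreeLT, degree_lt_iff_coeff_zero, natDegree_le_iff_coeff_eq_zero]
  exact forall_congr' fun m => by rw [Nat.succ_le_iff]

/-! ### Legendre polynomials on an interval -/

/-- `((X - l) (X - r)) ^ n`. -/
def bubble (n : ℕ) (l r : ℝ) : ℝ[X] := (X - C l) ^ n * (X - C r) ^ n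

/-- The Legendre polynomial of degree `n` on `[l, r]`, with value `1` at `r`. -/
def leg (n : ℕ) (l r : ℝ) : ℝ[X] :=
  C ((n.factorial * (r - l) ^ n : ℝ)⁻¹) * derivative^[n] (bubble n l r)

theorem bubble_monic (n : ℕ) (l r : ℝ) : (bubble n l r).Monic :=
  ((monic_X_sub_C l).pow n).mul ((monic_X_sub_C r).pow n)

theorem natDegree_bubble (n : ℕ) (l r : ℝ) : (bubble n l r).natDegree = 2 * n := by
  rw [bubble, ((monic_X_sub_C l).pow n).natDegree_mul ((monic_X_sub_C r).pow n),
    natDegree_pow, natDegree_pow, natDegree_X_sub_C, natDegree_X_sub_C]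
  ring

theorem natDegree_leg_le (n : ℕ) (l r : ℝ) : (leg n l r).natDegree ≤ n := by
  refine (natDegree_C_mul_le _ _).trans ((natDegree_iterate_derivative _ _).trans ?_)
  rw [natDegree_bubble]; omega

/-- The leading coefficient of the Legendre polynomial. -/
def legLead (n : ℕ) (l r : ℝ) : ℝ := n.centralBinom / (r - l) ^ n

theorem coeff_leg (n : ℕ) {l r : ℝ} (h : l < r) : (leg n l r).coeff n = legLead n l r := by
  have hb : (bubble n l r).coeff (n + n) = 1 := by
    have := (bubble_monic n l r).coeff_natDegree
    rwa [natDegree_bubble, two_mul] at this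
  rw [leg, coeff_C_mul, coeff_iterate_derivative, hb, legLead, Nat.centralBinom, two_mul,
    Nat.choose_eq_descFactorial_div_factorial, Nat.cast_div (Nat.factorial_dvd_descFactorial _ _)
      (by positivity)]
  have : 0 < r - l := sub_pos.2 h
  simp only [nsmul_eq_mul, mul_one]
  field_simp

/-- The `n`-th derivative is `n!` times a Taylor coefficient at `r`; the factor `(X - r)^n` already
uses up the whole order, so the other factor is evaluated at `r`. -/
theorem eval_iterate_derivative_bubble {n : ℕ} {l r : ℝ} :
    (derivative^[n] (bubble n l r)).eval r = n.factorial * (r - l) ^ n := by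
  have h1 : derivative^[n] (bubble n l r) = n.factorial • hasseDeriv n (bubble n l r) := by
    rw [← factorial_smul_hasseDeriv]; rfl
  rw [h1, eval_smul, ← taylor_coeff, bubble, taylor_mul]
  have : taylor r ((X - C r) ^ n) = X ^ n := by
    rw [taylor_apply]; simp
  rw [this, coeff_mul_X_pow', if_pos le_rfl, Nat.sub_self, taylor_coeff_zero]
  simp

theorem bubble_comm (n : ℕ) (l r : ℝ) : bubble n l r = bubble n r l := mul_comm _ _

theorem eval_leg_right (n : ℕ) {l r : ℝ} (h : l < r) : (leg n l r).eval r = 1 := by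
  have : 0 < r - l := sub_pos.2 h
  rw [leg, eval_mul, eval_C, eval_iterate_derivative_bubble]
  field_simp

theorem eval_leg_left (n : ℕ) {l r : ℝ} (h : l < r) : (leg n l r).eval l = (-1) ^ n := by
  have : 0 < r - l := sub_pos.2 h
  rw [leg, eval_mul, eval_C, bubble_comm, eval_iterate_derivative_bubble,
    show l - r = (-1) * (r - l) by ring, mul_pow]
  field_simp

theorem eval_iterate_derivative_bubble_right {n j : ℕ} (hj : j < n) (l r : ℝ) :
    (derivative^[j] (bubble n l r)).eval r = 0 := by
  have h1 : (X - C r) ^ n ∣ bubble n l r := dvd_mul_left _ _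
  have h2 := pow_sub_dvd_iterate_derivative_of_pow_dvd j h1
  have h3 : X - C r ∣ derivative^[j] (bubble n l r) :=
    (dvd_pow_self _ (by omega)).trans h2
  exact dvd_iff_isRoot.1 h3

theorem itg_derivative_mul (l r : ℝ) (p q : ℝ[X]) :
    itg l r (derivative p * q) = (p * q).eval r - (p * q).eval l - itg l r (p * derivative q) := by
  rw [← itg_derivative, derivative_mul, map_add]; ring

/-- Repeated integration by parts: derivatives of the bubble of order below `n` vanish at both ends,
and every step lowers the degree of `v`. -/
theorem itg_iterate_derivative_bubble_mul {n : ℕ} (l r : ℝ) : ∀ j ≤ n, ∀ v : ℝ[X],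
    v.natDegree < j → itg l r (derivative^[j] (bubble n l r) * v) = 0 := by
  intro j
  induction j with
  | zero => intro _ v hv; omega
  | succ j ih =>
    intro hj v hv
    rw [Function.iterate_succ_apply', itg_derivative_mul, eval_mul, eval_mul,
      eval_iterate_derivative_bubble_right (by omega), bubble_comm,
      eval_iterate_derivative_bubble_right (by omega), ← bubble_comm]
    rcases Nat.eq_zero_or_pos v.natDegree with h0 | h0
    · rw [eq_C_of_natDegree_eq_zero h0]; simp
    · rw [ih (by omega) _ (lt_of_lt_of_le (natDegree_derivative_lt h0.ne') (by omega))]; simp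

/-- Orthogonality of the Legendre polynomial to polynomials of lower degree. -/
theorem itg_leg_mul_eq_zero {n : ℕ} (l r : ℝ) {v : ℝ[X]} (hv : v.natDegree < n) :
    itg l r (leg n l r * v) = 0 := by
  rw [leg, mul_assoc, itg_C_mul, itg_iterate_derivative_bubble_mul l r n le_rfl v hv, mul_zero]

theorem itg_leg_mul_eq_zero' {n : ℕ} (l r : ℝ) {v : ℝ[X]} (hv : v.natDegree < n) :
    itg l r (v * leg n l r) = 0 := by rw [mul_comm, itg_leg_mul_eq_zero l r hv]

theorem legLead_pos (n : ℕ) {l r : ℝ} (h : l < r) : 0 < legLead n l r :=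
  div_pos (by exact_mod_cast n.centralBinom_pos) (pow_pos (sub_pos.2 h) _)

theorem natDegree_lt_of_coeff_eq_zero {n : ℕ} {p : ℝ[X]} (h0 : 0 < n) (h : p.natDegree ≤ n)
    (hc : p.coeff n = 0) : p.natDegree < n := by
  refine lt_of_le_of_ne h fun he => ?_
  rw [← he, coeff_natDegree, leadingCoeff_eq_zero] at hc
  rw [hc] at he; simp at he; omega

/-- The remainder after division of the leading term by the Legendre polynomial. -/
theorem coeff_sub_leg {n : ℕ} {l r : ℝ} (h : l < r) (p : ℝ[X]) :
    (p - C (p.coeff n / legLead n l r) * leg n l r).coeff n = 0 := by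
  rw [coeff_sub, coeff_C_mul, coeff_leg n h, div_mul_cancel₀ _ (legLead_pos n h).ne', sub_self]

theorem natDegree_sub_leg {n : ℕ} {l r : ℝ} {p : ℝ[X]} (hp : p.natDegree ≤ n) (c : ℝ) :
    (p - C c * leg n l r).natDegree ≤ n :=
  (natDegree_sub_le _ _).trans
    (max_le hp ((natDegree_C_mul_le _ _).trans (natDegree_leg_le n l r)))

/-- `(L, p)` for `p` of the same degree, in terms of the leading coefficients. -/
theorem itg_leg_mul {n : ℕ} {l r : ℝ} (h : l < r) {p : ℝ[X]} (hp : p.natDegree ≤ n) :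
    itg l r (leg n l r * p)
      = p.coeff n / legLead n l r * itg l r (leg n l r * leg n l r) := by
  have e : leg n l r * p = leg n l r * (p - C (p.coeff n / legLead n l r) * leg n l r)
      + C (p.coeff n / legLead n l r) * (leg n l r * leg n l r) := by ring
  rw [e, map_add, itg_C_mul]
  rcases Nat.eq_zero_or_pos n with h0 | h0
  · subst h0
    have h1 : p - C (p.coeff 0 / legLead 0 l r) * leg 0 l r = 0 := by
      rw [eq_C_of_natDegree_le_zero (natDegree_sub_leg hp _), coeff_sub_leg h]; simp
    rw [h1]; simp
  · rw [itg_leg_mul_eq_zero l r (natDegree_lt_of_coeff_eq_zero h0 (natDegree_sub_leg hp _)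
      (coeff_sub_leg h p)), zero_add]

/-- Integrate `(L²)' (x - l)` by parts. The boundary term is the length, and `(x - l) L'` has `n`
times the leading coefficient of `L`, so `2n‖L‖² = (r - l) - ‖L‖²`. -/
theorem itg_leg_mul_self (n : ℕ) {l r : ℝ} (h : l < r) :
    itg l r (leg n l r * leg n l r) = (r - l) / (2 * n + 1) := by
  have h1 := itg_derivative_mul l r (leg n l r * leg n l r) (X - C l)
  rw [derivative_mul, derivative_sub, derivative_X, derivative_C, sub_zero, mul_one,
    eval_mul, eval_mul, eval_mul, eval_leg_right n h] at h1
  have h2 : (derivative (leg n l r) * leg n l r + leg n l r * derivative (leg n l r)) * (X - C l)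
      = C 2 * (leg n l r * (derivative (leg n l r) * (X - C l))) := by
    rw [map_ofNat]; ring
  rw [h2, itg_C_mul] at h1
  have hd : (derivative (leg n l r) * (X - C l)).natDegree ≤ n := by
    rcases Nat.eq_zero_or_pos n with h0 | h0
    · subst h0
      rw [derivative_of_natDegree_zero (Nat.le_zero.1 (natDegree_leg_le 0 l r))]; simp
    · refine natDegree_mul_le.trans ?_
      have := natDegree_derivative_le (leg n l r)
      have := natDegree_leg_le n l r
      rw [natDegree_X_sub_C]; omega
  have hc : (derivative (leg n l r) * (X - C l)).coeff n = n * legLead n l r := by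
    rcases Nat.eq_zero_or_pos n with h0 | h0
    · subst h0
      rw [derivative_of_natDegree_zero (Nat.le_zero.1 (natDegree_leg_le 0 l r))]; simp
    · obtain ⟨m, rfl⟩ : ∃ m, n = m + 1 := ⟨n - 1, by omega⟩
      have hz : (leg (m + 1) l r).coeff (m + 1 + 1) = 0 :=
        coeff_eq_zero_of_natDegree_lt (lt_of_le_of_lt (natDegree_leg_le _ l r) (by omega))
      rw [mul_sub, coeff_sub, coeff_mul_X, coeff_mul_C, coeff_derivative, coeff_derivative,
        coeff_leg _ h, hz]
      push_cast; ring
  rw [itg_leg_mul h hd, hc, mul_div_assoc, div_self (legLead_pos n h).ne'] at h1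
  simp only [eval_sub, eval_X, eval_C] at h1
  rw [eq_div_iff (by positivity)]
  linarith

/-- For `p` of degree at most `n`, `ℓ (p', L_{n-1}) = 2 (p, L_n)`. -/
theorem itg_derivative_mul_leg {n : ℕ} {l r : ℝ} (h : l < r) {p : ℝ[X]}
    (hp : p.natDegree ≤ n + 1) :
    itg l r (derivative p * leg n l r) * itg l r (leg (n + 1) l r * leg (n + 1) l r)
      = 2 * itg l r (leg (n + 1) l r * p) := by
  set c := p.coeff (n + 1) / legLead (n + 1) l r with hc
  set y := p - C c * leg (n + 1) l r with hy
  have hyd : y.natDegree < n + 1 :=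
    natDegree_lt_of_coeff_eq_zero (by omega) (natDegree_sub_leg hp _) (coeff_sub_leg h p)
  have e : derivative p * leg n l r
      = derivative y * leg n l r + C c * (derivative (leg (n + 1) l r) * leg n l r) := by
    rw [hy, derivative_sub, derivative_C_mul]; ring
  have h1 : itg l r (derivative y * leg n l r) = 0 := by
    rcases Nat.eq_zero_or_pos y.natDegree with h0 | h0
    · rw [derivative_of_natDegree_zero h0]; simp
    · exact itg_leg_mul_eq_zero' l r (lt_of_lt_of_le (natDegree_derivative_lt h0.ne') (by omega))
  -- Only boundary values contribute: the product `L_{n+1} L_n` is `1` at `r` and `-1` at `l`.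
  have h2 : itg l r (derivative (leg (n + 1) l r) * leg n l r) = 2 := by
    rw [itg_derivative_mul, eval_mul, eval_mul, eval_leg_right _ h, eval_leg_right _ h,
      eval_leg_left _ h, eval_leg_left _ h]
    have h3 : itg l r (leg (n + 1) l r * derivative (leg n l r)) = 0 :=
      itg_leg_mul_eq_zero l r (lt_of_le_of_lt ((natDegree_derivative_le _).trans
        (Nat.sub_le_of_le_add ((natDegree_leg_le n l r).trans (by omega)))) (Nat.lt_succ_self n))
    rw [h3, ← pow_add, show n + 1 + n = 2 * n + 1 by ring, pow_succ, pow_mul]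
    norm_num
  rw [e, map_add, itg_C_mul, h1, h2, itg_leg_mul h hp]
  ring

/-- The `L²` projection of `(X + c) p` on polynomials of degree at most `n + 1`: the correction
is a multiple of the next Legendre polynomial. -/
theorem natDegree_mul_linear_sub {n : ℕ} {l r : ℝ} (h : l < r) (c : ℝ) {p : ℝ[X]}
    (hp : p.natDegree ≤ n) :
    ((X + C c) * p - C ((n + 1) / 2 * itg l r (leg n l r * p)) * leg (n + 1) l r).natDegree
      ≤ n := by
  -- The leading coefficients of `L_{n+1}` and `L_n` have ratio `2(2n+1) / ((n+1)(r-l))`; the length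
  -- and `2n+1` cancel against `‖L_n‖²`.
  have h0 : (n + 1 : ℝ) / 2 * itg l r (leg n l r * p)
      = ((X + C c) * p).coeff (n + 1) / legLead (n + 1) l r := by
    have e1 : ((X + C c) * p).coeff (n + 1) = p.coeff n := by
      rw [add_mul, coeff_add, coeff_X_mul, coeff_C_mul,
        coeff_eq_zero_of_natDegree_lt (lt_of_le_of_lt hp (Nat.lt_succ_self n)), mul_zero, add_zero]
    have hh : 0 < r - l := sub_pos.2 h
    have e2 : ((n + 1 : ℕ) : ℝ) * (n + 1).centralBinom = 2 * (2 * n + 1 : ℕ) * n.centralBinom := by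
      exact_mod_cast n.succ_mul_centralBinom_succ
    have e3 : (0 : ℝ) < n.centralBinom := by exact_mod_cast n.centralBinom_pos
    have e4 : (0 : ℝ) < (n + 1).centralBinom := by exact_mod_cast (n + 1).centralBinom_pos
    rw [itg_leg_mul h hp, itg_leg_mul_self n h, e1, legLead, legLead]
    push_cast at e2
    field_simp
    linear_combination p.coeff n * (r - l) ^ (n + 1) * e2
  rw [h0]
  have hd : ((X + C c) * p).natDegree ≤ n + 1 :=
    natDegree_mul_le.trans (by rw [natDegree_X_add_C]; omega)
  exact Nat.lt_succ_iff.1 (natDegree_lt_of_coeff_eq_zero (by omega) (natDegree_sub_leg hd _)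
    (coeff_sub_leg h _))

/-- Polynomials of degree at most `n` that are orthogonal to those of degree less than `n` are
multiples of the Legendre polynomial. -/
theorem eq_C_mul_leg {n : ℕ} {l r : ℝ} (h : l < r) {p : ℝ[X]} (hp : p.natDegree ≤ n)
    (ho : ∀ v ∈ degreeLT ℝ n, itg l r (p * v) = 0) :
    p = C (p.coeff n / legLead n l r) * leg n l r := by
  set y := p - C (p.coeff n / legLead n l r) * leg n l r with hy
  suffices y = 0 from sub_eq_zero.1 this
  have hyd : y ∈ degreeLT ℝ n := by
    rw [mem_degreeLT]
    have h1 : y.natDegree ≤ n := natDegree_sub_leg hp _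
    rw [degree_lt_iff_coeff_zero]
    intro m hm
    rcases hm.eq_or_lt with rfl | hm
    · exact coeff_sub_leg h p
    · exact coeff_eq_zero_of_natDegree_lt (lt_of_le_of_lt h1 hm)
  by_contra hne
  have h1 := itg_mul_self_pos h hne
  have e : y * y = p * y - C (p.coeff n / legLead n l r) * (leg n l r * y) := by
    rw [hy]; ring
  have h2 : itg l r (leg n l r * y) = 0 :=
    itg_leg_mul_eq_zero l r ((natDegree_lt_iff_degree_lt hne).2 (mem_degreeLT.1 hyd))
  rw [e, map_sub, itg_C_mul, ho y hyd, h2] at h1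
  simp at h1

end KdVHDG

end

/-! ### Moments and energy identities of the error equations on one element. -/

noncomputable section

namespace KdVHDG

/-! ### The error equations on one element -/

/-- The restriction to an element of a discrete error: polynomials `u, q, p`, a polynomial `g` in
the role of the time derivative of `u`, single valued traces at the left and right end, and the
residuals of the equations. -/
structure ElemData where
  u : ℝ[X]
  q : ℝ[X]
  p : ℝ[X]
  g : ℝ[X]
  ul : ℝ
  ur : ℝ
  ql : ℝ
  qr : ℝ
  pl : ℝ
  pr : ℝ
  cq : ℝ
  cp : ℝ
  α : ℝ
  β : ℝ
  γ : ℝ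

namespace ElemData

variable (k : ℕ) (l r : ℝ) (e : ElemData)

/-- Jumps between single valued traces and traces of the polynomials. -/
def jul : ℝ := e.ul - e.u.eval l
def jur : ℝ := e.ur - e.u.eval r
def jql : ℝ := e.ql - e.q.eval l
def jqr : ℝ := e.qr - e.q.eval r
def jpl : ℝ := e.pl - e.p.eval l
def jpr : ℝ := e.pr - e.p.eval r

/-- The error equations. -/
structure IsSys (τp σ τ : ℝ) : Prop where
  deg_u : e.u.natDegree ≤ k
  deg_q : e.q.natDegree ≤ k
  deg_p : e.p.natDegree ≤ k
  deg_g : e.g.natDegree ≤ k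
  -- The equations are in the form obtained after integration by parts, so only jumps occur at the
  -- ends.
  eq_q : ∀ v : ℝ[X], v.natDegree ≤ k →
    itg l r ((e.q - derivative e.u + C e.cq * leg k l r) * v)
      = e.jur r * v.eval r - e.jul l * v.eval l
  eq_p : ∀ v : ℝ[X], v.natDegree ≤ k →
    itg l r ((e.p - derivative e.q + C e.cp * leg k l r) * v)
      = e.jqr r * v.eval r - e.jql l * v.eval l
  eq_u : ∀ v : ℝ[X], v.natDegree ≤ k →
    itg l r ((e.g + derivative e.p) * v) = -(e.jpr r * v.eval r - e.jpl l * v.eval l)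
  -- Here `τp`, `σ`, `τ`, `τ⁻¹` stand for `τ_qu⁺`, `τ_pu⁺`, `τ_qu⁻`, `τ_qp⁻`; the minus signs at the
  -- left end are the normal `n = -1`.
  flux_ql : e.jql l = -τp * e.jul l + e.α
  flux_pl : e.jpl l = -σ * e.jul l + e.β
  flux_qr : e.jqr r = τ * e.jur r + τ⁻¹ * e.jpr r + e.γ

/-- Scaled differences. -/
def diff (c : ℝ) (e₁ e₂ : ElemData) : ElemData where
  u := C c * (e₁.u - e₂.u)
  q := C c * (e₁.q - e₂.q)
  p := C c * (e₁.p - e₂.p)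
  g := C c * (e₁.g - e₂.g)
  ul := c * (e₁.ul - e₂.ul)
  ur := c * (e₁.ur - e₂.ur)
  ql := c * (e₁.ql - e₂.ql)
  qr := c * (e₁.qr - e₂.qr)
  pl := c * (e₁.pl - e₂.pl)
  pr := c * (e₁.pr - e₂.pr)
  cq := c * (e₁.cq - e₂.cq)
  cp := c * (e₁.cp - e₂.cp)
  α := c * (e₁.α - e₂.α)
  β := c * (e₁.β - e₂.β)
  γ := c * (e₁.γ - e₂.γ)

theorem natDegree_C_mul_sub_le {k : ℕ} {p q : ℝ[X]} (c : ℝ) (hp : p.natDegree ≤ k)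
    (hq : q.natDegree ≤ k) : (C c * (p - q)).natDegree ≤ k :=
  (natDegree_C_mul_le _ _).trans ((natDegree_sub_le _ _).trans (max_le hp hq))

variable {k l r}

theorem IsSys.diff {τp σ τ : ℝ} {e₁ e₂ : ElemData} (h₁ : e₁.IsSys k l r τp σ τ)
    (h₂ : e₂.IsSys k l r τp σ τ) (c : ℝ) : (diff c e₁ e₂).IsSys k l r τp σ τ where
  deg_u := natDegree_C_mul_sub_le c h₁.deg_u h₂.deg_u
  deg_q := natDegree_C_mul_sub_le c h₁.deg_q h₂.deg_q
  deg_p := natDegree_C_mul_sub_le c h₁.deg_p h₂.deg_p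
  deg_g := natDegree_C_mul_sub_le c h₁.deg_g h₂.deg_g
  eq_q v hv := by
    have e : ((ElemData.diff c e₁ e₂).q - derivative (ElemData.diff c e₁ e₂).u
        + C (ElemData.diff c e₁ e₂).cq * leg k l r) * v
        = C c * ((e₁.q - derivative e₁.u + C e₁.cq * leg k l r) * v
          - (e₂.q - derivative e₂.u + C e₂.cq * leg k l r) * v) := by
      simp only [ElemData.diff, derivative_C_mul, derivative_sub, C_mul, C_sub]; ring
    rw [e, itg_C_mul, map_sub, h₁.eq_q v hv, h₂.eq_q v hv]
    simp only [ElemData.diff, jur, jul, eval_mul, eval_C, eval_sub]; ring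
  eq_p v hv := by
    have e : ((ElemData.diff c e₁ e₂).p - derivative (ElemData.diff c e₁ e₂).q
        + C (ElemData.diff c e₁ e₂).cp * leg k l r) * v
        = C c * ((e₁.p - derivative e₁.q + C e₁.cp * leg k l r) * v
          - (e₂.p - derivative e₂.q + C e₂.cp * leg k l r) * v) := by
      simp only [ElemData.diff, derivative_C_mul, derivative_sub, C_mul, C_sub]; ring
    rw [e, itg_C_mul, map_sub, h₁.eq_p v hv, h₂.eq_p v hv]
    simp only [ElemData.diff, jqr, jql, eval_mul, eval_C, eval_sub]; ring
  eq_u v hv := by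
    have e : ((ElemData.diff c e₁ e₂).g + derivative (ElemData.diff c e₁ e₂).p) * v
        = C c * ((e₁.g + derivative e₁.p) * v - (e₂.g + derivative e₂.p) * v) := by
      simp only [ElemData.diff, derivative_C_mul, derivative_sub]; ring
    rw [e, itg_C_mul, map_sub, h₁.eq_u v hv, h₂.eq_u v hv]
    simp only [ElemData.diff, jpr, jpl, eval_mul, eval_C, eval_sub]; ring
  flux_ql := by
    have a := h₁.flux_ql; have b := h₂.flux_ql
    simp only [ElemData.diff, jql, jul, eval_mul, eval_C, eval_sub] at a b ⊢
    linear_combination c * a - c * b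
  flux_pl := by
    have a := h₁.flux_pl; have b := h₂.flux_pl
    simp only [ElemData.diff, jpl, jul, eval_mul, eval_C, eval_sub] at a b ⊢
    linear_combination c * a - c * b
  flux_qr := by
    have a := h₁.flux_qr; have b := h₂.flux_qr
    simp only [ElemData.diff, jqr, jur, jpr, eval_mul, eval_C, eval_sub] at a b ⊢
    linear_combination c * a - c * b

/-- Subtraction of multiples of the Legendre polynomial of degree `k`. -/
def shift (k : ℕ) (l r τp σ τ cu cq cp : ℝ) (e : ElemData) : ElemData where
  u := e.u - C cu * leg k l r
  q := e.q - C cq * leg k l r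
  p := e.p - C cp * leg k l r
  g := e.g
  ul := e.ul
  ur := e.ur
  ql := e.ql
  qr := e.qr
  pl := e.pl
  pr := e.pr
  cq := e.cq + cq
  cp := e.cp + cp
  α := e.α + (-1) ^ k * cq + τp * (-1) ^ k * cu
  β := e.β + (-1) ^ k * cp + σ * (-1) ^ k * cu
  γ := e.γ + cq - τ * cu - τ⁻¹ * cp

/-- `L_k` is orthogonal to `v'`, so integration by parts leaves only end values. A differentiated
multiple of `L_k` therefore acts on the error equations through its traces alone. -/
theorem itg_derivative_leg_mul (h : l < r) {v : ℝ[X]} (hv : v.natDegree ≤ k) :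
    itg l r (derivative (leg k l r) * v) = v.eval r - (-1) ^ k * v.eval l := by
  rw [itg_derivative_mul, eval_mul, eval_mul, eval_leg_right k h, eval_leg_left k h]
  have : itg l r (leg k l r * derivative v) = 0 := by
    rcases Nat.eq_zero_or_pos v.natDegree with h0 | h0
    · rw [derivative_of_natDegree_zero h0]; simp
    · exact itg_leg_mul_eq_zero l r (lt_of_lt_of_le (natDegree_derivative_lt h0.ne') hv)
  rw [this]; ring

/-- Differentiated multiples of `L_k` become end values, which the new jumps contain; the
undifferentiated ones in `q` and `p` become the volume residuals. Since `g` is left alone the third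
equation gets no residual, but after a time-dependent shift `g` is no longer the time derivative of
`u`. -/
theorem IsSys.shift {τp σ τ : ℝ} (h : l < r) (he : e.IsSys k l r τp σ τ) (cu cq cp : ℝ) :
    (e.shift k l r τp σ τ cu cq cp).IsSys k l r τp σ τ where
  deg_u := natDegree_sub_leg he.deg_u cu
  deg_q := natDegree_sub_leg he.deg_q cq
  deg_p := natDegree_sub_leg he.deg_p cp
  deg_g := he.deg_g
  eq_q v hv := by
    have e1 : ((e.shift k l r τp σ τ cu cq cp).q - derivative (e.shift k l r τp σ τ cu cq cp).u
        + C (e.shift k l r τp σ τ cu cq cp).cq * leg k l r) * v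
        = (e.q - derivative e.u + C e.cq * leg k l r) * v
          + C cu * (derivative (leg k l r) * v) := by
      simp only [ElemData.shift, derivative_C_mul, derivative_sub, C_add]; ring
    rw [e1, map_add, itg_C_mul, itg_derivative_leg_mul h hv, he.eq_q v hv]
    simp only [ElemData.shift, jur, jul, eval_mul, eval_C, eval_sub, eval_leg_left k h,
      eval_leg_right k h]
    ring
  eq_p v hv := by
    have e1 : ((e.shift k l r τp σ τ cu cq cp).p - derivative (e.shift k l r τp σ τ cu cq cp).q
        + C (e.shift k l r τp σ τ cu cq cp).cp * leg k l r) * v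
        = (e.p - derivative e.q + C e.cp * leg k l r) * v
          + C cq * (derivative (leg k l r) * v) := by
      simp only [ElemData.shift, derivative_C_mul, derivative_sub, C_add]; ring
    rw [e1, map_add, itg_C_mul, itg_derivative_leg_mul h hv, he.eq_p v hv]
    simp only [ElemData.shift, jqr, jql, eval_mul, eval_C, eval_sub, eval_leg_left k h,
      eval_leg_right k h]
    ring
  eq_u v hv := by
    have e1 : ((e.shift k l r τp σ τ cu cq cp).g
        + derivative (e.shift k l r τp σ τ cu cq cp).p) * v
        = (e.g + derivative e.p) * v - C cp * (derivative (leg k l r) * v) := by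
      simp only [ElemData.shift, derivative_C_mul, derivative_sub]; ring
    rw [e1, map_sub, itg_C_mul, itg_derivative_leg_mul h hv, he.eq_u v hv]
    simp only [ElemData.shift, jpr, jpl, eval_mul, eval_C, eval_sub, eval_leg_left k h,
      eval_leg_right k h]
    ring
  flux_ql := by
    have a := he.flux_ql
    simp only [ElemData.shift, jql, jul, eval_mul, eval_C, eval_sub, eval_leg_left k h] at a ⊢
    linear_combination a
  flux_pl := by
    have a := he.flux_pl
    simp only [ElemData.shift, jpl, jul, eval_mul, eval_C, eval_sub, eval_leg_left k h] at a ⊢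
    linear_combination a
  flux_qr := by
    have a := he.flux_qr
    simp only [ElemData.shift, jqr, jur, jpr, eval_mul, eval_C, eval_sub,
      eval_leg_right k h] at a ⊢
    linear_combination a

variable {e} {τp σ τ : ℝ}

/-! #### Moments -/

theorem itg_derivative_mul_leg_eq_zero {p : ℝ[X]} (hk : 0 < k) (hp : p.natDegree ≤ k) :
    itg l r (derivative p * leg k l r) = 0 :=
  itg_leg_mul_eq_zero' l r (lt_of_le_of_lt (natDegree_derivative_le _) (by omega))

/-- `L_k` annihilates the derivative in the equation, so the top moment is given by jumps and
residual alone. -/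
theorem IsSys.moment_q (hk : 0 < k) (h : l < r) (he : e.IsSys k l r τp σ τ) :
    itg l r (leg k l r * e.q) + e.cq * ((r - l) / (2 * k + 1))
      = e.jur r - (-1) ^ k * e.jul l := by
  have := he.eq_q _ (natDegree_leg_le k l r)
  rw [add_mul, sub_mul, mul_assoc, map_add, map_sub, itg_derivative_mul_leg_eq_zero hk he.deg_u,
    itg_C_mul, itg_leg_mul_self k h, eval_leg_right k h, eval_leg_left k h] at this
  rw [mul_comm (leg k l r)]; linarith

theorem IsSys.moment_p (hk : 0 < k) (h : l < r) (he : e.IsSys k l r τp σ τ) :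
    itg l r (leg k l r * e.p) + e.cp * ((r - l) / (2 * k + 1))
      = e.jqr r - (-1) ^ k * e.jql l := by
  have := he.eq_p _ (natDegree_leg_le k l r)
  rw [add_mul, sub_mul, mul_assoc, map_add, map_sub, itg_derivative_mul_leg_eq_zero hk he.deg_q,
    itg_C_mul, itg_leg_mul_self k h, eval_leg_right k h, eval_leg_left k h] at this
  rw [mul_comm (leg k l r)]; linarith

theorem itg_derivative_mul_leg' {n : ℕ} {p : ℝ[X]} (h : l < r) (hp : p.natDegree ≤ n + 1) :
    itg l r (derivative p * leg n l r) * (r - l)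
      = 2 * (2 * n + 3) * itg l r (leg (n + 1) l r * p) := by
  have := itg_derivative_mul_leg h hp
  rw [itg_leg_mul_self (n + 1) h] at this
  push_cast at this
  field_simp at this
  linear_combination this

/-- Testing with `L_{k-1}` removes the residual and turns the derivative into the top moment of `u`
divided by the length. Since the parity of the Legendre polynomial changes, this and `moment_q`
involve the sum and the difference of the two jumps, and can be solved for the left one. -/
theorem IsSys.moment_q' {n : ℕ} (h : l < r) (he : e.IsSys (n + 1) l r τp σ τ) :
    itg l r (leg n l r * e.q) * (r - l) - 2 * (2 * n + 3) * itg l r (leg (n + 1) l r * e.u)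
      = (r - l) * (e.jur r - (-1) ^ (n + 1) * -e.jul l) := by
  have h1 := he.eq_q _ ((natDegree_leg_le n l r).trans (by omega))
  rw [add_mul, sub_mul, mul_assoc, map_add, map_sub, itg_C_mul,
    itg_leg_mul_eq_zero l r (lt_of_le_of_lt (natDegree_leg_le n l r) (Nat.lt_succ_self n)),
    eval_leg_right n h, eval_leg_left n h] at h1
  have h2 := itg_derivative_mul_leg' h he.deg_u
  rw [mul_comm (leg n l r), ← h2, pow_succ]
  linear_combination (r - l) * h1

theorem IsSys.moment_p' {n : ℕ} (h : l < r) (he : e.IsSys (n + 1) l r τp σ τ) :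
    itg l r (leg n l r * e.p) * (r - l) - 2 * (2 * n + 3) * itg l r (leg (n + 1) l r * e.q)
      = (r - l) * (e.jqr r - (-1) ^ (n + 1) * -e.jql l) := by
  have h1 := he.eq_p _ ((natDegree_leg_le n l r).trans (by omega))
  rw [add_mul, sub_mul, mul_assoc, map_add, map_sub, itg_C_mul,
    itg_leg_mul_eq_zero l r (lt_of_le_of_lt (natDegree_leg_le n l r) (Nat.lt_succ_self n)),
    eval_leg_right n h, eval_leg_left n h] at h1
  have h2 := itg_derivative_mul_leg' h he.deg_q
  rw [mul_comm (leg n l r), ← h2, pow_succ]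
  linear_combination (r - l) * h1

/-- This trades the top moment of `p`, which no dissipation controls, for jumps and a moment of `g`,
that is, of a time derivative. -/
theorem IsSys.moment_g' {n : ℕ} (h : l < r) (he : e.IsSys (n + 1) l r τp σ τ) :
    itg l r (e.g * leg n l r) * (r - l) + 2 * (2 * n + 3) * itg l r (leg (n + 1) l r * e.p)
      = -((r - l) * (e.jpr r + (-1) ^ (n + 1) * e.jpl l)) := by
  have h1 := he.eq_u _ ((natDegree_leg_le n l r).trans (by omega))
  rw [add_mul, map_add, eval_leg_right n h, eval_leg_left n h] at h1
  have h2 := itg_derivative_mul_leg' h he.deg_p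
  rw [← h2, pow_succ]
  linear_combination (r - l) * h1

/-! #### Energy identities -/

/-- The first equation tested with `q` plus the second tested with `u`; the derivatives combine to
that of `u q`. It is the source of a bound for `‖q‖²`. -/
theorem IsSys.product_qu (he : e.IsSys k l r τp σ τ) :
    itg l r (e.q * e.q) + itg l r (e.p * e.u) + (e.jur r * e.jqr r - e.jul l * e.jql l)
      - (e.ur * e.qr - e.ul * e.ql)
      + e.cq * itg l r (leg k l r * e.q) + e.cp * itg l r (leg k l r * e.u) = 0 := by
  have h1 := he.eq_q _ he.deg_q
  have h2 := he.eq_p _ he.deg_u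
  have h3 := itg_derivative_mul l r e.u e.q
  rw [add_mul, sub_mul, mul_assoc, map_add, map_sub, itg_C_mul] at h1 h2
  rw [mul_comm e.u (derivative e.q), eval_mul, eval_mul] at h3
  simp only [jur, jul, jqr, jql] at h1 h2 ⊢
  linear_combination h1 + h2 + h3

/-- The second equation tested with `p` minus the third tested with `q`; the derivatives combine to
that of `p q`. It is the source of a bound for `‖p‖²`. -/
theorem IsSys.product_pq (he : e.IsSys k l r τp σ τ) :
    itg l r (e.p * e.p) - itg l r (e.g * e.q) + e.cp * itg l r (leg k l r * e.p)
      = (e.pr * e.qr - e.pl * e.ql) - (e.jpr r * e.jqr r - e.jpl l * e.jql l) := by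
  have h1 := he.eq_p _ he.deg_p
  have h2 := he.eq_u _ he.deg_q
  have h3 := itg_derivative_mul l r e.p e.q
  rw [add_mul, sub_mul, mul_assoc, map_add, map_sub, itg_C_mul] at h1
  rw [add_mul, map_add] at h2
  rw [mul_comm e.p (derivative e.q), eval_mul, eval_mul] at h3
  simp only [jpr, jpl, jqr, jql] at h1 h2 ⊢
  linear_combination h1 - h2 + h3

/-- The KdV energy: third equation with `u`, minus first with `p`, plus second with `q`. The volume
terms are the derivative of `p u - q²/2`. The boundary terms split into a part in the single valued
traces, which telescopes over the mesh, and one in the jumps, which is dissipative. -/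
theorem IsSys.energy (he : e.IsSys k l r τp σ τ) :
    itg l r (e.g * e.u) + ((e.pr * e.ur - e.qr ^ 2 / 2) - (e.pl * e.ul - e.ql ^ 2 / 2))
      + ((e.jqr r ^ 2 / 2 - e.jpr r * e.jur r) - (e.jql l ^ 2 / 2 - e.jpl l * e.jul l))
      = e.cq * itg l r (leg k l r * e.p) - e.cp * itg l r (leg k l r * e.q) := by
  have h1 := he.eq_u _ he.deg_u
  have h2 := he.eq_q _ he.deg_p
  have h3 := he.eq_p _ he.deg_q
  have h4 := itg_derivative_mul l r e.p e.u
  have h5 := itg_derivative_mul l r e.q e.q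
  rw [add_mul, map_add] at h1
  rw [add_mul, sub_mul, mul_assoc, map_add, map_sub, itg_C_mul] at h2 h3
  rw [mul_comm e.p (derivative e.u), eval_mul, eval_mul] at h4
  rw [mul_comm e.q (derivative e.q), eval_mul, eval_mul] at h5
  rw [mul_comm e.p e.q] at h3
  simp only [jpr, jpl, jqr, jql, jur, jul] at h1 h2 h3 ⊢
  linear_combination h1 - h2 + h3 - h4 + h5 / 2

/-- The energy identity with the weight `X + c`. -/
theorem IsSys.weighted_energy (h : l < r) (he : e.IsSys k l r τp σ τ) (c : ℝ) :
    itg l r (e.g * ((X + C c) * e.u)) + 3 / 2 * itg l r (e.q * e.q)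
      + ((r + c) * (e.pr * e.ur - e.qr ^ 2 / 2) - (l + c) * (e.pl * e.ul - e.ql ^ 2 / 2))
      - (e.ur * e.qr - e.ul * e.ql)
      + ((r + c) * (e.jqr r ^ 2 / 2 - e.jpr r * e.jur r)
        - (l + c) * (e.jql l ^ 2 / 2 - e.jpl l * e.jul l))
      + (e.jur r * e.jqr r - e.jul l * e.jql l)
      - e.cq * itg l r (leg k l r * ((X + C c) * e.p))
      + e.cp * itg l r (leg k l r * ((X + C c) * e.q))
      + e.cq * itg l r (leg k l r * e.q) + e.cp * itg l r (leg k l r * e.u)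
      = (k + 1) / 2 * itg l r (leg k l r * e.u) * (e.jpr r + (-1) ^ k * e.jpl l)
        + (k + 1) / 2 * itg l r (leg k l r * e.p) * (e.jur r + (-1) ^ k * e.jul l)
        - (k + 1) / 2 * itg l r (leg k l r * e.q) * (e.jqr r + (-1) ^ k * e.jql l) := by
  -- `(X + c) x` has degree `k + 1` and is not an admissible test function, but its `L²` projection
  -- is. The subtracted multiple of `L_{k+1}` is invisible in the volume integrals and appears only
  -- at the ends; this produces the right-hand side of the identity.
  have test : ∀ f x : ℝ[X], f.natDegree ≤ k → itg l r (f * ((X + C c) * x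
      - C ((k + 1) / 2 * itg l r (leg k l r * x)) * leg (k + 1) l r))
      = itg l r (f * ((X + C c) * x)) := by
    intro f x hf
    rw [mul_sub, map_sub, mul_left_comm f (C _), itg_C_mul,
      itg_leg_mul_eq_zero' l r (Nat.lt_succ_iff.2 hf), mul_zero, sub_zero]
  have dd : ∀ {x : ℝ[X]}, x.natDegree ≤ k → (derivative x).natDegree ≤ k := fun hx =>
    (natDegree_derivative_le _).trans (by omega)
  have h1 := he.eq_u _ (natDegree_mul_linear_sub h c he.deg_u)
  have h2 := he.eq_q _ (natDegree_mul_linear_sub h c he.deg_p)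
  have h3 := he.eq_p _ (natDegree_mul_linear_sub h c he.deg_q)
  rw [add_mul, map_add, test _ _ he.deg_g, test _ _ (dd he.deg_p)] at h1
  rw [add_mul, sub_mul, mul_assoc (C _), map_add, map_sub, itg_C_mul, test _ _ he.deg_q,
    test _ _ (dd he.deg_u), test _ _ (natDegree_leg_le k l r)] at h2
  rw [add_mul, sub_mul, mul_assoc (C _), map_add, map_sub, itg_C_mul, test _ _ he.deg_p,
    test _ _ (dd he.deg_q), test _ _ (natDegree_leg_le k l r)] at h3
  have h4 : itg l r (derivative e.p * ((X + C c) * e.u))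
      + itg l r (derivative e.u * ((X + C c) * e.p)) + itg l r (e.p * e.u)
      = (r + c) * e.p.eval r * e.u.eval r - (l + c) * e.p.eval l * e.u.eval l := by
    have := itg_derivative l r ((X + C c) * e.p * e.u)
    rw [derivative_mul, derivative_mul, derivative_add, derivative_X, derivative_C] at this
    rw [← map_add, ← map_add]
    simp only [eval_mul, eval_add, eval_X, eval_C] at this
    rw [← this]; congr 1; ring
  have h5 : 2 * itg l r (derivative e.q * ((X + C c) * e.q)) + itg l r (e.q * e.q)
      = (r + c) * e.q.eval r * e.q.eval r - (l + c) * e.q.eval l * e.q.eval l := by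
    have := itg_derivative l r ((X + C c) * e.q * e.q)
    rw [derivative_mul, derivative_mul, derivative_add, derivative_X, derivative_C] at this
    rw [← itg_C_mul, ← map_add]
    simp only [eval_mul, eval_add, eval_X, eval_C] at this
    rw [← this, map_ofNat]; congr 1; ring
  have h6 : itg l r (e.p * ((X + C c) * e.q)) = itg l r (e.q * ((X + C c) * e.p)) := by
    congr 1; ring
  -- Differentiating the weight gives `½‖q‖² - (p, u)`; adding this identity removes the indefinite
  -- product and raises the coefficient of `‖q‖²` to `3/2`.
  have h7 := he.product_qu
  simp only [eval_sub, eval_mul, eval_add, eval_X, eval_C, eval_leg_right _ h,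
    eval_leg_left _ h] at h1 h2 h3
  simp only [pow_succ, jpr, jpl, jqr, jql, jur, jul] at h1 h2 h3 h7 ⊢
  linear_combination h1 - h2 + h3 - h4 + h5 / 2 + h7 - h6

end ElemData

end KdVHDG

end

noncomputable section

namespace KdVHDG

/-! ### Moments against `(X - l) L` -/

/-- The mean of `X - l` with the weight `L²`. -/
def legMean (k : ℕ) (l r : ℝ) : ℝ :=
  itg l r ((X - C l) * (leg k l r * leg k l r)) / itg l r (leg k l r * leg k l r)

/-- The coefficient of `L_k` in the Legendre expansion of `(X - l) L_{k+1}`. -/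
def legCoupling (n : ℕ) (l r : ℝ) : ℝ :=
  itg l r ((X - C l) * leg (n + 1) l r * leg n l r) / itg l r (leg n l r * leg n l r)

theorem itg_leg_mul_self_pos (n : ℕ) {l r : ℝ} (h : l < r) :
    0 < itg l r (leg n l r * leg n l r) := by
  rw [itg_leg_mul_self n h]; exact div_pos (sub_pos.2 h) (by positivity)

theorem legMean_nonneg (k : ℕ) {l r : ℝ} (h : l < r) : 0 ≤ legMean k l r := by
  refine div_nonneg (itg_nonneg h.le fun x hx => ?_) (itg_leg_mul_self_pos k h).le
  simp only [eval_mul, eval_sub, eval_X, eval_C]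
  exact mul_nonneg (sub_nonneg.2 hx.1) (mul_self_nonneg _)

theorem legMean_le (k : ℕ) {l r : ℝ} (h : l < r) : legMean k l r ≤ r - l := by
  rw [legMean, div_le_iff₀ (itg_leg_mul_self_pos k h), ← itg_C_mul]
  refine itg_mono h.le fun x hx => ?_
  simp only [eval_mul, eval_sub, eval_X, eval_C]
  exact mul_le_mul_of_nonneg_right (by linarith [hx.2]) (mul_self_nonneg _)

theorem abs_legCoupling_le (n : ℕ) {l r : ℝ} (h : l < r) : |legCoupling n l r| ≤ r - l := by
  have hh : 0 < r - l := sub_pos.2 h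
  have h0 := itg_leg_mul_self_pos n h
  have h1 := itg_mul_sq_le h.le ((X - C l) * leg (n + 1) l r) (leg n l r)
  have h2 : itg l r ((X - C l) * leg (n + 1) l r * ((X - C l) * leg (n + 1) l r))
      ≤ (r - l) ^ 2 * itg l r (leg (n + 1) l r * leg (n + 1) l r) := by
    rw [← itg_C_mul]
    refine itg_mono h.le fun x hx => ?_
    simp only [eval_mul, eval_sub, eval_X, eval_C]
    have : (x - l) ^ 2 ≤ (r - l) ^ 2 := by
      have := hx.1; have := hx.2
      exact pow_le_pow_left₀ (by linarith) (by linarith) 2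
    nlinarith [mul_self_nonneg ((leg (n + 1) l r).eval x)]
  have h3 : itg l r (leg (n + 1) l r * leg (n + 1) l r) ≤ itg l r (leg n l r * leg n l r) := by
    rw [itg_leg_mul_self _ h, itg_leg_mul_self _ h]
    refine div_le_div_of_nonneg_left hh.le (by positivity) ?_
    push_cast; linarith
  rw [legCoupling, abs_div, abs_of_pos h0, div_le_iff₀ h0]
  refine abs_le_of_sq_le_sq ?_ (by positivity)
  calc _ ≤ _ := h1
    _ ≤ ((r - l) ^ 2 * itg l r (leg (n + 1) l r * leg (n + 1) l r))
        * itg l r (leg n l r * leg n l r) := mul_le_mul_of_nonneg_right h2 h0.le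
    _ ≤ ((r - l) ^ 2 * itg l r (leg n l r * leg n l r)) * itg l r (leg n l r * leg n l r) := by
        gcongr
    _ = _ := by ring

theorem itg_leg_mul_eq_zero_of_mem {n : ℕ} (l r : ℝ) {v : ℝ[X]} (hv : v ∈ degreeLT ℝ n) :
    itg l r (leg n l r * v) = 0 := by
  rcases eq_or_ne v 0 with rfl | h0
  · simp
  · exact itg_leg_mul_eq_zero l r ((natDegree_lt_iff_degree_lt h0).2 (mem_degreeLT.1 hv))

/-- Only the two top Legendre components of `x` matter: for a remainder `y` of degree below `n`, `(X
- l) y` still has degree at most `n` and is orthogonal to `L_{n+1}`. -/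
theorem itg_leg_weight {n : ℕ} {l r : ℝ} (h : l < r) (c : ℝ) {x : ℝ[X]}
    (hx : x.natDegree ≤ n + 1) :
    itg l r (leg (n + 1) l r * ((X + C c) * x))
      = (l + c + legMean (n + 1) l r) * itg l r (leg (n + 1) l r * x)
        + legCoupling n l r * itg l r (leg n l r * x) := by
  set c₁ := x.coeff (n + 1) / legLead (n + 1) l r with hc₁
  set z := x - C c₁ * leg (n + 1) l r with hz
  have hzd : z.natDegree ≤ n := Nat.lt_succ_iff.1 (natDegree_lt_of_coeff_eq_zero (by omega)
    (natDegree_sub_leg hx _) (coeff_sub_leg h x))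
  set c₂ := z.coeff n / legLead n l r with hc₂
  set y := z - C c₂ * leg n l r with hy
  have hyd : y ∈ degreeLT ℝ n := by
    rw [mem_degreeLT, degree_lt_iff_coeff_zero]
    intro m hm
    rcases hm.eq_or_lt with rfl | hm
    · exact coeff_sub_leg h z
    · exact coeff_eq_zero_of_natDegree_lt (lt_of_le_of_lt (natDegree_sub_leg hzd _) hm)
  have hyd' : (X - C l) * y ∈ degreeLT ℝ (n + 1) := by
    rcases eq_or_ne y 0 with h0 | h0
    · rw [h0, mul_zero]; exact zero_mem _
    · have := (natDegree_lt_iff_degree_lt h0).2 (mem_degreeLT.1 hyd)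
      rw [mem_degreeLT_iff]
      refine natDegree_mul_le.trans ?_
      rw [natDegree_X_sub_C]; omega
  have hx' : x = C c₁ * leg (n + 1) l r + C c₂ * leg n l r + y := by rw [hy, hz]; ring
  have l1 := itg_leg_mul_self_pos (n + 1) h
  have l0 := itg_leg_mul_self_pos n h
  have o1 : itg l r (leg (n + 1) l r * leg n l r) = 0 :=
    itg_leg_mul_eq_zero l r (Nat.lt_succ_iff.2 (natDegree_leg_le n l r))
  have o2 : itg l r (leg (n + 1) l r * y) = 0 := itg_leg_mul_eq_zero_of_mem l r
    (degreeLT_mono (Nat.le_succ n) hyd)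
  have o3 : itg l r (leg n l r * y) = 0 := itg_leg_mul_eq_zero_of_mem l r hyd
  have o4 : itg l r (leg (n + 1) l r * ((X - C l) * y)) = 0 :=
    itg_leg_mul_eq_zero_of_mem l r hyd'
  have m1 : itg l r (leg (n + 1) l r * x)
      = c₁ * itg l r (leg (n + 1) l r * leg (n + 1) l r) := itg_leg_mul h hx
  have m0 : itg l r (leg n l r * x) = c₂ * itg l r (leg n l r * leg n l r) := by
    rw [hx', mul_add, mul_add, map_add, map_add, mul_left_comm, itg_C_mul, mul_left_comm,
      itg_C_mul, o3, mul_comm (leg n l r), o1]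
    ring
  have e : leg (n + 1) l r * ((X + C c) * x) = C (l + c) * (leg (n + 1) l r * x)
      + C c₁ * ((X - C l) * (leg (n + 1) l r * leg (n + 1) l r))
      + C c₂ * ((X - C l) * leg (n + 1) l r * leg n l r)
      + leg (n + 1) l r * ((X - C l) * y) := by
    have : leg (n + 1) l r * ((X - C l) * x) = C c₁ * ((X - C l) * (leg (n + 1) l r
        * leg (n + 1) l r)) + C c₂ * ((X - C l) * leg (n + 1) l r * leg n l r)
        + leg (n + 1) l r * ((X - C l) * y) := by rw [hx']; ring
    rw [add_assoc, add_assoc, ← add_assoc (C c₁ * _), ← this, C_add]; ring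
  rw [e, map_add, map_add, map_add, itg_C_mul, itg_C_mul, itg_C_mul, o4, m0, legMean, legCoupling]
  have : c₁ * itg l r ((X - C l) * (leg (n + 1) l r * leg (n + 1) l r))
      = itg l r ((X - C l) * (leg (n + 1) l r * leg (n + 1) l r))
        / itg l r (leg (n + 1) l r * leg (n + 1) l r) * itg l r (leg (n + 1) l r * x) := by
    rw [m1]; field_simp
  rw [this]
  field_simp
  ring

/-! ### Sizes on one element -/

namespace ElemData

variable {k : ℕ} {l r τp σ τ : ℝ} {e : ElemData}

/-- The sum of the squares of the independent jumps. -/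
def jumpSq (l r : ℝ) (e : ElemData) : ℝ := e.jul l ^ 2 + e.jur r ^ 2 + e.jpr r ^ 2

theorem jumpSq_nonneg (l r : ℝ) (e : ElemData) : 0 ≤ e.jumpSq l r := by
  unfold jumpSq; positivity

theorem abs_jul_le (l r : ℝ) (e : ElemData) : |e.jul l| ≤ Real.sqrt (e.jumpSq l r) :=
  Real.abs_le_sqrt (by unfold jumpSq; nlinarith [sq_nonneg (e.jur r), sq_nonneg (e.jpr r)])

theorem abs_jur_le (l r : ℝ) (e : ElemData) : |e.jur r| ≤ Real.sqrt (e.jumpSq l r) :=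
  Real.abs_le_sqrt (by unfold jumpSq; nlinarith [sq_nonneg (e.jul l), sq_nonneg (e.jpr r)])

theorem abs_jpr_le (l r : ℝ) (e : ElemData) : |e.jpr r| ≤ Real.sqrt (e.jumpSq l r) :=
  Real.abs_le_sqrt (by unfold jumpSq; nlinarith [sq_nonneg (e.jur r), sq_nonneg (e.jul l)])

end ElemData

/-- Admissible values of the stabilization function on an element, with `τ` and `τ⁻¹` bounded
by `A`. -/
structure StabBound (A τp σ τ : ℝ) : Prop where
  one_le : 1 ≤ A
  pos : 0 < τ
  le : τ ≤ A
  inv_le : τ⁻¹ ≤ A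
  tp_nonneg : 0 ≤ τp
  tp_le : τp ≤ 1
  sig_ge : -2 ≤ σ
  sig_le : σ ≤ -(1 / 2) - 1 / 2 * τp ^ 2

namespace ElemData

variable {k : ℕ} {l r τp σ τ A : ℝ} {e : ElemData}

theorem IsSys.abs_jqr_le (hs : StabBound A τp σ τ) (he : e.IsSys k l r τp σ τ) :
    |e.jqr r| ≤ 2 * A * Real.sqrt (e.jumpSq l r) + |e.γ| := by
  rw [he.flux_qr]
  have h1 : |τ * e.jur r| ≤ A * Real.sqrt (e.jumpSq l r) := by
    rw [abs_mul, abs_of_pos hs.pos]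
    exact mul_le_mul hs.le (abs_jur_le l r e) (abs_nonneg _) (by linarith [hs.one_le])
  have h2 : |τ⁻¹ * e.jpr r| ≤ A * Real.sqrt (e.jumpSq l r) := by
    rw [abs_mul, abs_of_pos (inv_pos.2 hs.pos)]
    exact mul_le_mul hs.inv_le (abs_jpr_le l r e) (abs_nonneg _) (by linarith [hs.one_le])
  have := abs_add_three (τ * e.jur r) (τ⁻¹ * e.jpr r) e.γ
  linarith

theorem IsSys.abs_jql_le (hs : StabBound A τp σ τ) (he : e.IsSys k l r τp σ τ) :
    |e.jql l| ≤ A * Real.sqrt (e.jumpSq l r) + |e.α| := by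
  rw [he.flux_ql]
  have h1 : |-τp * e.jul l| ≤ A * Real.sqrt (e.jumpSq l r) := by
    rw [abs_mul, abs_neg, abs_of_nonneg hs.tp_nonneg]
    exact mul_le_mul (hs.tp_le.trans hs.one_le) (abs_jul_le l r e) (abs_nonneg _)
      (by linarith [hs.one_le])
  have := abs_add_le (-τp * e.jul l) e.α
  linarith

theorem IsSys.abs_jpl_le (hs : StabBound A τp σ τ) (he : e.IsSys k l r τp σ τ) :
    |e.jpl l| ≤ 2 * Real.sqrt (e.jumpSq l r) + |e.β| := by
  rw [he.flux_pl]
  have h1 : |-σ * e.jul l| ≤ 2 * Real.sqrt (e.jumpSq l r) := by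
    rw [abs_mul, abs_neg]
    refine mul_le_mul ?_ (abs_jul_le l r e) (abs_nonneg _) (by norm_num)
    rw [abs_le]
    have := hs.sig_le; have := hs.sig_ge
    constructor <;> nlinarith [sq_nonneg τp]
  have := abs_add_le (-σ * e.jul l) e.β
  linarith

/-- The bound `τ⁻¹ ≤ A` is a lower bound for `τ`; this keeps the dissipation uniform over the
stabilization functions. -/
theorem sq_div_le_mul_self_sq (hs : StabBound A τp σ τ) (x : ℝ) : x ^ 2 / A ^ 2 ≤ (τ * x) ^ 2 := by
  have hA : 0 < A := lt_of_lt_of_le one_pos hs.one_le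
  have h1 : 1 ≤ τ * A := by
    have := mul_le_mul_of_nonneg_left hs.inv_le hs.pos.le
    rwa [mul_inv_cancel₀ hs.pos.ne'] at this
  rw [div_le_iff₀ (by positivity)]
  have h2 : 1 ≤ (τ * A) ^ 2 := one_le_pow₀ h1
  nlinarith [mul_le_mul_of_nonneg_right h2 (sq_nonneg x)]

theorem sq_div_le_inv_mul_self_sq (hs : StabBound A τp σ τ) (x : ℝ) :
    x ^ 2 / A ^ 2 ≤ (τ⁻¹ * x) ^ 2 := by
  have hA : 0 < A := lt_of_lt_of_le one_pos hs.one_le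
  have hi : 0 < τ⁻¹ := inv_pos.2 hs.pos
  have h1 : 1 ≤ τ⁻¹ * A := by
    have := mul_le_mul_of_nonneg_left hs.le hi.le
    rwa [inv_mul_cancel₀ hs.pos.ne'] at this
  rw [div_le_iff₀ (by positivity)]
  have h2 : 1 ≤ (τ⁻¹ * A) ^ 2 := one_le_pow₀ h1
  nlinarith [mul_le_mul_of_nonneg_right h2 (sq_nonneg x)]

/-- Dissipation at the right end of an element. -/
theorem IsSys.dissipation_right (hs : StabBound A τp σ τ) (he : e.IsSys k l r τp σ τ)
    (hγ : e.γ = 0) :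
    (e.jur r ^ 2 + e.jpr r ^ 2) / (2 * A ^ 2) ≤ e.jqr r ^ 2 / 2 - e.jpr r * e.jur r := by
  have hA : 0 < A := lt_of_lt_of_le one_pos hs.one_le
  have h1 := sq_div_le_mul_self_sq hs (e.jur r)
  have h2 := sq_div_le_inv_mul_self_sq hs (e.jpr r)
  -- Because the coefficients of the two jumps have product `1`, the cross term of the square
  -- cancels the product of the jumps exactly.
  have h3 : e.jqr r ^ 2 / 2 - e.jpr r * e.jur r
      = ((τ * e.jur r) ^ 2 + (τ⁻¹ * e.jpr r) ^ 2) / 2 := by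
    rw [he.flux_qr, hγ]
    have : τ * τ⁻¹ = 1 := mul_inv_cancel₀ hs.pos.ne'
    linear_combination e.jur r * e.jpr r * this
  rw [h3]
  have : (e.jur r ^ 2 + e.jpr r ^ 2) / (2 * A ^ 2)
      = (e.jur r ^ 2 / A ^ 2 + e.jpr r ^ 2 / A ^ 2) / 2 := by field_simp
  rw [this]; linarith

/-- Dissipation at the left end of an element. -/
theorem IsSys.dissipation_left (hs : StabBound A τp σ τ) (he : e.IsSys k l r τp σ τ)
    (hα : e.α = 0) :
    e.jul l ^ 2 / 2 + e.β * e.jul l ≤ -(e.jql l ^ 2 / 2 - e.jpl l * e.jul l) := by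
  -- The coefficient of the squared jump becomes `-σ - τp²/2`, at least `1/2` by the upper bound on
  -- `σ`.
  rw [he.flux_ql, he.flux_pl, hα]
  nlinarith [mul_le_mul_of_nonneg_right hs.sig_le (sq_nonneg (e.jul l))]

end ElemData

end KdVHDG

end

noncomputable section

namespace KdVHDG

/-! ### The weighted energy inequality on one element -/

theorem abs_mul_le_of_abs_le {x y a b : ℝ} (hx : |x| ≤ a) (hy : |y| ≤ b) : |x * y| ≤ a * b := by
  rw [abs_mul]; exact mul_le_mul hx hy (abs_nonneg _) ((abs_nonneg _).trans hx)

theorem abs_itg_leg_mul_le (n : ℕ) {l r : ℝ} (h : l < r) (x : ℝ[X]) :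
    |itg l r (leg n l r * x)| ≤ Real.sqrt (r - l) * Real.sqrt (itg l r (x * x)) := by
  refine (abs_itg_mul_le h.le _ _).trans (mul_le_mul_of_nonneg_right (Real.sqrt_le_sqrt ?_)
    (Real.sqrt_nonneg _))
  rw [itg_leg_mul_self n h]
  exact div_le_self (sub_pos.2 h).le (by linarith [(Nat.cast_nonneg n : (0 : ℝ) ≤ n)])

/-- The weight that the energy estimate needs at the left end. -/
def weightMin (n : ℕ) (A : ℝ) : ℝ := 2 * A ^ 2 * (15 * (2 * n + 3) * A + 1)

/-- The constant of the weighted energy inequality, for elements of length at most `D` and weights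
bounded by `Ψ`. -/
def weightConst (n : ℕ) (A D Ψ : ℝ) : ℝ :=
  (3 * (2 * n + 3) * (1 + D)) ^ 2
    + (2 * (2 * n + 3) * (1 + D) + 3 * A * (2 * n + 3) * (1 + D) + 3 * A * (1 + D)
        + 3 * Ψ * (1 + D)) ^ 2
    + (2 * Ψ + D + 1 + 2 * (2 * n + 3)) ^ 2 + (3 * (2 * n + 3) + 1) + 2 * Ψ

/-- The dissipation exceeds the bad `j²` terms by one unit of `j²`. This unit absorbs the products
`a j` and `m j`, and `b²` absorbs `m b`; only `a²` and `m²` survive. -/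
theorem young_absorb {a b j m c1 c2 c3 c4 c5 c6 : ℝ} (hc3 : 0 ≤ c3) (hc6 : 0 ≤ c6) :
    -(3 / 2) * b ^ 2 - (c1 + 1) * j ^ 2 + c1 * j ^ 2 + c2 * (a * j) + c3 * (a * m)
      + c4 * (m * j) + c5 * (m * b) + c6 * m ^ 2
      ≤ (c2 ^ 2 + c4 ^ 2 + c5 ^ 2 + c3 + c6) * (a ^ 2 + m ^ 2) := by
  nlinarith [sq_nonneg (c2 * a - j), sq_nonneg (c4 * m - j), sq_nonneg (c5 * m - b),
    sq_nonneg b, sq_nonneg j, mul_nonneg hc3 (sq_nonneg (a - m)), mul_nonneg hc6 (sq_nonneg a),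
    mul_nonneg hc3 (sq_nonneg a), mul_nonneg hc3 (sq_nonneg m), sq_nonneg (c2 * m),
    sq_nonneg (c4 * a), sq_nonneg (c5 * a), sq_nonneg (c2 * a), sq_nonneg (c4 * m),
    sq_nonneg (c5 * m)]

namespace ElemData

variable {l r τp σ τ A : ℝ} {e : ElemData}

-- In the application `x` is the time derivative of the shifted `u`, and `g` exceeds it by the
-- velocity of the relaxed coefficient times `L_k`, of size `β/(r - l)`. The bound nevertheless
-- contains no negative power of the length. The term with `cq` and `x` is part of the time
-- derivative of a correction of the energy; it is there to dispose of the top moment of `p`.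
set_option maxHeartbeats 1600000 in
theorem IsSys.weighted_le {n : ℕ} (h : l < r) (hs : StabBound A τp σ τ)
    (he : e.IsSys (n + 1) l r τp σ τ) (hα : e.α = 0) (hγ : e.γ = 0) {x : ℝ[X]}
    (hg : e.g = x + C ((-1) ^ (n + 1) * e.β / ((r - l) / (2 * n + 3))) * leg (n + 1) l r)
    {c D Ψ : ℝ} (hD : r - l ≤ D) (hK : weightMin n A ≤ l + c) (hψ : r + c ≤ Ψ) :
    itg l r (x * ((X + C c) * e.u))
      + 1 / 2 * (l + c + legMean (n + 1) l r) * ((r - l) / (2 * n + 3)) * e.cq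
        * itg l r (x * leg n l r)
      + ((r + c) * (e.pr * e.ur - e.qr ^ 2 / 2) - (l + c) * (e.pl * e.ul - e.ql ^ 2 / 2))
      - (e.ur * e.qr - e.ul * e.ql)
      ≤ weightConst n A D Ψ
        * (itg l r (e.u * e.u) + (r - l) * (e.cq ^ 2 + e.cp ^ 2 + e.β ^ 2)) := by
  have hh : 0 < r - l := sub_pos.2 h
  have hn : (0 : ℝ) ≤ n := Nat.cast_nonneg n
  have hA1 := hs.one_le
  have hA : 0 < A := by linarith
  set s : ℝ := (-1) ^ (n + 1) with hsdef
  have hs2 : s * s = 1 := by rw [hsdef, ← pow_add, ← two_mul, pow_mul]; norm_num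
  have hsabs : |s| ≤ 1 := by rw [hsdef, abs_pow, abs_neg, abs_one, one_pow]
  set κ : ℝ := 2 * n + 3 with hκ
  have hκ1 : 1 ≤ κ := by rw [hκ]; linarith
  have hκ0 : 0 < κ := by linarith
  set η := Real.sqrt (r - l) with hη
  have hη0 : 0 < η := Real.sqrt_pos.2 hh
  have hηsq : η * η = r - l := Real.mul_self_sqrt hh.le
  have hD0 : 0 < D := lt_of_lt_of_le hh hD
  set E : ℝ := 1 + D with hE
  have hE0 : 0 < E := by rw [hE]; linarith
  have hηE : η ≤ E := by
    rw [hη, hE, Real.sqrt_le_left (by linarith)]; nlinarith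
  set a := Real.sqrt (itg l r (e.u * e.u)) with ha
  set b := Real.sqrt (itg l r (e.q * e.q)) with hb
  set j := Real.sqrt (e.jumpSq l r) with hj
  set m := Real.sqrt ((r - l) * (e.cq ^ 2 + e.cp ^ 2 + e.β ^ 2)) with hm
  have ha0 : 0 ≤ a := Real.sqrt_nonneg _
  have hb0 : 0 ≤ b := Real.sqrt_nonneg _
  have hj0 : 0 ≤ j := Real.sqrt_nonneg _
  have hm0 : 0 ≤ m := Real.sqrt_nonneg _
  have hasq : a ^ 2 = itg l r (e.u * e.u) := Real.sq_sqrt (itg_mul_self_nonneg h.le _)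
  have hbsq : b ^ 2 = itg l r (e.q * e.q) := Real.sq_sqrt (itg_mul_self_nonneg h.le _)
  have hjsq : j ^ 2 = e.jul l ^ 2 + e.jur r ^ 2 + e.jpr r ^ 2 :=
    Real.sq_sqrt (jumpSq_nonneg l r e)
  have hmsq : m ^ 2 = (r - l) * (e.cq ^ 2 + e.cp ^ 2 + e.β ^ 2) :=
    Real.sq_sqrt (by positivity)
  have hmc : ∀ y : ℝ, y ^ 2 ≤ e.cq ^ 2 + e.cp ^ 2 + e.β ^ 2 → η * |y| ≤ m := by
    intro y hy
    have := Real.abs_le_sqrt (x := η * |y|) (y := (r - l) * (e.cq ^ 2 + e.cp ^ 2 + e.β ^ 2)) (by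
      rw [mul_pow, sq_abs, pow_two η, hηsq]; exact mul_le_mul_of_nonneg_left hy hh.le)
    rwa [abs_of_nonneg (by positivity)] at this
  have hmq : η * |e.cq| ≤ m := hmc _ (by nlinarith [sq_nonneg e.cp, sq_nonneg e.β])
  have hmp : η * |e.cp| ≤ m := hmc _ (by nlinarith [sq_nonneg e.cq, sq_nonneg e.β])
  have hmβ : η * |e.β| ≤ m := hmc _ (by nlinarith [sq_nonneg e.cq, sq_nonneg e.cp])
  -- moments
  have u1 := abs_itg_leg_mul_le (n + 1) h e.u
  have u0 := abs_itg_leg_mul_le n h e.u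
  have q1 := abs_itg_leg_mul_le (n + 1) h e.q
  have q0 := abs_itg_leg_mul_le n h e.q
  rw [← ha, ← hη] at u1 u0
  rw [← hb, ← hη] at q1 q0
  have R1 := he.moment_q (by omega) h
  have R2 := he.moment_p (by omega) h
  have R3 := he.moment_q' h
  have R4 := he.moment_p' h
  have R5 := he.moment_g' h
  have Wt := he.weighted_energy h c
  have wu := itg_leg_weight h c he.deg_u
  have wq := itg_leg_weight h c he.deg_q
  have wp := itg_leg_weight h c he.deg_p
  have hgm : itg l r (e.g * leg n l r) = itg l r (x * leg n l r) := by
    rw [hg, add_mul, map_add, mul_assoc, itg_C_mul, itg_leg_mul_eq_zero l r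
      (Nat.lt_succ_iff.2 (natDegree_leg_le n l r)), mul_zero, add_zero]
  have hgw : itg l r (e.g * ((X + C c) * e.u)) = itg l r (x * ((X + C c) * e.u))
      + s * e.β / ((r - l) / κ) * itg l r (leg (n + 1) l r * ((X + C c) * e.u)) := by
    rw [hg, add_mul, map_add, mul_assoc (C _), itg_C_mul]
  rw [hgm] at R5
  rw [hgw, wu, wp, wq, ← hsdef, ← hbsq] at Wt
  rw [← hsdef] at R1 R2 R3 R4 R5
  rw [← hκ] at R3 R4 R5
  push_cast at R1 R2 Wt
  have hk2 : (2 * ((n : ℝ) + 1) + 1) = κ := by rw [hκ]; ring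
  rw [hk2] at R1 R2
  have B0 := legMean_nonneg (n + 1) h
  have B1 := legMean_le (n + 1) h
  have A1 := abs_legCoupling_le n h
  set B := legMean (n + 1) l r
  set Q := legCoupling n l r
  set mu := itg l r (leg (n + 1) l r * e.u)
  set mq := itg l r (leg (n + 1) l r * e.q)
  set mp := itg l r (leg (n + 1) l r * e.p)
  set mu' := itg l r (leg n l r * e.u)
  set mq' := itg l r (leg n l r * e.q)
  set mp' := itg l r (leg n l r * e.p)
  set G := itg l r (x * leg n l r)
  have ul := abs_jul_le l r e
  have ur := abs_jur_le l r e
  have pr := abs_jpr_le l r e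
  have ql := he.abs_jql_le hs
  have qr := he.abs_jqr_le hs
  have pl := he.abs_jpl_le hs
  have dr := he.dissipation_right hs hγ
  have dl := he.dissipation_left hs hα
  rw [hα, abs_zero, add_zero] at ql
  rw [hγ, abs_zero, add_zero] at qr
  rw [← hj] at ul ur pr ql qr pl
  set Ul := e.jul l
  set Ur := e.jur r
  set Ql := e.jql l
  set Qr := e.jqr r
  set Pl := e.jpl l
  set Pr := e.jpr r
  clear_value B Q mu mq mp mu' mq' mp' G Ul Ur Ql Qr Pl Pr a b j m E κ s η
  have absS : ∀ {y z : ℝ}, |y| ≤ z → |s * y| ≤ z := fun {y z} hy => by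
    have := abs_mul_le_of_abs_le hsabs hy; rwa [one_mul] at this
  have absadd : ∀ {y z Y Z : ℝ}, |y| ≤ Y → |z| ≤ Z → |y + z| ≤ Y + Z :=
    fun hy hz => (abs_add_le _ _).trans (add_le_add hy hz)
  have abssub : ∀ {y z Y Z : ℝ}, |y| ≤ Y → |z| ≤ Z → |y - z| ≤ Y + Z :=
    fun hy hz => (abs_sub _ _).trans (add_le_add hy hz)
  -- weights
  have hK0 : 0 ≤ weightMin n A := by unfold weightMin; positivity
  have hΨ0 : 0 ≤ Ψ := by linarith
  have hw0 : 0 ≤ l + c + B := by linarith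
  have hw : |l + c + B| ≤ Ψ := by rw [abs_of_nonneg hw0]; linarith
  have hl0 : 0 ≤ l + c := by linarith
  have hl : |l + c| ≤ Ψ := by rw [abs_of_nonneg hl0]; linarith
  have hhcq : (r - l) * |e.cq| ≤ E * m := by
    rw [← hηsq, mul_assoc]; exact mul_le_mul hηE hmq (by positivity) hE0.le
  have hAη : |Q| ≤ η * η := hηsq ▸ A1
  -- the terms of the identity
  have T1 : (n + 1 + 1) / 2 * mu * (Pr + s * Pl) ≤ κ * (3 * E * (a * j) + a * m) := by
    have h1 : |(n + 1 + 1) / 2 * mu| ≤ κ * (η * a) := abs_mul_le_of_abs_le (by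
      rw [abs_of_nonneg (by positivity), hκ]; linarith) u1
    have h2 := abs_mul_le_of_abs_le h1 (absadd pr (absS pl))
    refine (le_abs_self _).trans (h2.trans ?_)
    calc κ * (η * a) * (j + (2 * j + |e.β|)) = κ * (3 * η * (a * j) + a * (η * |e.β|)) := by ring
      _ ≤ _ := by gcongr
  have T2 : (n + 1 + 1) / 2 * mp * (Ur + s * Ul) ≤ κ * (6 * A * j ^ 2 + 2 * E * (m * j)) := by
    have h0 : |mp| ≤ 3 * A * j + E * m := by
      have e1 : mp = (Qr - s * Ql) - e.cp * ((r - l) / κ) := by linarith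
      have h3 : |e.cp * ((r - l) / κ)| ≤ E * m := by
        rw [abs_mul, abs_of_nonneg (by positivity : 0 ≤ (r - l) / κ)]
        calc |e.cp| * ((r - l) / κ) ≤ |e.cp| * (r - l) := by
              gcongr; exact div_le_self hh.le hκ1
          _ = η * (η * |e.cp|) := by rw [← hηsq]; ring
          _ ≤ E * m := mul_le_mul hηE hmp (by positivity) hE0.le
      rw [e1]
      exact (abssub (abssub qr (absS ql)) h3).trans (le_of_eq (by ring))
    have h1 : |(n + 1 + 1) / 2 * mp| ≤ κ * (3 * A * j + E * m) := abs_mul_le_of_abs_le (by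
      rw [abs_of_nonneg (by positivity), hκ]; linarith) h0
    have h2 := abs_mul_le_of_abs_le h1 (absadd ur (absS ul))
    exact (le_abs_self _).trans (h2.trans (le_of_eq (by ring)))
  have T3 : -((n + 1 + 1) / 2 * mq * (Qr + s * Ql))
      ≤ κ * (6 * A * j ^ 2 + 3 * A * E * (m * j)) := by
    have h0 : |mq| ≤ 2 * j + E * m := by
      have e1 : mq = (Ur - s * Ul) - e.cq * ((r - l) / κ) := by linarith
      have h3 : |e.cq * ((r - l) / κ)| ≤ E * m := by
        rw [abs_mul, abs_of_nonneg (by positivity : 0 ≤ (r - l) / κ), mul_comm]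
        exact (mul_le_mul_of_nonneg_right (div_le_self hh.le hκ1) (abs_nonneg _)).trans hhcq
      rw [e1]
      exact (abssub (abssub ur (absS ul)) h3).trans (le_of_eq (by ring))
    have h1 : |(n + 1 + 1) / 2 * mq| ≤ κ * (2 * j + E * m) := abs_mul_le_of_abs_le (by
      rw [abs_of_nonneg (by positivity), hκ]; linarith) h0
    have h2 := abs_mul_le_of_abs_le h1 (absadd qr (absS ql))
    exact (neg_le_abs _).trans (h2.trans (le_of_eq (by ring)))
  have T4 : -(Ur * Qr - Ul * Ql) ≤ 3 * A * j ^ 2 :=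
    (neg_le_abs _).trans ((abssub (abs_mul_le_of_abs_le ur qr) (abs_mul_le_of_abs_le ul ql)).trans
      (le_of_eq (by ring)))
  -- The cancellation behind the relaxation: with weight `l + c`, the singular part `κ mu / (r - l)`
  -- of the velocity term is removed by the term `β Ul` of the left dissipation. The leftovers carry
  -- `B` or `Q`, which are of the order of the length, or moments of `q`.
  have T5 : -(s * e.β / ((r - l) / κ) * ((l + c + B) * mu + Q * mu')) - (l + c) * (e.β * Ul)
      ≤ 2 * κ * (a * m) + Ψ * (m * b) + Ψ * m ^ 2 := by
    -- `moment_q` and `moment_q'`, solved for the left jump of `u`.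
    have hU : e.β * Ul
        = s * e.β * (1 / 2 * (mq' - mq - e.cq * ((r - l) / κ)) - κ * mu / (r - l)) := by
      have : s * Ul = 1 / 2 * (mq' - mq - e.cq * ((r - l) / κ)) - κ * mu / (r - l) := by
        field_simp
        field_simp at R1
        linear_combination -R3 * κ + R1 * (r - l)
      rw [← this]; linear_combination -e.β * Ul * hs2
    have e1 : -(s * e.β / ((r - l) / κ) * ((l + c + B) * mu + Q * mu')) - (l + c) * (e.β * Ul)
        = -(s * e.β * (κ / (r - l) * (B * mu)) + s * e.β * (κ / (r - l) * (Q * mu'))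
          + 1 / 2 * ((l + c) * (s * e.β * (mq' - mq - e.cq * ((r - l) / κ))))) := by
      rw [hU]; field_simp; ring
    have hβ : |s * e.β| ≤ |e.β| := absS le_rfl
    have hq : |κ / (r - l)| ≤ κ / (η * η) := by rw [hηsq, abs_of_nonneg (by positivity)]
    have hB : |B| ≤ η * η := by rw [hηsq, abs_of_nonneg B0]; exact B1
    have h1 : ∀ y z : ℝ, |y| ≤ η * η → |z| ≤ η * a →
        |s * e.β * (κ / (r - l) * (y * z))| ≤ κ * (a * m) := by
      intro y z hy hz
      have := abs_mul_le_of_abs_le hβ (abs_mul_le_of_abs_le hq (abs_mul_le_of_abs_le hy hz))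
      refine this.trans ?_
      calc |e.β| * (κ / (η * η) * (η * η * (η * a))) = κ * (a * (η * |e.β|)) := by
            field_simp
        _ ≤ _ := by gcongr
    have hc : |e.cq * ((r - l) / κ)| ≤ (r - l) * |e.cq| := by
      rw [abs_mul, abs_of_nonneg (by positivity : 0 ≤ (r - l) / κ), mul_comm]
      exact mul_le_mul_of_nonneg_right (div_le_self hh.le hκ1) (abs_nonneg _)
    have h2 := abs_mul_le_of_abs_le hl (abs_mul_le_of_abs_le hβ (abssub (abssub q0 q1) hc))
    have h3 : Ψ * (|e.β| * (η * b + η * b + (r - l) * |e.cq|)) ≤ 2 * Ψ * (m * b) + Ψ * m ^ 2 := by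
      calc Ψ * (|e.β| * (η * b + η * b + (r - l) * |e.cq|))
          = 2 * Ψ * ((η * |e.β|) * b) + Ψ * ((η * |e.β|) * (η * |e.cq|)) := by
            rw [← hηsq]; ring
        _ ≤ 2 * Ψ * (m * b) + Ψ * (m * m) := by gcongr
        _ = _ := by ring
    have h4 := h1 B mu hB u1
    have h5 := h1 Q mu' hAη u0
    rw [e1]
    have h6 := neg_le_abs (s * e.β * (κ / (r - l) * (B * mu)))
    have h7 := neg_le_abs (s * e.β * (κ / (r - l) * (Q * mu')))
    have h8 := neg_le_abs ((l + c) * (s * e.β * (mq' - mq - e.cq * ((r - l) / κ))))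
    have h9 : 0 ≤ Ψ * m ^ 2 := by positivity
    linarith
  have T6 : -(e.cp * ((l + c + B) * mq + Q * mq')) - e.cq * mq - e.cp * mu
      ≤ (Ψ + D + 1) * (m * b) + a * m := by
    have h1 : |e.cp * ((l + c + B) * mq + Q * mq')| ≤ (Ψ + D) * (m * b) := by
      refine (abs_mul_le_of_abs_le le_rfl (absadd (abs_mul_le_of_abs_le hw q1)
        (abs_mul_le_of_abs_le (A1.trans hD) q0))).trans ?_
      calc |e.cp| * (Ψ * (η * b) + D * (η * b)) = (Ψ + D) * ((η * |e.cp|) * b) := by ring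
        _ ≤ _ := by gcongr
    have h2 : |e.cq * mq| ≤ m * b := by
      refine (abs_mul_le_of_abs_le le_rfl q1).trans ?_
      calc |e.cq| * (η * b) = (η * |e.cq|) * b := by ring
        _ ≤ _ := by gcongr
    have h3 : |e.cp * mu| ≤ a * m := by
      refine (abs_mul_le_of_abs_le le_rfl u1).trans ?_
      calc |e.cp| * (η * a) = a * (η * |e.cp|) := by ring
        _ ≤ _ := by gcongr
    have h4 := neg_le_abs (e.cp * ((l + c + B) * mq + Q * mq'))
    have h5 := neg_le_abs (e.cq * mq)
    have h6 := neg_le_abs (e.cp * mu)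
    linarith
  -- `moment_p'` replaces this moment of `p` by one of `q` divided by the length; the factor `Q`
  -- compensates the division.
  have T7 : e.cq * (Q * mp') ≤ 2 * κ * (m * b) + 3 * A * E * (m * j) := by
    have e1 : mp' = 2 * κ * mq / (r - l) + (Qr + s * Ql) := by
      field_simp; linear_combination R4
    have h1 : |2 * κ * mq / (r - l)| ≤ 2 * κ * (η * b) / (η * η) := by
      rw [hηsq, abs_div, abs_mul, abs_of_nonneg (by positivity : 0 ≤ 2 * κ), abs_of_pos hh]
      gcongr
    have h2 := abs_mul_le_of_abs_le (le_refl |e.cq|) (abs_mul_le_of_abs_le hAη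
      (absadd h1 (absadd qr (absS ql))))
    rw [← e1] at h2
    refine (le_abs_self _).trans (h2.trans ?_)
    calc |e.cq| * (η * η * (2 * κ * (η * b) / (η * η) + (2 * A * j + A * j)))
        = 2 * κ * ((η * |e.cq|) * b) + 3 * A * η * ((η * |e.cq|) * j) := by field_simp; ring
      _ ≤ _ := by gcongr
  -- By `moment_g'` the top moment of `p` and the moment `G` of the time derivative combine to jumps
  -- of `p`; neither is bounded separately.
  have T8 : e.cq * ((l + c + B) * mp) + 1 / 2 * (l + c + B) * ((r - l) / κ) * e.cq * G
      ≤ 3 * Ψ * E * (m * j) + Ψ * m ^ 2 := by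
    have e1 : e.cq * ((l + c + B) * mp) + 1 / 2 * (l + c + B) * ((r - l) / κ) * e.cq * G
        = -(1 / 2 * ((l + c + B) * (e.cq * ((r - l) / κ) * (Pr + s * Pl)))) := by
      field_simp
      linear_combination e.cq * (l + c + B) * R5
    have hc : |e.cq * ((r - l) / κ)| ≤ (r - l) * |e.cq| := by
      rw [abs_mul, abs_of_nonneg (by positivity : 0 ≤ (r - l) / κ), mul_comm]
      exact mul_le_mul_of_nonneg_right (div_le_self hh.le hκ1) (abs_nonneg _)
    have h1 := abs_mul_le_of_abs_le hw (abs_mul_le_of_abs_le hc (absadd pr (absS pl)))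
    have h2 : Ψ * ((r - l) * |e.cq| * (j + (2 * j + |e.β|)))
        ≤ 3 * Ψ * E * (m * j) + Ψ * m ^ 2 := by
      calc Ψ * ((r - l) * |e.cq| * (j + (2 * j + |e.β|)))
          = 3 * Ψ * ((r - l) * |e.cq| * j) + Ψ * ((η * |e.cq|) * (η * |e.β|)) := by
            rw [← hηsq]; ring
        _ ≤ 3 * Ψ * (E * m * j) + Ψ * (m * m) := by gcongr
        _ = _ := by ring
    rw [e1]
    have h3 := neg_le_abs ((l + c + B) * (e.cq * ((r - l) / κ) * (Pr + s * Pl)))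
    have h4 : 0 ≤ 3 * Ψ * E * (m * j) + Ψ * m ^ 2 := by positivity
    linarith
  -- dissipation
  have hdiss : (15 * κ * A + 1) * j ^ 2
      ≤ (r + c) * (Qr ^ 2 / 2 - Pr * Ur) - (l + c) * (Ql ^ 2 / 2 - Pl * Ul)
        - (l + c) * (e.β * Ul) := by
    have hKe : weightMin n A = 2 * A ^ 2 * (15 * κ * A + 1) := by rw [hκ]; rfl
    have hlr : l + c ≤ r + c := by linarith
    have h1 : (15 * κ * A + 1) * (Ur ^ 2 + Pr ^ 2) ≤ (r + c) * (Qr ^ 2 / 2 - Pr * Ur) := by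
      calc (15 * κ * A + 1) * (Ur ^ 2 + Pr ^ 2)
          = weightMin n A * ((Ur ^ 2 + Pr ^ 2) / (2 * A ^ 2)) := by rw [hKe]; field_simp
        _ ≤ (r + c) * ((Ur ^ 2 + Pr ^ 2) / (2 * A ^ 2)) :=
            mul_le_mul_of_nonneg_right (hK.trans hlr) (by positivity)
        _ ≤ _ := mul_le_mul_of_nonneg_left dr (hl0.trans hlr)
    have h2 : (15 * κ * A + 1) * Ul ^ 2 ≤ (l + c) * (Ul ^ 2 / 2) := by
      have h3 : 15 * κ * A + 1 ≤ (l + c) / 2 := by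
        have hA2 : 1 ≤ A ^ 2 := one_le_pow₀ hA1
        have : (15 * κ * A + 1) * 1 ≤ (15 * κ * A + 1) * A ^ 2 :=
          mul_le_mul_of_nonneg_left hA2 (by positivity)
        rw [hKe] at hK; linarith
      calc _ ≤ (l + c) / 2 * Ul ^ 2 := mul_le_mul_of_nonneg_right h3 (sq_nonneg _)
        _ = _ := by ring
    have h3 := mul_le_mul_of_nonneg_left dl hl0
    rw [hjsq]
    linarith
  -- `15 κ A` collects the quadratic jump terms: `6 κ A` from each of `T2` and `T3`, and `3 A ≤ 3 κ
  -- A` from `T4`. `weightMin` was chosen so that the dissipation supplies one unit more.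
  have hfin := young_absorb (a := a) (b := b) (j := j) (m := m) (c1 := 15 * κ * A)
    (c2 := 3 * κ * E) (c3 := 3 * κ + 1) (c4 := 2 * κ * E + 3 * A * κ * E + 3 * A * E + 3 * Ψ * E)
    (c5 := 2 * Ψ + D + 1 + 2 * κ) (c6 := 2 * Ψ) (by positivity) (by positivity)
  rw [show weightConst n A D Ψ = (3 * κ * E) ^ 2
    + (2 * κ * E + 3 * A * κ * E + 3 * A * E + 3 * Ψ * E) ^ 2
    + (2 * Ψ + D + 1 + 2 * κ) ^ 2 + (3 * κ + 1) + 2 * Ψ by rw [hκ, hE]; rfl]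
  rw [← hasq, ← hmsq]
  refine le_trans ?_ hfin
  have hAj : A * j ^ 2 ≤ κ * (A * j ^ 2) := le_mul_of_one_le_left (by positivity) hκ1
  have hWt' : itg l r (x * ((X + C c) * e.u))
      + 1 / 2 * (l + c + B) * ((r - l) / κ) * e.cq * G
      + ((r + c) * (e.pr * e.ur - e.qr ^ 2 / 2) - (l + c) * (e.pl * e.ul - e.ql ^ 2 / 2))
      - (e.ur * e.qr - e.ul * e.ql)
      = -(3 / 2) * b ^ 2
        - ((r + c) * (Qr ^ 2 / 2 - Pr * Ur) - (l + c) * (Ql ^ 2 / 2 - Pl * Ul)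
          - (l + c) * (e.β * Ul))
        + (n + 1 + 1) / 2 * mu * (Pr + s * Pl) + (n + 1 + 1) / 2 * mp * (Ur + s * Ul)
        + -((n + 1 + 1) / 2 * mq * (Qr + s * Ql)) + -(Ur * Qr - Ul * Ql)
        + (-(s * e.β / ((r - l) / κ) * ((l + c + B) * mu + Q * mu')) - (l + c) * (e.β * Ul))
        + (-(e.cp * ((l + c + B) * mq + Q * mq')) - e.cq * mq - e.cp * mu)
        + e.cq * (Q * mp')
        + (e.cq * ((l + c + B) * mp) + 1 / 2 * (l + c + B) * ((r - l) / κ) * e.cq * G) := by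
    linear_combination Wt
  rw [hWt']
  linarith

end ElemData

end KdVHDG

end

/-! ### Norms and telescoping sums on a mesh, and the estimate at a fixed time. -/

noncomputable section

namespace KdVHDG

theorem sum_succ_sub_castSucc {N : ℕ} (F : Fin (N + 1) → ℝ) :
    ∑ i : Fin N, (F i.succ - F i.castSucc) = F (Fin.last N) - F 0 := by
  have h1 := Fin.sum_univ_succ F
  have h2 := Fin.sum_univ_castSucc F
  rw [Finset.sum_sub_distrib]; linarith

namespace Mesh

variable {a b : ℝ} (M : Mesh a b)

theorem xl_lt_xr (i : Fin M.N) : M.xl i < M.xr i := M.strictMono (Fin.castSucc_lt_succ)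

theorem le_xl (i : Fin M.N) : a ≤ M.xl i := by
  have := M.strictMono.monotone (Fin.zero_le i.castSucc)
  rwa [M.node_zero] at this

theorem xr_le (i : Fin M.N) : M.xr i ≤ b := by
  have := M.strictMono.monotone (Fin.le_last i.succ)
  rwa [M.node_last] at this

theorem len_le_size (i : Fin M.N) : M.xr i - M.xl i ≤ M.size :=
  le_ciSup (f := fun i : Fin M.N => M.xr i - M.xl i) (Set.finite_range _).bddAbove i

theorem len_pos (i : Fin M.N) : 0 < M.xr i - M.xl i := sub_pos.2 (M.xl_lt_xr i)

theorem len_le (i : Fin M.N) : M.xr i - M.xl i ≤ b - a := by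
  linarith [M.le_xl i, M.xr_le i]

theorem size_nonneg : 0 ≤ M.size := Real.iSup_nonneg fun i => (M.len_pos i).le

theorem sum_len : ∑ i, (M.xr i - M.xl i) = b - a := by
  have := sum_succ_sub_castSucc M.node
  rwa [M.node_last, M.node_zero] at this

/-! ### Norms -/

/-- The integral of a piecewise polynomial. -/
def int (f : M.PW) : ℝ := ∑ i, itg (M.xl i) (M.xr i) (f i)

theorem int_add (f g : M.PW) : M.int (f + g) = M.int f + M.int g := by
  simp [int, Finset.sum_add_distrib]

theorem int_sub (f g : M.PW) : M.int (f - g) = M.int f - M.int g := by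
  simp [int, Finset.sum_sub_distrib]

theorem int_smul (c : ℝ) (f : M.PW) : M.int (c • f) = c * M.int f := by
  simp [int, Finset.mul_sum]

theorem norm_eq (f : M.PW) : M.norm f = Real.sqrt (M.int (f * f)) := by
  simp only [norm, int, itg_apply, Pi.mul_apply, eval_mul, pow_two]

theorem norm_nonneg (f : M.PW) : 0 ≤ M.norm f := Real.sqrt_nonneg _

theorem int_mul_self_nonneg (f : M.PW) : 0 ≤ M.int (f * f) :=
  Finset.sum_nonneg fun i _ => itg_mul_self_nonneg (M.xl_lt_xr i).le _

theorem norm_sq (f : M.PW) : M.norm f ^ 2 = M.int (f * f) := by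
  rw [norm_eq, Real.sq_sqrt (M.int_mul_self_nonneg f)]

theorem sum_mul_le_of_sq {N : ℕ} {x y : Fin N → ℝ} :
    ∑ i, Real.sqrt (x i) * Real.sqrt (y i) ≤ Real.sqrt (∑ i, Real.sqrt (x i) ^ 2)
      * Real.sqrt (∑ i, Real.sqrt (y i) ^ 2) :=
  Real.sum_mul_le_sqrt_mul_sqrt _ _ _

theorem abs_int_mul_le (f g : M.PW) : |M.int (f * g)| ≤ M.norm f * M.norm g := by
  refine (Finset.abs_sum_le_sum_abs _ _).trans ((Finset.sum_le_sum fun i _ =>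
    abs_itg_mul_le (M.xl_lt_xr i).le (f i) (g i)).trans (sum_mul_le_of_sq.trans (le_of_eq ?_)))
  have : ∀ f : M.PW, ∀ i, Real.sqrt (itg (M.xl i) (M.xr i) (f i * f i)) ^ 2
      = itg (M.xl i) (M.xr i) (f i * f i) := fun f i =>
    Real.sq_sqrt (itg_mul_self_nonneg (M.xl_lt_xr i).le _)
  simp only [this, norm_eq, int, Pi.mul_apply]

theorem int_mul_le (f g : M.PW) : M.int (f * g) ≤ M.norm f * M.norm g :=
  (le_abs_self _).trans (M.abs_int_mul_le f g)

theorem norm_add_le (f g : M.PW) : M.norm (f + g) ≤ M.norm f + M.norm g := by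
  refine le_of_sq_le_sq ?_ (add_nonneg (M.norm_nonneg f) (M.norm_nonneg g))
  have e : M.int ((f + g) * (f + g)) = M.int (f * f) + 2 * M.int (f * g) + M.int (g * g) := by
    rw [← int_smul, ← int_add, ← int_add]; congr 1; rw [two_smul]; ring
  rw [norm_sq, e, ← norm_sq, ← norm_sq]
  nlinarith [M.int_mul_le f g]

theorem norm_smul (c : ℝ) (f : M.PW) : M.norm (c • f) = |c| * M.norm f := by
  have e : M.int ((c • f) * (c • f)) = c ^ 2 * M.int (f * f) := by
    rw [← int_smul]; congr 1; rw [smul_mul_smul_comm, pow_two]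
  rw [norm_eq, e, Real.sqrt_mul (sq_nonneg _), Real.sqrt_sq_eq_abs, ← norm_eq]

theorem norm_neg (f : M.PW) : M.norm (-f) = M.norm f := by
  rw [norm_eq, norm_eq, neg_mul_neg]

theorem norm_sub_le (f g : M.PW) : M.norm (f - g) ≤ M.norm f + M.norm g := by
  rw [sub_eq_add_neg, ← M.norm_neg g]; exact M.norm_add_le _ _

theorem norm_le_add (f g : M.PW) : M.norm f ≤ M.norm (f - g) + M.norm g := by
  have := M.norm_add_le (f - g) g
  rwa [sub_add_cancel] at this

/-- The `L²` norm of a piecewise constant function. -/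
def wnorm (c : Fin M.N → ℝ) : ℝ := Real.sqrt (∑ i, (M.xr i - M.xl i) * c i ^ 2)

theorem wnorm_nonneg (c : Fin M.N → ℝ) : 0 ≤ M.wnorm c := Real.sqrt_nonneg _

theorem wnorm_sq (c : Fin M.N → ℝ) : M.wnorm c ^ 2 = ∑ i, (M.xr i - M.xl i) * c i ^ 2 :=
  Real.sq_sqrt (Finset.sum_nonneg fun i _ => mul_nonneg (M.len_pos i).le (sq_nonneg _))

theorem abs_sum_mul_itg_leg_le (m : ℕ) (c : Fin M.N → ℝ) (f : M.PW) :
    |∑ i, c i * itg (M.xl i) (M.xr i) (leg m (M.xl i) (M.xr i) * f i)|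
      ≤ M.wnorm c * M.norm f := by
  refine (Finset.abs_sum_le_sum_abs _ _).trans ?_
  have : ∀ i, |c i * itg (M.xl i) (M.xr i) (leg m (M.xl i) (M.xr i) * f i)|
      ≤ Real.sqrt ((M.xr i - M.xl i) * c i ^ 2)
        * Real.sqrt (itg (M.xl i) (M.xr i) (f i * f i)) := by
    intro i
    rw [abs_mul, Real.sqrt_mul (M.len_pos i).le, Real.sqrt_sq_eq_abs]
    calc _ ≤ |c i| * (Real.sqrt (M.xr i - M.xl i)
          * Real.sqrt (itg (M.xl i) (M.xr i) (f i * f i))) := by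
          gcongr; exact abs_itg_leg_mul_le m (M.xl_lt_xr i) _
      _ = _ := by ring
  refine (Finset.sum_le_sum fun i _ => this i).trans (sum_mul_le_of_sq.trans (le_of_eq ?_))
  have h1 : ∀ i, Real.sqrt (itg (M.xl i) (M.xr i) (f i * f i)) ^ 2
      = itg (M.xl i) (M.xr i) (f i * f i) := fun i =>
    Real.sq_sqrt (itg_mul_self_nonneg (M.xl_lt_xr i).le _)
  have h2 : ∀ i, Real.sqrt ((M.xr i - M.xl i) * c i ^ 2) ^ 2 = (M.xr i - M.xl i) * c i ^ 2 :=
    fun i => Real.sq_sqrt (mul_nonneg (M.len_pos i).le (sq_nonneg _))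
  simp only [h1, h2, norm_eq, int, Pi.mul_apply, wnorm]

/-- Multiples of the Legendre polynomial of degree `k` on every element. -/
def legs (k : ℕ) (c : Fin M.N → ℝ) : M.PW := fun i => C (c i) * leg k (M.xl i) (M.xr i)

theorem norm_legs_le (k : ℕ) (c : Fin M.N → ℝ) : M.norm (M.legs k c) ≤ M.wnorm c := by
  rw [norm_eq, wnorm]
  refine Real.sqrt_le_sqrt (Finset.sum_le_sum fun i _ => ?_)
  have : (M.legs k c * M.legs k c) i = C (c i ^ 2) * (leg k (M.xl i) (M.xr i)
      * leg k (M.xl i) (M.xr i)) := by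
    simp only [legs, Pi.mul_apply, C_pow]; ring
  rw [this, itg_C_mul, itg_leg_mul_self k (M.xl_lt_xr i), mul_comm]
  refine mul_le_mul_of_nonneg_right (div_le_self (M.len_pos i).le ?_) (sq_nonneg _)
  linarith [(Nat.cast_nonneg k : (0 : ℝ) ≤ k)]

end Mesh

/-! ### The error equations on a mesh -/

/-- The error equations on all elements, with single valued traces. -/
structure MeshSys {a b : ℝ} (M : Mesh a b) (k : ℕ) (τ : Stabilization M.N)
    (E : Fin M.N → ElemData) : Prop where
  sys : ∀ i, (E i).IsSys k (M.xl i) (M.xr i) (τ.quP i) (τ.puP i) (τ.quM i)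
  nodes : ∃ U Q P : Fin (M.N + 1) → ℝ, U 0 = 0 ∧ U (Fin.last _) = 0 ∧ Q (Fin.last _) = 0 ∧
    ∀ i, (E i).ul = U i.castSucc ∧ (E i).ur = U i.succ ∧ (E i).ql = Q i.castSucc ∧
      (E i).qr = Q i.succ ∧ (E i).pl = P i.castSucc ∧ (E i).pr = P i.succ

namespace MeshSys

open ElemData

variable {a b : ℝ} {M : Mesh a b} {k : ℕ} {τ : Stabilization M.N} {E : Fin M.N → ElemData}

theorem diff {E' : Fin M.N → ElemData} (h : MeshSys M k τ E) (h' : MeshSys M k τ E') (c : ℝ) :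
    MeshSys M k τ (fun i => ElemData.diff c (E i) (E' i)) where
  sys i := (h.sys i).diff (h'.sys i) c
  nodes := by
    obtain ⟨U, Q, P, h1, h2, h3, h4⟩ := h.nodes
    obtain ⟨U', Q', P', h1', h2', h3', h4'⟩ := h'.nodes
    refine ⟨c • (U - U'), c • (Q - Q'), c • (P - P'), by simp [h1, h1'], by simp [h2, h2'],
      by simp [h3, h3'], fun i => ?_⟩
    simp [ElemData.diff, h4 i, h4' i]

theorem shift (h : MeshSys M k τ E) (cu cq cp : Fin M.N → ℝ) :
    MeshSys M k τ (fun i => (E i).shift k (M.xl i) (M.xr i) (τ.quP i) (τ.puP i) (τ.quM i)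
      (cu i) (cq i) (cp i)) where
  sys i := IsSys.shift (E i) (M.xl_lt_xr i) (h.sys i) _ _ _
  nodes := h.nodes

/-- The trace of `q` at the left end point. -/
theorem exists_trace (h : MeshSys M k τ E) : ∃ q₀ p₀ : ℝ,
    (∀ c : ℝ, ∑ i, ((M.xr i + c) * ((E i).pr * (E i).ur - (E i).qr ^ 2 / 2)
      - (M.xl i + c) * ((E i).pl * (E i).ul - (E i).ql ^ 2 / 2)) = (a + c) * q₀ ^ 2 / 2) ∧
    ∑ i, (((E i).pr * (E i).ur - (E i).qr ^ 2 / 2)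
      - ((E i).pl * (E i).ul - (E i).ql ^ 2 / 2)) = q₀ ^ 2 / 2 ∧
    ∑ i, ((E i).ur * (E i).qr - (E i).ul * (E i).ql) = 0 ∧
    ∑ i, ((E i).pr * (E i).qr - (E i).pl * (E i).ql) = -(p₀ * q₀) ∧
    ∑ i, ((b - M.xr i) * (E i).pr - (b - M.xl i) * (E i).pl) = -((b - a) * p₀) := by
  obtain ⟨U, Q, P, h1, h2, h3, h4⟩ := h.nodes
  -- All traces are single valued, so the sums telescope. Since `U` vanishes at both ends and `Q` at
  -- `b`, the energy flux leaves only `q₀²/2`, a term of good sign.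
  refine ⟨Q 0, P 0, fun c => ?_, ?_, ?_, ?_, ?_⟩
  · have := sum_succ_sub_castSucc fun j => (M.node j + c) * (P j * U j - Q j ^ 2 / 2)
    rw [M.node_zero, M.node_last, h1, h2, h3] at this
    simp only [h4, Mesh.xl, Mesh.xr]
    rw [this]; ring
  · have := sum_succ_sub_castSucc fun j => P j * U j - Q j ^ 2 / 2
    rw [h1, h2, h3] at this
    simp only [h4]
    rw [this]; ring
  · have := sum_succ_sub_castSucc fun j => U j * Q j
    rw [h1, h2] at this
    simp only [h4]
    rw [this]; ring
  · have := sum_succ_sub_castSucc fun j => P j * Q j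
    rw [h3] at this
    simp only [h4]
    rw [this]; ring
  · have := sum_succ_sub_castSucc fun j => (b - M.node j) * P j
    rw [M.node_zero, M.node_last] at this
    simp only [h4, Mesh.xl, Mesh.xr]
    rw [this]; ring

/-- The piecewise polynomials of an error system. -/
abbrev pu (E : Fin M.N → ElemData) : M.PW := fun i => (E i).u
abbrev pq (E : Fin M.N → ElemData) : M.PW := fun i => (E i).q
abbrev pp (E : Fin M.N → ElemData) : M.PW := fun i => (E i).p
abbrev pg (E : Fin M.N → ElemData) : M.PW := fun i => (E i).g

/-- No boundary condition prescribes `p` at `a`. The third equation is tested with `b - x`, which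
vanishes at `b` and is admissible because `k ≥ 1`; this expresses the trace by integrals of `g` and
`p`. -/
theorem abs_trace_le (h : MeshSys M k τ E) (hk : 0 < k) (hab : a < b) {p₀ : ℝ}
    (hp : ∑ i, ((b - M.xr i) * (E i).pr - (b - M.xl i) * (E i).pl) = -((b - a) * p₀)) :
    |p₀| ≤ (Real.sqrt (b - a) + (Real.sqrt (b - a))⁻¹) * (M.norm (pg E) + M.norm (pp E)) := by
  have hL : 0 < b - a := sub_pos.2 hab
  set η := Real.sqrt (b - a) with hη
  have hη0 : 0 < η := Real.sqrt_pos.2 hL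
  have hηsq : η * η = b - a := Real.mul_self_sqrt hL.le
  have n1 : M.norm (fun _ => (1 : ℝ[X])) = η := by
    rw [M.norm_eq, hη, ← M.sum_len]
    congr 1
    refine Finset.sum_congr rfl fun i _ => ?_
    simp [itg_apply]
  have nv : M.norm (fun _ => (C b - X : ℝ[X])) ≤ (b - a) * η := by
    rw [← n1, ← abs_of_pos hL, ← M.norm_smul, M.norm_eq, M.norm_eq]
    refine Real.sqrt_le_sqrt (Finset.sum_le_sum fun i _ => itg_mono (M.xl_lt_xr i).le fun x hx => ?_)
    simp only [Pi.mul_apply, Pi.smul_apply, eval_mul, eval_smul, eval_sub, eval_C, eval_X, eval_one,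
      smul_eq_mul, mul_one]
    have := M.le_xl i; have := M.xr_le i; have := hx.1; have := hx.2
    nlinarith
  have key : (b - a) * p₀ = M.int (pg E * fun _ => (C b - X : ℝ[X]))
      + M.int (pp E * fun _ => (1 : ℝ[X])) := by
    have : ∀ i, itg (M.xl i) (M.xr i) ((E i).g * (C b - X))
        + itg (M.xl i) (M.xr i) ((E i).p * 1)
        = -((b - M.xr i) * (E i).pr - (b - M.xl i) * (E i).pl) := by
      intro i
      have h1 := (h.sys i).eq_u (C b - X) (by
        refine (natDegree_sub_le _ _).trans ?_
        simp; omega)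
      have h2 := itg_derivative_mul (M.xl i) (M.xr i) (E i).p (C b - X)
      rw [add_mul, map_add] at h1
      simp only [derivative_sub, derivative_C, derivative_X, eval_mul, eval_sub, eval_C, eval_X,
        zero_sub, mul_neg, map_neg, jpr, jpl] at h1 h2 ⊢
      linear_combination h1 - h2
    have h2 := Finset.sum_congr rfl fun i (_ : i ∈ Finset.univ) => this i
    rw [Finset.sum_neg_distrib, hp, Finset.sum_add_distrib, neg_neg] at h2
    exact h2.symm
  have b1 := M.abs_int_mul_le (pg E) fun _ => (C b - X : ℝ[X])
  have b2 := M.abs_int_mul_le (pp E) fun _ => (1 : ℝ[X])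
  rw [n1] at b2
  have g0 := M.norm_nonneg (pg E)
  have q0 := M.norm_nonneg (pp E)
  have b3 : (b - a) * |p₀| ≤ M.norm (pg E) * ((b - a) * η) + M.norm (pp E) * η := by
    rw [← abs_of_pos hL, ← abs_mul, abs_of_pos hL, key]
    exact (abs_add_le _ _).trans (add_le_add (b1.trans (mul_le_mul_of_nonneg_left nv g0)) b2)
  have b4 : |p₀| ≤ M.norm (pg E) * η + M.norm (pp E) * η⁻¹ := by
    refine le_of_mul_le_mul_left (b3.trans (le_of_eq ?_)) hL
    rw [← hηsq]; field_simp
  have : 0 < η⁻¹ := inv_pos.2 hη0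
  nlinarith [mul_nonneg g0 this.le, mul_nonneg q0 hη0.le]

end MeshSys

/-- `F` is the data and `X` the unknown. The energy bounds `J` and `q₀²` by multiples of `F² + F X`;
inserted in the bounds for `Q²` and `P²` this gives a quadratic inequality whose `X²` part can be
absorbed. -/
theorem absorb_quadratic {F X Q P J G U e₁ e₂ q₀ p₀ A κ : ℝ} (hA : 1 ≤ A) (hκ : 0 ≤ κ)
    (hG : 0 ≤ G) (hU : 0 ≤ U) (h1 : 0 ≤ e₁) (h2 : 0 ≤ e₂) (hQ : 0 ≤ Q) (hP : 0 ≤ P)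
    (hF : F = G + U + e₁ + e₂) (hX : X = Q + P)
    (hE : J / (2 * A ^ 2) + q₀ ^ 2 / 2 ≤ G * U + e₁ * P + e₂ * Q) (hJ : 0 ≤ J)
    (ha : Q ^ 2 ≤ P * U + 3 * A * J + e₁ * Q + e₂ * U)
    (hb : P ^ 2 ≤ G * Q + e₂ * P + |p₀| * |q₀| + 4 * A * J) (hp : |p₀| ≤ κ * (G + P)) :
    X ≤ (18 + 64 * A ^ 3 + 20 * κ ^ 2) * F := by
  have hF0 : 0 ≤ F := by rw [hF]; positivity
  have hX0 : 0 ≤ X := by rw [hX]; positivity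
  set Y := F ^ 2 + F * X with hY
  have hY0 : 0 ≤ Y := by positivity
  have hE' : G * U + e₁ * P + e₂ * Q ≤ Y := by
    rw [← sub_nonneg, hY, hF, hX]; ring_nf; positivity
  have hJY : J ≤ 2 * A ^ 2 * Y := by
    have : J / (2 * A ^ 2) ≤ Y := by nlinarith [sq_nonneg q₀]
    rw [div_le_iff₀ (by positivity)] at this; linarith
  have hq : |q₀| ^ 2 ≤ 2 * Y := by
    rw [sq_abs]
    have : 0 ≤ J / (2 * A ^ 2) := by positivity
    linarith
  have hAJ : A * J ≤ 2 * A ^ 3 * Y := by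
    calc A * J ≤ A * (2 * A ^ 2 * Y) := by gcongr
      _ = _ := by ring
  have hQ2 : Q ^ 2 ≤ (2 + 6 * A ^ 3) * Y := by
    have : P * U + e₁ * Q + e₂ * U ≤ 2 * Y := by
      rw [← sub_nonneg, hY, hF, hX]; ring_nf; positivity
    linarith
  have hP2 : P ^ 2 ≤ (2 + 8 * A ^ 3) * Y + ((F + X) ^ 2 / 8 + 4 * κ ^ 2 * Y) := by
    have t1 : G * Q + e₂ * P ≤ 2 * Y := by
      rw [← sub_nonneg, hY, hF, hX]; ring_nf; positivity
    -- The weight `1/8` becomes `1/4` when `P²` is doubled in `hX2`, and `(F + X)²/4 ≤ F²/2 + X²/2`;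
    -- half of `X²` remains on the left.
    have t2 : |p₀| * |q₀| ≤ (F + X) ^ 2 / 8 + 4 * κ ^ 2 * Y := by
      have : |p₀| ≤ κ * (F + X) := hp.trans (by gcongr <;> linarith)
      have h3 : |p₀| * |q₀| ≤ κ * (F + X) * |q₀| := by gcongr
      have h4 := mul_le_mul_of_nonneg_left hq (sq_nonneg κ)
      have h5 : κ * (F + X) * |q₀| ≤ (F + X) ^ 2 / 8 + 2 * (κ ^ 2 * |q₀| ^ 2) := by
        linarith only [sq_nonneg ((F + X) - 4 * κ * |q₀|)]
      linarith only [h3, h4, h5]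
    linarith
  have hX2 : X ^ 2 ≤ 2 * Q ^ 2 + 2 * P ^ 2 := by rw [hX]; linarith only [sq_nonneg (Q - P)]
  set K := 8 + 28 * A ^ 3 + 8 * κ ^ 2 with hK
  have h5 : X ^ 2 ≤ K * Y + (F + X) ^ 2 / 4 := by rw [hK]; linarith
  have h6 : X ^ 2 ≤ (2 * K + 1) * F ^ 2 + 2 * K * (F * X) := by
    have : (F + X) ^ 2 ≤ 2 * F ^ 2 + 2 * X ^ 2 := by linarith only [sq_nonneg (F - X)]
    rw [hY] at h5; linarith only [h5, this]
  have hA3 : 1 ≤ A ^ 3 := one_le_pow₀ hA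
  have hK0 : 0 ≤ K := by positivity
  have h7 : X ≤ (2 * K + 2) * F := by
    by_contra! hc
    have hXp : 0 < X := lt_of_le_of_lt (by positivity) hc
    have m1 : (2 * K + 2) * F * X < X * X := mul_lt_mul_of_pos_right hc hXp
    have m2 : F * ((2 * K + 2) * F) ≤ F * X := mul_le_mul_of_nonneg_left hc.le hF0
    have m3 : 0 ≤ F ^ 2 := sq_nonneg F
    have m4 : (2 * K + 1) * F ^ 2 ≤ (2 * K + 2) * F ^ 2 := by gcongr; norm_num
    have m5 : 0 ≤ F * X := mul_nonneg hF0 hX0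
    linarith
  refine h7.trans (mul_le_mul_of_nonneg_right ?_ hF0)
  rw [hK]; nlinarith [sq_nonneg κ]

/-- The constant of the estimate of the stationary problem. -/
def staticConst (A L : ℝ) : ℝ := 18 + 64 * A ^ 3 + 20 * (Real.sqrt L + (Real.sqrt L)⁻¹) ^ 2

namespace MeshSys

open ElemData

variable {a b A : ℝ} {M : Mesh a b} {k : ℕ} {τ : Stabilization M.N} {E : Fin M.N → ElemData}

theorem energy_le (h : MeshSys M k τ E)
    (hs : ∀ i, StabBound A (τ.quP i) (τ.puP i) (τ.quM i))
    (h0 : ∀ i, (E i).α = 0 ∧ (E i).β = 0 ∧ (E i).γ = 0) {q₀ : ℝ}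
    (hq : ∑ i, (((E i).pr * (E i).ur - (E i).qr ^ 2 / 2)
      - ((E i).pl * (E i).ul - (E i).ql ^ 2 / 2)) = q₀ ^ 2 / 2) :
    M.int (pg E * pu E) + (∑ i, (E i).jumpSq (M.xl i) (M.xr i)) / (2 * A ^ 2) + q₀ ^ 2 / 2
      ≤ M.wnorm (fun i => (E i).cq) * M.norm (pp E)
        + M.wnorm (fun i => (E i).cp) * M.norm (pq E) := by
  have key : ∀ i, itg (M.xl i) (M.xr i) ((E i).g * (E i).u)
      + (E i).jumpSq (M.xl i) (M.xr i) / (2 * A ^ 2)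
      + (((E i).pr * (E i).ur - (E i).qr ^ 2 / 2) - ((E i).pl * (E i).ul - (E i).ql ^ 2 / 2))
      ≤ (E i).cq * itg (M.xl i) (M.xr i) (leg k (M.xl i) (M.xr i) * (E i).p)
        - (E i).cp * itg (M.xl i) (M.xr i) (leg k (M.xl i) (M.xr i) * (E i).q) := by
    intro i
    obtain ⟨hα, hβ, hγ⟩ := h0 i
    have d1 := (h.sys i).dissipation_right (hs i) hγ
    have d2 := (h.sys i).dissipation_left (hs i) hα
    have en := (h.sys i).energy
    have hA := (hs i).one_le
    rw [hβ, zero_mul, add_zero] at d2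
    have : (E i).jumpSq (M.xl i) (M.xr i) / (2 * A ^ 2)
        ≤ (E i).jul (M.xl i) ^ 2 / 2
          + ((E i).jur (M.xr i) ^ 2 + (E i).jpr (M.xr i) ^ 2) / (2 * A ^ 2) := by
      unfold jumpSq
      rw [add_assoc, add_div]
      gcongr
      exact le_mul_of_one_le_right (by norm_num) (one_le_pow₀ hA)
    linarith
  have hsum := Finset.sum_le_sum fun i (_ : i ∈ Finset.univ) => key i
  rw [Finset.sum_add_distrib, Finset.sum_add_distrib, hq, Finset.sum_sub_distrib,
    ← Finset.sum_div] at hsum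
  have b1 := le_trans (le_abs_self _) (M.abs_sum_mul_itg_leg_le k (fun i => (E i).cq) (pp E))
  have b2 := le_trans (neg_le_abs _) (M.abs_sum_mul_itg_leg_le k (fun i => (E i).cp) (pq E))
  have e : M.int (pg E * pu E) = ∑ i, itg (M.xl i) (M.xr i) ((E i).g * (E i).u) := rfl
  rw [e]
  linarith

/-- `product_qu` bounds `‖q‖²`, `product_pq` bounds `‖p‖²`, the energy bounds the jumps and the
trace of `q` at `a`, and `abs_trace_le` the trace of `p` there. The four bounds are coupled and are
solved together by `absorb_quadratic`. Consequently only `u` and its time derivative need an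
evolution estimate. -/
theorem static_le (h : MeshSys M k τ E) (hk : 0 < k) (hab : a < b) (hA : 1 ≤ A)
    (hs : ∀ i, StabBound A (τ.quP i) (τ.puP i) (τ.quM i))
    (h0 : ∀ i, (E i).α = 0 ∧ (E i).β = 0 ∧ (E i).γ = 0) :
    M.norm (pq E) + M.norm (pp E) ≤ staticConst A (b - a)
      * (M.norm (pg E) + M.norm (pu E) + M.wnorm (fun i => (E i).cq)
        + M.wnorm (fun i => (E i).cp)) := by
  obtain ⟨q₀, p₀, -, h1, h2, h3, h4⟩ := h.exists_trace
  set e₁ := M.wnorm fun i => (E i).cq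
  set e₂ := M.wnorm fun i => (E i).cp
  set J := ∑ i, (E i).jumpSq (M.xl i) (M.xr i) with hJ
  have hen := h.energy_le hs h0 h1
  have hp := h.abs_trace_le hk hab h4
  have hgu := neg_le_of_abs_le (M.abs_int_mul_le (pg E) (pu E))
  have j : ∀ i, |(E i).jur (M.xr i) * (E i).jqr (M.xr i)|
        ≤ 2 * A * (E i).jumpSq (M.xl i) (M.xr i) ∧
      |(E i).jul (M.xl i) * (E i).jql (M.xl i)| ≤ A * (E i).jumpSq (M.xl i) (M.xr i) ∧
      |(E i).jpr (M.xr i) * (E i).jqr (M.xr i)| ≤ 2 * A * (E i).jumpSq (M.xl i) (M.xr i) ∧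
      |(E i).jpl (M.xl i) * (E i).jql (M.xl i)| ≤ 2 * A * (E i).jumpSq (M.xl i) (M.xr i) := by
    intro i
    obtain ⟨hα, hβ, hγ⟩ := h0 i
    have ul := abs_jul_le (M.xl i) (M.xr i) (E i)
    have ur := abs_jur_le (M.xl i) (M.xr i) (E i)
    have pr := abs_jpr_le (M.xl i) (M.xr i) (E i)
    have ql := (h.sys i).abs_jql_le (hs i)
    have qr := (h.sys i).abs_jqr_le (hs i)
    have pl := (h.sys i).abs_jpl_le (hs i)
    rw [hα, abs_zero, add_zero] at ql
    rw [hγ, abs_zero, add_zero] at qr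
    rw [hβ, abs_zero, add_zero] at pl
    have hsq := Real.mul_self_sqrt (jumpSq_nonneg (M.xl i) (M.xr i) (E i))
    refine ⟨(abs_mul_le_of_abs_le ur qr).trans (le_of_eq ?_),
      (abs_mul_le_of_abs_le ul ql).trans (le_of_eq ?_),
      (abs_mul_le_of_abs_le pr qr).trans (le_of_eq ?_),
      (abs_mul_le_of_abs_le pl ql).trans (le_of_eq ?_)⟩
    · linear_combination 2 * A * hsq
    · linear_combination A * hsq
    · linear_combination 2 * A * hsq
    · linear_combination 2 * A * hsq
  have hJ0 : 0 ≤ J := Finset.sum_nonneg fun i _ => jumpSq_nonneg _ _ _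
  have ba : M.norm (pq E) ^ 2 ≤ M.norm (pp E) * M.norm (pu E) + 3 * A * J
      + e₁ * M.norm (pq E) + e₂ * M.norm (pu E) := by
    have key : ∀ i, itg (M.xl i) (M.xr i) ((E i).q * (E i).q)
        + itg (M.xl i) (M.xr i) ((E i).p * (E i).u)
        + (E i).cq * itg (M.xl i) (M.xr i) (leg k (M.xl i) (M.xr i) * (E i).q)
        + (E i).cp * itg (M.xl i) (M.xr i) (leg k (M.xl i) (M.xr i) * (E i).u)
        ≤ 3 * A * (E i).jumpSq (M.xl i) (M.xr i)
          + ((E i).ur * (E i).qr - (E i).ul * (E i).ql) := by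
      intro i
      have := (h.sys i).product_qu
      have t1 := neg_le_of_abs_le (j i).1
      have t2 := le_of_abs_le (j i).2.1
      linarith
    have hsum := Finset.sum_le_sum fun i (_ : i ∈ Finset.univ) => key i
    rw [Finset.sum_add_distrib, Finset.sum_add_distrib, Finset.sum_add_distrib,
      Finset.sum_add_distrib, h2, ← Finset.mul_sum] at hsum
    have b1 := neg_le_of_abs_le (M.abs_sum_mul_itg_leg_le k (fun i => (E i).cq) (pq E))
    have b2 := neg_le_of_abs_le (M.abs_sum_mul_itg_leg_le k (fun i => (E i).cp) (pu E))
    have b3 := neg_le_of_abs_le (M.abs_int_mul_le (pp E) (pu E))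
    simp only [Mesh.int, Pi.mul_apply] at b3
    rw [M.norm_sq]
    simp only [Mesh.int, Pi.mul_apply]
    linarith
  have bb : M.norm (pp E) ^ 2 ≤ M.norm (pg E) * M.norm (pq E) + e₂ * M.norm (pp E)
      + |p₀| * |q₀| + 4 * A * J := by
    have key : ∀ i, itg (M.xl i) (M.xr i) ((E i).p * (E i).p)
        + (E i).cp * itg (M.xl i) (M.xr i) (leg k (M.xl i) (M.xr i) * (E i).p)
        ≤ itg (M.xl i) (M.xr i) ((E i).g * (E i).q)
          + 4 * A * (E i).jumpSq (M.xl i) (M.xr i)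
          + ((E i).pr * (E i).qr - (E i).pl * (E i).ql) := by
      intro i
      have := (h.sys i).product_pq
      have t1 := neg_le_of_abs_le (j i).2.2.1
      have t2 := le_of_abs_le (j i).2.2.2
      linarith
    have hsum := Finset.sum_le_sum fun i (_ : i ∈ Finset.univ) => key i
    rw [Finset.sum_add_distrib, Finset.sum_add_distrib, Finset.sum_add_distrib,
      h3, ← Finset.mul_sum] at hsum
    have b2 := neg_le_of_abs_le (M.abs_sum_mul_itg_leg_le k (fun i => (E i).cp) (pp E))
    have b3 := M.int_mul_le (pg E) (pq E)
    have b4 := neg_le_abs (p₀ * q₀)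
    rw [abs_mul] at b4
    simp only [Mesh.int, Pi.mul_apply] at b3
    rw [M.norm_sq]
    simp only [Mesh.int, Pi.mul_apply]
    linarith
  exact absorb_quadratic hA (by positivity) (M.norm_nonneg _) (M.norm_nonneg _)
    (M.wnorm_nonneg _) (M.wnorm_nonneg _) (M.norm_nonneg _) (M.norm_nonneg _) rfl rfl
    (by linarith) hJ0 ba bb hp

end MeshSys

end KdVHDG

end

/-! ### Calculus in time and relaxed coefficients. -/

noncomputable section

namespace KdVHDG

open Filter Topology

/-! ### Time-dependent polynomials -/

/-- The bilinear form with weight `W`. -/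
def bil (W : ℝ[X]) (l r : ℝ) : ℝ[X] →ₗ[ℝ] ℝ[X] →ₗ[ℝ] ℝ :=
  LinearMap.mk₂ ℝ (fun p q => itg l r (p * (W * q)))
    (fun p p' q => by rw [add_mul, map_add])
    (fun c p q => by rw [smul_mul_assoc, map_smul])
    (fun p q q' => by rw [mul_add, mul_add, map_add])
    (fun c p q => by rw [mul_smul_comm, mul_smul_comm, map_smul])

theorem bil_apply (W : ℝ[X]) (l r : ℝ) (p q : ℝ[X]) : bil W l r p q = itg l r (p * (W * q)) := rfl

theorem bil_comm (W : ℝ[X]) (l r : ℝ) (p q : ℝ[X]) : bil W l r p q = bil W l r q p := by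
  rw [bil_apply, bil_apply]; congr 1; ring

theorem bil_one (l r : ℝ) (p q : ℝ[X]) : bil 1 l r p q = itg l r (p * q) := by
  rw [bil_apply, one_mul]

/-- With bounded degree a bilinear form depends on finitely many coefficients, so limits and time
derivatives may be taken coefficient by coefficient. -/
theorem bil_eq_sum {k : ℕ} (B : ℝ[X] →ₗ[ℝ] ℝ[X] →ₗ[ℝ] ℝ) {p q : ℝ[X]}
    (hp : p.natDegree ≤ k) (hq : q.natDegree ≤ k) :
    B p q = ∑ i ∈ Finset.range (k + 1), ∑ j ∈ Finset.range (k + 1),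
      p.coeff i * q.coeff j * B (X ^ i) (X ^ j) := by
  conv_lhs => rw [p.as_sum_range' (k + 1) (Nat.lt_succ_of_le hp),
    q.as_sum_range' (k + 1) (Nat.lt_succ_of_le hq)]
  simp only [← smul_X_eq_monomial, map_sum, map_smul, LinearMap.sum_apply, LinearMap.smul_apply,
    smul_eq_mul]
  rw [Finset.sum_comm]
  simp only [Finset.mul_sum]
  refine Finset.sum_congr rfl fun i _ => Finset.sum_congr rfl fun j _ => by ring

theorem tendsto_bil {ι : Type*} {F : Filter ι} {k : ℕ} (B : ℝ[X] →ₗ[ℝ] ℝ[X] →ₗ[ℝ] ℝ)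
    {P Q : ι → ℝ[X]} {p q : ℝ[X]} (hP : ∀ᶠ s in F, (P s).natDegree ≤ k)
    (hQ : ∀ᶠ s in F, (Q s).natDegree ≤ k)
    (hp : p.natDegree ≤ k) (hq : q.natDegree ≤ k)
    (h1 : ∀ j, Tendsto (fun s => (P s).coeff j) F (𝓝 (p.coeff j)))
    (h2 : ∀ j, Tendsto (fun s => (Q s).coeff j) F (𝓝 (q.coeff j))) :
    Tendsto (fun s => B (P s) (Q s)) F (𝓝 (B p q)) := by
  rw [bil_eq_sum B hp hq]
  refine Tendsto.congr' (f₁ := fun s => ∑ i ∈ Finset.range (k + 1), ∑ j ∈ Finset.range (k + 1),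
    (P s).coeff i * (Q s).coeff j * B (X ^ i) (X ^ j)) ?_ ?_
  · filter_upwards [hP, hQ] with s h h' using (bil_eq_sum B h h').symm
  · exact tendsto_finsetSum _ fun i _ => tendsto_finsetSum _ fun j _ =>
      ((h1 i).mul (h2 j)).mul_const _

theorem hasDerivWithinAt_bil {k : ℕ} (B : ℝ[X] →ₗ[ℝ] ℝ[X] →ₗ[ℝ] ℝ) {P Q : ℝ → ℝ[X]} {p q : ℝ[X]}
    {S : Set ℝ} {t : ℝ} (ht : t ∈ S) (hP : ∀ s ∈ S, (P s).natDegree ≤ k)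
    (hQ : ∀ s ∈ S, (Q s).natDegree ≤ k)
    (hp : p.natDegree ≤ k) (hq : q.natDegree ≤ k)
    (h1 : ∀ j, HasDerivWithinAt (fun s => (P s).coeff j) (p.coeff j) S t)
    (h2 : ∀ j, HasDerivWithinAt (fun s => (Q s).coeff j) (q.coeff j) S t) :
    HasDerivWithinAt (fun s => B (P s) (Q s)) (B p (Q t) + B (P t) q) S t := by
  rw [bil_eq_sum B hp (hQ t ht), bil_eq_sum B (hP t ht) hq, ← Finset.sum_add_distrib]
  refine HasDerivWithinAt.congr (f := fun s => ∑ i ∈ Finset.range (k + 1),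
    ∑ j ∈ Finset.range (k + 1), (P s).coeff i * (Q s).coeff j * B (X ^ i) (X ^ j)) ?_
    (fun s hs => bil_eq_sum B (hP s hs) (hQ s hs)) (bil_eq_sum B (hP t ht) (hQ t ht))
  refine HasDerivWithinAt.fun_sum fun i _ => ?_
  rw [← Finset.sum_add_distrib]
  refine HasDerivWithinAt.fun_sum fun j _ => ?_
  exact (((h1 i).mul (h2 j)).mul_const _).congr_deriv (by ring)

namespace Mesh

variable {a b : ℝ} (M : Mesh a b)

theorem int_mul_eq (f g : M.PW) : M.int (f * g) = ∑ i, bil 1 (M.xl i) (M.xr i) (f i) (g i) := by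
  simp only [int, bil_one, Pi.mul_apply]

theorem tendsto_int_mul {ι : Type*} {F : Filter ι} {k : ℕ} {P Q : ι → M.PW} {p q : M.PW}
    (hP : ∀ᶠ s in F, ∀ i, (P s i).natDegree ≤ k) (hQ : ∀ᶠ s in F, ∀ i, (Q s i).natDegree ≤ k)
    (hp : ∀ i, (p i).natDegree ≤ k) (hq : ∀ i, (q i).natDegree ≤ k)
    (h1 : ∀ i j, Tendsto (fun s => (P s i).coeff j) F (𝓝 ((p i).coeff j)))
    (h2 : ∀ i j, Tendsto (fun s => (Q s i).coeff j) F (𝓝 ((q i).coeff j))) :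
    Tendsto (fun s => M.int (P s * Q s)) F (𝓝 (M.int (p * q))) := by
  simp only [int_mul_eq]
  exact tendsto_finsetSum _ fun i _ => tendsto_bil _ (hP.mono fun s h => h i)
    (hQ.mono fun s h => h i) (hp i) (hq i) (h1 i) (h2 i)

theorem tendsto_norm {ι : Type*} {F : Filter ι} {k : ℕ} {P : ι → M.PW} {p : M.PW}
    (hP : ∀ᶠ s in F, ∀ i, (P s i).natDegree ≤ k) (hp : ∀ i, (p i).natDegree ≤ k)
    (h1 : ∀ i j, Tendsto (fun s => (P s i).coeff j) F (𝓝 ((p i).coeff j))) :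
    Tendsto (fun s => M.norm (P s)) F (𝓝 (M.norm p)) := by
  simp only [norm_eq]
  exact (Real.continuous_sqrt.tendsto _).comp (M.tendsto_int_mul hP hP hp hp h1 h1)

theorem hasDerivWithinAt_int_mul {k : ℕ} {P Q : ℝ → M.PW} {p q : M.PW}
    {S : Set ℝ} {t : ℝ} (ht : t ∈ S) (hP : ∀ s ∈ S, ∀ i, (P s i).natDegree ≤ k)
    (hQ : ∀ s ∈ S, ∀ i, (Q s i).natDegree ≤ k)
    (hp : ∀ i, (p i).natDegree ≤ k) (hq : ∀ i, (q i).natDegree ≤ k)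
    (h1 : ∀ i j, HasDerivWithinAt (fun s => (P s i).coeff j) ((p i).coeff j) S t)
    (h2 : ∀ i j, HasDerivWithinAt (fun s => (Q s i).coeff j) ((q i).coeff j) S t) :
    HasDerivWithinAt (fun s => M.int (P s * Q s)) (M.int (p * Q t) + M.int (P t * q)) S t := by
  simp only [int_mul_eq]
  rw [← Finset.sum_add_distrib]
  exact HasDerivWithinAt.fun_sum fun i _ => hasDerivWithinAt_bil _ ht (fun s hs => hP s hs i)
    (fun s hs => hQ s hs i) (hp i) (hq i) (h1 i) (h2 i)

/-- A bound of the derivative from bounds of difference quotients. -/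
theorem norm_sub_le_of_norm_deriv_le {k : ℕ} {R B : ℝ} {P p : ℝ → M.PW}
    (hP : ∀ s ∈ Icc 0 R, ∀ i, (P s i).natDegree ≤ k)
    (hp : ∀ s ∈ Icc 0 R, ∀ i, (p s i).natDegree ≤ k)
    (h1 : ∀ t ∈ Icc 0 R, ∀ i j,
      HasDerivWithinAt (fun s => (P s i).coeff j) ((p t i).coeff j) (Icc 0 R) t)
    (hB : ∀ t ∈ Icc 0 R, M.norm (p t) ≤ B) {t : ℝ} (ht : t ∈ Icc 0 R) :
    M.norm (P t - P 0) ≤ B * t := by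
  have h0 : (0 : ℝ) ∈ Icc 0 R := ⟨le_rfl, ht.1.trans ht.2⟩
  -- The scalar mean value inequality is applied to `s ↦ (P s, w)` with `w` frozen, and one factor
  -- `‖w‖` is divided out.
  set w := P t - P 0 with hw
  have hwd : ∀ i, (w i).natDegree ≤ k := fun i =>
    (natDegree_sub_le _ _).trans (max_le (hP t ht i) (hP 0 h0 i))
  have hd : ∀ s ∈ Icc 0 R, HasDerivWithinAt (fun s => M.int (P s * w)) (M.int (p s * w))
      (Icc 0 R) s := by
    intro s hs
    have := M.hasDerivWithinAt_int_mul (Q := fun _ => w) (q := 0) hs hP (fun _ _ => hwd) (hp s hs)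
      (fun i => by simp) (h1 s hs) (fun i j => by simpa using hasDerivWithinAt_const _ _ _)
    simpa [int] using this
  have hmv := (convex_Icc (0 : ℝ) R).norm_image_sub_le_of_norm_hasDerivWithin_le
    (C := B * M.norm w) hd (fun s hs => (M.abs_int_mul_le _ _).trans
      (mul_le_mul_of_nonneg_right (hB s hs) (M.norm_nonneg _))) h0 ht
  rw [← M.int_sub, ← sub_mul, ← hw, sub_zero, Real.norm_eq_abs, Real.norm_eq_abs,
    abs_of_nonneg ht.1, abs_of_nonneg (M.int_mul_self_nonneg w), ← M.norm_sq] at hmv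
  rcases (M.norm_nonneg w).eq_or_lt with h | h
  · rw [← h]; exact mul_nonneg ((M.norm_nonneg _).trans (hB 0 h0)) ht.1
  · refine le_of_mul_le_mul_right ?_ h
    nlinarith

end Mesh

/-! ### Scalar differential inequalities -/

theorem le_exp_mul_of_deriv_le {f f' : ℝ → ℝ} {c R : ℝ} (hf : ContinuousOn f (Icc 0 R))
    (hd : ∀ t ∈ Ioo 0 R, HasDerivAt f (f' t) t) (hle : ∀ t ∈ Ioo 0 R, f' t ≤ c * f t)
    {t : ℝ} (ht : t ∈ Icc 0 R) : f t ≤ Real.exp (c * t) * f 0 := by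
  have hd' : ∀ t ∈ Ioo 0 R, HasDerivAt (fun t => Real.exp (-(c * t)) * f t)
      (Real.exp (-(c * t)) * (f' t - c * f t)) t := fun t ht => by
    have h1 : HasDerivAt (fun t : ℝ => Real.exp (-(c * t))) (Real.exp (-(c * t)) * (-c)) t :=
      (((hasDerivAt_id t).const_mul c).neg.congr_deriv (by simp)).exp
    exact (h1.mul (hd t ht)).congr_deriv (by ring)
  have anti : AntitoneOn (fun t => Real.exp (-(c * t)) * f t) (Icc 0 R) := by
    refine antitoneOn_of_deriv_nonpos (convex_Icc 0 R) (by fun_prop) ?_ ?_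
    · rw [interior_Icc]
      exact fun t ht => (hd' t ht).differentiableAt.differentiableWithinAt
    · rw [interior_Icc]
      intro t ht
      rw [(hd' t ht).deriv]
      exact mul_nonpos_of_nonneg_of_nonpos (Real.exp_pos _).le (by linarith [hle t ht])
  have := anti (left_mem_Icc.2 (ht.1.trans ht.2)) ht ht.1
  simp only [mul_zero, neg_zero, Real.exp_zero, one_mul] at this
  have h2 := mul_le_mul_of_nonneg_left this (Real.exp_pos (c * t)).le
  rwa [← mul_assoc, ← Real.exp_add, add_neg_cancel, Real.exp_zero, one_mul] at h2

/-- Variation of constants. Extending `d` by its end values makes the derivative two-sided also at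
`0` and `R`. Only continuity of `d` is needed, which is the point of relaxing instead of following
`d`. -/
theorem exists_relaxation {d : ℝ → ℝ} {R μ : ℝ} (hR : 0 ≤ R) (hd : ContinuousOn d (Icc 0 R)) :
    ∃ c : ℝ → ℝ, c 0 = 0 ∧ ContinuousOn c (Icc 0 R) ∧
      ∀ t ∈ Icc 0 R, HasDerivAt c (-(μ * (c t - d t))) t := by
  set d' : ℝ → ℝ := IccExtend hR ((Icc 0 R).domRestrict d) with hd'
  have hc : Continuous d' := (continuousOn_iff_continuous_domRestrict.1 hd).Icc_extend'
  set g : ℝ → ℝ := fun r => μ * Real.exp (μ * r) * d' r with hg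
  have hgc : Continuous g := by fun_prop
  have key : ∀ t, HasDerivAt (fun t => Real.exp (-(μ * t)) * ∫ r in (0 : ℝ)..t, g r)
      (-(μ * (Real.exp (-(μ * t)) * (∫ r in (0 : ℝ)..t, g r) - d' t))) t := by
    intro t
    have h1 : HasDerivAt (fun t : ℝ => Real.exp (-(μ * t))) (Real.exp (-(μ * t)) * (-μ)) t :=
      (((hasDerivAt_id t).const_mul μ).neg.congr_deriv (by simp)).exp
    have h2 := hgc.integral_hasStrictDerivAt 0 t
    refine (h1.mul h2.hasDerivAt).congr_deriv ?_
    have : Real.exp (-(μ * t)) * Real.exp (μ * t) = 1 := by rw [← Real.exp_add]; simp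
    simp only [hg]
    linear_combination (μ * d' t) * this
  refine ⟨_, by simp, fun t _ => (key t).continuousAt.continuousWithinAt, fun t ht => ?_⟩
  have : d' t = d t := by rw [hd', IccExtend_of_mem hR _ ht]; rfl
  rw [← this]; exact key t

/-! ### Relaxed coefficients -/

/-- The relaxation rate of the local problem. -/
def relRate (τp σ τ : ℝ) : ℝ := τ * (τp + τ) - σ

/-- The stationary coefficient of `L_k` in the projection of `u`. -/
def relCu (k : ℕ) (τp σ τ α β γ : ℝ) : ℝ :=
  ((-1) ^ k * β + τ * (γ - (-1) ^ k * α)) / relRate τp σ τ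

/-- For a given coefficient `cu`, `relCq` and `relCp` are the choices for which `α` and `γ` vanish
after the shift. With `cu = relCu` the residual `β` vanishes as well. -/
def relCq (k : ℕ) (τp α cu : ℝ) : ℝ := -((-1) ^ k * α) - τp * cu

def relCp (k : ℕ) (τp τ α γ cu : ℝ) : ℝ := τ * (γ - (-1) ^ k * α - (τp + τ) * cu)

section

variable {A τp σ τ : ℝ}

/-- Up to a nonzero factor this is the determinant of the local system for the projection; its lower
bound makes the projection unique and the relaxation stable. -/
theorem half_le_relRate (hs : StabBound A τp σ τ) : 1 / 2 ≤ relRate τp σ τ := by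
  have := hs.sig_le
  have := mul_nonneg hs.pos.le (add_nonneg hs.tp_nonneg hs.pos.le)
  unfold relRate; nlinarith [sq_nonneg τp]

theorem relRate_le (hs : StabBound A τp σ τ) : relRate τp σ τ ≤ 4 * A ^ 2 := by
  have h1 := hs.sig_ge
  have h2 : τ * (τp + τ) ≤ A * (1 + A) :=
    mul_le_mul hs.le (add_le_add hs.tp_le hs.le) (add_nonneg hs.tp_nonneg hs.pos.le)
      (by linarith [hs.one_le])
  unfold relRate; nlinarith [hs.one_le]

theorem neg_one_pow_sq (k : ℕ) (x : ℝ) : ((-1) ^ k * x) ^ 2 = x ^ 2 := by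
  rw [mul_pow, ← pow_mul, mul_comm k, pow_mul]; norm_num

theorem relCu_sq_le (hs : StabBound A τp σ τ) (k : ℕ) (α β γ : ℝ) :
    relCu k τp σ τ α β γ ^ 2 ≤ 12 * A ^ 2 * (α ^ 2 + β ^ 2 + γ ^ 2) := by
  have hr := half_le_relRate hs
  have hA := hs.one_le
  rw [relCu, div_pow, div_le_iff₀ (by positivity)]
  have h1 : ((-1) ^ k * β + τ * (γ - (-1) ^ k * α)) ^ 2
      ≤ 3 * A ^ 2 * (α ^ 2 + β ^ 2 + γ ^ 2) := by
    have hτ : τ ^ 2 ≤ A ^ 2 := pow_le_pow_left₀ hs.pos.le hs.le 2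
    have hA2 : 1 ≤ A ^ 2 := one_le_pow₀ hA
    have e1 := neg_one_pow_sq k β
    have e2 := neg_one_pow_sq k α
    set B := (-1) ^ k * β
    set C := (-1) ^ k * α
    rw [← e1, ← e2]
    calc (B + τ * (γ - C)) ^ 2 ≤ 3 * (B ^ 2 + τ ^ 2 * γ ^ 2 + τ ^ 2 * C ^ 2) := by
          linarith only [sq_nonneg (B - τ * γ), sq_nonneg (B + τ * C), sq_nonneg (τ * γ + τ * C)]
      _ ≤ 3 * (A ^ 2 * B ^ 2 + A ^ 2 * γ ^ 2 + A ^ 2 * C ^ 2) := by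
          gcongr; exact le_mul_of_one_le_left (sq_nonneg _) hA2
      _ = _ := by ring
  have h2 : 1 / 4 ≤ relRate τp σ τ ^ 2 := by nlinarith
  calc _ ≤ _ := h1
    _ = 12 * A ^ 2 * (α ^ 2 + β ^ 2 + γ ^ 2) * (1 / 4) := by ring
    _ ≤ _ := by gcongr

theorem relCq_relCp_sq_le (hs : StabBound A τp σ τ) (k : ℕ) (α γ cu : ℝ) :
    relCq k τp α cu ^ 2 + relCp k τp τ α γ cu ^ 2
      ≤ 14 * A ^ 4 * (α ^ 2 + γ ^ 2 + cu ^ 2) := by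
  have hA := hs.one_le
  have hτ : τ ^ 2 ≤ A ^ 2 := pow_le_pow_left₀ hs.pos.le hs.le 2
  have hA2 : 1 ≤ A ^ 2 := one_le_pow₀ hA
  have hA4 : A ^ 2 ≤ A ^ 4 := pow_le_pow_right₀ hA (by norm_num)
  have hp : τp ^ 2 ≤ 1 := by nlinarith [hs.tp_nonneg, hs.tp_le]
  have hpt : (τp + τ) ^ 2 ≤ 4 * A ^ 2 := by
    have h1 : τp + τ ≤ 2 * A := by linarith [hs.tp_le, hs.le]
    have := pow_le_pow_left₀ (add_nonneg hs.tp_nonneg hs.pos.le) h1 2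
    linarith
  have e2 := neg_one_pow_sq k α
  unfold relCq relCp
  set C := (-1) ^ k * α
  rw [← e2]
  have h1 : (-C - τp * cu) ^ 2 ≤ 2 * C ^ 2 + 2 * cu ^ 2 := by
    have := mul_le_mul_of_nonneg_right hp (sq_nonneg cu)
    linarith only [sq_nonneg (C - τp * cu), this]
  have h2 : (γ - C - (τp + τ) * cu) ^ 2 ≤ 3 * (γ ^ 2 + C ^ 2 + 4 * A ^ 2 * cu ^ 2) := by
    have := mul_le_mul_of_nonneg_right hpt (sq_nonneg cu)
    linarith only [this, sq_nonneg (γ + C), sq_nonneg (γ + (τp + τ) * cu),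
      sq_nonneg (C - (τp + τ) * cu)]
  have h3 : (τ * (γ - C - (τp + τ) * cu)) ^ 2
      ≤ A ^ 2 * (3 * (γ ^ 2 + C ^ 2 + 4 * A ^ 2 * cu ^ 2)) := by
    rw [mul_pow]; gcongr
  have h4 : A ^ 2 * (3 * (γ ^ 2 + C ^ 2 + 4 * A ^ 2 * cu ^ 2))
      ≤ 3 * A ^ 4 * γ ^ 2 + 3 * A ^ 4 * C ^ 2 + 12 * A ^ 4 * cu ^ 2 := by
    nlinarith [mul_le_mul_of_nonneg_right hA4 (sq_nonneg γ),
      mul_le_mul_of_nonneg_right hA4 (sq_nonneg C)]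
  have h5 : 1 ≤ A ^ 4 := hA2.trans hA4
  nlinarith [mul_le_mul_of_nonneg_right h5 (sq_nonneg γ),
    mul_le_mul_of_nonneg_right h5 (sq_nonneg C), mul_le_mul_of_nonneg_right h5 (sq_nonneg cu)]

/-- The shift by relaxed coefficients. -/
def ElemData.relShift (k : ℕ) (l r τp σ τ cu : ℝ) (e : ElemData) : ElemData :=
  e.shift k l r τp σ τ cu (relCq k τp e.α cu) (relCp k τp τ e.α e.γ cu)

theorem ElemData.relShift_α (k : ℕ) (l r τp σ τ cu : ℝ) (e : ElemData) :
    (e.relShift k l r τp σ τ cu).α = 0 := by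
  have : ((-1 : ℝ) ^ k) * (-1) ^ k = 1 := by rw [← mul_pow]; norm_num
  simp only [relShift, shift, relCq]
  linear_combination -e.α * this

theorem ElemData.relShift_γ (k : ℕ) (l r τp σ τ cu : ℝ) (hτ : τ ≠ 0) (e : ElemData) :
    (e.relShift k l r τp σ τ cu).γ = 0 := by
  simp only [relShift, shift, relCq, relCp]
  field_simp; ring

/-- The remaining residual measures the distance of `cu` from its stationary value. If `cu` relaxes
at rate `relRate * κ / (r - l)`, then `β` is, up to sign, its velocity times `(r - l) / κ`, as
required by `weighted_le`. -/
theorem ElemData.relShift_β (k : ℕ) (l r cu : ℝ) (hs : StabBound A τp σ τ) (e : ElemData) :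
    (e.relShift k l r τp σ τ cu).β
      = (-1) ^ k * (relRate τp σ τ * (relCu k τp σ τ e.α e.β e.γ - cu)) := by
  have : ((-1 : ℝ) ^ k) * (-1) ^ k = 1 := by rw [← mul_pow]; norm_num
  have hr : relRate τp σ τ ≠ 0 := by linarith [half_le_relRate hs]
  rw [mul_sub, relCu, mul_div_cancel₀ _ hr]
  simp only [relShift, shift, relCp, relRate]
  linear_combination -e.β * this

end

end KdVHDG

end

noncomputable section

namespace KdVHDG

open Filter Topology MeshSys

/-! ### The evolution of the discrete error -/

/-- A time-dependent solution `y` of the error equations, without residuals except for those in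
the fluxes, which are of size `δ`. -/
structure ErrFlow {a b : ℝ} (M : Mesh a b) (k : ℕ) (τ : Stabilization M.N) (T δ : ℝ)
    (y : ℝ → Fin M.N → ElemData) (w : M.PW) (α' β' γ' : ℝ → Fin M.N → ℝ) : Prop where
  sys : ∀ t ∈ Icc 0 T, MeshSys M k τ (y t)
  cq_zero : ∀ t ∈ Icc 0 T, ∀ i, (y t i).cq = 0
  cp_zero : ∀ t ∈ Icc 0 T, ∀ i, (y t i).cp = 0
  -- At time zero the third equation is the stationary one, so `g` is `u` and not its time
  -- derivative; the latter is the separate polynomial `w`.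
  init : ∀ i, (y 0 i).g = (y 0 i).u
  deriv : ∀ t ∈ Ioc 0 T, ∀ i j,
    HasDerivWithinAt (fun s => (y s i).u.coeff j) ((y t i).g.coeff j) (Icc 0 T) t
  natDegree_w : ∀ i, (w i).natDegree ≤ k
  deriv_zero : ∀ i j, HasDerivWithinAt (fun s => (y s i).u.coeff j) ((w i).coeff j) (Icc 0 T) 0
  deriv_α : ∀ t ∈ Icc 0 T, ∀ i, HasDerivWithinAt (fun s => (y s i).α) (α' t i) (Icc 0 T) t
  deriv_β : ∀ t ∈ Icc 0 T, ∀ i, HasDerivWithinAt (fun s => (y s i).β) (β' t i) (Icc 0 T) t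
  deriv_γ : ∀ t ∈ Icc 0 T, ∀ i, HasDerivWithinAt (fun s => (y s i).γ) (γ' t i) (Icc 0 T) t
  δ_nonneg : 0 ≤ δ
  bound : ∀ t ∈ Icc 0 T, ∑ i, ((y t i).α ^ 2 + (y t i).β ^ 2 + (y t i).γ ^ 2) ≤ δ ^ 2
  lip : ∀ s ∈ Icc 0 T, ∀ t ∈ Icc 0 T, ∑ i, (((y t i).α - (y s i).α) ^ 2
    + ((y t i).β - (y s i).β) ^ 2 + ((y t i).γ - (y s i).γ) ^ 2) ≤ δ ^ 2 * (t - s) ^ 2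
  -- Second order information in time is required of `α` alone and with the weight of a squared
  -- length. The other residuals are only Lipschitz in time.
  lip_deriv : ∀ s ∈ Ioo 0 T, ∀ t ∈ Ioo 0 T,
    ∑ i, (M.xr i - M.xl i) ^ 2 * (α' t i - α' s i) ^ 2 ≤ δ ^ 2 * (t - s) ^ 2

theorem Mesh.wnorm_sq_le {a b : ℝ} (M : Mesh a b) {c : Fin M.N → ℝ} {B : ℝ}
    (h : ∑ i, c i ^ 2 ≤ B) : M.wnorm c ^ 2 ≤ M.size * B := by
  rw [M.wnorm_sq]
  calc ∑ i, (M.xr i - M.xl i) * c i ^ 2 ≤ ∑ i, M.size * c i ^ 2 :=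
        Finset.sum_le_sum fun i _ => mul_le_mul_of_nonneg_right (M.len_le_size i) (sq_nonneg _)
    _ = M.size * ∑ i, c i ^ 2 := by rw [Finset.mul_sum]
    _ ≤ _ := mul_le_mul_of_nonneg_left h M.size_nonneg

namespace ErrFlow

variable {a b : ℝ} {M : Mesh a b} {k : ℕ} {τ : Stabilization M.N} {T δ A : ℝ}
  {y : ℝ → Fin M.N → ElemData} {w : M.PW} {α' β' γ' : ℝ → Fin M.N → ℝ}

/-- The time derivative of the discrete error in `u`. -/
def ut (y : ℝ → Fin M.N → ElemData) (w : M.PW) (t : ℝ) : M.PW := if t = 0 then w else pg (y t)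

theorem hasDeriv (h : ErrFlow M k τ T δ y w α' β' γ') {t : ℝ} (ht : t ∈ Icc 0 T) (i : Fin M.N)
    (j : ℕ) :
    HasDerivWithinAt (fun s => (y s i).u.coeff j) ((ut y w t i).coeff j) (Icc 0 T) t := by
  unfold ut
  split_ifs with h0
  · rw [h0]; exact h.deriv_zero i j
  · exact h.deriv t ⟨lt_of_le_of_ne ht.1 (Ne.symm h0), ht.2⟩ i j

theorem natDegree_ut (h : ErrFlow M k τ T δ y w α' β' γ') {t : ℝ} (ht : t ∈ Icc 0 T)
    (i : Fin M.N) : (ut y w t i).natDegree ≤ k := by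
  unfold ut
  split_ifs with h0
  · exact h.natDegree_w i
  · exact ((h.sys t ht).sys i).deg_g

/-! #### The derivative at the initial time -/

/-- The flux residuals are kept instead of shifted away: their products with jumps are absorbed by
the dissipation, which leaves their squares. The trace of `q` at `a` has a good sign. -/
theorem energy_diff_le {E : Fin M.N → ElemData} (h : MeshSys M k τ E)
    (hs : ∀ i, StabBound A (τ.quP i) (τ.puP i) (τ.quM i))
    (hq : ∀ i, (E i).cq = 0) (hp : ∀ i, (E i).cp = 0) :
    M.int (pg E * pu E) ≤ 2 * ∑ i, ((E i).α ^ 2 + (E i).β ^ 2 + (E i).γ ^ 2) := by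
  obtain ⟨q₀, p₀, -, h1, -⟩ := h.exists_trace
  have key : ∀ i, itg (M.xl i) (M.xr i) ((E i).g * (E i).u)
      + (((E i).pr * (E i).ur - (E i).qr ^ 2 / 2) - ((E i).pl * (E i).ul - (E i).ql ^ 2 / 2))
      ≤ 2 * ((E i).α ^ 2 + (E i).β ^ 2 + (E i).γ ^ 2) := by
    intro i
    have en := (h.sys i).energy
    rw [hq, hp, zero_mul, zero_mul, sub_zero] at en
    have d1 : -(1 / 2) * (E i).γ ^ 2 ≤ (E i).jqr (M.xr i) ^ 2 / 2
        - (E i).jpr (M.xr i) * (E i).jur (M.xr i) := by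
      rw [(h.sys i).flux_qr]
      have : τ.quM i * (τ.quM i)⁻¹ = 1 := mul_inv_cancel₀ (hs i).pos.ne'
      have e : (E i).jpr (M.xr i) * (E i).jur (M.xr i)
          = (τ.quM i * (E i).jur (M.xr i)) * ((τ.quM i)⁻¹ * (E i).jpr (M.xr i)) := by
        linear_combination -(E i).jpr (M.xr i) * (E i).jur (M.xr i) * this
      rw [e]
      nlinarith [sq_nonneg (τ.quM i * (E i).jur (M.xr i) + (E i).γ),
        sq_nonneg ((τ.quM i)⁻¹ * (E i).jpr (M.xr i) + (E i).γ)]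
    have d2 : -((3 / 2) * ((E i).α ^ 2 + (E i).β ^ 2)) ≤ -((E i).jql (M.xl i) ^ 2 / 2
        - (E i).jpl (M.xl i) * (E i).jul (M.xl i)) := by
      rw [(h.sys i).flux_ql, (h.sys i).flux_pl]
      set U := (E i).jul (M.xl i)
      have t1 := mul_le_mul_of_nonneg_right (hs i).sig_le (sq_nonneg U)
      have t2 : (τ.quP i) ^ 2 * (E i).α ^ 2 ≤ (E i).α ^ 2 :=
        mul_le_of_le_one_left (sq_nonneg _)
          (pow_le_one₀ (hs i).tp_nonneg (hs i).tp_le)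
      nlinarith [sq_nonneg (U + (τ.quP i * (E i).α + (E i).β)),
        sq_nonneg (τ.quP i * (E i).α - (E i).β)]
    linarith [sq_nonneg (E i).α, sq_nonneg (E i).β, sq_nonneg (E i).γ]
  have hsum := Finset.sum_le_sum fun i (_ : i ∈ Finset.univ) => key i
  rw [Finset.sum_add_distrib, h1, ← Finset.mul_sum] at hsum
  have e : M.int (pg E * pu E) = ∑ i, itg (M.xl i) (M.xr i) ((E i).g * (E i).u) := rfl
  rw [e]; linarith [sq_nonneg q₀]

/-- Let `Δ r = u r - u 0`. The difference of the systems at times `s` and `0` has `g`-component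
`u_t(s) - u 0`, so `energy_diff_le` gives `½ (‖Δ‖²)' ≤ (u 0, Δ) + 2 δ² s²`. Since `Δ` is `s w` to
first order, integrating and dividing by the squared time gives `‖w‖² ≤ (u 0, w)`. Continuity of
`u_t` at `0` is not used. -/
theorem norm_w_le (h : ErrFlow M k τ T δ y w α' β' γ') (hT : 0 < T)
    (hs : ∀ i, StabBound A (τ.quP i) (τ.puP i) (τ.quM i)) :
    M.norm w ≤ M.norm (pu (y 0)) := by
  have h0 : (0 : ℝ) ∈ Icc 0 T := ⟨le_rfl, hT.le⟩
  set v := pu (y 0) with hv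
  have hvd : ∀ i, (v i).natDegree ≤ k := fun i => ((h.sys 0 h0).sys i).deg_u
  set Δ : ℝ → M.PW := fun r => pu (y r) - v with hΔ
  have hΔd : ∀ r ∈ Icc 0 T, ∀ i, (Δ r i).natDegree ≤ k := fun r hr i =>
    (natDegree_sub_le _ _).trans (max_le ((h.sys r hr).sys i).deg_u (hvd i))
  have hΔ' : ∀ r ∈ Icc 0 T, ∀ i j,
      HasDerivWithinAt (fun s => (Δ s i).coeff j) ((ut y w r i).coeff j) (Icc 0 T) r := by
    intro r hr i j
    have := (h.hasDeriv hr i j).sub_const ((v i).coeff j)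
    simpa [hΔ] using this
  have hut0 : ut y w 0 = w := if_pos rfl
  have hΔ0 : Δ 0 = 0 := sub_self _
  -- quotients
  have hquot : ∀ i j, Tendsto (fun r => ((r⁻¹ • Δ r) i).coeff j) (𝓝[>] 0)
      (𝓝 ((w i).coeff j)) := by
    intro i j
    have h1 := hasDerivWithinAt_iff_tendsto_slope.1 (hΔ' 0 h0 i j)
    rw [hut0] at h1
    have h2 : 𝓝[>] (0 : ℝ) ≤ 𝓝[Icc 0 T \ {0}] 0 := by
      refine nhdsWithin_le_of_mem (mem_of_superset (Ioo_mem_nhdsGT hT) fun r hr => ?_)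
      exact ⟨⟨hr.1.le, hr.2.le⟩, hr.1.ne'⟩
    refine (h1.mono_left h2).congr fun r => ?_
    rw [slope_def_field, hΔ0]
    simp [div_eq_inv_mul]
  have hmem : ∀ᶠ r in 𝓝[>] (0 : ℝ), r ∈ Ioo 0 T := Ioo_mem_nhdsGT hT
  have hqd : ∀ᶠ r in 𝓝[>] (0 : ℝ), ∀ i, ((r⁻¹ • Δ r) i).natDegree ≤ k := by
    filter_upwards [hmem] with r hr i
    exact (natDegree_smul_le _ _).trans (hΔd r ⟨hr.1.le, hr.2.le⟩ i)
  have lim1 := M.tendsto_int_mul hqd hqd h.natDegree_w h.natDegree_w hquot hquot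
  have lim2 := M.tendsto_int_mul (P := fun _ => v) (p := v) (Eventually.of_forall fun _ => hvd) hqd
    hvd h.natDegree_w (fun _ _ => tendsto_const_nhds) hquot
  have main : ∀ η > 0, M.int (w * w) ≤ M.int (v * w) + η := by
    intro η hη
    have ev := (tendsto_order.1 lim2).2 _ (lt_add_of_pos_right (M.int (v * w)) hη)
    obtain ⟨R, hR0, hR⟩ := mem_nhdsGT_iff_exists_Ioo_subset.1 (inter_mem ev hmem)
    have hR0 : 0 < R := hR0
    have hRT : Ioo 0 R ⊆ Ioo 0 T := fun r hr => (hR hr).2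
    have hRT' : R ≤ T := by
      by_contra! hc
      have := (hRT (a := (max T (R / 2) + R) / 2) ⟨by positivity, by
        have : max T (R / 2) < R := max_lt hc (by linarith)
        linarith⟩).2
      have h2 : T ≤ max T (R / 2) := le_max_left _ _
      linarith
    set B := M.int (v * w) + η with hB
    set S : ℝ := 4 * δ ^ 2 with hS
    have hfd : ∀ r ∈ Icc 0 T, HasDerivWithinAt (fun r => M.int (Δ r * Δ r))
        (2 * M.int (ut y w r * Δ r)) (Icc 0 T) r := by
      intro r hr
      refine (M.hasDerivWithinAt_int_mul hr hΔd hΔd (fun i => h.natDegree_ut hr i)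
        (fun i => h.natDegree_ut hr i) (hΔ' r hr) (hΔ' r hr)).congr_deriv ?_
      rw [mul_comm (Δ r)]; ring
    have bnd : ∀ r ∈ Ioo 0 R, M.int (Δ r * Δ r) ≤ B * r ^ 2 + S / 3 * r ^ 3 := by
      intro r hr
      -- Gronwall with rate zero, that is, monotonicity: the bound on the derivative integrates to
      -- `B r² + S r³ / 3`, and the cubic term disappears after division by `r²`.
      have := le_exp_mul_of_deriv_le (f := fun r => M.int (Δ r * Δ r) - (B * r ^ 2 + S / 3 * r ^ 3))
        (f' := fun r => 2 * M.int (ut y w r * Δ r) - (B * (2 * r) + S / 3 * (3 * r ^ 2)))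
        (c := 0) (R := R) ?_ ?_ ?_ ⟨hr.1.le, hr.2.le⟩
      · rw [zero_mul, Real.exp_zero, one_mul, hΔ0, zero_mul] at this
        have h0 : M.int (0 : M.PW) = 0 := by simp [Mesh.int]
        rw [h0] at this
        norm_num at this
        linarith
      · refine ContinuousOn.sub (fun s hs => ?_) (by fun_prop)
        exact (hfd s ⟨hs.1, hs.2.trans hRT'⟩).continuousWithinAt.mono (Icc_subset_Icc_right hRT')
      · intro s hs
        have hsT := hRT hs
        have h1 := (hfd s ⟨hsT.1.le, hsT.2.le⟩).hasDerivAt (Icc_mem_nhds hsT.1 hsT.2)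
        have h2 : HasDerivAt (fun r : ℝ => B * r ^ 2 + S / 3 * r ^ 3)
            (B * (2 * s) + S / 3 * (3 * s ^ 2)) s := by
          refine (((hasDerivAt_pow 2 s).const_mul B).add
            ((hasDerivAt_pow 3 s).const_mul (S / 3))).congr_deriv ?_
          norm_num
        exact h1.sub h2
      · intro s hsR
        have hsT := hRT hsR
        have hsI : s ∈ Icc 0 T := ⟨hsT.1.le, hsT.2.le⟩
        rw [zero_mul]
        have hE := (h.sys s hsI).diff (h.sys 0 h0) 1
        have e1 := energy_diff_le hE hs
          (fun i => by simp [ElemData.diff, h.cq_zero s hsI i, h.cq_zero 0 h0 i])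
          (fun i => by simp [ElemData.diff, h.cp_zero s hsI i, h.cp_zero 0 h0 i])
        have e2 := h.lip 0 h0 s hsI
        rw [sub_zero] at e2
        have e3 : M.int (pg (fun i => ElemData.diff 1 (y s i) (y 0 i))
            * pu (fun i => ElemData.diff 1 (y s i) (y 0 i)))
            = M.int (ut y w s * Δ s) - M.int (v * Δ s) := by
          rw [← M.int_sub, ← sub_mul]
          congr 1
          funext i
          have : ut y w s = pg (y s) := if_neg hsR.1.ne'
          simp only [Pi.mul_apply, Pi.sub_apply, this, hΔ, hv, pu, pg]
          simp only [ElemData.diff, C_1, one_mul, h.init i]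
        rw [e3] at e1
        simp only [ElemData.diff, one_mul] at e1
        have e4 : M.int (v * Δ s) ≤ B * s := by
          have : M.int (v * s⁻¹ • Δ s) < B := (hR hsR).1
          rw [mul_smul_comm, M.int_smul, inv_mul_lt_iff₀ hsR.1] at this
          linarith
        rw [hS]; linarith
    have lim3 : Tendsto (fun r : ℝ => B + S / 3 * r) (𝓝[>] 0) (𝓝 (B + S / 3 * 0)) :=
      (Continuous.tendsto (by fun_prop) 0).mono_left nhdsWithin_le_nhds
    rw [mul_zero, add_zero] at lim3
    refine le_of_tendsto_of_tendsto lim1 lim3 ?_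
    filter_upwards [Ioo_mem_nhdsGT hR0] with r hr
    have := bnd r hr
    rw [smul_mul_smul_comm, M.int_smul, ← mul_inv, ← pow_two, inv_mul_le_iff₀ (by have := hr.1; positivity)]
    calc _ ≤ _ := this
      _ = _ := by ring
  have hle : M.int (w * w) ≤ M.int (v * w) := le_of_forall_pos_le_add main
  rw [← M.norm_sq] at hle
  have := M.int_mul_le v w
  rcases (M.norm_nonneg w).eq_or_lt with h1 | h1
  · rw [← h1]; exact M.norm_nonneg _
  · refine le_of_mul_le_mul_right ?_ h1
    nlinarith

end ErrFlow

end KdVHDG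

end

/-! ### Weighted energy estimate of time difference quotients. -/

noncomputable section

namespace KdVHDG

open Filter Topology MeshSys

theorem hasDerivWithinAt_comp_add {f : ℝ → ℝ} {f' T s t : ℝ} (hs : 0 ≤ s)
    (h : HasDerivWithinAt f f' (Icc 0 T) (t + s)) :
    HasDerivWithinAt (fun t => f (t + s)) f' (Icc 0 (T - s)) t := by
  have hm : MapsTo (fun x => x + s) (Icc 0 (T - s)) (Icc 0 T) :=
    fun x hx => ⟨add_nonneg hx.1 hs, by linarith [hx.2]⟩
  have := HasDerivWithinAt.comp t h ((hasDerivWithinAt_id t (Icc 0 (T - s))).add_const s) hm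
  simpa [Function.comp_def] using this

/-- The constants of the estimate of the relaxed coefficients. -/
def relConst (A : ℝ) : ℝ := 14 * A ^ 4 * (1 + 96 * A ^ 4) + 32 * A ^ 4 * (12 * A ^ 2 + 96 * A ^ 4)

def relDerivConst (n : ℕ) (A : ℝ) : ℝ := 2 + 2 * (2 * n + 3) ^ 2 * relConst A

def evoRate (n : ℕ) (A D : ℝ) : ℝ := 4 * (weightConst n A D (weightMin n A + D) + 1)

def evoNoise (n : ℕ) (A D : ℝ) : ℝ :=
  (weightMin n A + D) ^ 2 * D ^ 2 * relConst A + relConst A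
    + (weightMin n A + D) ^ 2 * relDerivConst n A

/-- The constant of the estimate of time differences of the discrete error. -/
def evoConst (n : ℕ) (A D T : ℝ) : ℝ :=
  8 * Real.exp (evoRate n A D * T) * (weightMin n A + D + 1 + 2 * evoNoise n A D) + 192 * A ^ 4

theorem Mesh.size_pos {a b : ℝ} (M : Mesh a b) (hab : a < b) : 0 < M.size := by
  rcases isEmpty_or_nonempty (Fin M.N) with h | ⟨⟨i⟩⟩
  · have := M.sum_len
    simp at this; linarith
  · exact (M.len_pos i).trans_le (M.len_le_size i)

/-- The relaxed coefficients stay small. -/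
theorem relaxation_bound {a b : ℝ} (M : Mesh a b) (hab : a < b) {κ R S A : ℝ} (hκ : 0 < κ)
    (rate : Fin M.N → ℝ) (hr1 : ∀ i, 1 / 2 ≤ rate i) (hr2 : ∀ i, rate i ≤ 4 * A ^ 2)
    {c d : ℝ → Fin M.N → ℝ} (c0 : ∀ i, c 0 i = 0)
    (hc : ∀ t ∈ Icc 0 R, ∀ i, HasDerivAt (fun t => c t i)
      (-(rate i / ((M.xr i - M.xl i) / κ) * (c t i - d t i))) t)
    (hd : ∀ t ∈ Icc 0 R, ∑ i, d t i ^ 2 ≤ S) {t : ℝ} (ht : t ∈ Icc 0 R) :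
    ∑ i, (M.xr i - M.xl i) * c t i ^ 2 ≤ 8 * A ^ 2 * (M.size * S) := by
  have hsz := M.size_pos hab
  -- Relaxation rates differ between elements like the inverse lengths; the length as weight
  -- compensates this. The comparison equation `y' = -κ/(2h) y + 4A²κS` has the equilibrium `8A² h
  -- S`, which is subtracted here.
  have hD : ∀ t ∈ Icc 0 R, HasDerivAt
      (fun t => ∑ i, (M.xr i - M.xl i) * c t i ^ 2 - 8 * A ^ 2 * (M.size * S))
      (∑ i, (M.xr i - M.xl i) * (2 * c t i
        * (-(rate i / ((M.xr i - M.xl i) / κ) * (c t i - d t i))))) t := fun t ht => by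
    refine HasDerivAt.sub_const _ (HasDerivAt.fun_sum fun i _ => ?_)
    exact (((hc t ht i).pow 2).const_mul _).congr_deriv (by norm_num)
  have := le_exp_mul_of_deriv_le (c := -(κ / (2 * M.size)))
    (fun t ht => (hD t ht).continuousAt.continuousWithinAt)
    (fun t ht => hD t ⟨ht.1.le, ht.2.le⟩) (fun t ht => ?_) ht
  · have h0 : ∑ i, (M.xr i - M.xl i) * c 0 i ^ 2 = 0 :=
      Finset.sum_eq_zero fun i _ => by rw [c0]; ring
    have hS : 0 ≤ S := (Finset.sum_nonneg fun i _ => sq_nonneg _).trans (hd t ht)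
    rw [h0] at this
    have h2 : 0 ≤ Real.exp (-(κ / (2 * M.size)) * t) * (8 * A ^ 2 * (M.size * S)) := by positivity
    linarith
  · have htI : t ∈ Icc 0 R := ⟨ht.1.le, ht.2.le⟩
    have h1 : ∀ i, (M.xr i - M.xl i) * (2 * c t i
        * (-(rate i / ((M.xr i - M.xl i) / κ) * (c t i - d t i))))
        ≤ -(κ / (2 * M.size)) * ((M.xr i - M.xl i) * c t i ^ 2) + 4 * A ^ 2 * κ * d t i ^ 2 := by
      intro i
      have hh := M.len_pos i
      have e : (M.xr i - M.xl i) * (2 * c t i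
        * (-(rate i / ((M.xr i - M.xl i) / κ) * (c t i - d t i))))
        = κ * (rate i * (2 * c t i * d t i - 2 * c t i ^ 2)) := by field_simp; ring
      have e1 : rate i * (2 * c t i * d t i - 2 * c t i ^ 2)
          ≤ rate i * (d t i ^ 2 - c t i ^ 2) := by
        refine mul_le_mul_of_nonneg_left ?_ (by linarith [hr1 i])
        linarith [sq_nonneg (c t i - d t i)]
      have e2 : rate i * (d t i ^ 2 - c t i ^ 2) ≤ 4 * A ^ 2 * d t i ^ 2 - 1 / 2 * c t i ^ 2 := by
        have := mul_le_mul_of_nonneg_right (hr1 i) (sq_nonneg (c t i))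
        have := mul_le_mul_of_nonneg_right (hr2 i) (sq_nonneg (d t i))
        linarith
      have e3 : κ / (2 * M.size) * ((M.xr i - M.xl i) * c t i ^ 2) ≤ κ * (1 / 2 * c t i ^ 2) := by
        rw [div_mul_eq_mul_div, div_le_iff₀ (by positivity)]
        have := mul_le_mul_of_nonneg_right (M.len_le_size i) (sq_nonneg (c t i))
        nlinarith
      rw [e]
      have := mul_le_mul_of_nonneg_left (e1.trans e2) hκ.le
      linarith
    refine (Finset.sum_le_sum fun i _ => h1 i).trans ?_
    rw [Finset.sum_add_distrib, ← Finset.mul_sum, ← Finset.mul_sum]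
    have h2 := mul_le_mul_of_nonneg_left (hd t htI) (by positivity : 0 ≤ 4 * A ^ 2 * κ)
    have e : -(κ / (2 * M.size)) * (8 * A ^ 2 * (M.size * S)) = -(4 * A ^ 2 * κ * S) := by
      field_simp; ring
    rw [mul_sub, e]
    linarith

namespace ErrFlow

variable {a b : ℝ} {M : Mesh a b} {k n : ℕ} {τ : Stabilization M.N} {T δ A : ℝ}
  {y : ℝ → Fin M.N → ElemData} {w : M.PW} {α' β' γ' : ℝ → Fin M.N → ℝ}

/-- Difference quotients in time. -/
abbrev quot (y : ℝ → Fin M.N → ElemData) (s t : ℝ) : Fin M.N → ElemData :=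
  fun i => ElemData.diff s⁻¹ (y (t + s) i) (y t i)

theorem quot_sum_le (h : ErrFlow M k τ T δ y w α' β' γ') {s t : ℝ} (hs0 : 0 < s)
    (ht : t ∈ Icc 0 (T - s)) :
    ∑ i, ((quot y s t i).α ^ 2 + (quot y s t i).β ^ 2 + (quot y s t i).γ ^ 2) ≤ δ ^ 2 := by
  have := h.lip t ⟨ht.1, by linarith [ht.2]⟩ (t + s) ⟨by linarith [ht.1], by linarith [ht.2]⟩
  have e : ∑ i, ((quot y s t i).α ^ 2 + (quot y s t i).β ^ 2 + (quot y s t i).γ ^ 2)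
      = s⁻¹ ^ 2 * ∑ i, (((y (t + s) i).α - (y t i).α) ^ 2
    + ((y (t + s) i).β - (y t i).β) ^ 2 + ((y (t + s) i).γ - (y t i).γ) ^ 2) := by
    rw [Finset.mul_sum]
    refine Finset.sum_congr rfl fun i _ => ?_
    simp only [quot, ElemData.diff]; ring
  rw [e, inv_pow, inv_mul_le_iff₀ (by positivity)]
  calc _ ≤ _ := this
    _ = _ := by ring

theorem one_le_weightMin (n : ℕ) (hA : 1 ≤ A) : 1 ≤ weightMin n A := by
  unfold weightMin
  have h1 : 1 ≤ A ^ 2 := one_le_pow₀ hA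
  have h2 : 0 ≤ 15 * (2 * (n : ℝ) + 3) * A := by positivity
  nlinarith

-- A quotient with a fixed step solves the error equations and has the time regularity of `u`, so
-- its energy can be differentiated in time. The constant does not depend on the step, so the step
-- may later tend to zero.
set_option maxHeartbeats 1000000 in
theorem quot_le (h : ErrFlow M (n + 1) τ T δ y w α' β' γ') (hab : a < b) (hA : 1 ≤ A)
    (hs : ∀ i, StabBound A (τ.quP i) (τ.puP i) (τ.quM i)) {s : ℝ} (hs0 : 0 < s) (hsT : s < T)
    {t : ℝ} (ht : t ∈ Icc 0 (T - s)) :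
    M.norm (pu (quot y s t)) ^ 2
      ≤ evoConst n A (b - a) T * (M.norm (pu (quot y s 0)) ^ 2 + M.size * δ ^ 2) := by
  set R := T - s with hR
  have hR0 : 0 < R := sub_pos.2 hsT
  set κ : ℝ := 2 * n + 3 with hκ
  have hκ0 : 0 < κ := by rw [hκ]; positivity
  have hκ1 : 1 ≤ κ := by rw [hκ]; linarith [(Nat.cast_nonneg n : (0 : ℝ) ≤ n)]
  set D := b - a with hD
  have hD0 : 0 < D := sub_pos.2 hab
  set K := weightMin n A with hK
  have hK1 : 1 ≤ K := one_le_weightMin n hA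
  set Ψ := K + D with hΨ
  have hΨ0 : 0 < Ψ := by linarith
  -- The weight `x + c` then increases from `K` at `a`, enough for the dissipation, to `Ψ` at `b`.
  set c := K - a with hc
  set ε2 := M.size * δ ^ 2 with hε2
  have hε0 : 0 ≤ ε2 := mul_nonneg M.size_nonneg (sq_nonneg _)
  have memT : ∀ {t}, t ∈ Icc 0 R → t ∈ Icc 0 T := fun ht => ⟨ht.1, by linarith [ht.2]⟩
  have memT' : ∀ {t}, t ∈ Icc 0 R → t + s ∈ Icc 0 T := fun ht =>
    ⟨by linarith [ht.1], by linarith [ht.2]⟩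
  -- time derivatives
  have dα : ∀ t ∈ Icc 0 R, ∀ i, HasDerivWithinAt (fun t => (quot y s t i).α)
      (s⁻¹ * (α' (t + s) i - α' t i)) (Icc 0 R) t := fun t ht i =>
    ((hasDerivWithinAt_comp_add hs0.le (h.deriv_α _ (memT' ht) i)).sub
      ((h.deriv_α t (memT ht) i).mono (Icc_subset_Icc_right (by linarith)))).const_mul _
  have dβ : ∀ t ∈ Icc 0 R, ∀ i, HasDerivWithinAt (fun t => (quot y s t i).β)
      (s⁻¹ * (β' (t + s) i - β' t i)) (Icc 0 R) t := fun t ht i =>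
    ((hasDerivWithinAt_comp_add hs0.le (h.deriv_β _ (memT' ht) i)).sub
      ((h.deriv_β t (memT ht) i).mono (Icc_subset_Icc_right (by linarith)))).const_mul _
  have dγ : ∀ t ∈ Icc 0 R, ∀ i, HasDerivWithinAt (fun t => (quot y s t i).γ)
      (s⁻¹ * (γ' (t + s) i - γ' t i)) (Icc 0 R) t := fun t ht i =>
    ((hasDerivWithinAt_comp_add hs0.le (h.deriv_γ _ (memT' ht) i)).sub
      ((h.deriv_γ t (memT ht) i).mono (Icc_subset_Icc_right (by linarith)))).const_mul _
  set ud : ℝ → M.PW := fun t i => C s⁻¹ * (ut y w (t + s) i - ut y w t i) with hud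
  have du : ∀ t ∈ Icc 0 R, ∀ i j, HasDerivWithinAt (fun t => (quot y s t i).u.coeff j)
      ((ud t i).coeff j) (Icc 0 R) t := fun t ht i j => by
    have := ((hasDerivWithinAt_comp_add hs0.le (h.hasDeriv (memT' ht) i j)).fun_sub
      ((h.hasDeriv (memT ht) i j).mono (Icc_subset_Icc_right (by linarith : T - s ≤ T)))).const_mul
        s⁻¹
    simp only [quot, ElemData.diff, coeff_C_mul, coeff_sub, hud]
    exact this
  have udg : ∀ t ∈ Ioo 0 R, ∀ i, (quot y s t i).g = ud t i := fun t ht i => by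
    have e1 : ut y w (t + s) = pg (y (t + s)) := if_neg (by linarith [ht.1])
    have e2 : ut y w t = pg (y t) := if_neg ht.1.ne'
    simp only [hud, e1, e2, quot, ElemData.diff]
  have udd : ∀ t ∈ Icc 0 R, ∀ i, (ud t i).natDegree ≤ n + 1 := fun t ht i =>
    ElemData.natDegree_C_mul_sub_le _ (h.natDegree_ut (memT' ht) i) (h.natDegree_ut (memT ht) i)
  -- relaxed coefficients
  set rate : Fin M.N → ℝ := fun i => relRate (τ.quP i) (τ.puP i) (τ.quM i) with hrate
  set d : ℝ → Fin M.N → ℝ := fun t i => relCu (n + 1) (τ.quP i) (τ.puP i) (τ.quM i)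
    (quot y s t i).α (quot y s t i).β (quot y s t i).γ with hd
  have hdc : ∀ i, ContinuousOn (fun t => d t i) (Icc 0 R) := fun i t ht => by
    have h1 := (dα t ht i).continuousWithinAt
    have h2 := (dβ t ht i).continuousWithinAt
    have h3 := (dγ t ht i).continuousWithinAt
    simp only [hd, relCu]
    exact ((h2.const_mul _).add ((h3.sub (h1.const_mul _)).const_mul _)).div_const _
  -- Shifting by `d` itself would need the time derivative of `d`, hence second time derivatives of
  -- `p`. The relaxed coefficient replaces it.
  choose cu' cu0 cuc cud using fun i =>
    exists_relaxation (μ := rate i / ((M.xr i - M.xl i) / κ)) hR0.le (hdc i)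
  set cu : ℝ → Fin M.N → ℝ := fun t i => cu' i t with hcu
  set cud' : ℝ → Fin M.N → ℝ := fun t i =>
    -(rate i / ((M.xr i - M.xl i) / κ) * (cu t i - d t i)) with hcud'
  have hdsum : ∀ t ∈ Icc 0 R, ∑ i, d t i ^ 2 ≤ 12 * A ^ 2 * δ ^ 2 := fun t ht => by
    refine (Finset.sum_le_sum fun i _ => relCu_sq_le (hs i) (n + 1) _ _ _).trans ?_
    rw [← Finset.mul_sum]
    exact mul_le_mul_of_nonneg_left (h.quot_sum_le hs0 ht) (by positivity)
  have hcuS : ∀ t ∈ Icc 0 R, ∑ i, (M.xr i - M.xl i) * cu t i ^ 2 ≤ 96 * A ^ 4 * ε2 := fun t ht => by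
    refine (relaxation_bound M hab hκ0 rate (fun i => half_le_relRate (hs i))
      (fun i => relRate_le (hs i)) (fun i => cu0 i) (fun t ht i => cud i t ht) hdsum ht).trans
      (le_of_eq ?_)
    rw [hε2]; ring
  -- the shifted system
  set x : ℝ → Fin M.N → ElemData := fun t i => (quot y s t i).relShift (n + 1) (M.xl i) (M.xr i)
    (τ.quP i) (τ.puP i) (τ.quM i) (cu t i) with hx
  have xsys : ∀ t ∈ Icc 0 R, MeshSys M (n + 1) τ (x t) := fun t ht =>
    ((h.sys _ (memT' ht)).diff (h.sys _ (memT ht)) _).shift _ _ _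
  have xα : ∀ t i, (x t i).α = 0 := fun t i => ElemData.relShift_α _ _ _ _ _ _ _ _
  have xγ : ∀ t i, (x t i).γ = 0 := fun t i =>
    ElemData.relShift_γ _ _ _ _ _ _ _ (hs i).pos.ne' _
  have xβ : ∀ t i, (x t i).β = (-1) ^ (n + 1) * (rate i * (d t i - cu t i)) := fun t i =>
    ElemData.relShift_β _ _ _ _ (hs i) _
  have xcq : ∀ t ∈ Icc 0 R, ∀ i, (x t i).cq
      = relCq (n + 1) (τ.quP i) (quot y s t i).α (cu t i) := fun t ht i => by
    simp only [hx, ElemData.relShift, ElemData.shift, quot, ElemData.diff,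
      h.cq_zero _ (memT ht), h.cq_zero _ (memT' ht), sub_self, mul_zero, zero_add]
  have xcp : ∀ t ∈ Icc 0 R, ∀ i, (x t i).cp
      = relCp (n + 1) (τ.quP i) (τ.quM i) (quot y s t i).α (quot y s t i).γ (cu t i) :=
    fun t ht i => by
    simp only [hx, ElemData.relShift, ElemData.shift, quot, ElemData.diff,
      h.cp_zero _ (memT ht), h.cp_zero _ (memT' ht), sub_self, mul_zero, zero_add]
  set xd : ℝ → M.PW := fun t i => ud t i - C (cud' t i) * leg (n + 1) (M.xl i) (M.xr i) with hxd
  have xdd : ∀ t ∈ Icc 0 R, ∀ i, (xd t i).natDegree ≤ n + 1 := fun t ht i =>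
    natDegree_sub_leg (udd t ht i) _
  have xud : ∀ t ∈ Icc 0 R, ∀ i j, HasDerivWithinAt (fun t => (x t i).u.coeff j)
      ((xd t i).coeff j) (Icc 0 R) t := fun t ht i j => by
    have := (du t ht i j).fun_sub (((cud i t ht).hasDerivWithinAt (s := Icc 0 R)).mul_const
      ((leg (n + 1) (M.xl i) (M.xr i)).coeff j))
    simp only [hx, ElemData.relShift, ElemData.shift, coeff_sub, coeff_C_mul, hxd, hcud']
    exact this
  -- The relaxation equation identifies the velocity of the shift with the multiple of `β` allowed
  -- in `weighted_le`.
  have xg : ∀ t ∈ Ioo 0 R, ∀ i, (x t i).g = xd t i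
      + C ((-1) ^ (n + 1) * (x t i).β / ((M.xr i - M.xl i) / κ))
        * leg (n + 1) (M.xl i) (M.xr i) := fun t ht i => by
    have e1 : (x t i).g = ud t i := udg t ht i
    have e2 : (-1) ^ (n + 1) * (x t i).β / ((M.xr i - M.xl i) / κ) = cud' t i := by
      have : ((-1 : ℝ) ^ (n + 1)) * (-1) ^ (n + 1) = 1 := by rw [← mul_pow]; norm_num
      rw [xβ, hcud', ← mul_assoc, this, one_mul]; ring
    rw [e1, e2, hxd]; ring
  set cqd : ℝ → Fin M.N → ℝ := fun t i =>
    -((-1) ^ (n + 1) * (s⁻¹ * (α' (t + s) i - α' t i))) - τ.quP i * cud' t i with hcqd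
  have xcqd : ∀ t ∈ Icc 0 R, ∀ i, HasDerivWithinAt (fun t => (x t i).cq) (cqd t i) (Icc 0 R) t :=
    fun t ht i => by
    have := ((dα t ht i).const_mul ((-1) ^ (n + 1))).neg.sub
      (((cud i t ht).hasDerivWithinAt (s := Icc 0 R)).const_mul (τ.quP i))
    exact this.congr (fun t ht => xcq t ht i) (xcq t ht i)
  -- sizes
  have hA4 : 0 ≤ A ^ 4 := by positivity
  have hN : ∀ t ∈ Icc 0 R, ∑ i, (M.xr i - M.xl i)
      * ((x t i).cq ^ 2 + (x t i).cp ^ 2 + (x t i).β ^ 2) ≤ relConst A * ε2 := fun t ht => by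
    have h1 : ∀ i, (M.xr i - M.xl i) * ((x t i).cq ^ 2 + (x t i).cp ^ 2 + (x t i).β ^ 2)
        ≤ 14 * A ^ 4 * (M.size * ((quot y s t i).α ^ 2 + (quot y s t i).β ^ 2
          + (quot y s t i).γ ^ 2) + (M.xr i - M.xl i) * cu t i ^ 2)
        + 32 * A ^ 4 * (M.size * d t i ^ 2 + (M.xr i - M.xl i) * cu t i ^ 2) := by
      intro i
      have hh := M.len_pos i
      have hhs := M.len_le_size i
      have e1 := relCq_relCp_sq_le (hs i) (n + 1) (quot y s t i).α (quot y s t i).γ (cu t i)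
      rw [← xcq t ht i, ← xcp t ht i] at e1
      have e2 : (x t i).β ^ 2 ≤ 32 * A ^ 4 * (d t i ^ 2 + cu t i ^ 2) := by
        rw [xβ, neg_one_pow_sq, mul_pow]
        have r1 : rate i ^ 2 ≤ 16 * A ^ 4 := by
          have := pow_le_pow_left₀ (by linarith [half_le_relRate (hs i)]) (relRate_le (hs i)) 2
          calc _ ≤ _ := this
            _ = _ := by ring
        have r2 : (d t i - cu t i) ^ 2 ≤ 2 * (d t i ^ 2 + cu t i ^ 2) := by
          linarith [sq_nonneg (d t i + cu t i)]
        calc _ ≤ 16 * A ^ 4 * (2 * (d t i ^ 2 + cu t i ^ 2)) :=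
              mul_le_mul r1 r2 (sq_nonneg _) (by positivity)
          _ = _ := by ring
      have e3 : (M.xr i - M.xl i) * ((quot y s t i).α ^ 2 + (quot y s t i).γ ^ 2)
          ≤ M.size * ((quot y s t i).α ^ 2 + (quot y s t i).β ^ 2 + (quot y s t i).γ ^ 2) :=
        mul_le_mul hhs (by linarith [sq_nonneg (quot y s t i).β]) (by positivity) (hh.le.trans hhs)
      have e4 : (M.xr i - M.xl i) * d t i ^ 2 ≤ M.size * d t i ^ 2 :=
        mul_le_mul_of_nonneg_right hhs (sq_nonneg _)
      calc _ ≤ (M.xr i - M.xl i) * (14 * A ^ 4 * ((quot y s t i).α ^ 2 + (quot y s t i).γ ^ 2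
              + cu t i ^ 2) + 32 * A ^ 4 * (d t i ^ 2 + cu t i ^ 2)) :=
            mul_le_mul_of_nonneg_left (add_le_add e1 e2) hh.le
        _ = 14 * A ^ 4 * ((M.xr i - M.xl i) * ((quot y s t i).α ^ 2 + (quot y s t i).γ ^ 2)
              + (M.xr i - M.xl i) * cu t i ^ 2) + 32 * A ^ 4 * ((M.xr i - M.xl i) * d t i ^ 2
              + (M.xr i - M.xl i) * cu t i ^ 2) := by ring
        _ ≤ _ := by gcongr
    refine (Finset.sum_le_sum fun i _ => h1 i).trans ?_
    rw [Finset.sum_add_distrib, ← Finset.mul_sum, ← Finset.mul_sum, Finset.sum_add_distrib,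
      Finset.sum_add_distrib, ← Finset.mul_sum, ← Finset.mul_sum]
    have b1 := mul_le_mul_of_nonneg_left (h.quot_sum_le hs0 ht) M.size_nonneg
    have b2 := mul_le_mul_of_nonneg_left (hdsum t ht) M.size_nonneg
    have b3 := hcuS t ht
    calc _ ≤ 14 * A ^ 4 * (M.size * δ ^ 2 + 96 * A ^ 4 * ε2)
          + 32 * A ^ 4 * (M.size * (12 * A ^ 2 * δ ^ 2) + 96 * A ^ 4 * ε2) := by gcongr
      _ = _ := by rw [relConst, hε2]; ring
  -- The velocity of `cu` carries an inverse length, so its product with the length is `κ β` up to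
  -- sign; the part from the quotient of `α` is a second difference in time and is bounded by
  -- `lip_deriv`.
  have hW : ∀ t ∈ Ioo 0 R, ∑ i, (M.xr i - M.xl i) * ((M.xr i - M.xl i) * cqd t i) ^ 2
      ≤ relDerivConst n A * ε2 := fun t htO => by
    have ht : t ∈ Icc 0 R := ⟨htO.1.le, htO.2.le⟩
    have h1 : ∀ i, (M.xr i - M.xl i) * ((M.xr i - M.xl i) * cqd t i) ^ 2
        ≤ 2 * (M.size * (s⁻¹ ^ 2 * ((M.xr i - M.xl i) ^ 2 * (α' (t + s) i - α' t i) ^ 2)))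
          + 2 * κ ^ 2 * ((M.xr i - M.xl i) * ((x t i).cq ^ 2 + (x t i).cp ^ 2 + (x t i).β ^ 2)) := by
      intro i
      have hh := M.len_pos i
      have hhs := M.len_le_size i
      set hi := M.xr i - M.xl i with hhi
      have e1 : hi * cqd t i = -((-1) ^ (n + 1) * (s⁻¹ * (hi * (α' (t + s) i - α' t i))))
          - τ.quP i * (hi * cud' t i) := by rw [hcqd]; ring
      have e2 : (hi * cud' t i) ^ 2 = κ ^ 2 * (x t i).β ^ 2 := by
        have e : hi * cud' t i = κ * (rate i * (d t i - cu t i)) := by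
          simp only [hcud', ← hhi]
          field_simp
          ring
        rw [xβ, neg_one_pow_sq, e, mul_pow]
      have e3 : (hi * cqd t i) ^ 2 ≤ 2 * (s⁻¹ * (hi * (α' (t + s) i - α' t i))) ^ 2
          + 2 * (hi * cud' t i) ^ 2 := by
        rw [e1]
        have q1 := neg_one_pow_sq (n + 1) (s⁻¹ * (hi * (α' (t + s) i - α' t i)))
        have q2 : (τ.quP i * (hi * cud' t i)) ^ 2 ≤ (hi * cud' t i) ^ 2 := by
          rw [mul_pow]
          exact mul_le_of_le_one_left (sq_nonneg _) (pow_le_one₀ (hs i).tp_nonneg (hs i).tp_le)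
        rw [← q1]
        linarith [sq_nonneg ((-1) ^ (n + 1) * (s⁻¹ * (hi * (α' (t + s) i - α' t i)))
          - τ.quP i * (hi * cud' t i))]
      have e4 : hi * (s⁻¹ * (hi * (α' (t + s) i - α' t i))) ^ 2
          ≤ M.size * (s⁻¹ ^ 2 * (hi ^ 2 * (α' (t + s) i - α' t i) ^ 2)) := by
        rw [mul_pow, mul_pow]
        exact mul_le_mul_of_nonneg_right hhs (by positivity)
      have e5 : κ ^ 2 * (x t i).β ^ 2 ≤ κ ^ 2 * ((x t i).cq ^ 2 + (x t i).cp ^ 2 + (x t i).β ^ 2) :=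
        mul_le_mul_of_nonneg_left (by linarith [sq_nonneg (x t i).cq, sq_nonneg (x t i).cp])
          (sq_nonneg _)
      have e6 := mul_le_mul_of_nonneg_left e3 hh.le
      have e7 := mul_le_mul_of_nonneg_left e5 hh.le
      rw [e2] at e6
      linarith
    refine (Finset.sum_le_sum fun i _ => h1 i).trans ?_
    rw [Finset.sum_add_distrib, ← Finset.mul_sum, ← Finset.mul_sum, ← Finset.mul_sum,
      ← Finset.mul_sum]
    have b1 := h.lip_deriv t ⟨htO.1, by linarith [htO.2]⟩ (t + s)
      ⟨by linarith [htO.1], by linarith [htO.2]⟩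
    have b2 := hN t ht
    have b3 : s⁻¹ ^ 2 * ∑ i, (M.xr i - M.xl i) ^ 2 * (α' (t + s) i - α' t i) ^ 2 ≤ δ ^ 2 := by
      rw [inv_pow, inv_mul_le_iff₀ (by positivity)]
      calc _ ≤ _ := b1
        _ = _ := by ring
    calc _ ≤ 2 * (M.size * δ ^ 2) + 2 * κ ^ 2 * (relConst A * ε2) := by
          gcongr; exact M.size_nonneg
      _ = _ := by rw [relDerivConst, hε2]; ring
  -- the energy
  set wt : Fin M.N → ℝ := fun i => M.xl i + c + legMean (n + 1) (M.xl i) (M.xr i) with hwt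
  have wt0 : ∀ i, 0 ≤ wt i := fun i => by
    have := legMean_nonneg (n + 1) (M.xl_lt_xr i); have := M.le_xl i
    simp only [hwt, hc]; linarith
  have wtΨ : ∀ i, wt i ≤ Ψ := fun i => by
    have := legMean_le (n + 1) (M.xl_lt_xr i); have := M.xr_le i
    simp only [hwt, hc, hΨ, hD]; linarith
  have wl : ∀ (z : Fin M.N → ℝ), M.wnorm (fun i => 1 / 2 * wt i * ((M.xr i - M.xl i) / κ) * z i) ^ 2
      ≤ Ψ ^ 2 * ∑ i, (M.xr i - M.xl i) * ((M.xr i - M.xl i) * z i) ^ 2 := fun z => by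
    rw [M.wnorm_sq, Finset.mul_sum]
    refine Finset.sum_le_sum fun i _ => ?_
    have hh := M.len_pos i
    have e : |1 / 2 * wt i * ((M.xr i - M.xl i) / κ)| ≤ Ψ * (M.xr i - M.xl i) := by
      rw [abs_of_nonneg (mul_nonneg (by linarith [wt0 i]) (by positivity))]
      exact mul_le_mul (by linarith [wtΨ i, wt0 i]) (div_le_self hh.le hκ1) (by positivity) hΨ0.le
    have e2 := pow_le_pow_left₀ (abs_nonneg _) e 2
    rw [sq_abs] at e2
    calc _ = (1 / 2 * wt i * ((M.xr i - M.xl i) / κ)) ^ 2 * ((M.xr i - M.xl i) * z i ^ 2) := by ring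
      _ ≤ (Ψ * (M.xr i - M.xl i)) ^ 2 * ((M.xr i - M.xl i) * z i ^ 2) := by gcongr
      _ = _ := by ring
  -- The second term is the correction whose time derivative contains the term with `x` and
  -- `L_{k-1}` on the left of `weighted_le`; the rest of its derivative contains `cqd` times the
  -- length.
  set En : ℝ → ℝ := fun t => ∑ i, (1 / 2 * bil (X + C c) (M.xl i) (M.xr i) (x t i).u (x t i).u
    + 1 / 2 * wt i * ((M.xr i - M.xl i) / κ) * (x t i).cq
      * bil 1 (M.xl i) (M.xr i) (x t i).u (leg n (M.xl i) (M.xr i))) with hEn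
  set En' : ℝ → ℝ := fun t => ∑ i, (bil (X + C c) (M.xl i) (M.xr i) (xd t i) (x t i).u
    + (1 / 2 * wt i * ((M.xr i - M.xl i) / κ) * cqd t i
      * bil 1 (M.xl i) (M.xr i) (x t i).u (leg n (M.xl i) (M.xr i))
      + 1 / 2 * wt i * ((M.xr i - M.xl i) / κ) * (x t i).cq
      * bil 1 (M.xl i) (M.xr i) (xd t i) (leg n (M.xl i) (M.xr i)))) with hEn'
  have legd : ∀ i, (leg n (M.xl i) (M.xr i)).natDegree ≤ n + 1 := fun i =>
    (natDegree_leg_le _ _ _).trans (Nat.le_succ n)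
  have hEd : ∀ t ∈ Icc 0 R, HasDerivWithinAt En (En' t) (Icc 0 R) t := fun t ht => by
    refine HasDerivWithinAt.fun_sum fun i _ => ?_
    have xdeg : ∀ t ∈ Icc 0 R, (x t i).u.natDegree ≤ n + 1 := fun t ht => ((xsys t ht).sys i).deg_u
    have d1 := hasDerivWithinAt_bil (bil (X + C c) (M.xl i) (M.xr i)) ht xdeg xdeg
      (xdd t ht i) (xdd t ht i) (xud t ht i) (xud t ht i)
    have d2 := hasDerivWithinAt_bil (bil 1 (M.xl i) (M.xr i)) (q := 0)
      (Q := fun _ => leg n (M.xl i) (M.xr i)) ht xdeg (fun _ _ => legd i)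
      (xdd t ht i) (by simp) (xud t ht i) (fun j => by simpa using hasDerivWithinAt_const _ _ _)
    refine ((d1.const_mul (1 / 2)).add (((xcqd t ht i).const_mul
      (1 / 2 * wt i * ((M.xr i - M.xl i) / κ))).mul d2)).congr_deriv ?_
    rw [bil_comm _ _ _ (x t i).u (xd t i), map_zero]; ring
  have cross : ∀ t (z : Fin M.N → ℝ), |∑ i, 1 / 2 * wt i * ((M.xr i - M.xl i) / κ) * z i
      * bil 1 (M.xl i) (M.xr i) (x t i).u (leg n (M.xl i) (M.xr i))|
      ≤ M.wnorm (fun i => 1 / 2 * wt i * ((M.xr i - M.xl i) / κ) * z i) * M.norm (pu (x t)) :=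
    fun t z => by
    have := M.abs_sum_mul_itg_leg_le n
      (fun i => 1 / 2 * wt i * ((M.xr i - M.xl i) / κ) * z i) (pu (x t))
    simpa only [bil_one, mul_comm (leg n _ _)] using this
  have hE' : ∀ t ∈ Ioo 0 R, En' t ≤ weightConst n A D Ψ * (M.norm (pu (x t)) ^ 2
      + relConst A * ε2) + (Ψ ^ 2 * (relDerivConst n A * ε2) + M.norm (pu (x t)) ^ 2) := by
    intro t ht
    have htI : t ∈ Icc 0 R := ⟨ht.1.le, ht.2.le⟩
    -- Summed over the mesh, the weighted boundary fluxes reduce to `(a + c) q₀²/2`, which is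
    -- nonnegative and is dropped, and the unweighted ones to zero.
    obtain ⟨q₀, p₀, n1, -, n2, -⟩ := (xsys t htI).exists_trace
    have key : ∀ i, _ := fun i => ((xsys t htI).sys i).weighted_le (M.xl_lt_xr i) (hs i) (xα t i)
      (xγ t i) (xg t ht i) (D := D) (Ψ := Ψ) (c := c) (M.len_le i)
      (by have := M.le_xl i; rw [hc]; linarith) (by have := M.xr_le i; rw [hc, hΨ, hD]; linarith)
    have hsum := Finset.sum_le_sum fun i (_ : i ∈ Finset.univ) => key i
    rw [Finset.sum_sub_distrib, n2, Finset.sum_add_distrib, n1, ← Finset.mul_sum,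
      Finset.sum_add_distrib, Finset.sum_add_distrib] at hsum
    simp only [← hκ] at hsum
    have e1 : ∑ i, itg (M.xl i) (M.xr i) ((x t i).u * (x t i).u) = M.norm (pu (x t)) ^ 2 := by
      rw [M.norm_sq]; rfl
    rw [e1] at hsum
    have hac : 0 ≤ (a + c) * q₀ ^ 2 / 2 := by
      have : 0 ≤ a + c := by rw [hc]; linarith
      positivity
    have hw0 : 0 ≤ weightConst n A D Ψ := by unfold weightConst; positivity
    have b1 := mul_le_mul_of_nonneg_left (add_le_add_right (hN t htI) (M.norm (pu (x t)) ^ 2)) hw0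
    have b2 := (le_abs_self _).trans (cross t (cqd t))
    have b3 := (wl (cqd t)).trans (mul_le_mul_of_nonneg_left (hW t ht) (sq_nonneg Ψ))
    have e2 : En' t = ∑ i, (itg (M.xl i) (M.xr i) (xd t i * ((X + C c) * (x t i).u))
        + 1 / 2 * (M.xl i + c + legMean (n + 1) (M.xl i) (M.xr i)) * ((M.xr i - M.xl i) / κ)
          * (x t i).cq * itg (M.xl i) (M.xr i) (xd t i * leg n (M.xl i) (M.xr i)))
        + ∑ i, 1 / 2 * wt i * ((M.xr i - M.xl i) / κ) * cqd t i
      * bil 1 (M.xl i) (M.xr i) (x t i).u (leg n (M.xl i) (M.xr i)) := by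
      rw [← Finset.sum_add_distrib]
      refine Finset.sum_congr rfl fun i _ => ?_
      rw [← bil_apply, ← bil_one]; ring
    rw [Finset.sum_add_distrib] at e2
    rw [e2]
    set N1 := M.wnorm (fun i => 1 / 2 * wt i * ((M.xr i - M.xl i) / κ) * cqd t i)
    set N2 := M.norm (pu (x t))
    have b4 : N1 * N2 ≤ N1 ^ 2 + N2 ^ 2 := by
      linarith only [sq_nonneg (N1 - N2), sq_nonneg N1, sq_nonneg N2]
    linarith
  have hcq : ∀ t ∈ Icc 0 R, M.wnorm (fun i => 1 / 2 * wt i * ((M.xr i - M.xl i) / κ)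
      * (x t i).cq) ^ 2 ≤ Ψ ^ 2 * D ^ 2 * relConst A * ε2 := fun t ht => by
    refine (wl _).trans ?_
    have : ∑ i, (M.xr i - M.xl i) * ((M.xr i - M.xl i) * (x t i).cq) ^ 2
        ≤ D ^ 2 * ∑ i, (M.xr i - M.xl i) * ((x t i).cq ^ 2 + (x t i).cp ^ 2 + (x t i).β ^ 2) := by
      rw [Finset.mul_sum]
      refine Finset.sum_le_sum fun i _ => ?_
      have hh := M.len_pos i
      have e : (M.xr i - M.xl i) ^ 2 ≤ D ^ 2 := pow_le_pow_left₀ hh.le (M.len_le i) 2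
      calc _ = (M.xr i - M.xl i) ^ 2 * ((M.xr i - M.xl i) * (x t i).cq ^ 2) := by ring
        _ ≤ D ^ 2 * ((M.xr i - M.xl i) * ((x t i).cq ^ 2 + (x t i).cp ^ 2 + (x t i).β ^ 2)) := by
          gcongr
          linarith [sq_nonneg (x t i).cp, sq_nonneg (x t i).β]
    calc _ ≤ Ψ ^ 2 * (D ^ 2 * (relConst A * ε2)) :=
          mul_le_mul_of_nonneg_left (this.trans (mul_le_mul_of_nonneg_left (hN t ht)
            (sq_nonneg D))) (sq_nonneg Ψ)
      _ = _ := by ring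
  have hψ : ∀ t, M.norm (pu (x t)) ^ 2 ≤ ∑ i, bil (X + C c) (M.xl i) (M.xr i) (x t i).u (x t i).u
      ∧ ∑ i, bil (X + C c) (M.xl i) (M.xr i) (x t i).u (x t i).u ≤ Ψ * M.norm (pu (x t)) ^ 2 := by
    intro t
    rw [M.norm_sq, Mesh.int, Finset.mul_sum]
    constructor
    · refine Finset.sum_le_sum fun i _ => ?_
      rw [bil_apply]
      refine itg_mono (M.xl_lt_xr i).le fun z hz => ?_
      simp only [Pi.mul_apply, eval_mul, eval_add, eval_X, eval_C]
      have := M.le_xl i; have := hz.1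
      have : 1 ≤ z + c := by rw [hc]; linarith
      nlinarith [mul_self_nonneg ((x t i).u.eval z)]
    · refine Finset.sum_le_sum fun i _ => ?_
      rw [bil_apply, ← itg_C_mul]
      refine itg_mono (M.xl_lt_xr i).le fun z hz => ?_
      simp only [Pi.mul_apply, eval_mul, eval_add, eval_X, eval_C]
      have := M.xr_le i; have := hz.2
      have : z + c ≤ Ψ := by rw [hc, hΨ, hD]; linarith
      nlinarith [mul_self_nonneg ((x t i).u.eval z)]
  set G := Ψ ^ 2 * D ^ 2 * relConst A * ε2 with hG
  have hrel0 : 0 ≤ relConst A := by unfold relConst; positivity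
  have hrd0 : 0 ≤ relDerivConst n A := by unfold relDerivConst; positivity
  have hG0 : 0 ≤ G := by positivity
  have Esplit : ∀ t, En t = 1 / 2 * ∑ i, bil (X + C c) (M.xl i) (M.xr i) (x t i).u (x t i).u
      + ∑ i, 1 / 2 * wt i * ((M.xr i - M.xl i) / κ) * (x t i).cq
      * bil 1 (M.xl i) (M.xr i) (x t i).u (leg n (M.xl i) (M.xr i)) := fun t => by
    rw [Finset.mul_sum, ← Finset.sum_add_distrib]
  have hlow : ∀ t ∈ Icc 0 R, 1 / 4 * M.norm (pu (x t)) ^ 2 - G ≤ En t := fun t ht => by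
    have h1 := neg_le_of_abs_le (cross t fun i => (x t i).cq)
    have h2 := hcq t ht
    have h3 := (hψ t).1
    rw [Esplit]
    nlinarith [sq_nonneg (M.wnorm (fun i => 1 / 2 * wt i * ((M.xr i - M.xl i) / κ)
      * (x t i).cq) - 1 / 2 * M.norm (pu (x t)))]
  have hupp : ∀ t ∈ Icc 0 R, En t ≤ (Ψ + 1) * M.norm (pu (x t)) ^ 2 + G := fun t ht => by
    have h1 := le_of_abs_le (cross t fun i => (x t i).cq)
    have h2 := hcq t ht
    have h3 := (hψ t).2
    have h4 : 0 ≤ Ψ * M.norm (pu (x t)) ^ 2 := by positivity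
    rw [Esplit]
    nlinarith [sq_nonneg (M.wnorm (fun i => 1 / 2 * wt i * ((M.xr i - M.xl i) / κ)
      * (x t i).cq) - 1 / 2 * M.norm (pu (x t)))]
  set Z := evoNoise n A D * ε2 with hZ
  have hZe : Z = G + relConst A * ε2 + Ψ ^ 2 * (relDerivConst n A * ε2) := by
    rw [hZ, hG, evoNoise]; ring
  have hw0 : 0 ≤ weightConst n A D Ψ := by unfold weightConst; positivity
  -- Adding the constant `Z` makes the differential inequality homogeneous. `Z` also dominates the
  -- defect `G` in the lower bound `hlow`.
  have gron := le_exp_mul_of_deriv_le (f := fun t => En t + Z) (f' := En') (c := evoRate n A D)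
    (R := R) (fun t ht => (hEd t ht).continuousWithinAt.add continuousWithinAt_const)
    (fun t ht => ((hEd t ⟨ht.1.le, ht.2.le⟩).hasDerivAt (Icc_mem_nhds ht.1 ht.2)).add_const Z)
    (fun t ht => by
      have h1 := hE' t ht
      have h2 := hlow t ⟨ht.1.le, ht.2.le⟩
      have h3 : 0 ≤ relConst A * ε2 := by positivity
      have h4 : 0 ≤ Ψ ^ 2 * (relDerivConst n A * ε2) := by positivity
      have e : evoRate n A D = 4 * (weightConst n A D Ψ + 1) := rfl
      have h5 := mul_le_mul_of_nonneg_left h2 (by linarith : 0 ≤ 4 * (weightConst n A D Ψ + 1))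
      have h6 := mul_nonneg hw0 h3
      have h7 := mul_nonneg hw0 h4
      rw [e, hZe]
      linarith) ht
  have R0 : (0 : ℝ) ∈ Icc 0 R := ⟨le_rfl, hR0.le⟩
  -- The relaxed coefficient starts at zero, so the shift does not change the initial quotient.
  have hx0 : pu (x 0) = pu (quot y s 0) := by
    funext i
    have : cu 0 i = 0 := cu0 i
    change (quot y s 0 i).u - C (cu 0 i) * leg (n + 1) (M.xl i) (M.xr i) = (quot y s 0 i).u
    rw [this, C_0, zero_mul, sub_zero]
  have f1 := hupp 0 R0
  have f2 := hlow t ht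
  rw [hx0] at f1
  set U0 := M.norm (pu (quot y s 0)) with hU0
  have hexp : Real.exp (evoRate n A D * t) ≤ Real.exp (evoRate n A D * T) :=
    Real.exp_le_exp.2 (mul_le_mul_of_nonneg_left (by linarith [ht.2]) (by
      unfold evoRate; positivity))
  have hZ0 : 0 ≤ Z := by rw [hZe]; positivity
  have hGZ : G ≤ Z := by
    have : 0 ≤ relConst A * ε2 := by positivity
    have : 0 ≤ Ψ ^ 2 * (relDerivConst n A * ε2) := by positivity
    linarith
  have f0 : 0 ≤ En 0 + Z := by
    have := hlow 0 R0
    nlinarith [sq_nonneg (M.norm (pu (x 0)))]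
  have f3 : 1 / 4 * M.norm (pu (x t)) ^ 2
      ≤ Real.exp (evoRate n A D * T) * ((Ψ + 1) * U0 ^ 2 + 2 * Z) := by
    calc _ ≤ En t + Z := by linarith
      _ ≤ Real.exp (evoRate n A D * t) * (En 0 + Z) := gron
      _ ≤ Real.exp (evoRate n A D * T) * (En 0 + Z) := mul_le_mul_of_nonneg_right hexp f0
      _ ≤ _ := mul_le_mul_of_nonneg_left (by linarith) (Real.exp_pos _).le
  have f4 : M.norm (pu (quot y s t)) ≤ M.norm (pu (x t)) + M.wnorm (cu t) := by
    have e : pu (x t) = pu (quot y s t) - M.legs (n + 1) (cu t) := by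
      funext i; rfl
    have := M.norm_le_add (pu (quot y s t)) (M.legs (n + 1) (cu t))
    rw [← e] at this
    linarith [M.norm_legs_le (n + 1) (cu t)]
  have f5 : M.wnorm (cu t) ^ 2 ≤ 96 * A ^ 4 * ε2 := by rw [M.wnorm_sq]; exact hcuS t ht
  have f6 : M.norm (pu (quot y s t)) ^ 2 ≤ 2 * M.norm (pu (x t)) ^ 2 + 2 * M.wnorm (cu t) ^ 2 := by
    have := pow_le_pow_left₀ (M.norm_nonneg _) f4 2
    linarith [sq_nonneg (M.norm (pu (x t)) - M.wnorm (cu t))]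
  have f7 : (Ψ + 1) * U0 ^ 2 + 2 * Z ≤ (Ψ + 1 + 2 * evoNoise n A D) * (U0 ^ 2 + ε2) := by
    have hn0 : 0 ≤ evoNoise n A D := by unfold evoNoise; positivity
    have := mul_nonneg hn0 (sq_nonneg U0)
    have : 0 ≤ (Ψ + 1) * ε2 := by positivity
    rw [hZ]; linarith
  have f8 := mul_le_mul_of_nonneg_left f7 (Real.exp_pos (evoRate n A D * T)).le
  have f9 : 0 ≤ A ^ 4 * U0 ^ 2 := by positivity
  have e : evoConst n A D T * (U0 ^ 2 + ε2) = 8 * (Real.exp (evoRate n A D * T)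
      * ((Ψ + 1 + 2 * evoNoise n A D) * (U0 ^ 2 + ε2))) + 192 * A ^ 4 * (U0 ^ 2 + ε2) := by
    rw [evoConst]; ring
  rw [e]
  linarith

end ErrFlow

end KdVHDG

end

/-! ### The bound for the discrete error. -/

noncomputable section

namespace KdVHDG

open Filter Topology MeshSys

/-- The constants of the estimate of the discrete error. -/
def initConst (A D : ℝ) : ℝ :=
  4 * A + 56 * A ^ 3 * staticConst A D + 896 * A ^ 6 * staticConst A D + 4 * A

def derivConst (n : ℕ) (A D T : ℝ) : ℝ := evoConst n A D T * (initConst A D ^ 2 + 1)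

def flowConst (n : ℕ) (A D T : ℝ) : ℝ :=
  staticConst A D * (derivConst n A D T + initConst A D
      + (derivConst n A D T * T + initConst A D + 4 * A) + 28 * A ^ 3)
    + (derivConst n A D T * T + initConst A D + 4 * A) + derivConst n A D T

namespace ErrFlow

variable {a b : ℝ} {M : Mesh a b} {k n : ℕ} {τ : Stabilization M.N} {T δ A : ℝ}
  {y : ℝ → Fin M.N → ElemData} {w : M.PW} {α' β' γ' : ℝ → Fin M.N → ℝ}

/-- The coefficients of the projection. -/
abbrev projCu (k : ℕ) (τ : Stabilization M.N) (E : Fin M.N → ElemData) : Fin M.N → ℝ := fun i =>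
  relCu k (τ.quP i) (τ.puP i) (τ.quM i) (E i).α (E i).β (E i).γ

/-- The discrete error relative to the projection. -/
abbrev projErr (k : ℕ) (τ : Stabilization M.N) (E : Fin M.N → ElemData) : Fin M.N → ElemData :=
  fun i => (E i).relShift k (M.xl i) (M.xr i) (τ.quP i) (τ.puP i) (τ.quM i) (projCu k τ E i)

theorem le_mul_of_sq_le_sq {x c e : ℝ} (hc : 0 ≤ c) (he : 0 ≤ e) (h : x ^ 2 ≤ c ^ 2 * e ^ 2) :
    x ≤ c * e := by
  rw [← mul_pow] at h
  exact (abs_le_of_sq_le_sq' h (mul_nonneg hc he)).2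

theorem wnorm_projCu_le (h : ErrFlow M k τ T δ y w α' β' γ') (hA : 1 ≤ A)
    (hs : ∀ i, StabBound A (τ.quP i) (τ.puP i) (τ.quM i)) {t : ℝ} (ht : t ∈ Icc 0 T) :
    M.wnorm (projCu k τ (y t)) ≤ 4 * A * (Real.sqrt M.size * δ) := by
  refine le_mul_of_sq_le_sq (by linarith) (mul_nonneg (Real.sqrt_nonneg _) h.δ_nonneg) ?_
  rw [mul_pow (Real.sqrt _), Real.sq_sqrt M.size_nonneg]
  refine (M.wnorm_sq_le (B := 12 * A ^ 2 * δ ^ 2) ?_).trans ?_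
  · refine (Finset.sum_le_sum fun i _ => relCu_sq_le (hs i) k _ _ _).trans ?_
    rw [← Finset.mul_sum]
    exact mul_le_mul_of_nonneg_left (h.bound t ht) (by positivity)
  · have : 0 ≤ M.size * δ ^ 2 := mul_nonneg M.size_nonneg (sq_nonneg _)
    nlinarith [mul_nonneg (sq_nonneg A) this]

theorem projErr_eqs (h : ErrFlow M k τ T δ y w α' β' γ')
    (hs : ∀ i, StabBound A (τ.quP i) (τ.puP i) (τ.quM i)) {t : ℝ} (ht : t ∈ Icc 0 T) :
    MeshSys M k τ (projErr k τ (y t)) ∧ ∀ i, (projErr k τ (y t) i).α = 0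
      ∧ (projErr k τ (y t) i).β = 0 ∧ (projErr k τ (y t) i).γ = 0 := by
  refine ⟨(h.sys t ht).shift _ _ _, fun i => ⟨ElemData.relShift_α _ _ _ _ _ _ _ _, ?_,
    ElemData.relShift_γ _ _ _ _ _ _ _ (hs i).pos.ne' _⟩⟩
  rw [ElemData.relShift_β _ _ _ _ (hs i), sub_self, mul_zero, mul_zero]

theorem wnorm_projErr_le (h : ErrFlow M k τ T δ y w α' β' γ') (hA : 1 ≤ A)
    (hs : ∀ i, StabBound A (τ.quP i) (τ.puP i) (τ.quM i)) {t : ℝ} (ht : t ∈ Icc 0 T) :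
    M.wnorm (fun i => (projErr k τ (y t) i).cq) ≤ 14 * A ^ 3 * (Real.sqrt M.size * δ) ∧
    M.wnorm (fun i => (projErr k τ (y t) i).cp) ≤ 14 * A ^ 3 * (Real.sqrt M.size * δ) := by
  -- `182 = 14 · (1 + 12)`: the constant of `relCq_relCp_sq_le`, with `1` for the fluxes and `12`
  -- for `relCu`. It is at most `14²`.
  have key : ∑ i, ((projErr k τ (y t) i).cq ^ 2 + (projErr k τ (y t) i).cp ^ 2)
      ≤ 182 * A ^ 6 * δ ^ 2 := by
    have h1 : ∀ i, (projErr k τ (y t) i).cq ^ 2 + (projErr k τ (y t) i).cp ^ 2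
        ≤ 182 * A ^ 6 * ((y t i).α ^ 2 + (y t i).β ^ 2 + (y t i).γ ^ 2) := by
      intro i
      have e1 := relCq_relCp_sq_le (hs i) k (y t i).α (y t i).γ (projCu k τ (y t) i)
      have e2 : projCu k τ (y t) i ^ 2 ≤ _ := relCu_sq_le (hs i) k (y t i).α (y t i).β (y t i).γ
      simp only [ElemData.relShift, ElemData.shift, h.cq_zero t ht, h.cp_zero t ht, zero_add]
      have hA2 : 1 ≤ A ^ 2 := one_le_pow₀ hA
      set S := (y t i).α ^ 2 + (y t i).β ^ 2 + (y t i).γ ^ 2 with hS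
      have hS0 : 0 ≤ S := by positivity
      have e3 : (y t i).α ^ 2 + (y t i).γ ^ 2 ≤ A ^ 2 * S := by
        have : S ≤ A ^ 2 * S := le_mul_of_one_le_left hS0 hA2
        linarith [sq_nonneg (y t i).β]
      have e4 := mul_le_mul_of_nonneg_left (add_le_add e3 e2) (by positivity : 0 ≤ 14 * A ^ 4)
      refine e1.trans (e4.trans (le_of_eq (by ring)))
    refine (Finset.sum_le_sum fun i _ => h1 i).trans ?_
    rw [← Finset.mul_sum]
    exact mul_le_mul_of_nonneg_left (h.bound t ht) (by positivity)
  have hsz : 0 ≤ M.size * δ ^ 2 := mul_nonneg M.size_nonneg (sq_nonneg _)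
  have fin : ∀ c : Fin M.N → ℝ, ∑ i, c i ^ 2 ≤ 182 * A ^ 6 * δ ^ 2 →
      M.wnorm c ≤ 14 * A ^ 3 * (Real.sqrt M.size * δ) := fun c hc => by
    refine le_mul_of_sq_le_sq (by positivity) (mul_nonneg (Real.sqrt_nonneg _) h.δ_nonneg) ?_
    rw [mul_pow (Real.sqrt _), Real.sq_sqrt M.size_nonneg]
    refine (M.wnorm_sq_le hc).trans ?_
    nlinarith [mul_nonneg (by positivity : 0 ≤ A ^ 6) hsz]
  exact ⟨fin _ ((Finset.sum_le_sum fun i _ => le_add_of_nonneg_right (sq_nonneg _)).trans key),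
    fin _ ((Finset.sum_le_sum fun i _ => le_add_of_nonneg_left (sq_nonneg _)).trans key)⟩

theorem projErr_u (k : ℕ) (τ : Stabilization M.N) (E : Fin M.N → ElemData) :
    pu (projErr k τ E) = pu E - M.legs k (projCu k τ E) := rfl

theorem one_le_staticConst (hA : 1 ≤ A) (D : ℝ) : 1 ≤ staticConst A D := by
  unfold staticConst
  have : 0 ≤ A ^ 3 := by positivity
  have := sq_nonneg (Real.sqrt D + (Real.sqrt D)⁻¹)
  linarith

theorem projErr_static (h : ErrFlow M k τ T δ y w α' β' γ') (hk : 0 < k) (hab : a < b) (hA : 1 ≤ A)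
    (hs : ∀ i, StabBound A (τ.quP i) (τ.puP i) (τ.quM i)) {t : ℝ} (ht : t ∈ Icc 0 T) :
    M.norm (pq (projErr k τ (y t))) + M.norm (pp (projErr k τ (y t)))
      ≤ staticConst A (b - a) * (M.norm (pg (y t)) + M.norm (pu (projErr k τ (y t)))
        + 28 * A ^ 3 * (Real.sqrt M.size * δ)) := by
  obtain ⟨h1, h2⟩ := h.projErr_eqs hs ht
  obtain ⟨h3, h4⟩ := h.wnorm_projErr_le hA hs ht
  refine (h1.static_le hk hab hA hs h2).trans (mul_le_mul_of_nonneg_left ?_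
    (by linarith [one_le_staticConst hA (b - a)]))
  have : pg (projErr k τ (y t)) = pg (y t) := rfl
  rw [this]; linarith

/-- At time zero `g = u`, so the energy bounds `‖u‖²` itself. On its right-hand side `q` and `p` are
replaced through `projErr_static`, and a quadratic inequality for the norm of `u` remains. -/
theorem init_le (h : ErrFlow M k τ T δ y w α' β' γ') (hk : 0 < k) (hab : a < b) (hT : 0 < T)
    (hA : 1 ≤ A) (hs : ∀ i, StabBound A (τ.quP i) (τ.puP i) (τ.quM i)) :
    M.norm (pu (y 0)) ≤ initConst A (b - a) * (Real.sqrt M.size * δ) := by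
  have h0 : (0 : ℝ) ∈ Icc 0 T := ⟨le_rfl, hT.le⟩
  obtain ⟨h1, h2⟩ := h.projErr_eqs hs h0
  obtain ⟨h3, h4⟩ := h.wnorm_projErr_le hA hs h0
  have h5 := h.projErr_static hk hab hA hs h0
  have h6 := h.wnorm_projCu_le hA hs h0
  obtain ⟨q₀, p₀, -, hq, -⟩ := h1.exists_trace
  have h7 := h1.energy_le hs h2 hq
  set e := Real.sqrt M.size * δ with he
  have he0 : 0 ≤ e := mul_nonneg (Real.sqrt_nonneg _) h.δ_nonneg
  set E := projErr k τ (y 0) with hE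
  set U := M.norm (pu E) with hU
  have hU0 : 0 ≤ U := M.norm_nonneg _
  set S := staticConst A (b - a) with hS
  have hS1 : 1 ≤ S := one_le_staticConst hA _
  have g1 : pg E = pu E + M.legs k (projCu k τ (y 0)) := by
    have e1 : pg E = pg (y 0) := rfl
    have e2 : pg (y 0) = pu (y 0) := by funext i; exact h.init i
    rw [e1, e2, hE, projErr_u, sub_add_cancel]
  have l1 : M.norm (M.legs k (projCu k τ (y 0))) ≤ 4 * A * e := (M.norm_legs_le _ _).trans h6
  have g2 : M.norm (pg (y 0)) ≤ U + 4 * A * e := by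
    have e1 : pg E = pg (y 0) := rfl
    rw [← e1, g1]
    exact (M.norm_add_le _ _).trans (by linarith)
  have i1 : U ^ 2 - 4 * A * e * U ≤ M.int (pg E * pu E) := by
    rw [g1, add_mul, M.int_add, ← M.norm_sq]
    have := neg_le_of_abs_le (M.abs_int_mul_le (M.legs k (projCu k τ (y 0))) (pu E))
    have := mul_le_mul_of_nonneg_right l1 hU0
    linarith
  have P0 := M.norm_nonneg (pp E)
  have Q0 := M.norm_nonneg (pq E)
  have i2 : U ^ 2 - 4 * A * e * U ≤ 14 * A ^ 3 * e * (M.norm (pq E) + M.norm (pp E)) := by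
    have t1 := mul_le_mul_of_nonneg_right h3 P0
    have t2 := mul_le_mul_of_nonneg_right h4 Q0
    have t3 : 0 ≤ (∑ i, (E i).jumpSq (M.xl i) (M.xr i)) / (2 * A ^ 2) :=
      div_nonneg (Finset.sum_nonneg fun i _ => ElemData.jumpSq_nonneg _ _ _) (by positivity)
    linarith [sq_nonneg q₀]
  have i3 : M.norm (pq E) + M.norm (pp E) ≤ S * (2 * U + 32 * A ^ 3 * e) := by
    refine h5.trans (mul_le_mul_of_nonneg_left ?_ (by linarith))
    have : 4 * A * e ≤ 4 * A ^ 3 * e := by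
      gcongr; exact le_self_pow₀ hA (by norm_num)
    linarith
  have i4 := mul_le_mul_of_nonneg_left i3 (by positivity : 0 ≤ 14 * A ^ 3 * e)
  have i5 : U ^ 2 ≤ (4 * A + 28 * A ^ 3 * S) * e * U + 448 * A ^ 6 * S * e ^ 2 := by
    calc U ^ 2 ≤ 4 * A * e * U + 14 * A ^ 3 * e * (S * (2 * U + 32 * A ^ 3 * e)) := by linarith
      _ = _ := by ring
  have i6 : U ≤ (4 * A + 28 * A ^ 3 * S + 448 * A ^ 6 * S) * e := by
    by_contra! hc
    have hUe : e ≤ U := by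
      have : 1 * e ≤ (4 * A + 28 * A ^ 3 * S + 448 * A ^ 6 * S) * e := by
        gcongr
        have : 0 ≤ 28 * A ^ 3 * S + 448 * A ^ 6 * S := by positivity
        linarith
      linarith
    have hUp : 0 < U := lt_of_le_of_lt (by positivity) hc
    have j1 := mul_lt_mul_of_pos_right hc hUp
    have j2 : 448 * A ^ 6 * S * e ^ 2 ≤ 448 * A ^ 6 * S * (e * U) := by
      gcongr; nlinarith
    linarith
  have e1 : pu (y 0) = pu E + M.legs k (projCu k τ (y 0)) := by
    rw [hE, projErr_u, sub_add_cancel]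
  rw [e1]
  refine (M.norm_add_le _ _).trans ?_
  have : 0 ≤ (28 * A ^ 3 * S + 448 * A ^ 6 * S) * e := by positivity
  rw [initConst, ← hS]
  linarith

theorem coeff_quot (y : ℝ → Fin M.N → ElemData) (s t : ℝ) (i : Fin M.N) (j : ℕ) :
    (pu (quot y s t) i).coeff j = s⁻¹ * ((y (t + s) i).u.coeff j - (y t i).u.coeff j) := by
  simp only [pu, quot, ElemData.diff, coeff_C_mul, coeff_sub]

theorem tendsto_quot (h : ErrFlow M k τ T δ y w α' β' γ') {t : ℝ} (ht : t ∈ Ico 0 T) :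
    Tendsto (fun s => M.norm (pu (quot y s t))) (𝓝[>] 0) (𝓝 (M.norm (ut y w t))) := by
  have htI : t ∈ Icc 0 T := ⟨ht.1, ht.2.le⟩
  have hmem : ∀ᶠ s in 𝓝[>] (0 : ℝ), s ∈ Ioo 0 (T - t) := Ioo_mem_nhdsGT (by linarith [ht.2])
  refine M.tendsto_norm (k := k) ?_ (fun i => h.natDegree_ut htI i) fun i j => ?_
  · filter_upwards [hmem] with s hs i
    exact ElemData.natDegree_C_mul_sub_le _
      ((h.sys _ ⟨by linarith [hs.1, ht.1], by linarith [hs.2]⟩).sys i).deg_u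
      ((h.sys _ htI).sys i).deg_u
  · have h1 := hasDerivWithinAt_iff_tendsto_slope.1 (h.hasDeriv htI i j)
    have h2 : Tendsto (fun s : ℝ => t + s) (𝓝[>] 0) (𝓝[Icc 0 T \ {t}] t) := by
      refine tendsto_nhdsWithin_iff.2 ⟨?_, ?_⟩
      · have : Tendsto (fun s : ℝ => t + s) (𝓝 0) (𝓝 (t + 0)) :=
          (continuous_const.add continuous_id).tendsto 0
        rw [add_zero] at this
        exact this.mono_left nhdsWithin_le_nhds
      · filter_upwards [hmem] with s hs
        exact ⟨⟨by linarith [hs.1, ht.1], by linarith [hs.2]⟩, by simpa using hs.1.ne'⟩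
    refine (h1.comp h2).congr fun s => ?_
    rw [coeff_quot]
    simp [slope_def_field, div_eq_inv_mul]

/-- At `T` only backward quotients exist. The one with step `s` starts at `T - s`, the last time
covered by `quot_le`. -/
theorem tendsto_quot_last (h : ErrFlow M k τ T δ y w α' β' γ') (hT : 0 < T) :
    Tendsto (fun s => M.norm (pu (quot y s (T - s)))) (𝓝[>] 0) (𝓝 (M.norm (ut y w T))) := by
  have htI : T ∈ Icc 0 T := ⟨hT.le, le_rfl⟩
  have hmem : ∀ᶠ s in 𝓝[>] (0 : ℝ), s ∈ Ioo 0 T := Ioo_mem_nhdsGT hT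
  refine M.tendsto_norm (k := k) ?_ (fun i => h.natDegree_ut htI i) fun i j => ?_
  · filter_upwards [hmem] with s hs i
    exact ElemData.natDegree_C_mul_sub_le _
      ((h.sys _ ⟨by linarith, by linarith⟩).sys i).deg_u
      ((h.sys _ ⟨by linarith [hs.2], by linarith [hs.1]⟩).sys i).deg_u
  · have h1 := hasDerivWithinAt_iff_tendsto_slope.1 (h.hasDeriv htI i j)
    have h2 : Tendsto (fun s : ℝ => T - s) (𝓝[>] 0) (𝓝[Icc 0 T \ {T}] T) := by
      refine tendsto_nhdsWithin_iff.2 ⟨?_, ?_⟩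
      · have : Tendsto (fun s : ℝ => T - s) (𝓝 0) (𝓝 (T - 0)) :=
          (continuous_const.sub continuous_id).tendsto 0
        rw [sub_zero] at this
        exact this.mono_left nhdsWithin_le_nhds
      · filter_upwards [hmem] with s hs
        exact ⟨⟨by linarith [hs.2], by linarith [hs.1]⟩, by simpa using hs.1.ne'⟩
    refine (h1.comp h2).congr fun s => ?_
    have : (T - s - T) = -s := by ring
    rw [coeff_quot]
    simp only [Function.comp, slope_def_field, sub_add_cancel, this, div_eq_inv_mul, inv_neg]
    ring

theorem initConst_nonneg (hA : 1 ≤ A) (D : ℝ) : 0 ≤ initConst A D := by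
  have := one_le_staticConst hA D
  unfold initConst; positivity

theorem one_le_evoConst (hA : 1 ≤ A) {D : ℝ} (hD : 0 < D) (T : ℝ) : 1 ≤ evoConst n A D T := by
  have h1 := one_le_weightMin n hA
  have h2 : 0 ≤ relConst A := by unfold relConst; positivity
  have h3 : 0 ≤ relDerivConst n A := by unfold relDerivConst; positivity
  have h4 : 0 ≤ evoNoise n A D := by unfold evoNoise; positivity
  have h5 : 1 ≤ A ^ 4 := one_le_pow₀ hA
  have h6 : 0 ≤ 8 * Real.exp (evoRate n A D * T) * (weightMin n A + D + 1 + 2 * evoNoise n A D) := by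
    positivity
  unfold evoConst; linarith

/-- The limit of `quot_le` for vanishing step. The initial quotients tend to `w`, which `norm_w_le`
and `init_le` bound. -/
theorem norm_ut_le (h : ErrFlow M (n + 1) τ T δ y w α' β' γ') (hab : a < b) (hT : 0 < T)
    (hA : 1 ≤ A) (hs : ∀ i, StabBound A (τ.quP i) (τ.puP i) (τ.quM i)) {t : ℝ}
    (ht : t ∈ Icc 0 T) :
    M.norm (ut y w t) ≤ derivConst n A (b - a) T * (Real.sqrt M.size * δ) := by
  set e := Real.sqrt M.size * δ with he
  have he0 : 0 ≤ e := mul_nonneg (Real.sqrt_nonneg _) h.δ_nonneg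
  have he2 : e ^ 2 = M.size * δ ^ 2 := by rw [he, mul_pow, Real.sq_sqrt M.size_nonneg]
  have hw : M.norm w ≤ initConst A (b - a) * e :=
    (h.norm_w_le hT hs).trans (h.init_le (Nat.succ_pos n) hab hT hA hs)
  have hE1 := one_le_evoConst (n := n) hA (sub_pos.2 hab) T
  have lim0 := h.tendsto_quot (left_mem_Ico.2 hT)
  have e0 : ut y w 0 = w := if_pos rfl
  rw [e0] at lim0
  have lim1 : Tendsto (fun s => evoConst n A (b - a) T * (M.norm (pu (quot y s 0)) ^ 2
      + M.size * δ ^ 2)) (𝓝[>] 0) (𝓝 (evoConst n A (b - a) T * (M.norm w ^ 2 + M.size * δ ^ 2))) :=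
    ((lim0.pow 2).add_const _).const_mul _
  have key : M.norm (ut y w t) ^ 2 ≤ evoConst n A (b - a) T * (M.norm w ^ 2 + M.size * δ ^ 2) := by
    rcases ht.2.eq_or_lt with rfl | htT
    · refine le_of_tendsto_of_tendsto ((h.tendsto_quot_last hT).pow 2) lim1 ?_
      filter_upwards [Ioo_mem_nhdsGT hT] with s hs'
      exact h.quot_le hab hA hs hs'.1 hs'.2 ⟨by linarith [hs'.2], le_rfl⟩
    · refine le_of_tendsto_of_tendsto ((h.tendsto_quot ⟨ht.1, htT⟩).pow 2) lim1 ?_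
      filter_upwards [Ioo_mem_nhdsGT (sub_pos.2 htT)] with s hs'
      exact h.quot_le hab hA hs hs'.1 (by linarith [hs'.2, ht.1]) ⟨ht.1, by linarith [hs'.2]⟩
  have hd1 : 1 ≤ derivConst n A (b - a) T := by
    unfold derivConst; nlinarith [sq_nonneg (initConst A (b - a))]
  refine le_mul_of_sq_le_sq (by linarith) he0 (key.trans ?_)
  have hw2 := pow_le_pow_left₀ (M.norm_nonneg w) hw 2
  calc _ ≤ evoConst n A (b - a) T * ((initConst A (b - a) * e) ^ 2 + e ^ 2) := by
        rw [← he2]; gcongr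
    _ = derivConst n A (b - a) T * e ^ 2 := by rw [derivConst]; ring
    _ ≤ _ := by
        gcongr
        exact le_self_pow₀ hd1 (by norm_num)

/-- The estimate of the discrete error. -/
theorem error_le (h : ErrFlow M (n + 1) τ T δ y w α' β' γ') (hab : a < b) (hT : 0 < T)
    (hA : 1 ≤ A) (hs : ∀ i, StabBound A (τ.quP i) (τ.puP i) (τ.quM i)) {t : ℝ}
    (ht : t ∈ Icc 0 T) :
    M.norm (pu (projErr (n + 1) τ (y t))) + M.norm (pq (projErr (n + 1) τ (y t)))
      + M.norm (pp (projErr (n + 1) τ (y t))) + M.norm (ut y w t)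
      ≤ flowConst n A (b - a) T * (Real.sqrt M.size * δ) := by
  have h0 : (0 : ℝ) ∈ Icc 0 T := ⟨le_rfl, hT.le⟩
  have hinit := h.init_le (Nat.succ_pos n) hab hT hA hs
  have hst := h.projErr_static (Nat.succ_pos n) hab hA hs ht
  have hut := fun t ht => h.norm_ut_le (t := t) hab hT hA hs ht
  set e := Real.sqrt M.size * δ with he
  have he0 : 0 ≤ e := mul_nonneg (Real.sqrt_nonneg _) h.δ_nonneg
  set S := staticConst A (b - a) with hS
  have hS1 : 1 ≤ S := one_le_staticConst hA _
  set I := initConst A (b - a) with hI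
  have hI0 : 0 ≤ I := initConst_nonneg hA _
  set d := derivConst n A (b - a) T with hd
  have hd0 : 0 ≤ d := by
    have := one_le_evoConst (n := n) hA (sub_pos.2 hab) T
    rw [hd, derivConst]; positivity
  have g1 : M.norm (pg (y t)) ≤ (d + I) * e := by
    rcases eq_or_ne t 0 with rfl | ht0
    · have : pg (y 0) = pu (y 0) := by funext i; exact h.init i
      rw [this]
      have := mul_nonneg hd0 he0
      linarith
    · have : ut y w t = pg (y t) := if_neg ht0
      rw [← this]
      have := mul_nonneg hI0 he0
      linarith [hut t ht]
  have u1 : M.norm (pu (y t)) ≤ (d * T + I) * e := by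
    have b1 := M.norm_sub_le_of_norm_deriv_le (k := n + 1) (P := fun t => pu (y t))
      (fun s hs i => ((h.sys s hs).sys i).deg_u) (fun s hs i => h.natDegree_ut hs i)
      (fun t ht i j => h.hasDeriv ht i j) hut ht
    have b2 := M.norm_le_add (pu (y t)) (pu (y 0))
    have b3 : d * e * t ≤ d * e * T := by gcongr; exact ht.2
    linarith
  have u2 : M.norm (pu (projErr (n + 1) τ (y t))) ≤ (d * T + I + 4 * A) * e := by
    rw [projErr_u]
    have := M.norm_sub_le (pu (y t)) (M.legs (n + 1) (projCu (n + 1) τ (y t)))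
    have := (M.norm_legs_le (n + 1) (projCu (n + 1) τ (y t))).trans (h.wnorm_projCu_le hA hs ht)
    linarith
  have x1 : S * (M.norm (pg (y t)) + M.norm (pu (projErr (n + 1) τ (y t))) + 28 * A ^ 3 * e)
      ≤ S * ((d + I) * e + (d * T + I + 4 * A) * e + 28 * A ^ 3 * e) := by gcongr
  have e1 : flowConst n A (b - a) T * e
      = S * ((d + I) * e + (d * T + I + 4 * A) * e + 28 * A ^ 3 * e)
        + (d * T + I + 4 * A) * e + d * e := by
    rw [flowConst]; ring
  have := hut t ht
  rw [e1]; linarith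

end ErrFlow

end KdVHDG

end

/-! ### Approximation by polynomials and Sobolev functions of one variable. -/

noncomputable section

namespace KdVHDG

/-! ### The `L²` projection onto polynomials -/

/-- The `L²(l,r)` projection onto polynomials of degree less than `n`. -/
def legProj (n : ℕ) (l r : ℝ) (w : ℝ → ℝ) : ℝ[X] :=
  ∑ j ∈ Finset.range n,
    C ((2 * j + 1) / (r - l) * ∫ x in l..r, w x * (leg j l r).eval x) * leg j l r

theorem legProj_succ (n : ℕ) (l r : ℝ) (w : ℝ → ℝ) : legProj (n + 1) l r w = legProj n l r w
    + C ((2 * n + 1) / (r - l) * ∫ x in l..r, w x * (leg n l r).eval x) * leg n l r :=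
  Finset.sum_range_succ _ _

theorem legProj_mem (n : ℕ) (l r : ℝ) (w : ℝ → ℝ) : legProj n l r w ∈ degreeLT ℝ n := by
  refine Submodule.sum_mem _ fun j hj => ?_
  rw [← smul_eq_C_mul]
  refine Submodule.smul_mem _ _ (degreeLT_mono (Finset.mem_range.1 hj) ?_)
  rw [mem_degreeLT_iff]; exact natDegree_leg_le j l r

theorem natDegree_legProj_le (k : ℕ) (l r : ℝ) (w : ℝ → ℝ) :
    (legProj (k + 1) l r w).natDegree ≤ k := mem_degreeLT_iff.1 (legProj_mem _ _ _ _)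

variable {l r : ℝ} {w w' : ℝ → ℝ}

theorem intervalIntegrable_mul_eval (hw : IntervalIntegrable w volume l r) (v : ℝ[X]) :
    IntervalIntegrable (fun x => w x * v.eval x) volume l r :=
  hw.mul_continuousOn v.continuous.continuousOn

theorem exists_sub_leg_mem {n : ℕ} (h : l < r) {v : ℝ[X]} (hv : v.natDegree ≤ n) :
    ∃ c : ℝ, v - C c * leg n l r ∈ degreeLT ℝ n := by
  refine ⟨v.coeff n / legLead n l r, ?_⟩
  rw [mem_degreeLT, degree_lt_iff_coeff_zero]
  intro m hm
  rcases hm.eq_or_lt with rfl | hm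
  · exact coeff_sub_leg h v
  · exact coeff_eq_zero_of_natDegree_lt (lt_of_le_of_lt (natDegree_sub_leg hv _) hm)

theorem integral_mul_eq_itg_legProj (h : l < r) (hw : IntervalIntegrable w volume l r) (n : ℕ) :
    ∀ v ∈ degreeLT ℝ n, ∫ x in l..r, w x * v.eval x = itg l r (legProj n l r w * v) := by
  induction n with
  | zero =>
    intro v hv
    have : v = 0 := by simpa [mem_degreeLT] using hv
    simp [this]
  | succ n ih =>
    intro v hv
    obtain ⟨c, hc⟩ := exists_sub_leg_mem h (mem_degreeLT_iff.1 hv)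
    set v' := v - C c * leg n l r with hv'
    have e : v = v' + C c * leg n l r := by rw [hv']; ring
    have e1 : ∫ x in l..r, w x * v.eval x = (∫ x in l..r, w x * v'.eval x)
        + c * ∫ x in l..r, w x * (leg n l r).eval x := by
      rw [← intervalIntegral.integral_const_mul, ← intervalIntegral.integral_add
        (intervalIntegrable_mul_eval hw _) ((intervalIntegrable_mul_eval hw _).const_mul _)]
      refine intervalIntegral.integral_congr fun x _ => ?_
      simp only [e, eval_add, eval_mul, eval_C]; ring
    have o1 : itg l r (leg n l r * v') = 0 := itg_leg_mul_eq_zero_of_mem l r hc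
    have o2 : itg l r (leg n l r * legProj n l r w) = 0 :=
      itg_leg_mul_eq_zero_of_mem l r (legProj_mem _ _ _ _)
    set m := ∫ x in l..r, w x * (leg n l r).eval x with hm
    have e2 : legProj (n + 1) l r w * v = legProj n l r w * v'
        + C c * (leg n l r * legProj n l r w)
        + C ((2 * n + 1) / (r - l) * m) * (leg n l r * v')
        + C ((2 * n + 1) / (r - l) * m * c) * (leg n l r * leg n l r) := by
      rw [legProj_succ, e, C_mul (b := c)]; ring
    have hh : r - l ≠ 0 := (sub_pos.2 h).ne'
    have hn : (2 * (n : ℝ) + 1) ≠ 0 := by positivity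
    rw [e1, ih v' hc, e2, map_add, map_add, map_add, itg_C_mul, itg_C_mul, itg_C_mul, o1, o2,
      itg_leg_mul_self n h]
    field_simp
    ring

theorem legProj_add (h1 : IntervalIntegrable w volume l r) (h2 : IntervalIntegrable w' volume l r)
    (n : ℕ) : legProj n l r (fun x => w x + w' x) = legProj n l r w + legProj n l r w' := by
  rw [legProj, legProj, legProj, ← Finset.sum_add_distrib]
  refine Finset.sum_congr rfl fun j _ => ?_
  have : ∫ x in l..r, (w x + w' x) * (leg j l r).eval x
      = (∫ x in l..r, w x * (leg j l r).eval x) + ∫ x in l..r, w' x * (leg j l r).eval x := by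
    rw [← intervalIntegral.integral_add (intervalIntegrable_mul_eval h1 _)
      (intervalIntegrable_mul_eval h2 _)]
    exact intervalIntegral.integral_congr fun x _ => add_mul _ _ _
  rw [this, mul_add, C_add, add_mul]

theorem legProj_const_mul (c : ℝ) (w : ℝ → ℝ) (n : ℕ) :
    legProj n l r (fun x => c * w x) = C c * legProj n l r w := by
  rw [legProj, legProj, Finset.mul_sum]
  refine Finset.sum_congr rfl fun j _ => ?_
  have : ∫ x in l..r, c * w x * (leg j l r).eval x = c * ∫ x in l..r, w x * (leg j l r).eval x := by
    rw [← intervalIntegral.integral_const_mul]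
    exact intervalIntegral.integral_congr fun x _ => mul_assoc _ _ _
  rw [this, mul_left_comm, C_mul]; ring

theorem legProj_sub (h1 : IntervalIntegrable w volume l r) (h2 : IntervalIntegrable w' volume l r)
    (n : ℕ) : legProj n l r (fun x => w x - w' x) = legProj n l r w - legProj n l r w' := by
  have := legProj_add h1 (h2.const_mul (-1)) n
  rw [legProj_const_mul] at this
  rw [sub_eq_add_neg, neg_eq_neg_one_mul (legProj n l r w')]
  simp only [neg_one_mul] at this
  rw [show (fun x => w x - w' x) = fun x => w x + -w' x by funext x; ring, this]
  simp

theorem legProj_eval {n : ℕ} (h : l < r) {T : ℝ[X]} (hT : T ∈ degreeLT ℝ n) :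
    legProj n l r (fun x => T.eval x) = T := by
  have hi : IntervalIntegrable (fun x => T.eval x) volume l r := T.continuous.intervalIntegrable _ _
  set z := T - legProj n l r fun x => T.eval x with hz
  have hzm : z ∈ degreeLT ℝ n := Submodule.sub_mem _ hT (legProj_mem _ _ _ _)
  have h1 := integral_mul_eq_itg_legProj h hi n z hzm
  have h2 : ∫ x in l..r, T.eval x * z.eval x = itg l r (T * z) := by
    rw [itg_apply]; exact intervalIntegral.integral_congr fun x _ => by simp
  have h3 : itg l r (z * z) = 0 := by
    rw [hz, sub_mul, map_sub, ← hz, ← h2, h1, sub_self]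
  have h4 : z = 0 := by
    by_contra hne
    exact (itg_mul_self_pos h hne).ne' h3
  exact (sub_eq_zero.1 h4).symm

/-- The residuals of the projection at the end points. -/
def residL (n : ℕ) (l r : ℝ) (w : ℝ → ℝ) : ℝ := w l - (legProj n l r w).eval l
def residR (n : ℕ) (l r : ℝ) (w : ℝ → ℝ) : ℝ := w r - (legProj n l r w).eval r

/-- Since `|L_j| ≤ (1 + L_j²)/2`, the integral of `|L_j|` is at most the length; no maximum bound
for Legendre polynomials is needed. -/
theorem abs_legCoeff_le (h : l < r) {B : ℝ} (hw : ContinuousOn w (Icc l r))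
    (hB : ∀ x ∈ Icc l r, |w x| ≤ B) (j : ℕ) :
    |(2 * j + 1) / (r - l) * ∫ x in l..r, w x * (leg j l r).eval x| ≤ (2 * j + 1) * B := by
  have hh : 0 < r - l := sub_pos.2 h
  have hB0 : 0 ≤ B := (abs_nonneg _).trans (hB l (left_mem_Icc.2 h.le))
  have hj : (0 : ℝ) < 2 * j + 1 := by positivity
  have key : |∫ x in l..r, w x * (leg j l r).eval x| ≤ B * (r - l) := by
    have h1 : |∫ x in l..r, w x * (leg j l r).eval x| ≤ ∫ x in l..r, B * |(leg j l r).eval x| := by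
      refine (intervalIntegral.abs_integral_le_integral_abs h.le).trans
        (intervalIntegral.integral_mono_on h.le ?_ ?_ fun x hx => ?_)
      · exact (ContinuousOn.intervalIntegrable_of_Icc h.le
          (hw.mul (leg j l r).continuous.continuousOn)).abs
      · exact ((leg j l r).continuous.abs.const_smul B).intervalIntegrable _ _
      · rw [abs_mul]; exact mul_le_mul_of_nonneg_right (hB x hx) (abs_nonneg _)
    have h2 : ∫ x in l..r, |(leg j l r).eval x| ≤ ∫ x in l..r, (1 + (leg j l r).eval x ^ 2) / 2 := by
      refine intervalIntegral.integral_mono_on h.le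
        ((leg j l r).continuous.abs.intervalIntegrable _ _)
        (Continuous.intervalIntegrable (by fun_prop) _ _) fun x _ => ?_
      rw [← sq_abs]; nlinarith [sq_nonneg (|(leg j l r).eval x| - 1)]
    have h3 : ∫ x in l..r, (1 + (leg j l r).eval x ^ 2) / 2
        = ((r - l) + itg l r (leg j l r * leg j l r)) / 2 := by
      have : ∫ x in l..r, (leg j l r).eval x ^ 2 = itg l r (leg j l r * leg j l r) := by
        rw [itg_apply]; exact intervalIntegral.integral_congr fun x _ => by simp [pow_two]
      rw [intervalIntegral.integral_div, intervalIntegral.integral_add (by simp)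
        (Continuous.intervalIntegrable (by fun_prop) _ _), this]
      simp
    have h4 : itg l r (leg j l r * leg j l r) ≤ r - l := by
      rw [itg_leg_mul_self j h]
      exact div_le_self hh.le (by linarith [(Nat.cast_nonneg j : (0 : ℝ) ≤ j)])
    rw [intervalIntegral.integral_const_mul] at h1
    refine h1.trans (mul_le_mul_of_nonneg_left (h2.trans ?_) hB0)
    rw [h3]; linarith
  rw [abs_mul, abs_of_pos (div_pos hj hh)]
  calc _ ≤ (2 * (j : ℝ) + 1) / (r - l) * (B * (r - l)) := by gcongr
    _ = _ := by field_simp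

/-- Used at the end points, where every `|L_j|` is `1`; the factor is the sum of the first `n` odd
numbers. -/
theorem abs_eval_legProj_le (h : l < r) {B : ℝ} (hw : ContinuousOn w (Icc l r))
    (hB : ∀ x ∈ Icc l r, |w x| ≤ B) (n : ℕ) {x : ℝ} (hx : ∀ j, |(leg j l r).eval x| = 1) :
    |(legProj n l r w).eval x| ≤ n ^ 2 * B := by
  rw [legProj, eval_finsetSum]
  refine (Finset.abs_sum_le_sum_abs _ _).trans ?_
  have : ∀ j ∈ Finset.range n, |(C ((2 * (j : ℝ) + 1) / (r - l)
      * ∫ x in l..r, w x * (leg j l r).eval x) * leg j l r).eval x| ≤ (2 * j + 1) * B := by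
    intro j _
    rw [eval_mul, eval_C, abs_mul, hx, mul_one]
    exact abs_legCoeff_le h hw hB j
  refine (Finset.sum_le_sum this).trans (le_of_eq ?_)
  rw [← Finset.sum_mul]
  congr 1
  induction n with
  | zero => simp
  | succ n ih =>
    rw [Finset.sum_range_succ, ih fun j hj => this j (Finset.mem_range.2
      ((Finset.mem_range.1 hj).trans (Nat.lt_succ_self n)))]
    push_cast; ring

/-- Residuals are bounded by polynomial approximation. -/
theorem abs_resid_le (h : l < r) {B : ℝ} (hw : ContinuousOn w (Icc l r)) {n : ℕ} {T : ℝ[X]}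
    (hT : T ∈ degreeLT ℝ n) (hB : ∀ x ∈ Icc l r, |w x - T.eval x| ≤ B) :
    |residL n l r w| ≤ (n ^ 2 + 1) * B ∧ |residR n l r w| ≤ (n ^ 2 + 1) * B := by
  have hc : ContinuousOn (fun x => w x - T.eval x) (Icc l r) := hw.sub T.continuous.continuousOn
  -- The projection reproduces `T`, so the residuals of `w` are those of `w - T`.
  have e := legProj_sub (hw.intervalIntegrable_of_Icc h.le)
    (T.continuous.intervalIntegrable l r) n
  rw [legProj_eval h hT] at e
  have b1 := abs_eval_legProj_le h hc hB n (x := l) fun j => by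
    rw [eval_leg_left j h, abs_pow]; simp
  have b2 := abs_eval_legProj_le h hc hB n (x := r) fun j => by
    rw [eval_leg_right j h]; simp
  rw [e, eval_sub] at b1 b2
  have c1 := hB l (left_mem_Icc.2 h.le)
  have c2 := hB r (right_mem_Icc.2 h.le)
  constructor
  · have : residL n l r w = (w l - T.eval l) - ((legProj n l r w).eval l - T.eval l) := by
      rw [residL]; ring
    rw [this]
    exact (abs_sub _ _).trans (by linarith)
  · have : residR n l r w = (w r - T.eval r) - ((legProj n l r w).eval r - T.eval r) := by
      rw [residR]; ring
    rw [this]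
    exact (abs_sub _ _).trans (by linarith)

theorem residL_sub (h1 : IntervalIntegrable w volume l r) (h2 : IntervalIntegrable w' volume l r)
    (n : ℕ) : residL n l r (fun x => w x - w' x) = residL n l r w - residL n l r w' := by
  rw [residL, residL, residL, legProj_sub h1 h2, eval_sub]; ring

theorem residR_sub (h1 : IntervalIntegrable w volume l r) (h2 : IntervalIntegrable w' volume l r)
    (n : ℕ) : residR n l r (fun x => w x - w' x) = residR n l r w - residR n l r w' := by
  rw [residR, residR, residR, legProj_sub h1 h2, eval_sub]; ring

end KdVHDG

end

noncomputable section

namespace KdVHDG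

/-! ### Weak derivatives in one dimension -/

theorem deriv_eq_zero_of_notMem_tsupport {φ : ℝ → ℝ} {x : ℝ} (hx : x ∉ tsupport φ) :
    deriv φ x = 0 := by
  by_contra h
  exact hx (support_deriv_subset h)

theorem setIntegral_mul_test_eq {D : Set ℝ} {φ : ℝ → ℝ} (v : ℝ → ℝ) (h : tsupport φ ⊆ D) :
    ∫ x in D, v x * φ x = ∫ x, v x * φ x :=
  setIntegral_eq_integral_of_forall_compl_eq_zero fun x hx => by
    rw [image_eq_zero_of_notMem_tsupport fun hx' => hx (h hx'), mul_zero]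

theorem setIntegral_mul_deriv_test_eq {D : Set ℝ} {φ : ℝ → ℝ} (v : ℝ → ℝ) (h : tsupport φ ⊆ D) :
    ∫ x in D, v x * deriv φ x = ∫ x, v x * deriv φ x :=
  setIntegral_eq_integral_of_forall_compl_eq_zero fun x hx => by
    rw [deriv_eq_zero_of_notMem_tsupport fun hx' => hx (h hx'), mul_zero]

theorem HasWeakDerivOn.mono {D D' : Set ℝ} {v w : ℝ → ℝ} (h : HasWeakDerivOn D v w)
    (hD : D' ⊆ D) : HasWeakDerivOn D' v w := by
  intro φ h1 h2 h3
  rw [setIntegral_mul_test_eq w h3, setIntegral_mul_deriv_test_eq v h3,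
    ← setIntegral_mul_test_eq w (h3.trans hD), ← setIntegral_mul_deriv_test_eq v (h3.trans hD)]
  exact h φ h1 h2 (h3.trans hD)

theorem HasWeakDerivOn.congr {D : Set ℝ} {v v' w w' : ℝ → ℝ} (h : HasWeakDerivOn D v w)
    (hv : v =ᵐ[volume.restrict D] v') (hw : w =ᵐ[volume.restrict D] w') :
    HasWeakDerivOn D v' w' := by
  intro φ h1 h2 h3
  have e1 : ∫ x in D, v' x * deriv φ x = ∫ x in D, v x * deriv φ x :=
    integral_congr_ae (by filter_upwards [hv] with x hx; rw [hx])
  have e2 : ∫ x in D, w' x * φ x = ∫ x in D, w x * φ x :=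
    integral_congr_ae (by filter_upwards [hw] with x hx; rw [hx])
  rw [e1, e2]; exact h φ h1 h2 h3

theorem ae_eq_zero_of_forall_test {D : Set ℝ} (hD : IsOpen D) {z : ℝ → ℝ}
    (hz : LocallyIntegrableOn z D)
    (h : ∀ φ : ℝ → ℝ, ContDiff ℝ ∞ φ → HasCompactSupport φ → tsupport φ ⊆ D →
      ∫ x in D, z x * φ x = 0) : z =ᵐ[volume.restrict D] 0 := by
  rw [Filter.EventuallyEq, ae_restrict_iff' hD.measurableSet]
  refine hD.ae_eq_zero_of_integral_contDiff_smul_eq_zero hz fun g h1 h2 h3 => ?_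
  rw [← h g h1 h2 h3, setIntegral_mul_test_eq z h3]
  simp only [smul_eq_mul, mul_comm]

/-- Weak derivatives are unique. -/
theorem HasWeakDerivOn.unique {D : Set ℝ} (hD : IsOpen D) {v w w' : ℝ → ℝ}
    (hw : LocallyIntegrableOn w D) (hw' : LocallyIntegrableOn w' D)
    (h : HasWeakDerivOn D v w) (h' : HasWeakDerivOn D v w') : w =ᵐ[volume.restrict D] w' := by
  have key : (fun x => w x - w' x) =ᵐ[volume.restrict D] 0 := by
    refine ae_eq_zero_of_forall_test hD (hw.sub hw') fun φ h1 h2 h3 => ?_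
    have i : ∀ {z : ℝ → ℝ}, LocallyIntegrableOn z D → Integrable (fun x => z x * φ x)
        (volume.restrict D) := by
      intro z hz
      have hK : IntegrableOn z (tsupport φ) := hz.integrableOn_compact_subset h3 h2
      have : IntegrableOn (fun x => z x * φ x) (tsupport φ) :=
        hK.mul_continuousOn h1.continuous.continuousOn h2
      have h4 : Integrable (fun x => z x * φ x) :=
        (integrableOn_iff_integrable_of_support_subset (fun x hx => by
          by_contra hx'
          exact hx (by simp [image_eq_zero_of_notMem_tsupport hx']))).1 this
      exact h4.integrableOn
    simp only [sub_mul]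
    rw [integral_sub (i hw) (i hw')]
    linarith [h φ h1 h2 h3, h' φ h1 h2 h3]
  filter_upwards [key] with x hx
  exact sub_eq_zero.1 hx

/-! ### Primitives -/

/-- `F` is a primitive of the integrable function `f` on `[l,r]`. -/
def IsPrim (l r : ℝ) (F f : ℝ → ℝ) : Prop :=
  IntervalIntegrable f volume l r ∧ ∀ x ∈ Icc l r, F x = F l + ∫ y in l..x, f y

variable {l r : ℝ}

theorem IsPrim.continuousOn {F f : ℝ → ℝ} (h : IsPrim l r F f) (hlr : l ≤ r) :
    ContinuousOn F (Icc l r) := by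
  have h1 : IntegrableOn f (uIcc l r) := by
    rw [uIcc_of_le hlr, integrableOn_Icc_iff_integrableOn_Ioc]
    exact (intervalIntegrable_iff_integrableOn_Ioc_of_le hlr).1 h.1
  have h2 := intervalIntegral.continuousOn_primitive_interval h1
  rw [uIcc_of_le hlr] at h2
  exact (continuousOn_const.add h2).congr h.2

theorem IsPrim.ae_hasDerivAt {F f : ℝ → ℝ} (h : IsPrim l r F f) :
    ∀ᵐ x, x ∈ Ioo l r → HasDerivAt F (f x) x := by
  filter_upwards [h.1.ae_hasDerivAt_integral] with x hx hxm
  have hlr : l ≤ r := (hxm.1.trans hxm.2).le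
  have h1 := hx (by rw [uIcc_of_le hlr]; exact Ioo_subset_Icc_self hxm) l
    (by rw [uIcc_of_le hlr]; exact left_mem_Icc.2 hlr)
  refine (h1.const_add (F l)).congr_of_eventuallyEq ?_
  filter_upwards [Icc_mem_nhds hxm.1 hxm.2] with y hy using h.2 y hy

/-- Integration by parts for a primitive and a smooth function. -/
theorem IsPrim.integral_mul_deriv {F f : ℝ → ℝ} (h : IsPrim l r F f) (hlr : l ≤ r) {φ : ℝ → ℝ}
    (hφ : ContDiff ℝ 1 φ) :
    ∫ x in l..r, F x * deriv φ x = F r * φ r - F l * φ l - ∫ x in l..r, f x * φ x := by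
  have ac1 : AbsolutelyContinuousOnInterval (fun x => ∫ y in l..x, f y) l r :=
    h.1.absolutelyContinuousOnInterval_intervalIntegral (by simp)
  have ac2 : AbsolutelyContinuousOnInterval φ l r := hφ.contDiffOn.absolutelyContinuousOnInterval
  have key := ac1.integral_mul_deriv_eq_deriv_mul ac2
  have e1 : ∫ x in l..r, F x * deriv φ x
      = F l * (φ r - φ l) + ∫ x in l..r, (∫ y in l..x, f y) * deriv φ x := by
    have hd : IntervalIntegrable (deriv φ) volume l r :=
      (hφ.continuous_deriv le_rfl).intervalIntegrable _ _
    rw [← ac2.integral_deriv_eq_sub, ← intervalIntegral.integral_const_mul,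
      ← intervalIntegral.integral_add (hd.const_mul _) (hd.continuousOn_mul ac1.continuousOn)]
    refine intervalIntegral.integral_congr fun x hx => ?_
    rw [uIcc_of_le hlr] at hx
    simp only [h.2 x hx, add_mul]
  have e2 : ∫ x in l..r, deriv (fun x => ∫ y in l..x, f y) x * φ x = ∫ x in l..r, f x * φ x := by
    refine intervalIntegral.integral_congr_ae ?_
    filter_upwards [h.1.ae_hasDerivAt_integral] with x hx hxm
    rw [(hx (uIoc_subset_uIcc hxm) l (by simp)).deriv]
  have e3 := h.2 r (right_mem_Icc.2 hlr)
  rw [e1, key, e2, intervalIntegral.integral_same, e3]; ring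

theorem IsPrim.integral_mul_eval_derivative {F f : ℝ → ℝ} (h : IsPrim l r F f) (hlr : l ≤ r)
    (v : ℝ[X]) : ∫ x in l..r, F x * (derivative v).eval x
      = F r * v.eval r - F l * v.eval l - ∫ x in l..r, f x * v.eval x := by
  have := h.integral_mul_deriv hlr (φ := fun x => v.eval x) (by
    simpa [coe_aeval_eq_eval] using v.contDiff_aeval (𝕜 := ℝ) 1)
  simpa using this

theorem isPrim_of_hasDerivWithinAt {F f : ℝ → ℝ} (hf : ContinuousOn f (Icc l r))
    (h : ∀ x ∈ Icc l r, HasDerivWithinAt F (f x) (Icc l r) x) (hlr : l ≤ r) : IsPrim l r F f := by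
  refine ⟨hf.intervalIntegrable_of_Icc hlr, fun x hx => ?_⟩
  have hs : Icc l x ⊆ Icc l r := Icc_subset_Icc_right hx.2
  rw [intervalIntegral.integral_eq_sub_of_hasDeriv_right_of_le hx.1
    (fun y hy => ((h y (hs hy)).mono hs).continuousWithinAt)
    (fun y hy => ((h y (hs (Ioo_subset_Icc_self hy))).hasDerivAt
      (Icc_mem_nhds hy.1 (hy.2.trans_le hx.2))).hasDerivWithinAt)
    ((hf.mono hs).intervalIntegrable_of_Icc hx.1)]
  ring

theorem IsPrim.hasWeakDerivOn {F f : ℝ → ℝ} (h : IsPrim l r F f) (hlr : l ≤ r) :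
    HasWeakDerivOn (Ioo l r) F f := by
  intro φ h1 h2 h3
  have hl : φ l = 0 := image_eq_zero_of_notMem_tsupport fun hx => (h3 hx).1.false
  have hr : φ r = 0 := image_eq_zero_of_notMem_tsupport fun hx => (h3 hx).2.false
  have := h.integral_mul_deriv hlr (h1.of_le (by simp))
  rw [hl, hr, intervalIntegral.integral_of_le hlr, intervalIntegral.integral_of_le hlr,
    integral_Ioc_eq_integral_Ioo, integral_Ioc_eq_integral_Ioo] at this
  linarith

/-- The primitive from `l` vanishes before the support of `χ`, and after it because the mean of `χ`
is zero. -/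
theorem exists_test_primitive {χ : ℝ → ℝ} (h1 : ContDiff ℝ ∞ χ)
    (h2 : HasCompactSupport χ) (h3 : tsupport χ ⊆ Ioo l r) (h0 : ∫ x in l..r, χ x = 0) :
    ∃ ψ : ℝ → ℝ, ContDiff ℝ ∞ ψ ∧ HasCompactSupport ψ ∧ tsupport ψ ⊆ Ioo l r ∧ deriv ψ = χ := by
  rcases (tsupport χ).eq_empty_or_nonempty with he | hne
  · refine ⟨0, contDiff_const, HasCompactSupport.zero, by simp [tsupport], ?_⟩
    rw [tsupport_eq_empty_iff] at he
    rw [he]; ext x; simp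
  have hK : IsCompact (tsupport χ) := h2
  obtain ⟨l', hl'⟩ := hK.exists_isLeast hne
  obtain ⟨r', hr'⟩ := hK.exists_isGreatest hne
  have hd : ∀ x, HasDerivAt (fun x => ∫ y in l..x, χ y) (χ x) x := fun x =>
    h1.continuous.integral_hasStrictDerivAt l x |>.hasDerivAt
  have hde : deriv (fun x => ∫ y in l..x, χ y) = χ := funext fun x => (hd x).deriv
  have hz : ∀ x ∉ tsupport χ, χ x = 0 := fun x hx => image_eq_zero_of_notMem_tsupport hx
  have hsub : tsupport (fun x => ∫ y in l..x, χ y) ⊆ Icc l' r' := by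
    refine closure_minimal (fun x hx => ?_) isClosed_Icc
    by_contra hxm
    refine hx ?_
    rw [mem_Icc, not_and_or, not_le, not_le] at hxm
    rcases hxm with hxm | hxm
    · refine intervalIntegral.integral_zero_ae (Filter.Eventually.of_forall fun y hy => ?_)
      refine hz y fun hy' => ?_
      have := hl'.2 hy'
      have h4 := (h3 hl'.1).1
      have h5 : y ≤ max l x := hy.2
      have : max l x < l' := max_lt h4 hxm
      linarith
    · change ∫ y in l..x, χ y = 0
      rw [← intervalIntegral.integral_add_adjacent_intervals
        (h1.continuous.intervalIntegrable l r) (h1.continuous.intervalIntegrable r x), h0, zero_add]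
      refine intervalIntegral.integral_zero_ae (Filter.Eventually.of_forall fun y hy => ?_)
      refine hz y fun hy' => ?_
      have := hr'.2 hy'
      have h4 := (h3 hr'.1).2
      have h5 : min r x < y := hy.1
      have : r' < min r x := lt_min h4 hxm
      linarith
  refine ⟨_, ?_, IsCompact.of_isClosed_subset isCompact_Icc (isClosed_tsupport _) hsub,
    hsub.trans (Icc_subset_Ioo (h3 hl'.1).1 (h3 hr'.1).2), hde⟩
  rw [contDiff_infty_iff_deriv, hde]
  exact ⟨fun x => (hd x).differentiableAt, h1⟩

/-- The lemma of du Bois-Reymond. -/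
theorem ae_eq_const_of_weakDeriv_zero (hlr : l < r) {z : ℝ → ℝ}
    (hz : IntervalIntegrable z volume l r) (h : HasWeakDerivOn (Ioo l r) z 0) :
    ∃ c : ℝ, z =ᵐ[volume.restrict (Ioo l r)] fun _ => c := by
  have hzi : IntegrableOn z (Ioo l r) := by
    rw [← integrableOn_Ioc_iff_integrableOn_Ioo]
    exact (intervalIntegrable_iff_integrableOn_Ioc_of_le hlr.le).1 hz
  obtain ⟨η, e1, e2, e3, e4, e5⟩ := exists_contDiff_tsupport_subset (n := ⊤)
    (Ioo_mem_nhds (show l < (l + r) / 2 by linarith) (show (l + r) / 2 < r by linarith))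
  have hpos : 0 < ∫ x in l..r, η x := by
    refine intervalIntegral.integral_pos hlr e3.continuous.continuousOn (fun x _ => ?_)
      ⟨(l + r) / 2, ⟨by linarith, by linarith⟩, by rw [e5]; exact one_pos⟩
    exact (e4 (mem_range_self x)).1
  set κ := ∫ x in l..r, η x with hκ
  have im : ∀ {φ : ℝ → ℝ}, Continuous φ → HasCompactSupport φ →
      Integrable (fun x => z x * φ x) (volume.restrict (Ioo l r)) := by
    intro φ hφ hc
    obtain ⟨B, hB⟩ := hc.exists_bound_of_continuous hφ
    exact hzi.mul_bdd hφ.aestronglyMeasurable (Filter.Eventually.of_forall hB)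
  refine ⟨(∫ x in Ioo l r, z x * η x) / κ, ?_⟩
  set c := (∫ x in Ioo l r, z x * η x) / κ with hc
  have key : (fun x => z x - c) =ᵐ[volume.restrict (Ioo l r)] 0 := by
    refine ae_eq_zero_of_forall_test isOpen_Ioo
      (hzi.locallyIntegrableOn.sub (locallyIntegrableOn_const c)) fun φ h1 h2 h3 => ?_
    -- Subtracting `μ η` gives mean zero, so that the test function is a derivative of another one.
    set μ := (∫ x in l..r, φ x) / κ with hμ
    have c1 : ContDiff ℝ ∞ fun x => φ x - μ * η x := h1.sub (contDiff_const.mul e3)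
    have c2 : tsupport (fun x => φ x - μ * η x) ⊆ tsupport φ ∪ tsupport η := by
      refine closure_minimal (fun x hx => ?_) ((isClosed_tsupport _).union (isClosed_tsupport _))
      by_contra hn
      rw [mem_union, not_or] at hn
      exact hx (by simp [image_eq_zero_of_notMem_tsupport hn.1,
        image_eq_zero_of_notMem_tsupport hn.2])
    have c3 : HasCompactSupport fun x => φ x - μ * η x :=
      IsCompact.of_isClosed_subset (IsCompact.union h2 e2) (isClosed_tsupport _) c2
    have c4 : ∫ x in l..r, (φ x - μ * η x) = 0 := by
      rw [intervalIntegral.integral_sub (h1.continuous.intervalIntegrable _ _)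
        ((e3.continuous.intervalIntegrable _ _).const_mul μ),
        intervalIntegral.integral_const_mul, ← hκ, hμ]
      field_simp; ring
    obtain ⟨ψ, p1, p2, p3, p4⟩ := exists_test_primitive c1 c3 (c2.trans (union_subset h3 e1)) c4
    have hw := h ψ p1 p2 p3
    rw [p4] at hw
    simp only [Pi.zero_apply, zero_mul, integral_zero, neg_zero, mul_sub] at hw
    rw [integral_sub (im h1.continuous h2) (by
      have := (im e3.continuous e2).const_mul μ
      refine this.congr (Filter.Eventually.of_forall fun x => ?_)
      simp only; ring)] at hw
    have e6 : ∫ x in Ioo l r, z x * (μ * η x) = μ * (c * κ) := by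
      rw [hc, div_mul_cancel₀ _ hpos.ne', ← integral_const_mul]
      exact integral_congr_ae (Filter.Eventually.of_forall fun x => by simp only; ring)
    have hφi : Integrable φ (volume.restrict (Ioo l r)) :=
      (h1.continuous.integrable_of_hasCompactSupport h2).integrableOn
    have e7 : ∫ x in Ioo l r, φ x = μ * κ := by
      rw [hμ, div_mul_cancel₀ _ hpos.ne', intervalIntegral.integral_of_le hlr.le,
        integral_Ioc_eq_integral_Ioo]
    simp only [sub_mul]
    rw [integral_sub (im h1.continuous h2) (hφi.const_mul c), integral_const_mul, e7]
    rw [e6] at hw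
    linarith
  filter_upwards [key] with x hx
  exact sub_eq_zero.1 hx

theorem HasWeakDerivOn.exists_ae_eq (hlr : l < r) {v w : ℝ → ℝ}
    (hv : IntervalIntegrable v volume l r) (hw : IntervalIntegrable w volume l r)
    (h : HasWeakDerivOn (Ioo l r) v w) :
    ∃ c : ℝ, v =ᵐ[volume.restrict (Ioo l r)] fun x => c + ∫ y in l..x, w y := by
  have hp : IsPrim l r (fun x => ∫ y in l..x, w y) w := ⟨hw, fun x _ => by simp⟩
  have hpi : IntervalIntegrable (fun x => ∫ y in l..x, w y) volume l r :=
    (hp.continuousOn hlr.le).intervalIntegrable_of_Icc hlr.le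
  have io : ∀ {f : ℝ → ℝ}, IntervalIntegrable f volume l r → IntegrableOn f (Ioo l r) := by
    intro f hf
    rw [← integrableOn_Ioc_iff_integrableOn_Ioo]
    exact (intervalIntegrable_iff_integrableOn_Ioc_of_le hlr.le).1 hf
  have h0 : HasWeakDerivOn (Ioo l r) (fun x => v x - ∫ y in l..x, w y) 0 := by
    intro φ h1 h2 h3
    have im : ∀ {f : ℝ → ℝ}, IntegrableOn f (Ioo l r) →
        Integrable (fun x => f x * deriv φ x) (volume.restrict (Ioo l r)) := by
      intro f hf
      have hφ := h1.continuous_deriv (by simp)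
      obtain ⟨B, hB⟩ := h2.deriv.exists_bound_of_continuous hφ
      exact hf.mul_bdd hφ.aestronglyMeasurable (Filter.Eventually.of_forall hB)
    simp only [sub_mul]
    rw [integral_sub (im (io hv)) (im (io hpi)), h φ h1 h2 h3, hp.hasWeakDerivOn hlr.le φ h1 h2 h3]
    simp
  obtain ⟨c, hc⟩ := ae_eq_const_of_weakDeriv_zero hlr (hv.sub hpi) h0
  refine ⟨c, ?_⟩
  filter_upwards [hc] with x hx
  linarith

theorem eqOn_Icc_of_ae_eq (hlr : l < r) {f g : ℝ → ℝ} (hf : ContinuousOn f (Icc l r))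
    (hg : ContinuousOn g (Icc l r)) (h : f =ᵐ[volume.restrict (Ioo l r)] g) :
    EqOn f g (Icc l r) := by
  have h1 : EqOn f g (Ioo l r) := Measure.eqOn_open_of_ae_eq h isOpen_Ioo
    (hf.mono Ioo_subset_Icc_self) (hg.mono Ioo_subset_Icc_self)
  refine h1.of_subset_closure hf hg Ioo_subset_Icc_self ?_
  rw [closure_Ioo hlr.ne]

/-- A continuous function with an integrable weak derivative is its primitive. -/
theorem HasWeakDerivOn.isPrim (hlr : l < r) {F v w : ℝ → ℝ} (hF : ContinuousOn F (Icc l r))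
    (hv : v =ᵐ[volume.restrict (Ioo l r)] F) (hw : IntervalIntegrable w volume l r)
    (h : HasWeakDerivOn (Ioo l r) v w) : IsPrim l r F w := by
  obtain ⟨c, hc⟩ := (h.congr hv Filter.EventuallyEq.rfl).exists_ae_eq hlr
    (hF.intervalIntegrable_of_Icc hlr.le) hw
  have hp : IsPrim l r (fun x => c + ∫ y in l..x, w y) w := ⟨hw, fun x _ => by simp⟩
  have he := eqOn_Icc_of_ae_eq hlr hF (hp.continuousOn hlr.le) hc
  refine ⟨hw, fun x hx => ?_⟩
  rw [he hx, he (left_mem_Icc.2 hlr.le)]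
  simp

end KdVHDG

end

noncomputable section

namespace KdVHDG

/-! ### Functions with square integrable weak derivatives -/

/-- `w` has weak derivatives of order at most `m` on `D`, with `L²` norms at most `B`. -/
def InSob (D : Set ℝ) (m : ℕ) (B : ℝ) (w : ℝ → ℝ) : Prop :=
  ∃ v : Fin (m + 1) → ℝ → ℝ, (∀ j, MemLp (v j) 2 (volume.restrict D)) ∧
    (∀ j : Fin m, HasWeakDerivOn D (v j.castSucc) (v j.succ)) ∧
    v 0 =ᵐ[volume.restrict D] w ∧ ∀ j, ∫ x in D, v j x ^ 2 ≤ B ^ 2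

theorem InSob.congr {D : Set ℝ} {m : ℕ} {B : ℝ} {w w' : ℝ → ℝ} (h : InSob D m B w)
    (hw : w =ᵐ[volume.restrict D] w') : InSob D m B w' := by
  obtain ⟨v, h1, h2, h3, h4⟩ := h
  exact ⟨v, h1, h2, h3.trans hw, h4⟩

theorem SobolevH.inSob {m : ℕ} {D : Set ℝ} (V : SobolevH m D) :
    InSob D m ‖V‖ ((V : L2Tuple m D) 0) := by
  refine ⟨fun j => (V : L2Tuple m D) j, fun j => Lp.memLp _, V.2, Filter.EventuallyEq.rfl,
    fun j => ?_⟩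
  have h1 : ∫ x in D, (V : L2Tuple m D) j x ^ 2 = ‖(V : L2Tuple m D) j‖ ^ 2 := by
    rw [← real_inner_self_eq_norm_sq, L2.inner_def]
    exact integral_congr_ae (Filter.Eventually.of_forall fun x => by simp [pow_two])
  rw [h1]
  exact pow_le_pow_left₀ (norm_nonneg _) (PiLp.norm_apply_le _ j) 2

variable {l r : ℝ}

theorem sq_integral_abs_le (hlr : l < r) {v : ℝ → ℝ} (hv : MemLp v 2 (volume.restrict (Ioo l r))) :
    (∫ x in l..r, |v x|) ^ 2 ≤ (r - l) * ∫ x in Ioo l r, v x ^ 2 := by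
  have hh : 0 < r - l := sub_pos.2 hlr
  have i1 : Integrable (fun x => |v x|) (volume.restrict (Ioo l r)) :=
    (hv.integrable (by norm_num)).abs
  have i2 : Integrable (fun x => v x ^ 2) (volume.restrict (Ioo l r)) := hv.integrable_sq
  rw [intervalIntegral.integral_of_le hlr.le, integral_Ioc_eq_integral_Ioo]
  set m := (∫ x in Ioo l r, |v x|) / (r - l) with hm
  have h0 : 0 ≤ ∫ x in Ioo l r, (|v x| - m) ^ 2 := integral_nonneg fun x => sq_nonneg _
  have h1 : ∫ x in Ioo l r, (|v x| - m) ^ 2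
      = (∫ x in Ioo l r, v x ^ 2) - 2 * m * (∫ x in Ioo l r, |v x|) + m ^ 2 * (r - l) := by
    have : ∀ x, (|v x| - m) ^ 2 = v x ^ 2 - 2 * m * |v x| + m ^ 2 := by
      intro x; rw [sub_sq, sq_abs]; ring
    simp only [this]
    rw [integral_add (f := fun x => v x ^ 2 - 2 * m * |v x|) (i2.sub (i1.const_mul _))
      (integrable_const _), integral_sub i2 (i1.const_mul _), integral_const_mul]
    simp [hlr.le, mul_comm]
  have h2 : ∫ x in Ioo l r, |v x| = m * (r - l) := by rw [hm]; field_simp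
  rw [h1, h2] at h0
  rw [h2]
  nlinarith

theorem intervalIntegrable_of_memLp (hlr : l ≤ r) {v : ℝ → ℝ}
    (hv : MemLp v 2 (volume.restrict (Ioo l r))) : IntervalIntegrable v volume l r := by
  rw [intervalIntegrable_iff_integrableOn_Ioc_of_le hlr, integrableOn_Ioc_iff_integrableOn_Ioo]
  exact hv.integrable (by norm_num)

theorem exists_antiderivative (p : ℝ[X]) :
    ∃ P : ℝ[X], derivative P = p ∧ P.natDegree ≤ p.natDegree + 1 := by
  refine ⟨∑ n ∈ Finset.range (p.natDegree + 1), C (p.coeff n / (n + 1)) * X ^ (n + 1), ?_, ?_⟩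
  · conv_rhs => rw [p.as_sum_range_C_mul_X_pow]
    rw [derivative_sum]
    refine Finset.sum_congr rfl fun n _ => ?_
    rw [derivative_C_mul_X_pow]
    have : ((n : ℝ) + 1) ≠ 0 := by positivity
    push_cast
    rw [div_mul_cancel₀ _ this]
  · refine natDegree_sum_le_of_forall_le _ _ fun n hn => (natDegree_C_mul_X_pow_le _ _).trans ?_
    exact Finset.mem_range.1 hn

/-- A Taylor polynomial built by induction: integrate the polynomial that approximates the first
derivative. Every integration gains one factor of the length. -/
theorem ae_le_of_weakDeriv_chain (hlr : l < r) : ∀ (m : ℕ) (v : Fin (m + 2) → ℝ → ℝ),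
    (∀ j, IntervalIntegrable (v j) volume l r) →
    (∀ j : Fin (m + 1), HasWeakDerivOn (Ioo l r) (v j.castSucc) (v j.succ)) →
    ∃ T : ℝ[X], T.natDegree ≤ m ∧ ∀ᵐ x ∂volume.restrict (Ioo l r),
      |v 0 x - T.eval x| ≤ (r - l) ^ m * ∫ x in l..r, |v (Fin.last (m + 1)) x| := by
  have sub_le : ∀ {f : ℝ → ℝ}, IntervalIntegrable f volume l r → ∀ x ∈ Ioo l r,
      |∫ y in l..x, f y| ≤ ∫ y in l..r, |f y| := by
    intro f hf x hx
    have hs : IntervalIntegrable f volume l x := hf.mono_set (by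
      rw [uIcc_of_le hx.1.le, uIcc_of_le hlr.le]; exact Icc_subset_Icc_right hx.2.le)
    refine (intervalIntegral.abs_integral_le_integral_abs hx.1.le).trans ?_
    exact intervalIntegral.integral_mono_interval le_rfl hx.1.le hx.2.le
      (Filter.Eventually.of_forall fun y => abs_nonneg _) hf.abs
  intro m
  induction m with
  | zero =>
    intro v hv h
    obtain ⟨c, hc⟩ := (h 0).exists_ae_eq hlr (hv _) (hv _)
    refine ⟨C c, by simp, ?_⟩
    filter_upwards [hc, ae_restrict_mem measurableSet_Ioo] with x hx hxm
    rw [Fin.castSucc_zero] at hx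
    rw [hx, eval_C, add_sub_cancel_left, pow_zero, one_mul]
    exact sub_le (hv _) x hxm
  | succ m ih =>
    intro v hv h
    obtain ⟨T, hT, hb⟩ := ih (fun j => v j.succ) (fun j => hv _) fun j => h j.succ
    obtain ⟨c, hc⟩ := (h 0).exists_ae_eq hlr (hv _) (hv _)
    obtain ⟨P, hP, hPd⟩ := exists_antiderivative T
    refine ⟨P + C (c - P.eval l), ?_, ?_⟩
    · exact (natDegree_add_C).trans_le (hPd.trans (by omega))
    filter_upwards [hc, ae_restrict_mem measurableSet_Ioo] with x hx hxm
    rw [Fin.castSucc_zero] at hx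
    have e1 : P.eval x - P.eval l = ∫ y in l..x, T.eval y := by
      rw [intervalIntegral.integral_eq_sub_of_hasDerivAt
        (fun y _ => hP ▸ P.hasDerivAt y) (T.continuous.intervalIntegrable _ _)]
    have hs : IntervalIntegrable (v (Fin.succ 0)) volume l x := (hv _).mono_set (by
      rw [uIcc_of_le hxm.1.le, uIcc_of_le hlr.le]; exact Icc_subset_Icc_right hxm.2.le)
    have e2 : v 0 x - (P + C (c - P.eval l)).eval x
        = ∫ y in l..x, (v (Fin.succ 0) y - T.eval y) := by
      rw [intervalIntegral.integral_sub hs (T.continuous.intervalIntegrable _ _), ← e1, hx]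
      simp only [eval_add, eval_C]; ring
    set K := ∫ x in l..r, |v (Fin.last (m + 1)).succ x| with hK
    have hK0 : 0 ≤ K := intervalIntegral.integral_nonneg hlr.le fun _ _ => abs_nonneg _
    have e3 : ∫ y in l..r, |v (Fin.succ 0) y - T.eval y| ≤ (r - l) * ((r - l) ^ m * K) := by
      have hi : IntervalIntegrable (fun y => |v (Fin.succ 0) y - T.eval y|) volume l r :=
        ((hv _).sub (T.continuous.intervalIntegrable _ _)).abs
      have := intervalIntegral.integral_mono_ae_restrict hlr.le hi
        (intervalIntegrable_const (c := (r - l) ^ m * K)) (by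
          rw [← restrict_Ioo_eq_restrict_Icc]
          exact hb)
      simpa [mul_left_comm] using this
    rw [e2, pow_succ]
    refine (sub_le ((hv _).sub (T.continuous.intervalIntegrable _ _)) x hxm).trans (e3.trans ?_)
    rw [Fin.succ_last] at hK
    rw [← hK]
    exact le_of_eq (by ring)

theorem le_on_Icc_of_ae_le (hlr : l < r) {f : ℝ → ℝ} {K : ℝ} (hf : ContinuousOn f (Icc l r))
    (h : ∀ᵐ x ∂volume.restrict (Ioo l r), f x ≤ K) : ∀ x ∈ Icc l r, f x ≤ K := by
  have h1 : EqOn (fun x => max (f x) K) (fun _ => K) (Icc l r) := by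
    refine eqOn_Icc_of_ae_eq hlr (ContinuousOn.sup hf continuousOn_const) continuousOn_const ?_
    filter_upwards [h] with x hx
    exact max_eq_right hx
  intro x hx
  have := h1 hx
  simp only at this
  exact (le_max_left _ _).trans this.le

theorem memLp_mono_set {D D' : Set ℝ} {v : ℝ → ℝ} (hv : MemLp v 2 (volume.restrict D))
    (h : D' ⊆ D) : MemLp v 2 (volume.restrict D') :=
  hv.mono_measure (Measure.restrict_mono h le_rfl)

theorem setIntegral_sq_mono {D D' : Set ℝ} {v : ℝ → ℝ} (hv : MemLp v 2 (volume.restrict D))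
    (h : D' ⊆ D) : ∫ x in D', v x ^ 2 ≤ ∫ x in D, v x ^ 2 :=
  setIntegral_mono_set hv.integrable_sq (Filter.Eventually.of_forall fun _ => sq_nonneg _)
    h.eventuallyLE

/-- Hölder continuity of functions with a square integrable derivative. -/
theorem InSob.abs_sub_le {D : Set ℝ} {m : ℕ} {B : ℝ} {w : ℝ → ℝ} (h : InSob D (m + 1) B w)
    (hB : 0 ≤ B) (hlr : l < r) (hD : Ioo l r ⊆ D) (hw : ContinuousOn w (Icc l r)) {x y : ℝ}
    (hx : x ∈ Icc l r) (hy : y ∈ Icc l r) : |w y - w x| ≤ Real.sqrt |y - x| * B := by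
  wlog hxy : x ≤ y generalizing x y
  · rw [abs_sub_comm, abs_sub_comm y]; exact this hy hx (le_of_not_ge hxy)
  rcases hxy.eq_or_lt with rfl | hxy
  · simp
  obtain ⟨v, h1, h2, h3, h4⟩ := h
  have hi : IntervalIntegrable (v (Fin.succ 0)) volume l r :=
    intervalIntegrable_of_memLp hlr.le (memLp_mono_set (h1 _) hD)
  have hp : IsPrim l r w (v (Fin.succ 0)) := HasWeakDerivOn.isPrim hlr hw
    (ae_restrict_of_ae_restrict_of_subset hD h3) hi ((h2 0).mono hD)
  have hsub : uIcc x y ⊆ uIcc l r := by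
    rw [uIcc_of_le hxy.le, uIcc_of_le hlr.le]; exact Icc_subset_Icc hx.1 hy.2
  have e1 : w y - w x = ∫ s in x..y, v (Fin.succ 0) s := by
    have i1 : IntervalIntegrable (v (Fin.succ 0)) volume l x := hi.mono_set (by
      rw [uIcc_of_le hx.1, uIcc_of_le hlr.le]; exact Icc_subset_Icc_right hx.2)
    rw [hp.2 y hy, hp.2 x hx, ← intervalIntegral.integral_add_adjacent_intervals i1
      (hi.mono_set hsub)]
    ring
  have hDxy : Ioo x y ⊆ D := (Ioo_subset_Ioo hx.1 hy.2).trans hD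
  have e2 := sq_integral_abs_le hxy (memLp_mono_set (h1 (Fin.succ 0)) hDxy)
  have e3 := (setIntegral_sq_mono (h1 (Fin.succ 0)) hDxy).trans (h4 _)
  rw [abs_of_pos (sub_pos.2 hxy), e1]
  refine (intervalIntegral.abs_integral_le_integral_abs hxy.le).trans ?_
  refine abs_le_of_sq_le_sq' ?_ (by positivity) |>.2
  rw [mul_pow, Real.sq_sqrt (sub_pos.2 hxy).le]
  exact e2.trans (mul_le_mul_of_nonneg_left e3 (sub_pos.2 hxy).le)

/-- A Sobolev inequality. -/
theorem InSob.abs_le {D : Set ℝ} {m : ℕ} {B : ℝ} {w : ℝ → ℝ} (h : InSob D (m + 1) B w)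
    (hB : 0 ≤ B) (hlr : l < r) (hD : Ioo l r ⊆ D) (hw : ContinuousOn w (Icc l r)) {x : ℝ}
    (hx : x ∈ Icc l r) :
    |w x| ≤ (Real.sqrt (r - l) / (r - l) + Real.sqrt (r - l)) * B := by
  have hh : 0 < r - l := sub_pos.2 hlr
  have h5 : ∀ y ∈ Icc l r, |w x| ≤ |w y| + Real.sqrt (r - l) * B := by
    intro y hy
    have := h.abs_sub_le hB hlr hD hw hy hx
    have h6 : Real.sqrt |x - y| ≤ Real.sqrt (r - l) := Real.sqrt_le_sqrt
      (abs_sub_le_iff.2 ⟨by linarith [hx.2, hy.1], by linarith [hx.1, hy.2]⟩)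
    have h7 := mul_le_mul_of_nonneg_right h6 hB
    have h8 := abs_sub_abs_le_abs_sub (w x) (w y)
    linarith
  have hi : IntervalIntegrable (fun y => |w y|) volume l r :=
    (hw.abs).intervalIntegrable_of_Icc hlr.le
  have h6 := intervalIntegral.integral_mono_on hlr.le (intervalIntegrable_const)
    (hi.add intervalIntegrable_const) h5
  rw [intervalIntegral.integral_add hi intervalIntegrable_const] at h6
  simp only [intervalIntegral.integral_const, smul_eq_mul] at h6
  obtain ⟨v, h1, h2, h3, h4⟩ := h
  have hc : ∀ᵐ y ∂volume.restrict (Ioo l r), v 0 y = w y :=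
    ae_restrict_of_ae_restrict_of_subset hD h3
  have e0 : MemLp w 2 (volume.restrict (Ioo l r)) := (memLp_mono_set (h1 0) hD).ae_eq hc
  have e2 := sq_integral_abs_le hlr e0
  have e3 : ∫ x in Ioo l r, w x ^ 2 ≤ B ^ 2 := by
    refine le_trans (le_of_eq (integral_congr_ae ?_))
      ((setIntegral_sq_mono (h1 0) hD).trans (h4 0))
    filter_upwards [hc] with y hy
    rw [hy]
  have e4 : ∫ x in l..r, |w x| ≤ Real.sqrt (r - l) * B := by
    refine abs_le_of_sq_le_sq' ?_ (by positivity) |>.2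
    rw [mul_pow, Real.sq_sqrt hh.le]
    exact e2.trans (mul_le_mul_of_nonneg_left e3 hh.le)
  have e5 : (r - l) * |w x| ≤ (r - l) * ((Real.sqrt (r - l) / (r - l) + Real.sqrt (r - l)) * B) := by
    calc _ ≤ Real.sqrt (r - l) * B + (r - l) * (Real.sqrt (r - l) * B) := by linarith
      _ = _ := by field_simp
  exact le_of_mul_le_mul_left e5 hh

/-- The classical derivative of a function in `H^{m+1}` is in `H^m`. -/
theorem InSob.deriv {D : Set ℝ} {m : ℕ} {B : ℝ} {w q : ℝ → ℝ} (h : InSob D (m + 1) B w)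
    (hq : ∀ {v : ℝ → ℝ}, MemLp v 2 (volume.restrict D) → HasWeakDerivOn D w v →
      v =ᵐ[volume.restrict D] q) : InSob D m B q := by
  obtain ⟨v, h1, h2, h3, h4⟩ := h
  exact ⟨fun j => v j.succ, fun j => h1 _, fun j => h2 j.succ,
    hq (h1 _) ((h2 0).congr h3 Filter.EventuallyEq.rfl), fun j => h4 _⟩

theorem locallyIntegrableOn_of_memLp {D : Set ℝ} {v : ℝ → ℝ}
    (hv : MemLp v 2 (volume.restrict D)) : LocallyIntegrableOn v D := by
  intro x hx
  refine ⟨Ioo (x - 1) (x + 1) ∩ D, Filter.inter_mem (mem_nhdsWithin_of_mem_nhds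
    (Ioo_mem_nhds (by linarith) (by linarith))) self_mem_nhdsWithin, ?_⟩
  have hm := memLp_mono_set hv (D' := Ioo (x - 1) (x + 1) ∩ D) inter_subset_right
  have : IsFiniteMeasure (volume.restrict (Ioo (x - 1) (x + 1) ∩ D)) :=
    ⟨by
      rw [Measure.restrict_apply_univ]
      exact (measure_mono inter_subset_left).trans_lt (by simp)⟩
  exact hm.integrable (by norm_num)

/-- The Sobolev norms of a function do not depend on null sets. -/
theorem InSob.transfer {D D₀ : Set ℝ} (hD : IsOpen D) (hD₀ : IsOpen D₀) (he : D =ᵐ[volume] D₀)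
    {m : ℕ} {B B' : ℝ} {w : ℝ → ℝ} (h₀ : InSob D₀ m B w) (h : InSob D m B' w) :
    InSob D m B w := by
  obtain ⟨v, h1, h2, h3, h4⟩ := h
  obtain ⟨v₀, g1, g2, g3, g4⟩ := h₀
  have r0 : volume.restrict D = volume.restrict D₀ := Measure.restrict_congr_set he
  have r1 : volume.restrict (D ∩ D₀) = volume.restrict D := by
    refine Measure.restrict_congr_set ?_
    filter_upwards [he] with x hx
    exact propext ⟨fun h => h.1, fun h => ⟨h, cast hx h⟩⟩
  -- On the intersection, which has full measure, both families are weak derivatives of the same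
  -- function; uniqueness passes equality from one order to the next.
  have key : ∀ j, v j =ᵐ[volume.restrict D] v₀ j := by
    intro j
    induction j using Fin.induction with
    | zero => rw [← r0] at g3; exact h3.trans g3.symm
    | succ j ih =>
      rw [← r1]
      have d1 : HasWeakDerivOn (D ∩ D₀) (v j.castSucc) (v j.succ) := (h2 j).mono inter_subset_left
      have d2 : HasWeakDerivOn (D ∩ D₀) (v₀ j.castSucc) (v₀ j.succ) :=
        (g2 j).mono inter_subset_right
      rw [← r1] at ih
      exact (d1.congr ih Filter.EventuallyEq.rfl).unique (hD.inter hD₀)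
        (locallyIntegrableOn_of_memLp (memLp_mono_set (h1 _) inter_subset_left))
        (locallyIntegrableOn_of_memLp (memLp_mono_set (g1 _) inter_subset_right)) d2
  refine ⟨v, h1, h2, h3, fun j => (le_of_eq ?_).trans (g4 j)⟩
  rw [← r0]
  refine integral_congr_ae ?_
  filter_upwards [key j] with x hx
  rw [hx]

namespace Mesh

variable {a b : ℝ} (M : Mesh a b)

theorem isOpen_elements : IsOpen M.elements := isOpen_iUnion fun _ => isOpen_Ioo

theorem Ioo_subset_elements (i : Fin M.N) : Ioo (M.xl i) (M.xr i) ⊆ M.elements :=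
  subset_iUnion (fun i => Ioo (M.xl i) (M.xr i)) i

theorem elements_subset : M.elements ⊆ Ioo a b :=
  iUnion_subset fun i => Ioo_subset_Ioo (M.le_xl i) (M.xr_le i)

theorem mem_elements_or_mem_range {x : ℝ} (ha : a < x) (hb : x < b) :
    x ∈ M.elements ∨ x ∈ range M.node := by
  by_contra! hn
  have : ∀ j, M.node j < x := by
    intro j
    induction j using Fin.induction with
    | zero => rwa [M.node_zero]
    | succ j ih =>
      by_contra hx
      have hne : M.node j.succ ≠ x := fun h => hn.2 ⟨_, h⟩
      exact hn.1 (mem_iUnion.2 ⟨j, ih, lt_of_le_of_ne (not_lt.1 hx) hne.symm⟩)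
  have := this (Fin.last _)
  rw [M.node_last] at this
  linarith

theorem elements_ae_eq : M.elements =ᵐ[volume] Ioo a b := by
  refine Filter.EventuallyLE.antisymm M.elements_subset.eventuallyLE ?_
  have : ∀ᵐ x, x ∉ range M.node := by
    rw [ae_iff]
    simp only [not_not]
    exact (finite_range M.node).measure_zero volume
  filter_upwards [this] with x hx hxm
  exact (M.mem_elements_or_mem_range hxm.1 hxm.2).resolve_right hx

theorem pairwise_disjoint_elements :
    Pairwise (Function.onFun Disjoint fun i => Ioo (M.xl i) (M.xr i)) := by
  have key : ∀ i j : Fin M.N, i < j → Disjoint (Ioo (M.xl i) (M.xr i)) (Ioo (M.xl j) (M.xr j)) := by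
    intro i j hij
    have h1 : M.xr i ≤ M.xl j := M.strictMono.monotone (Fin.succ_le_castSucc_iff.2 hij)
    rw [Set.disjoint_left]
    intro x hx hx'
    linarith [hx.2, hx'.1]
  intro i j hij
  rcases lt_or_gt_of_ne hij with h | h
  · exact key i j h
  · exact (key j i h).symm

theorem setIntegral_elements {f : ℝ → ℝ} (hf : IntegrableOn f M.elements) :
    ∫ x in M.elements, f x = ∑ i, ∫ x in Ioo (M.xl i) (M.xr i), f x :=
  integral_iUnion_fintype (fun _ => measurableSet_Ioo) M.pairwise_disjoint_elements
    fun i => hf.mono_set (M.Ioo_subset_elements i)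

end Mesh

/-- The approximation property of the `L²` projection. -/
theorem InSob.sum_resid_sq_le {a b : ℝ} {M : Mesh a b} {m N : ℕ} {B : ℝ} {w : ℝ → ℝ}
    (h : InSob M.elements (m + 1) B w)
    (hw : ∀ i, ContinuousOn w (Icc (M.xl i) (M.xr i))) (hN : m + 1 ≤ N) :
    ∑ i, residL N (M.xl i) (M.xr i) w ^ 2 ≤ (N ^ 2 + 1) ^ 2 * M.size ^ (2 * m + 1) * B ^ 2 ∧
    ∑ i, residR N (M.xl i) (M.xr i) w ^ 2 ≤ (N ^ 2 + 1) ^ 2 * M.size ^ (2 * m + 1) * B ^ 2 := by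
  obtain ⟨v, h1, h2, h3, h4⟩ := h
  have key : ∀ i, residL N (M.xl i) (M.xr i) w ^ 2
      ≤ (N ^ 2 + 1) ^ 2 * M.size ^ (2 * m + 1) * ∫ x in Ioo (M.xl i) (M.xr i), v (Fin.last _) x ^ 2 ∧
      residR N (M.xl i) (M.xr i) w ^ 2
      ≤ (N ^ 2 + 1) ^ 2 * M.size ^ (2 * m + 1)
        * ∫ x in Ioo (M.xl i) (M.xr i), v (Fin.last _) x ^ 2 := by
    intro i
    have hlr := M.xl_lt_xr i
    have hD := M.Ioo_subset_elements i
    have hc := hw i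
    obtain ⟨T, hT, hb⟩ := ae_le_of_weakDeriv_chain hlr m v
      (fun j => intervalIntegrable_of_memLp hlr.le (memLp_mono_set (h1 j) hD)) fun j => (h2 j).mono hD
    set K := (M.xr i - M.xl i) ^ m * ∫ x in (M.xl i)..(M.xr i), |v (Fin.last (m + 1)) x| with hK
    have hb' : ∀ x ∈ Icc (M.xl i) (M.xr i), |w x - T.eval x| ≤ K := by
      refine le_on_Icc_of_ae_le hlr (hc.sub T.continuous.continuousOn).abs ?_
      filter_upwards [hb, ae_restrict_of_ae_restrict_of_subset hD h3] with x hx hx'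
      rwa [← hx']
    obtain ⟨r1, r2⟩ := abs_resid_le hlr hc (n := N)
      (degreeLT_mono hN (mem_degreeLT_iff.2 hT)) hb'
    -- Cauchy–Schwarz turns the `L¹` norm of the highest derivative into its `L²` norm and
    -- contributes the odd power of the length.
    have hK2 : K ^ 2 ≤ M.size ^ (2 * m + 1) * ∫ x in Ioo (M.xl i) (M.xr i), v (Fin.last _) x ^ 2 := by
      have e1 := sq_integral_abs_le hlr (memLp_mono_set (h1 (Fin.last (m + 1))) hD)
      have e2 := M.len_le_size i
      have e3 := M.len_pos i
      have e4 : 0 ≤ ∫ x in Ioo (M.xl i) (M.xr i), v (Fin.last _) x ^ 2 :=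
        integral_nonneg fun _ => sq_nonneg _
      rw [hK, mul_pow]
      calc _ ≤ ((M.xr i - M.xl i) ^ m) ^ 2 * ((M.xr i - M.xl i)
            * ∫ x in Ioo (M.xl i) (M.xr i), v (Fin.last _) x ^ 2) := by gcongr
        _ = (M.xr i - M.xl i) ^ (2 * m + 1)
            * ∫ x in Ioo (M.xl i) (M.xr i), v (Fin.last _) x ^ 2 := by ring
        _ ≤ _ := by gcongr
    have fin : ∀ y : ℝ, |y| ≤ ((N : ℝ) ^ 2 + 1) * K → y ^ 2 ≤ (N ^ 2 + 1) ^ 2 * M.size ^ (2 * m + 1)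
        * ∫ x in Ioo (M.xl i) (M.xr i), v (Fin.last _) x ^ 2 := by
      intro y hy
      rw [← sq_abs y]
      refine (pow_le_pow_left₀ (abs_nonneg _) hy 2).trans ?_
      rw [mul_pow, mul_assoc]
      exact mul_le_mul_of_nonneg_left hK2 (by positivity)
    exact ⟨fin _ r1, fin _ r2⟩
  have hsum : (N ^ 2 + 1) ^ 2 * M.size ^ (2 * m + 1)
      * ∑ i, ∫ x in Ioo (M.xl i) (M.xr i), v (Fin.last _) x ^ 2
      ≤ (N ^ 2 + 1) ^ 2 * M.size ^ (2 * m + 1) * B ^ 2 := by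
    rw [← M.setIntegral_elements (h1 _).integrable_sq]
    exact mul_le_mul_of_nonneg_left (h4 _)
      (mul_nonneg (by positivity) (pow_nonneg M.size_nonneg _))
  rw [Finset.mul_sum] at hsum
  exact ⟨(Finset.sum_le_sum fun i _ => (key i).1).trans hsum,
    (Finset.sum_le_sum fun i _ => (key i).2).trans hsum⟩

end KdVHDG

end

noncomputable section

namespace KdVHDG

/-! ### Regularity in time -/

theorem InSob.mono {D : Set ℝ} {m : ℕ} {B B' : ℝ} {w : ℝ → ℝ} (h : InSob D m B w) (hB : 0 ≤ B)
    (hBB : B ≤ B') : InSob D m B' w := by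
  obtain ⟨v, h1, h2, h3, h4⟩ := h
  exact ⟨v, h1, h2, h3, fun j => (h4 j).trans (pow_le_pow_left₀ hB hBB 2)⟩

section Bochner

variable {X : Type*} [NormedAddCommGroup X] [NormedSpace ℝ X] {T : ℝ}

theorem exists_lipschitz_of_primitive (hT : 0 ≤ T) {F G : ℝ → X}
    (hG : MemLp G ∞ (volume.restrict (Ioc 0 T)))
    (h : ∀ t ∈ Icc 0 T, F t = F 0 + ∫ s in (0 : ℝ)..t, G s) :
    ∃ L, 0 ≤ L ∧ ∀ s ∈ Icc 0 T, ∀ t ∈ Icc 0 T,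
      ‖F t - F s‖ ≤ L * |t - s| ∧ F t - F s = ∫ ρ in s..t, G ρ := by
  have hGi : IntervalIntegrable G volume 0 T :=
    (intervalIntegrable_iff_integrableOn_Ioc_of_le hT).2 (hG.integrable le_top)
  have hGs : ∀ s ∈ Icc 0 T, ∀ t ∈ Icc 0 T, IntervalIntegrable G volume s t := fun s hs t ht =>
    hGi.mono_set (by rw [uIcc_of_le hT]; exact uIcc_subset_Icc hs ht)
  have h0 : (0 : ℝ) ∈ Icc 0 T := left_mem_Icc.2 hT
  refine ⟨(eLpNormEssSup G (volume.restrict (Ioc 0 T))).toReal, ENNReal.toReal_nonneg,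
    fun s hs t ht => ?_⟩
  have e : F t - F s = ∫ ρ in s..t, G ρ := by
    rw [h t ht, h s hs, ← intervalIntegral.integral_add_adjacent_intervals (hGs 0 h0 s hs)
      (hGs s hs t ht)]
    abel
  refine ⟨?_, e⟩
  rw [e]
  refine intervalIntegral.norm_integral_le_of_norm_le_const_ae ?_
  have hfin : eLpNormEssSup G (volume.restrict (Ioc 0 T)) ≠ ⊤ := by
    rw [← eLpNorm_exponent_top]; exact hG.2.ne
  have hae := ae_le_eLpNormEssSup (f := G) (μ := volume.restrict (Ioc 0 T))
  rw [ae_restrict_iff' measurableSet_Ioc] at hae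
  filter_upwards [hae] with x hx hxm
  have hxm' : x ∈ Ioc 0 T := ⟨(le_min hs.1 ht.1).trans_lt hxm.1, hxm.2.trans (max_le hs.2 ht.2)⟩
  have := hx hxm'
  rw [← toReal_enorm]
  exact ENNReal.toReal_mono hfin this

theorem MemWInfty.exists_bound {r : ℕ} (hr : 1 ≤ r) (hT : 0 ≤ T) {V : ℝ → X}
    (h : MemWInfty r T V) : ∃ L, 0 ≤ L ∧ (∀ t ∈ Icc 0 T, ‖V t‖ ≤ L) ∧
      ∀ s ∈ Icc 0 T, ∀ t ∈ Icc 0 T, ‖V t - V s‖ ≤ L * |t - s| := by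
  obtain ⟨G, h0, h1, h2⟩ := h
  obtain ⟨L, hL, hb⟩ := exists_lipschitz_of_primitive hT (h1 1 hr) (h2 0 hr)
  have hz : (0 : ℝ) ∈ Icc 0 T := left_mem_Icc.2 hT
  have hb' : ∀ s ∈ Icc 0 T, ∀ t ∈ Icc 0 T, ‖V t - V s‖ ≤ L * |t - s| := by
    intro s hs t ht
    rw [← h0 t ht, ← h0 s hs]
    exact (hb s hs t ht).1
  refine ⟨max L (‖V 0‖ + L * T), le_max_of_le_left hL, fun t ht => ?_, fun s hs t ht =>
    (hb' s hs t ht).trans (mul_le_mul_of_nonneg_right (le_max_left _ _) (abs_nonneg _))⟩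
  refine le_trans ?_ (le_max_right _ _)
  have e1 := hb' 0 hz t ht
  rw [sub_zero, abs_of_nonneg ht.1] at e1
  have e2 := mul_le_mul_of_nonneg_left ht.2 hL
  have e3 := norm_sub_norm_le (V t) (V 0)
  linarith

/-- The second difference is the integral over `[0, d]` of `V'(t + ρ) - V'(s + ρ)`, and `V'` is
Lipschitz. -/
theorem MemWInfty.exists_second_difference_le {r : ℕ} (hr : 2 ≤ r) (hT : 0 ≤ T) {V : ℝ → X}
    (h : MemWInfty r T V) : ∃ L, 0 ≤ L ∧ ∀ s t d, 0 ≤ d → s ∈ Icc 0 T → t ∈ Icc 0 T →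
      s + d ∈ Icc 0 T → t + d ∈ Icc 0 T →
      ‖V (t + d) - V t - (V (s + d) - V s)‖ ≤ L * |t - s| * d := by
  obtain ⟨G, h0, h1, h2⟩ := h
  obtain ⟨_, _, hb⟩ := exists_lipschitz_of_primitive hT (h1 1 (by omega)) (h2 0 (by omega))
  obtain ⟨L, hL, hc⟩ := exists_lipschitz_of_primitive hT (h1 2 hr) (h2 1 (by omega))
  refine ⟨L, hL, fun s t d hd hs ht hsd htd => ?_⟩
  have hcont : ContinuousOn (G 1) (Icc 0 T) := by
    have : LipschitzOnWith (Real.toNNReal L) (G 1) (Icc 0 T) :=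
      LipschitzOnWith.of_dist_le_mul fun x hx y hy => by
        rw [dist_eq_norm, Real.dist_eq, Real.coe_toNNReal L hL]
        exact (hc y hy x hx).1
    exact this.continuousOn
  have shift : ∀ t ∈ Icc 0 T, t + d ∈ Icc 0 T →
      IntervalIntegrable (fun ρ => G 1 (t + ρ)) volume 0 d ∧
      V (t + d) - V t = ∫ ρ in (0 : ℝ)..d, G 1 (t + ρ) := by
    intro t ht htd
    constructor
    · refine ContinuousOn.intervalIntegrable_of_Icc hd (hcont.comp (by fun_prop) fun ρ hρ => ?_)
      exact ⟨by linarith [ht.1, hρ.1], by linarith [htd.2, hρ.2]⟩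
    · rw [intervalIntegral.integral_comp_add_left, add_zero, ← (hb t ht (t + d) htd).2,
        h0 _ ht, h0 _ htd]
  rw [(shift t ht htd).2, (shift s hs hsd).2,
    ← intervalIntegral.integral_sub (shift t ht htd).1 (shift s hs hsd).1]
  have := intervalIntegral.norm_integral_le_of_norm_le_const (a := 0) (b := d) (C := L * |t - s|)
    (f := fun ρ => G 1 (t + ρ) - G 1 (s + ρ)) fun ρ hρ => by
      rw [uIoc_of_le hd] at hρ
      have := (hc (s + ρ) ⟨by linarith [hs.1, hρ.1], by linarith [hsd.2, hρ.2]⟩ (t + ρ)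
        ⟨by linarith [ht.1, hρ.1], by linarith [htd.2, hρ.2]⟩).1
      rwa [add_sub_add_right_eq_sub] at this
  rwa [sub_zero, abs_of_nonneg hd] at this

end Bochner

/-- `v` is bounded and Lipschitz continuous in time, with values in `H^m(D)`. -/
structure TimeReg (D : Set ℝ) (m : ℕ) (T L : ℝ) (v : ℝ → ℝ → ℝ) : Prop where
  nonneg : 0 ≤ L
  bound : ∀ t ∈ Icc 0 T, InSob D m L (v t)
  lip : ∀ s ∈ Icc 0 T, ∀ t ∈ Icc 0 T, InSob D m (L * |t - s|) fun x => v t x - v s x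

/-- The second differences in time of `v` are bounded in `H^m(D)`. -/
def TimeReg₂ (D : Set ℝ) (m : ℕ) (T L : ℝ) (v : ℝ → ℝ → ℝ) : Prop :=
  ∀ s t d, 0 ≤ d → s ∈ Icc 0 T → t ∈ Icc 0 T → s + d ∈ Icc 0 T → t + d ∈ Icc 0 T →
    InSob D m (L * |t - s| * d) fun x => v (t + d) x - v t x - (v (s + d) x - v s x)

variable {D D₀ : Set ℝ} {m : ℕ} {T L L' : ℝ} {v : ℝ → ℝ → ℝ}

theorem TimeReg.mono (h : TimeReg D m T L v) (hL : L ≤ L') : TimeReg D m T L' v where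
  nonneg := h.nonneg.trans hL
  bound t ht := (h.bound t ht).mono h.nonneg hL
  lip s hs t ht := (h.lip s hs t ht).mono (mul_nonneg h.nonneg (abs_nonneg _))
    (mul_le_mul_of_nonneg_right hL (abs_nonneg _))

theorem TimeReg₂.mono (h : TimeReg₂ D m T L v) (h0 : 0 ≤ L) (hL : L ≤ L') :
    TimeReg₂ D m T L' v := fun s t d hd hs ht hsd htd =>
  (h s t d hd hs ht hsd htd).mono (by positivity) (by gcongr)

theorem TimeReg.transfer (hD : IsOpen D) (hD₀ : IsOpen D₀) (he : D =ᵐ[volume] D₀)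
    (h₀ : TimeReg D₀ m T L v) (h : TimeReg D m T L' v) : TimeReg D m T L v where
  nonneg := h₀.nonneg
  bound t ht := (h₀.bound t ht).transfer hD hD₀ he (h.bound t ht)
  lip s hs t ht := (h₀.lip s hs t ht).transfer hD hD₀ he (h.lip s hs t ht)

theorem TimeReg₂.transfer (hD : IsOpen D) (hD₀ : IsOpen D₀) (he : D =ᵐ[volume] D₀)
    (h₀ : TimeReg₂ D₀ m T L v) (h : TimeReg₂ D m T L' v) : TimeReg₂ D m T L v :=
  fun s t d hd hs ht hsd htd =>
    (h₀ s t d hd hs ht hsd htd).transfer hD hD₀ he (h s t d hd hs ht hsd htd)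

theorem MemWInftySobolev.exists_timeReg {r : ℕ} (hr : 1 ≤ r) (hT : 0 ≤ T)
    (h : MemWInftySobolev r T m D v) : ∃ L, TimeReg D m T L v := by
  obtain ⟨V, hV, he⟩ := h
  obtain ⟨L, hL, h1, h2⟩ := hV.exists_bound hr hT
  refine ⟨L, hL, fun t ht => ((V t).inSob.congr (he t ht)).mono (norm_nonneg _) (h1 t ht),
    fun s hs t ht => ((V t - V s).inSob.congr ?_).mono (norm_nonneg _) (h2 s hs t ht)⟩
  filter_upwards [he t ht, he s hs,
    Lp.coeFn_sub ((V t : L2Tuple m D) 0) ((V s : L2Tuple m D) 0)] with x e1 e2 e3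
  rw [Submodule.coe_sub, PiLp.sub_apply, e3, Pi.sub_apply, e1, e2]

theorem MemWInftySobolev.exists_timeReg₂ {r : ℕ} (hr : 2 ≤ r) (hT : 0 ≤ T)
    (h : MemWInftySobolev r T m D v) : ∃ L, 0 ≤ L ∧ TimeReg₂ D m T L v := by
  obtain ⟨V, hV, he⟩ := h
  obtain ⟨L, hL, h1⟩ := hV.exists_second_difference_le hr hT
  refine ⟨L, hL, fun s t d hd hs ht hsd htd =>
    ((V (t + d) - V t - (V (s + d) - V s)).inSob.congr ?_).mono (norm_nonneg _)
      (h1 s t d hd hs ht hsd htd)⟩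
  filter_upwards [he t ht, he s hs, he _ htd, he _ hsd,
    Lp.coeFn_sub ((V (t + d) : L2Tuple m D) 0) ((V t : L2Tuple m D) 0),
    Lp.coeFn_sub ((V (s + d) : L2Tuple m D) 0) ((V s : L2Tuple m D) 0),
    Lp.coeFn_sub ((V (t + d) : L2Tuple m D) 0 - (V t : L2Tuple m D) 0)
      ((V (s + d) : L2Tuple m D) 0 - (V s : L2Tuple m D) 0)] with x e1 e2 e3 e4 e5 e6 e7
  simp only [Submodule.coe_sub, PiLp.sub_apply]
  rw [e7, Pi.sub_apply, e5, e6, Pi.sub_apply, Pi.sub_apply, e1, e2, e3, e4]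

end KdVHDG

end

noncomputable section

namespace KdVHDG

open Filter Topology

/-! ### Differentiability in time of the derivatives in space -/

/-- A function that is approximated by differentiable functions up to functions with small
Lipschitz constant is differentiable. -/
theorem differentiableWithinAt_of_approx {S : Set ℝ} {t : ℝ} {f : ℝ → ℝ}
    (h : ∀ ε > 0, ∃ g : ℝ → ℝ, DifferentiableWithinAt ℝ g S t ∧
      ∀ s ∈ S, |(f s - g s) - (f t - g t)| ≤ ε * |s - t|) : DifferentiableWithinAt ℝ f S t := by
  rcases (𝓝[S \ {t}] t).eq_or_neBot with h0 | h0
  · have : HasDerivWithinAt f 0 S t := by rw [hasDerivWithinAt_iff_tendsto_slope, h0]; exact tendsto_bot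
    exact this.differentiableWithinAt
  -- The limit of the slopes is not known in advance; near `t` they cluster around the derivatives
  -- of the approximating functions, so they form a Cauchy filter.
  have hc : Cauchy (map (slope f t) (𝓝[S \ {t}] t)) := by
    rw [Metric.cauchy_iff]
    refine ⟨inferInstance, fun ε hε => ?_⟩
    obtain ⟨g, hg, hb⟩ := h (ε / 8) (by positivity)
    have h1 := hasDerivWithinAt_iff_tendsto_slope.1 hg.hasDerivWithinAt
    have h2 := Metric.tendsto_nhds.1 h1 (ε / 8) (by positivity)
    have h3 : ∀ᶠ s in 𝓝[S \ {t}] t, dist (slope f t s) (derivWithin g S t) ≤ ε / 4 := by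
      filter_upwards [h2, self_mem_nhdsWithin] with s hs hsS
      have hne : s - t ≠ 0 := sub_ne_zero.2 hsS.2
      have e1 := hb s hsS.1
      have e2 : slope f t s - slope g t s = ((f s - g s) - (f t - g t)) / (s - t) := by
        rw [slope_def_field, slope_def_field]; ring
      have e3 : dist (slope f t s) (slope g t s) ≤ ε / 8 := by
        rw [Real.dist_eq, e2, abs_div, div_le_iff₀ (abs_pos.2 hne)]
        exact e1
      exact (dist_triangle _ (slope g t s) _).trans (by linarith)
    refine ⟨{y | dist y (derivWithin g S t) ≤ ε / 4}, h3, fun x hx y hy => ?_⟩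
    have := dist_triangle_right x y (derivWithin g S t)
    rw [mem_ofPred_eq] at hx hy
    linarith
  obtain ⟨d, hd⟩ := CompleteSpace.complete hc
  have : HasDerivWithinAt f d S t := hasDerivWithinAt_iff_tendsto_slope.2 hd
  exact this.differentiableWithinAt

/-- If `w` is differentiable in time, then so is its derivative in space, if its time increments are
Hölder continuous in space. -/
theorem differentiableWithinAt_spatial_deriv {l r L : ℝ} (hlr : l < r) {S : Set ℝ}
    {w w' : ℝ → ℝ → ℝ}
    (hw : ∀ t ∈ S, ∀ x ∈ Icc l r, HasDerivWithinAt (w t) (w' t x) (Icc l r) x)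
    (hL : 0 ≤ L)
    (hh : ∀ s ∈ S, ∀ t ∈ S, ∀ x ∈ Icc l r, ∀ y ∈ Icc l r,
      |(w' t y - w' s y) - (w' t x - w' s x)| ≤ Real.sqrt |y - x| * (L * |t - s|))
    (hd : ∀ t ∈ S, ∀ x ∈ Icc l r, DifferentiableWithinAt ℝ (fun s => w s x) S t)
    {t : ℝ} (ht : t ∈ S) {x : ℝ} (hx : x ∈ Icc l r) :
    DifferentiableWithinAt ℝ (fun s => w' s x) S t := by
  refine differentiableWithinAt_of_approx fun ε hε => ?_
  -- The approximating function is a spatial difference quotient of `w` with nearby `y`. Hölder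
  -- continuity makes the error's Lipschitz constant in time at most `ε`.
  obtain ⟨y, hy, hyx, hyε⟩ : ∃ y ∈ Icc l r, y ≠ x ∧ Real.sqrt |y - x| * L ≤ ε := by
    have hlim : Tendsto (fun y => Real.sqrt |y - x| * L) (𝓝 x) (𝓝 0) := by
      have : Continuous fun y => Real.sqrt |y - x| * L := by fun_prop
      simpa using this.tendsto x
    have h1 : ∀ᶠ y in 𝓝[Icc l r \ {x}] x, Real.sqrt |y - x| * L ≤ ε :=
      (hlim.mono_left nhdsWithin_le_nhds).eventually (Iic_mem_nhds hε)
    have hne : (𝓝[Icc l r \ {x}] x).NeBot := by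
      have := (uniqueDiffOn_Icc hlr x hx).accPt
      rwa [accPt_principal_iff_nhdsWithin] at this
    obtain ⟨y, hy1, hy2⟩ := (h1.and self_mem_nhdsWithin).exists
    exact ⟨y, hy2.1, hy2.2, hy1⟩
  have hyx' : y - x ≠ 0 := sub_ne_zero.2 hyx
  refine ⟨fun s => (w s y - w s x) / (y - x), ((hd t ht y hy).sub (hd t ht x hx)).div_const _,
    fun s hs => ?_⟩
  have hsub : uIcc x y ⊆ Icc l r := uIcc_subset_Icc hx hy
  set D := w' s x - w' t x with hD
  have key := Convex.norm_image_sub_le_of_norm_hasDerivWithin_le (𝕜 := ℝ)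
    (f := fun ξ => w s ξ - w t ξ - D * ξ) (f' := fun ξ => w' s ξ - w' t ξ - D * 1) (s := uIcc x y)
    (C := Real.sqrt |y - x| * (L * |s - t|)) (x := x) (y := y)
    (fun ξ hξ => (((hw s hs ξ (hsub hξ)).sub (hw t ht ξ (hsub hξ))).sub
      ((hasDerivWithinAt_id ξ _).const_mul D)).mono hsub)
    (fun ξ hξ => by
      rw [mul_one, hD, Real.norm_eq_abs]
      refine (hh t ht s hs x hx ξ (hsub hξ)).trans (mul_le_mul_of_nonneg_right
        (Real.sqrt_le_sqrt ?_) (by positivity))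
      simpa using abs_sub_left_of_mem_uIcc hξ)
    (convex_uIcc x y) left_mem_uIcc right_mem_uIcc
  have e : (w' s x - (w s y - w s x) / (y - x)) - (w' t x - (w t y - w t x) / (y - x))
      = -((w s y - w t y - D * y) - (w s x - w t x - D * x)) / (y - x) := by
    rw [hD]; field_simp; ring
  rw [e, abs_div, abs_neg, div_le_iff₀ (abs_pos.2 hyx')]
  rw [Real.norm_eq_abs, Real.norm_eq_abs] at key
  refine key.trans (mul_le_mul_of_nonneg_right ?_ (abs_nonneg _))
  rw [← mul_assoc]
  exact mul_le_mul_of_nonneg_right hyε (abs_nonneg _)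

/-! ### The exact solution on a mesh -/

/-- `f` agrees almost everywhere with a continuous `P`, so `F` is a primitive of `P`; derivatives
are unique, hence `f = P` everywhere. This makes the traces of `p` meaningful. -/
theorem continuousOn_deriv_of_inSob {D : Set ℝ} {l r : ℝ} (hlr : l < r) (hD : Ioo l r ⊆ D) {m : ℕ}
    {B : ℝ} {F f : ℝ → ℝ} (hF : ∀ x ∈ Icc l r, HasDerivWithinAt F (f x) (Icc l r) x)
    (hf : InSob D (m + 1) B f) : ContinuousOn f (Icc l r) := by
  obtain ⟨v, h1, h2, h3, -⟩ := hf
  have hi : ∀ j, IntervalIntegrable (v j) volume l r := fun j =>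
    intervalIntegrable_of_memLp hlr.le (memLp_mono_set (h1 j) hD)
  have h3' := ae_restrict_of_ae_restrict_of_subset hD h3
  obtain ⟨c, hc⟩ := (((h2 0).mono hD).congr h3' EventuallyEq.rfl).exists_ae_eq hlr
    ((hi 0).congr_ae (by
      rw [uIoc_of_le hlr.le, ← restrict_Ioo_eq_restrict_Ioc]; exact h3')) (hi _)
  set P : ℝ → ℝ := fun x => c + ∫ y in l..x, v (Fin.succ 0) y with hP
  have hPc : ContinuousOn P (Icc l r) :=
    IsPrim.continuousOn (F := P) (f := v (Fin.succ 0)) ⟨hi _, fun x _ => by simp [hP]⟩ hlr.le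
  have hfi : IntervalIntegrable f volume l r := (hPc.intervalIntegrable_of_Icc hlr.le).congr_ae (by
    rw [uIoc_of_le hlr.le, ← restrict_Ioo_eq_restrict_Ioc]; exact hc.symm)
  have hFi : ∀ x ∈ Icc l r, F x = F l + ∫ y in l..x, P y := by
    intro x hx
    have hs : Icc l x ⊆ Icc l r := Icc_subset_Icc_right hx.2
    have e1 := intervalIntegral.integral_eq_sub_of_hasDeriv_right_of_le hx.1
      (fun y hy => ((hF y (hs hy)).mono hs).continuousWithinAt)
      (fun y hy => ((hF y (hs (Ioo_subset_Icc_self hy))).hasDerivAt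
        (Icc_mem_nhds hy.1 (hy.2.trans_le hx.2))).hasDerivWithinAt)
      (hfi.mono_set (by rwa [uIcc_of_le hx.1, uIcc_of_le hlr.le]))
    have e2 : ∫ y in l..x, P y = ∫ y in l..x, f y := by
      refine intervalIntegral.integral_congr_ae_restrict ?_
      rw [uIoc_of_le hx.1, ← restrict_Ioo_eq_restrict_Ioc]
      exact EventuallyEq.symm (ae_restrict_of_ae_restrict_of_subset (Ioo_subset_Ioo_right hx.2) hc)
    rw [e2, e1]; ring
  refine hPc.congr fun x hx => ?_
  have d1 : HasDerivWithinAt (fun x => F l + ∫ y in l..x, P y) (P x) (Icc l r) x := by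
    refine HasDerivWithinAt.const_add _ ?_
    have : Fact (x ∈ Icc l r) := ⟨hx⟩
    refine intervalIntegral.integral_hasDerivWithinAt_right
      ((hPc.mono (Icc_subset_Icc_right hx.2)).intervalIntegrable_of_Icc hx.1)
      (hPc.stronglyMeasurableAtFilter_nhdsWithin measurableSet_Icc x) (hPc x hx)
  exact (uniqueDiffOn_Icc hlr x hx).eq_deriv _ (hF x hx) (d1.congr hFi (hFi x hx))

end KdVHDG

end

noncomputable section

namespace KdVHDG

open Filter Topology MeshSys

/-! ### The error equations of the HDG method -/

/-- One-sided values that match at interior nodes come from one nodal function. The default `0` is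
reached only if there are no elements. -/
theorem exists_nodal {N : ℕ} {L R : Fin N → ℝ}
    (h : ∀ i j : Fin N, i.succ = j.castSucc → R i = L j) :
    ∃ P : Fin (N + 1) → ℝ, ∀ i, L i = P i.castSucc ∧ R i = P i.succ := by
  classical
  refine ⟨fun j => if hj : ∃ i : Fin N, i.castSucc = j then L hj.choose else
    if hj : ∃ i : Fin N, i.succ = j then R hj.choose else 0, fun i => ⟨?_, ?_⟩⟩
  · have hj : ∃ j : Fin N, j.castSucc = i.castSucc := ⟨i, rfl⟩
    simp only [dif_pos hj]
    rw [Fin.castSucc_injective _ hj.choose_spec]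
  · by_cases hj : ∃ j : Fin N, j.castSucc = i.succ
    · simp only [dif_pos hj]; exact h _ _ hj.choose_spec.symm
    · have hj' : ∃ j : Fin N, j.succ = i.succ := ⟨i, rfl⟩
      simp only [dif_neg hj, dif_pos hj']
      rw [Fin.succ_injective _ hj'.choose_spec]

namespace Mesh

variable {a b : ℝ} (M : Mesh a b) {k : ℕ}

theorem single_mem_W (i : Fin M.N) {v : ℝ[X]} (hv : v.natDegree ≤ k) :
    (Pi.single i v : M.PW) ∈ M.W k := by
  intro j
  rcases eq_or_ne j i with rfl | hj
  · rw [Pi.single_eq_same]; exact mem_degreeLE_iff.2 hv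
  · rw [Pi.single_eq_of_ne hj]; exact Submodule.zero_mem _

theorem pair_single (w : M.PW) (i : Fin M.N) (v : ℝ[X]) :
    M.pair w (Pi.single i v) = itg (M.xl i) (M.xr i) (w i * v) := by
  rw [pair, Finset.sum_eq_single i]
  · rw [itg_apply]
    exact intervalIntegral.integral_congr fun x _ => by simp
  · intro j _ hj; simp [Pi.single_eq_of_ne hj]
  · simp

theorem dx_single (i : Fin M.N) (v : ℝ[X]) :
    M.dx (Pi.single i v) = Pi.single i (derivative v) := by
  funext j
  rcases eq_or_ne j i with rfl | hj
  · simp [dx]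
  · simp [dx, Pi.single_eq_of_ne hj]

theorem pairFun_single (F : ℝ → ℝ) (i : Fin M.N) (v : ℝ[X]) :
    M.pairFun F (Pi.single i v) = ∫ x in (M.xl i)..(M.xr i), F x * v.eval x := by
  rw [pairFun, Finset.sum_eq_single i]
  · simp
  · intro j _ hj; simp [Pi.single_eq_of_ne hj]
  · simp

theorem bdry_single (ζm ζp : Fin M.N → ℝ) (i : Fin M.N) (v : ℝ[X]) :
    M.bdry ζm ζp (M.trm (Pi.single i v)) (M.trp (Pi.single i v))
      = ζm i * v.eval (M.xr i) - ζp i * v.eval (M.xl i) := by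
  rw [bdry, Finset.sum_eq_single i]
  · simp only [trm, trp, Pi.single_eq_same]; ring
  · intro j _ hj; simp [trm, trp, Pi.single_eq_of_ne hj]
  · simp

theorem bdry_nodal_single (ζm ζp : Fin M.N → ℝ) {i j : Fin M.N} (h : i.succ = j.castSucc) :
    M.bdry ζm ζp (fun l => (Pi.single i.succ 1 : Fin (M.N + 1) → ℝ) l.succ)
      (fun l => (Pi.single i.succ 1 : Fin (M.N + 1) → ℝ) l.castSucc) = ζm i - ζp j := by
  rw [bdry, Finset.sum_add_distrib, Finset.sum_eq_single i, Finset.sum_eq_single j]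
  · rw [← h]; simp; ring
  · intro l _ hl
    rw [h, Pi.single_eq_of_ne fun h' => hl (Fin.castSucc_injective _ h')]; simp
  · simp
  · intro l _ hl
    rw [Pi.single_eq_of_ne fun h' => hl (Fin.succ_injective _ h')]; simp
  · simp

theorem bdry_nodal_single_last (ζm ζp : Fin M.N → ℝ) {i : Fin M.N} (h : i.succ = Fin.last M.N) :
    M.bdry ζm ζp (fun l => (Pi.single i.succ 1 : Fin (M.N + 1) → ℝ) l.succ)
      (fun l => (Pi.single i.succ 1 : Fin (M.N + 1) → ℝ) l.castSucc) = ζm i := by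
  rw [bdry, Finset.sum_eq_single i]
  · rw [Pi.single_eq_same, Pi.single_eq_of_ne (by rw [h]; exact (Fin.castSucc_lt_last i).ne)]
    ring
  · intro l _ hl
    rw [Pi.single_eq_of_ne fun h' => hl (Fin.succ_injective _ h'),
      Pi.single_eq_of_ne (by rw [h]; exact (Fin.castSucc_lt_last l).ne)]
    ring
  · simp

end Mesh

variable {a b : ℝ} {M : Mesh a b} {k : ℕ} {τ : Stabilization M.N} {ua ub qN : ℝ}
  {F u q p ψ : ℝ → ℝ} {ψh : M.PW} {s : State M}

/-- The difference of the `L²` projection of the exact solution and the discrete solution. -/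
def errData (M : Mesh a b) (k : ℕ) (τ : Stabilization M.N) (u q p ψ : ℝ → ℝ) (ψh : M.PW)
    (s : State M) (i : Fin M.N) : ElemData where
  u := legProj (k + 1) (M.xl i) (M.xr i) u - s.u i
  q := legProj (k + 1) (M.xl i) (M.xr i) q - s.q i
  p := legProj (k + 1) (M.xl i) (M.xr i) p - s.p i
  g := legProj (k + 1) (M.xl i) (M.xr i) ψ - ψh i
  ul := u (M.xl i) - s.uhat i.castSucc
  ur := u (M.xr i) - s.uhat i.succ
  ql := q (M.xl i) - s.qhatP τ i
  qr := q (M.xr i) - s.qhatM τ i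
  pl := p (M.xl i) - s.phatP τ i
  pr := p (M.xr i) - s.phat i
  -- The `L²` projection is orthogonal to all test polynomials, so the volume equations have no
  -- residual. The exact traces have no jumps; in the flux relations the end point residuals of the
  -- projection remain.
  cq := 0
  cp := 0
  α := residL (k + 1) (M.xl i) (M.xr i) q + τ.quP i * residL (k + 1) (M.xl i) (M.xr i) u
  β := residL (k + 1) (M.xl i) (M.xr i) p + τ.puP i * residL (k + 1) (M.xl i) (M.xr i) u
  γ := residR (k + 1) (M.xl i) (M.xr i) q - τ.quM i * residR (k + 1) (M.xl i) (M.xr i) u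
    - (τ.quM i)⁻¹ * residR (k + 1) (M.xl i) (M.xr i) p

theorem HDGEquations.single_valued_q (h : HDGEquations M k τ ua ub qN F ψh s) {i j : Fin M.N}
    (hij : i.succ = j.castSucc) : s.qhatM τ i = s.qhatP τ j := by
  have := h.trans_q (Pi.single i.succ 1) (Pi.single_eq_of_ne (Fin.succ_ne_zero i).symm 1)
  rw [M.bdry_nodal_single _ _ hij,
    Pi.single_eq_of_ne (by rw [hij]; exact (Fin.castSucc_lt_last j).ne')] at this
  linarith

theorem HDGEquations.single_valued_p (h : HDGEquations M k τ ua ub qN F ψh s) {i j : Fin M.N}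
    (hij : i.succ = j.castSucc) : s.phat i = s.phatP τ j := by
  have := h.trans_p (Pi.single i.succ 1) (Pi.single_eq_of_ne (Fin.succ_ne_zero i).symm 1)
    (Pi.single_eq_of_ne (by rw [hij]; exact (Fin.castSucc_lt_last j).ne') 1)
  rw [M.bdry_nodal_single _ _ hij] at this
  linarith

theorem HDGEquations.qhatM_last (h : HDGEquations M k τ ua ub qN F ψh s) {i : Fin M.N}
    (hi : i.succ = Fin.last M.N) : s.qhatM τ i = qN := by
  have := h.trans_q (Pi.single i.succ 1) (Pi.single_eq_of_ne (Fin.succ_ne_zero i).symm 1)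
  rw [M.bdry_nodal_single_last _ _ hi, ← hi, Pi.single_eq_same, mul_one] at this
  exact this

/-- The hypothesis `hF` is the weak form of `ψ + p_x = F`; with `ψ = u_t` it covers the evolution
and with `ψ = u` the initial problem. -/
theorem HDGEquations.isSys_errData (h : HDGEquations M k τ ua ub qN F ψh s)
    (hτ : τ.Admissible) (hψh : ψh ∈ M.W k) (i : Fin M.N)
    (hu : IsPrim (M.xl i) (M.xr i) u q) (hq : IsPrim (M.xl i) (M.xr i) q p)
    (hp : ContinuousOn p (Icc (M.xl i) (M.xr i)))
    (hψ : IntervalIntegrable ψ volume (M.xl i) (M.xr i))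
    (hF : ∀ v : ℝ[X], ∫ x in (M.xl i)..(M.xr i), F x * v.eval x
      = (∫ x in (M.xl i)..(M.xr i), ψ x * v.eval x) + p (M.xr i) * v.eval (M.xr i)
        - p (M.xl i) * v.eval (M.xl i) - ∫ x in (M.xl i)..(M.xr i), p x * (derivative v).eval x) :
    (errData M k τ u q p ψ ψh s i).IsSys k (M.xl i) (M.xr i) (τ.quP i) (τ.puP i) (τ.quM i) := by
  have hlr := M.xl_lt_xr i
  have proj : ∀ {w : ℝ → ℝ}, IntervalIntegrable w volume (M.xl i) (M.xr i) → ∀ v : ℝ[X],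
      v.natDegree ≤ k → ∫ x in (M.xl i)..(M.xr i), w x * v.eval x
        = itg (M.xl i) (M.xr i) (legProj (k + 1) (M.xl i) (M.xr i) w * v) := fun hw v hv =>
    integral_mul_eq_itg_legProj hlr hw (k + 1) v (mem_degreeLT_iff.2 hv)
  have hui := (hu.continuousOn hlr.le).intervalIntegrable_of_Icc hlr.le (μ := volume)
  have hpi := hp.intervalIntegrable_of_Icc hlr.le (μ := volume)
  have deg : ∀ {w : ℝ → ℝ} {z : M.PW}, z ∈ M.W k →
      (legProj (k + 1) (M.xl i) (M.xr i) w - z i).natDegree ≤ k := fun hz =>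
    (natDegree_sub_le_of_le (natDegree_legProj_le k _ _ _)
      (mem_degreeLE_iff.1 (hz i))).trans (max_self k).le
  have dv : ∀ {v : ℝ[X]}, v.natDegree ≤ k → (derivative v).natDegree ≤ k := fun hv =>
    (natDegree_derivative_le _).trans ((Nat.sub_le _ _).trans hv)
  have hqp : τ.qpM i = (τ.quM i)⁻¹ := by
    have := (hτ i).2.1
    rw [mul_comm] at this
    exact eq_inv_of_mul_eq_one_left this
  refine ⟨deg h.mem_u, deg h.mem_q, deg h.mem_p, deg hψh, fun v hv => ?_, fun v hv => ?_,
    fun v hv => ?_, ?_, ?_, ?_⟩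
  · have e1 := h.eq_q _ (M.single_mem_W i hv)
    rw [M.dx_single, M.pair_single, M.pair_single, M.bdry_single] at e1
    have e2 := hu.integral_mul_eval_derivative hlr.le v
    rw [proj hui _ (dv hv), proj hu.1 _ hv] at e2
    have e3 := itg_derivative_mul (M.xl i) (M.xr i)
      (legProj (k + 1) (M.xl i) (M.xr i) u - s.u i) v
    simp only [errData, ElemData.jur, ElemData.jul, C_0, zero_mul, add_zero, sub_mul, map_sub,
      eval_sub, eval_mul] at e3 ⊢
    linarith
  · have e1 := h.eq_p _ (M.single_mem_W i hv)
    rw [M.dx_single, M.pair_single, M.pair_single, M.bdry_single] at e1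
    have e2 := hq.integral_mul_eval_derivative hlr.le v
    rw [proj hu.1 _ (dv hv), proj hq.1 _ hv] at e2
    have e3 := itg_derivative_mul (M.xl i) (M.xr i)
      (legProj (k + 1) (M.xl i) (M.xr i) q - s.q i) v
    simp only [errData, ElemData.jqr, ElemData.jql, C_0, zero_mul, add_zero, sub_mul, map_sub,
      eval_sub, eval_mul] at e3 ⊢
    linarith
  · have e1 := h.eq_u _ (M.single_mem_W i hv)
    rw [M.dx_single, M.pair_single, M.pair_single, M.bdry_single, M.pairFun_single] at e1
    have e2 := hF v
    rw [proj hψ _ hv, proj hpi _ (dv hv)] at e2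
    have e3 := itg_derivative_mul (M.xl i) (M.xr i)
      (legProj (k + 1) (M.xl i) (M.xr i) p - s.p i) v
    simp only [errData, ElemData.jpr, ElemData.jpl, add_mul, sub_mul, map_add, map_sub,
      eval_sub, eval_mul] at e3 ⊢
    linarith
  · simp only [errData, ElemData.jql, ElemData.jul, State.qhatP, Mesh.trp, residL, eval_sub]
    ring
  · simp only [errData, ElemData.jpl, ElemData.jul, State.phatP, Mesh.trp, residL, eval_sub]
    ring
  · simp only [errData, ElemData.jqr, ElemData.jur, ElemData.jpr, State.qhatM, Mesh.trm, residR,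
      eval_sub, hqp]
    ring

theorem HDGEquations.meshSys_errData (h : HDGEquations M k τ ua ub qN F ψh s) (hab : a < b)
    (hτ : τ.Admissible) (hψh : ψh ∈ M.W k)
    (hu : ∀ i, IsPrim (M.xl i) (M.xr i) u q) (hq : ∀ i, IsPrim (M.xl i) (M.xr i) q p)
    (hp : ∀ i, ContinuousOn p (Icc (M.xl i) (M.xr i)))
    (hψ : ∀ i, IntervalIntegrable ψ volume (M.xl i) (M.xr i))
    (hF : ∀ i, ∀ v : ℝ[X], ∫ x in (M.xl i)..(M.xr i), F x * v.eval x
      = (∫ x in (M.xl i)..(M.xr i), ψ x * v.eval x) + p (M.xr i) * v.eval (M.xr i)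
        - p (M.xl i) * v.eval (M.xl i) - ∫ x in (M.xl i)..(M.xr i), p x * (derivative v).eval x)
    (ha : u a = ua) (hb : u b = ub) (hqb : q b = qN) :
    MeshSys M k τ (errData M k τ u q p ψ ψh s) := by
  refine ⟨fun i => h.isSys_errData hτ hψh i (hu i) (hq i) (hp i) (hψ i) (hF i), ?_⟩
  have nd : ∀ {i j : Fin M.N}, i.succ = j.castSucc → M.xr i = M.xl j := fun hij =>
    congrArg M.node hij
  obtain ⟨Q, hQ⟩ := exists_nodal (L := fun i => q (M.xl i) - s.qhatP τ i)
    (R := fun i => q (M.xr i) - s.qhatM τ i) fun i j hij => by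
      simp only [nd hij, h.single_valued_q hij]
  obtain ⟨P, hP⟩ := exists_nodal (L := fun i => p (M.xl i) - s.phatP τ i)
    (R := fun i => p (M.xr i) - s.phat i) fun i j hij => by
      simp only [nd hij, h.single_valued_p hij]
  refine ⟨fun j => u (M.node j) - s.uhat j, Q, P, ?_, ?_, ?_, fun i =>
    ⟨rfl, rfl, (hQ i).1, (hQ i).2, (hP i).1, (hP i).2⟩⟩
  · simp only [M.node_zero, h.uhat_left, ha, sub_self]
  · simp only [M.node_last, h.uhat_right, hb, sub_self]
  · have hne : Fin.last M.N ≠ 0 := by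
      intro h0
      have := M.node_last
      rw [h0, M.node_zero] at this
      exact hab.ne this
    obtain ⟨i, hi⟩ := Fin.exists_succ_eq.2 hne
    rw [← hi, ← (hQ i).2]
    simp only [h.qhatM_last hi, Mesh.xr, hi, M.node_last, hqb, sub_self]

end KdVHDG

end

noncomputable section

namespace KdVHDG

open Filter Topology MeshSys

/-! ### Integrals depending on time -/

section

variable {l r K t : ℝ} {S : Set ℝ} {w : ℝ → ℝ → ℝ} {w' : ℝ → ℝ}

theorem abs_slope_le (hL : ∀ s ∈ S, ∀ x ∈ Icc l r, |w s x - w t x| ≤ K * |s - t|) {s x : ℝ}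
    (hs : s ∈ S \ {t}) (hx : x ∈ Icc l r) : |slope (fun s => w s x) t s| ≤ K := by
  rw [slope_def_field, abs_div, div_le_iff₀ (abs_pos.2 (sub_ne_zero.2 hs.2))]
  exact hL s hs.1 x hx

theorem hasDerivWithinAt_integral_mul (hlr : l ≤ r) (ht : t ∈ S)
    (hc : ∀ s ∈ S, ContinuousOn (w s) (Icc l r))
    (hL : ∀ s ∈ S, ∀ x ∈ Icc l r, |w s x - w t x| ≤ K * |s - t|)
    (hd : ∀ x ∈ Icc l r, HasDerivWithinAt (fun s => w s x) (w' x) S t) {φ : ℝ → ℝ}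
    (hφ : Continuous φ) :
    HasDerivWithinAt (fun s => ∫ x in l..r, w s x * φ x) (∫ x in l..r, w' x * φ x) S t := by
  rw [hasDerivWithinAt_iff_tendsto_slope]
  have hi : ∀ s ∈ S, IntervalIntegrable (fun x => w s x * φ x) volume l r := fun s hs =>
    ((hc s hs).mul hφ.continuousOn).intervalIntegrable_of_Icc hlr
  have e : ∀ᶠ s in 𝓝[S \ {t}] t, ∫ x in l..r, slope (fun s => w s x) t s * φ x
      = slope (fun s => ∫ x in l..r, w s x * φ x) t s := by
    filter_upwards [self_mem_nhdsWithin] with s hs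
    rw [slope_def_field, ← intervalIntegral.integral_sub (hi s hs.1) (hi t ht),
      ← intervalIntegral.integral_div]
    refine intervalIntegral.integral_congr fun x _ => ?_
    simp only [slope_def_field]; ring
  refine Tendsto.congr' e ?_
  have hx : ∀ {x}, x ∈ uIoc l r → x ∈ Icc l r := fun hx => by
    rw [uIoc_of_le hlr] at hx; exact Ioc_subset_Icc_self hx
  refine intervalIntegral.tendsto_integral_filter_of_dominated_convergence (fun x => K * |φ x|)
    ?_ ?_ ((hφ.abs.intervalIntegrable _ _).const_mul K) ?_
  · filter_upwards [self_mem_nhdsWithin] with s hs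
    have : ContinuousOn (fun x => slope (fun s => w s x) t s * φ x) (Icc l r) := by
      simp only [slope_def_field]
      exact (((hc s hs.1).sub (hc t ht)).div_const _).mul hφ.continuousOn
    rw [uIoc_of_le hlr]
    exact (this.mono Ioc_subset_Icc_self).aestronglyMeasurable measurableSet_Ioc
  · filter_upwards [self_mem_nhdsWithin] with s hs
    refine Eventually.of_forall fun x hxm => ?_
    rw [Real.norm_eq_abs, abs_mul]
    exact mul_le_mul_of_nonneg_right (abs_slope_le hL hs (hx hxm)) (abs_nonneg _)
  · exact Eventually.of_forall fun x hxm =>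
      (hasDerivWithinAt_iff_tendsto_slope.1 (hd x (hx hxm))).mul_const _

/-- A pointwise limit of difference quotients that are continuous in `x` and uniformly bounded is
measurable and bounded. -/
theorem intervalIntegrable_time_deriv (hlr : l ≤ r) (ht : t ∈ S) (hS : UniqueDiffWithinAt ℝ S t)
    (hc : ∀ s ∈ S, ContinuousOn (w s) (Icc l r))
    (hL : ∀ s ∈ S, ∀ x ∈ Icc l r, |w s x - w t x| ≤ K * |s - t|)
    (hd : ∀ x ∈ Icc l r, HasDerivWithinAt (fun s => w s x) (w' x) S t) :
    IntervalIntegrable w' volume l r := by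
  have hne : (𝓝[S \ {t}] t).NeBot := by
    have := hS.accPt
    rwa [accPt_principal_iff_nhdsWithin] at this
  obtain ⟨σ, hσ, hσt⟩ := mem_closure_iff_seq_limit.1 (mem_closure_iff_nhdsWithin_neBot.2 hne)
  have hlim : ∀ x ∈ Icc l r, Tendsto (fun n => slope (fun s => w s x) t (σ n)) atTop (𝓝 (w' x)) :=
    fun x hx => (hasDerivWithinAt_iff_tendsto_slope.1 (hd x hx)).comp
      (tendsto_nhdsWithin_iff.2 ⟨hσt, Eventually.of_forall hσ⟩)
  rw [intervalIntegrable_iff_integrableOn_Icc_of_le hlr]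
  refine Integrable.of_bound (μ := volume.restrict (Icc l r)) ?_ K ?_
  · refine aestronglyMeasurable_of_tendsto_ae (μ := volume.restrict (Icc l r)) atTop
      (f := fun n x => slope (fun s => w s x) t (σ n)) (fun n => ?_)
      ((ae_restrict_mem measurableSet_Icc).mono hlim)
    have : ContinuousOn (fun x => slope (fun s => w s x) t (σ n)) (Icc l r) := by
      simp only [slope_def_field]
      exact ((hc _ (hσ n).1).sub (hc t ht)).div_const _
    exact this.aestronglyMeasurable measurableSet_Icc
  · filter_upwards [ae_restrict_mem measurableSet_Icc] with x hx
    exact le_of_tendsto (hlim x hx).norm (Eventually.of_forall fun n => abs_slope_le hL (hσ n) hx)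

variable {n : ℕ}

theorem hasDerivWithinAt_legProj_coeff
    (h : ∀ v : ℝ[X], HasDerivWithinAt (fun s => ∫ x in l..r, w s x * v.eval x)
      (∫ x in l..r, w' x * v.eval x) S t) (j : ℕ) :
    HasDerivWithinAt (fun s => (legProj n l r (w s)).coeff j) ((legProj n l r w').coeff j) S t := by
  simp only [legProj, finsetSum_coeff, coeff_C_mul]
  exact HasDerivWithinAt.fun_sum fun i _ => ((h (leg i l r)).const_mul _).mul_const _

theorem differentiableWithinAt_legProj_eval
    (h : ∀ v : ℝ[X], DifferentiableWithinAt ℝ (fun s => ∫ x in l..r, w s x * v.eval x) S t)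
    (x : ℝ) : DifferentiableWithinAt ℝ (fun s => (legProj n l r (w s)).eval x) S t := by
  simp only [legProj, eval_finsetSum, eval_mul, eval_C]
  exact DifferentiableWithinAt.fun_sum fun i _ => ((h (leg i l r)).const_mul _).mul_const _

end

/-! ### The exact solution on a mesh -/

/-- The exact solution, with its regularity on a mesh. -/
structure RegSol {a b : ℝ} (M : Mesh a b) (k : ℕ) (T L : ℝ) (f : ℝ → ℝ → ℝ) (u0 uDa uDb qN : ℝ → ℝ)
    (u q p ut : ℝ → ℝ → ℝ) : Prop where
  exact : IsExactSolution a b T f u0 uDa uDb qN u q p ut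
  pos : 0 < T
  reg_u : TimeReg M.elements (k + 1) T L u
  reg_q : TimeReg M.elements (k + 1) T L q
  reg_p : TimeReg M.elements (k + 1) T L p
  reg_u₂ : TimeReg₂ M.elements (k + 1) T L u

namespace RegSol

variable {a b : ℝ} {M : Mesh a b} {k : ℕ} {T L : ℝ} {f : ℝ → ℝ → ℝ} {u0 uDa uDb qN : ℝ → ℝ}
  {u q p ut : ℝ → ℝ → ℝ} (h : RegSol M k T L f u0 uDa uDb qN u q p ut)

include h

theorem deriv_u {t : ℝ} (ht : t ∈ Icc 0 T) (i : Fin M.N) {x : ℝ}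
    (hx : x ∈ Icc (M.xl i) (M.xr i)) :
    HasDerivWithinAt (u t) (q t x) (Icc (M.xl i) (M.xr i)) x :=
  (h.exact.eq_q t ht x (Icc_subset_Icc (M.le_xl i) (M.xr_le i) hx)).mono
    (Icc_subset_Icc (M.le_xl i) (M.xr_le i))

theorem deriv_q {t : ℝ} (ht : t ∈ Icc 0 T) (i : Fin M.N) {x : ℝ}
    (hx : x ∈ Icc (M.xl i) (M.xr i)) :
    HasDerivWithinAt (q t) (p t x) (Icc (M.xl i) (M.xr i)) x :=
  (h.exact.eq_p t ht x (Icc_subset_Icc (M.le_xl i) (M.xr_le i) hx)).mono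
    (Icc_subset_Icc (M.le_xl i) (M.xr_le i))

theorem cont_u {t : ℝ} (ht : t ∈ Icc 0 T) (i : Fin M.N) :
    ContinuousOn (u t) (Icc (M.xl i) (M.xr i)) :=
  fun _ hx => (h.deriv_u ht i hx).continuousWithinAt

theorem cont_q {t : ℝ} (ht : t ∈ Icc 0 T) (i : Fin M.N) :
    ContinuousOn (q t) (Icc (M.xl i) (M.xr i)) :=
  fun _ hx => (h.deriv_q ht i hx).continuousWithinAt

theorem cont_p {t : ℝ} (ht : t ∈ Icc 0 T) (i : Fin M.N) :
    ContinuousOn (p t) (Icc (M.xl i) (M.xr i)) :=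
  continuousOn_deriv_of_inSob (M.xl_lt_xr i) (M.Ioo_subset_elements i)
    (fun _ hx => h.deriv_q ht i hx) (h.reg_p.bound t ht)

theorem prim_u {t : ℝ} (ht : t ∈ Icc 0 T) (i : Fin M.N) :
    IsPrim (M.xl i) (M.xr i) (u t) (q t) :=
  isPrim_of_hasDerivWithinAt (h.cont_q ht i) (fun _ hx => h.deriv_u ht i hx) (M.xl_lt_xr i).le

theorem prim_q {t : ℝ} (ht : t ∈ Icc 0 T) (i : Fin M.N) :
    IsPrim (M.xl i) (M.xr i) (q t) (p t) :=
  isPrim_of_hasDerivWithinAt (h.cont_p ht i) (fun _ hx => h.deriv_q ht i hx) (M.xl_lt_xr i).le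

/-- The Sobolev constant depends on the element. This is harmless, since the bound serves only to
differentiate integrals in time. -/
theorem exists_lip_u (i : Fin M.N) : ∃ K, ∀ s ∈ Icc 0 T, ∀ t ∈ Icc 0 T,
    ∀ x ∈ Icc (M.xl i) (M.xr i), |u s x - u t x| ≤ K * |s - t| := by
  refine ⟨_, fun s hs t ht x hx => ((h.reg_u.lip t ht s hs).abs_le
    (mul_nonneg h.reg_u.nonneg (abs_nonneg _)) (M.xl_lt_xr i) (M.Ioo_subset_elements i)
    ((h.cont_u hs i).sub (h.cont_u ht i)) hx).trans (le_of_eq (mul_assoc _ _ _).symm)⟩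

theorem deriv_ut {t : ℝ} (ht : t ∈ Icc 0 T) (i : Fin M.N) {x : ℝ}
    (hx : x ∈ Icc (M.xl i) (M.xr i)) :
    HasDerivWithinAt (fun s => u s x) (ut t x) (Icc 0 T) t :=
  h.exact.time_deriv t ht x (Icc_subset_Icc (M.le_xl i) (M.xr_le i) hx)

theorem integrable_ut {t : ℝ} (ht : t ∈ Icc 0 T) (i : Fin M.N) :
    IntervalIntegrable (ut t) volume (M.xl i) (M.xr i) := by
  obtain ⟨K, hK⟩ := h.exists_lip_u i
  exact intervalIntegrable_time_deriv (M.xl_lt_xr i).le ht (uniqueDiffOn_Icc h.pos t ht)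
    (fun s hs => h.cont_u hs i) (fun s hs x hx => hK s hs t ht x hx)
    fun x hx => h.deriv_ut ht i hx

theorem deriv_moment_u {t : ℝ} (ht : t ∈ Icc 0 T) (i : Fin M.N) (v : ℝ[X]) :
    HasDerivWithinAt (fun s => ∫ x in (M.xl i)..(M.xr i), u s x * v.eval x)
      (∫ x in (M.xl i)..(M.xr i), ut t x * v.eval x) (Icc 0 T) t := by
  obtain ⟨K, hK⟩ := h.exists_lip_u i
  exact hasDerivWithinAt_integral_mul (M.xl_lt_xr i).le ht (fun s hs => h.cont_u hs i)
    (fun s hs x hx => hK s hs t ht x hx) (fun x hx => h.deriv_ut ht i hx) v.continuous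

theorem diff_u {t : ℝ} (ht : t ∈ Icc 0 T) (i : Fin M.N) {x : ℝ}
    (hx : x ∈ Icc (M.xl i) (M.xr i)) :
    DifferentiableWithinAt ℝ (fun s => u s x) (Icc 0 T) t :=
  (h.deriv_ut ht i hx).differentiableWithinAt

theorem diff_q {t : ℝ} (ht : t ∈ Icc 0 T) (i : Fin M.N) {x : ℝ}
    (hx : x ∈ Icc (M.xl i) (M.xr i)) :
    DifferentiableWithinAt ℝ (fun s => q s x) (Icc 0 T) t :=
  differentiableWithinAt_spatial_deriv (M.xl_lt_xr i) (fun _ ht _ hx => h.deriv_u ht i hx)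
    h.reg_q.nonneg (fun s hs t ht _ hx _ hy => (h.reg_q.lip s hs t ht).abs_sub_le
      (mul_nonneg h.reg_q.nonneg (abs_nonneg _)) (M.xl_lt_xr i) (M.Ioo_subset_elements i)
      ((h.cont_q ht i).sub (h.cont_q hs i)) hx hy) (fun _ ht _ hx => h.diff_u ht i hx) ht hx

theorem diff_p {t : ℝ} (ht : t ∈ Icc 0 T) (i : Fin M.N) {x : ℝ}
    (hx : x ∈ Icc (M.xl i) (M.xr i)) :
    DifferentiableWithinAt ℝ (fun s => p s x) (Icc 0 T) t :=
  differentiableWithinAt_spatial_deriv (M.xl_lt_xr i) (fun _ ht _ hx => h.deriv_q ht i hx)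
    h.reg_p.nonneg (fun s hs t ht _ hx _ hy => (h.reg_p.lip s hs t ht).abs_sub_le
      (mul_nonneg h.reg_p.nonneg (abs_nonneg _)) (M.xl_lt_xr i) (M.Ioo_subset_elements i)
      ((h.cont_p ht i).sub (h.cont_p hs i)) hx hy) (fun _ ht _ hx => h.diff_q ht i hx) ht hx

/-- Integration by parts in space reduces moments of `q = u_x` to end values and moments of `u`. -/
theorem diff_moment_q {t : ℝ} (ht : t ∈ Icc 0 T) (i : Fin M.N) (v : ℝ[X]) :
    DifferentiableWithinAt ℝ (fun s => ∫ x in (M.xl i)..(M.xr i), q s x * v.eval x) (Icc 0 T) t := by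
  have hl := left_mem_Icc.2 (M.xl_lt_xr i).le
  have hr := right_mem_Icc.2 (M.xl_lt_xr i).le
  refine ((((h.diff_u ht i hr).mul_const (v.eval (M.xr i))).sub
    ((h.diff_u ht i hl).mul_const (v.eval (M.xl i)))).sub
    (h.deriv_moment_u ht i (derivative v)).differentiableWithinAt).congr (fun s hs => ?_) ?_
  · simp only [Pi.sub_apply]
    linarith [(h.prim_u hs i).integral_mul_eval_derivative (M.xl_lt_xr i).le v]
  · simp only [Pi.sub_apply]
    linarith [(h.prim_u ht i).integral_mul_eval_derivative (M.xl_lt_xr i).le v]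

theorem diff_moment_p {t : ℝ} (ht : t ∈ Icc 0 T) (i : Fin M.N) (v : ℝ[X]) :
    DifferentiableWithinAt ℝ (fun s => ∫ x in (M.xl i)..(M.xr i), p s x * v.eval x) (Icc 0 T) t := by
  have hl := left_mem_Icc.2 (M.xl_lt_xr i).le
  have hr := right_mem_Icc.2 (M.xl_lt_xr i).le
  refine ((((h.diff_q ht i hr).mul_const (v.eval (M.xr i))).sub
    ((h.diff_q ht i hl).mul_const (v.eval (M.xl i)))).sub
    (h.diff_moment_q ht i (derivative v))).congr (fun s hs => ?_) ?_
  · simp only [Pi.sub_apply]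
    linarith [(h.prim_q hs i).integral_mul_eval_derivative (M.xl_lt_xr i).le v]
  · simp only [Pi.sub_apply]
    linarith [(h.prim_q ht i).integral_mul_eval_derivative (M.xl_lt_xr i).le v]

theorem integrable_f {t : ℝ} (ht : t ∈ Ioc 0 T) (i : Fin M.N) :
    IntervalIntegrable (f t) volume (M.xl i) (M.xr i) :=
  intervalIntegrable_of_memLp (M.xl_lt_xr i).le
    (memLp_mono_set (h.exact.f_mem t ht) (Ioo_subset_Ioo (M.le_xl i) (M.xr_le i)))

theorem prim_p {t : ℝ} (ht : t ∈ Ioc 0 T) (i : Fin M.N) :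
    IsPrim (M.xl i) (M.xr i) (p t) fun x => f t x - ut t x := by
  have ht' := Ioc_subset_Icc_self ht
  have hi : ∀ i, IntervalIntegrable (fun x => f t x - ut t x) volume (M.xl i) (M.xr i) := fun i =>
    (h.integrable_f ht i).sub (h.integrable_ut ht' i)
  have hj : ∀ j, IntervalIntegrable (fun x => f t x - ut t x) volume a (M.node j) := by
    intro j
    induction j using Fin.induction with
    | zero => rw [M.node_zero]
    | succ j ih => exact ih.trans (hi j)
  refine ⟨hi i, fun x hx => ?_⟩
  have hs := Icc_subset_Icc (M.le_xl i) (M.xr_le i)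
  rw [h.exact.eq_u t ht x (hs hx),
    h.exact.eq_u t ht (M.xl i) (hs (left_mem_Icc.2 (M.xl_lt_xr i).le)),
    ← intervalIntegral.integral_add_adjacent_intervals (hj i.castSucc)
      ((hi i).mono_set (by
        rw [show M.node i.castSucc = M.xl i from rfl, uIcc_of_le hx.1,
          uIcc_of_le (M.xl_lt_xr i).le]
        exact Icc_subset_Icc_right hx.2))]
  exact (add_assoc _ _ _).symm

theorem integral_f_mul {t : ℝ} (ht : t ∈ Ioc 0 T) (i : Fin M.N) (v : ℝ[X]) :
    ∫ x in (M.xl i)..(M.xr i), f t x * v.eval x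
      = (∫ x in (M.xl i)..(M.xr i), ut t x * v.eval x) + p t (M.xr i) * v.eval (M.xr i)
        - p t (M.xl i) * v.eval (M.xl i)
        - ∫ x in (M.xl i)..(M.xr i), p t x * (derivative v).eval x := by
  have e := (h.prim_p ht i).integral_mul_eval_derivative (M.xl_lt_xr i).le v
  simp only [sub_mul] at e
  rw [intervalIntegral.integral_sub (intervalIntegrable_mul_eval (h.integrable_f ht i) v)
    (intervalIntegrable_mul_eval (h.integrable_ut (Ioc_subset_Icc_self ht) i) v)] at e
  linarith

theorem iteratedDeriv_initial {x : ℝ} (hx : x ∈ Ioo a b) :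
    iteratedDeriv 3 u0 x = deriv (p 0) x := by
  have h0 : (0 : ℝ) ∈ Icc 0 T := left_mem_Icc.2 h.pos.le
  have e1 : ∀ x ∈ Ioo a b, iteratedDeriv 1 u0 x = q 0 x := by
    intro x hx
    have := (h.exact.eq_q 0 h0 x (Ioo_subset_Icc_self hx)).hasDerivAt (Icc_mem_nhds hx.1 hx.2)
    rw [iteratedDeriv_one]
    refine (this.congr_of_eventuallyEq ?_).deriv
    filter_upwards [Icc_mem_nhds hx.1 hx.2] with y hy using (h.exact.initial y hy).symm
  have e2 : ∀ x ∈ Ioo a b, iteratedDeriv 2 u0 x = p 0 x := by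
    intro x hx
    have := (h.exact.eq_p 0 h0 x (Ioo_subset_Icc_self hx)).hasDerivAt (Icc_mem_nhds hx.1 hx.2)
    rw [iteratedDeriv_succ]
    refine (this.congr_of_eventuallyEq ?_).deriv
    filter_upwards [Ioo_mem_nhds hx.1 hx.2] with y hy using e1 y hy
  rw [iteratedDeriv_succ]
  refine EventuallyEq.deriv_eq ?_
  filter_upwards [Ioo_mem_nhds hx.1 hx.2] with y hy using e2 y hy

/-- Inside the domain the third derivative of `u0` is the derivative of `p 0`. On each element it
agrees almost everywhere with the weak derivative, as `p 0` is a primitive of the latter. -/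
theorem integral_initial_mul (i : Fin M.N) (v : ℝ[X]) :
    ∫ x in (M.xl i)..(M.xr i), (u0 x + iteratedDeriv 3 u0 x) * v.eval x
      = (∫ x in (M.xl i)..(M.xr i), u 0 x * v.eval x) + p 0 (M.xr i) * v.eval (M.xr i)
        - p 0 (M.xl i) * v.eval (M.xl i)
        - ∫ x in (M.xl i)..(M.xr i), p 0 x * (derivative v).eval x := by
  have h0 : (0 : ℝ) ∈ Icc 0 T := left_mem_Icc.2 h.pos.le
  have hlr := M.xl_lt_xr i
  obtain ⟨z, z1, z2, z3, -⟩ := h.reg_p.bound 0 h0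
  have hz : IntervalIntegrable (z (Fin.succ 0)) volume (M.xl i) (M.xr i) :=
    intervalIntegrable_of_memLp hlr.le (memLp_mono_set (z1 _) (M.Ioo_subset_elements i))
  have hp : IsPrim (M.xl i) (M.xr i) (p 0) (z (Fin.succ 0)) :=
    HasWeakDerivOn.isPrim hlr (h.cont_p h0 i)
      (ae_restrict_of_ae_restrict_of_subset (M.Ioo_subset_elements i) z3) hz
      ((z2 0).mono (M.Ioo_subset_elements i))
  have e := hp.integral_mul_eval_derivative hlr.le v
  have e2 : ∫ x in (M.xl i)..(M.xr i), (u0 x + iteratedDeriv 3 u0 x) * v.eval x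
      = ∫ x in (M.xl i)..(M.xr i), (u 0 x * v.eval x + z (Fin.succ 0) x * v.eval x) := by
    refine intervalIntegral.integral_congr_ae ?_
    have hne : ∀ᵐ x : ℝ, x ≠ M.xr i := by simp [ae_iff]
    filter_upwards [hp.ae_hasDerivAt, hne] with x hx hxr hxm
    rw [uIoc_of_le hlr.le] at hxm
    have hxo : x ∈ Ioo (M.xl i) (M.xr i) := ⟨hxm.1, lt_of_le_of_ne hxm.2 hxr⟩
    have hxab := Ioo_subset_Ioo (M.le_xl i) (M.xr_le i) hxo
    rw [h.iteratedDeriv_initial hxab, (hx hxo).deriv,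
      ← h.exact.initial x (Ioo_subset_Icc_self hxab)]
    ring
  rw [e2, intervalIntegral.integral_add
    (intervalIntegrable_mul_eval ((h.cont_u h0 i).intervalIntegrable_of_Icc hlr.le) v)
    (intervalIntegrable_mul_eval hz v)]
  linarith

end RegSol

end KdVHDG

end

noncomputable section

namespace KdVHDG

open Filter Topology MeshSys

/-! ### Residuals of the fluxes -/

section

variable {a b : ℝ} (M : Mesh a b) (k : ℕ) (τ : Stabilization M.N)

def fluxα (u q : ℝ → ℝ) (i : Fin M.N) : ℝ :=
  residL (k + 1) (M.xl i) (M.xr i) q + τ.quP i * residL (k + 1) (M.xl i) (M.xr i) u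

def fluxβ (u p : ℝ → ℝ) (i : Fin M.N) : ℝ :=
  residL (k + 1) (M.xl i) (M.xr i) p + τ.puP i * residL (k + 1) (M.xl i) (M.xr i) u

def fluxγ (u q p : ℝ → ℝ) (i : Fin M.N) : ℝ :=
  residR (k + 1) (M.xl i) (M.xr i) q - τ.quM i * residR (k + 1) (M.xl i) (M.xr i) u
    - (τ.quM i)⁻¹ * residR (k + 1) (M.xl i) (M.xr i) p

/-- `w` is continuous on every element. -/
def ContElem (w : ℝ → ℝ) : Prop := ∀ i, ContinuousOn w (Icc (M.xl i) (M.xr i))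

variable {M k τ} {A B : ℝ} {u q p u' q' p' : ℝ → ℝ}

theorem ContElem.sub (h : ContElem M u) (h' : ContElem M u') : ContElem M fun x => u x - u' x :=
  fun i => (h i).sub (h' i)

theorem ContElem.integrable (h : ContElem M u) (i : Fin M.N) :
    IntervalIntegrable u volume (M.xl i) (M.xr i) :=
  (h i).intervalIntegrable_of_Icc (M.xl_lt_xr i).le

theorem ContElem.residL_sub (h : ContElem M u) (h' : ContElem M u') (n : ℕ) (i : Fin M.N) :
    residL n (M.xl i) (M.xr i) (fun x => u x - u' x)
      = residL n (M.xl i) (M.xr i) u - residL n (M.xl i) (M.xr i) u' :=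
  KdVHDG.residL_sub (h.integrable i) (h'.integrable i) n

theorem ContElem.residR_sub (h : ContElem M u) (h' : ContElem M u') (n : ℕ) (i : Fin M.N) :
    residR n (M.xl i) (M.xr i) (fun x => u x - u' x)
      = residR n (M.xl i) (M.xr i) u - residR n (M.xl i) (M.xr i) u' :=
  KdVHDG.residR_sub (h.integrable i) (h'.integrable i) n

theorem flux_sq_le (hs : ∀ i, StabBound A (τ.quP i) (τ.puP i) (τ.quM i)) (i : Fin M.N) :
    fluxα M k τ u q i ^ 2 + fluxβ M k τ u p i ^ 2 + fluxγ M k τ u q p i ^ 2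
      ≤ A ^ 2 * (12 * residL (k + 1) (M.xl i) (M.xr i) u ^ 2
        + 2 * residL (k + 1) (M.xl i) (M.xr i) q ^ 2 + 2 * residL (k + 1) (M.xl i) (M.xr i) p ^ 2
        + 3 * residR (k + 1) (M.xl i) (M.xr i) u ^ 2 + 3 * residR (k + 1) (M.xl i) (M.xr i) q ^ 2
        + 3 * residR (k + 1) (M.xl i) (M.xr i) p ^ 2) := by
  obtain ⟨h1, h2, h3, h4, h5, h6, h7, h8⟩ := hs i
  unfold fluxα fluxβ fluxγ
  set ul := residL (k + 1) (M.xl i) (M.xr i) u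
  set ql := residL (k + 1) (M.xl i) (M.xr i) q
  set pl := residL (k + 1) (M.xl i) (M.xr i) p
  set ur := residR (k + 1) (M.xl i) (M.xr i) u
  set qr := residR (k + 1) (M.xl i) (M.xr i) q
  set pr := residR (k + 1) (M.xl i) (M.xr i) p
  have hA2 : 1 ≤ A ^ 2 := one_le_pow₀ h1
  have sqb : ∀ {c B x : ℝ}, c ^ 2 ≤ B → (c * x) ^ 2 ≤ B * x ^ 2 := fun hc => by
    rw [mul_pow]; exact mul_le_mul_of_nonneg_right hc (sq_nonneg _)
  have e1 : (τ.quP i * ul) ^ 2 ≤ 1 * ul ^ 2 := sqb (by nlinarith)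
  have e2 : (τ.puP i * ul) ^ 2 ≤ 4 * ul ^ 2 := sqb (by nlinarith)
  have e3 : (τ.quM i * ur) ^ 2 ≤ A ^ 2 * ur ^ 2 := sqb (pow_le_pow_left₀ h2.le h3 2)
  have e4 : ((τ.quM i)⁻¹ * pr) ^ 2 ≤ A ^ 2 * pr ^ 2 :=
    sqb (pow_le_pow_left₀ (inv_nonneg.2 h2.le) h4 2)
  have a1 : (ql + τ.quP i * ul) ^ 2 ≤ 2 * ql ^ 2 + 2 * (τ.quP i * ul) ^ 2 := by
    nlinarith [sq_nonneg (ql - τ.quP i * ul)]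
  have a2 : (pl + τ.puP i * ul) ^ 2 ≤ 2 * pl ^ 2 + 2 * (τ.puP i * ul) ^ 2 := by
    nlinarith [sq_nonneg (pl - τ.puP i * ul)]
  have a3 : (qr - τ.quM i * ur - (τ.quM i)⁻¹ * pr) ^ 2
      ≤ 3 * qr ^ 2 + 3 * (τ.quM i * ur) ^ 2 + 3 * ((τ.quM i)⁻¹ * pr) ^ 2 := by
    nlinarith [sq_nonneg (qr + τ.quM i * ur), sq_nonneg (qr + (τ.quM i)⁻¹ * pr),
      sq_nonneg (τ.quM i * ur - (τ.quM i)⁻¹ * pr)]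
  have up : ∀ x : ℝ, x ^ 2 ≤ A ^ 2 * x ^ 2 := fun x => le_mul_of_one_le_left (sq_nonneg _) hA2
  linarith [up ul, up ql, up pl, up qr, sq_nonneg ul]

theorem sum_flux_sq_le (hs : ∀ i, StabBound A (τ.quP i) (τ.puP i) (τ.quM i))
    (hu : InSob M.elements (k + 1) B u) (hq : InSob M.elements (k + 1) B q)
    (hp : InSob M.elements (k + 1) B p) (cu : ContElem M u) (cq : ContElem M q)
    (cp : ContElem M p) :
    ∑ i, (fluxα M k τ u q i ^ 2 + fluxβ M k τ u p i ^ 2 + fluxγ M k τ u q p i ^ 2)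
      ≤ 25 * A ^ 2 * ((((k + 1 : ℕ) : ℝ) ^ 2 + 1) ^ 2 * M.size ^ (2 * k + 1) * B ^ 2) := by
  refine (Finset.sum_le_sum fun i _ => flux_sq_le hs i).trans ?_
  rw [← Finset.mul_sum]
  simp only [Finset.sum_add_distrib, ← Finset.mul_sum]
  obtain ⟨u1, u2⟩ := hu.sum_resid_sq_le cu le_rfl
  obtain ⟨q1, q2⟩ := hq.sum_resid_sq_le cq le_rfl
  obtain ⟨p1, p2⟩ := hp.sum_resid_sq_le cp le_rfl
  rw [mul_comm 25, mul_assoc]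
  refine mul_le_mul_of_nonneg_left ?_ (sq_nonneg A)
  linarith

theorem fluxα_sub (cu : ContElem M u) (cu' : ContElem M u') (cq : ContElem M q)
    (cq' : ContElem M q') (i : Fin M.N) :
    fluxα M k τ (fun x => u x - u' x) (fun x => q x - q' x) i
      = fluxα M k τ u q i - fluxα M k τ u' q' i := by
  rw [fluxα, cq.residL_sub cq', cu.residL_sub cu', fluxα, fluxα]; ring

theorem fluxβ_sub (cu : ContElem M u) (cu' : ContElem M u') (cp : ContElem M p)
    (cp' : ContElem M p') (i : Fin M.N) :
    fluxβ M k τ (fun x => u x - u' x) (fun x => p x - p' x) i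
      = fluxβ M k τ u p i - fluxβ M k τ u' p' i := by
  rw [fluxβ, cp.residL_sub cp', cu.residL_sub cu', fluxβ, fluxβ]; ring

theorem fluxγ_sub (cu : ContElem M u) (cu' : ContElem M u') (cq : ContElem M q)
    (cq' : ContElem M q') (cp : ContElem M p) (cp' : ContElem M p') (i : Fin M.N) :
    fluxγ M k τ (fun x => u x - u' x) (fun x => q x - q' x) (fun x => p x - p' x) i
      = fluxγ M k τ u q p i - fluxγ M k τ u' q' p' i := by
  rw [fluxγ, cq.residR_sub cq', cu.residR_sub cu', cp.residR_sub cp', fluxγ, fluxγ]; ring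

theorem InSob.deriv_of_isPrim {m : ℕ} (hu : InSob M.elements (m + 1) B u)
    (hq : ∀ i, IsPrim (M.xl i) (M.xr i) u q) : InSob M.elements m B q := by
  refine hu.deriv fun {v} hv hw => ?_
  rw [EventuallyEq, Mesh.elements, ae_restrict_iUnion_iff]
  intro i
  have hsub := M.Ioo_subset_elements i
  refine (hw.mono hsub).unique isOpen_Ioo (locallyIntegrableOn_of_memLp (memLp_mono_set hv hsub))
    (IntegrableOn.locallyIntegrableOn ?_) ((hq i).hasWeakDerivOn (M.xl_lt_xr i).le)
  rw [← integrableOn_Ioc_iff_integrableOn_Ioo]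
  exact (intervalIntegrable_iff_integrableOn_Ioc_of_le (M.xl_lt_xr i).le).1 (hq i).1

/-- No separate regularity of `q` is assumed: as the derivative of `u` it has one order less, and
the squared length restores the full power. Hence this can be applied to second time differences,
which are controlled for `u` only. -/
theorem sum_sq_mul_fluxα_sq_le (hs : ∀ i, StabBound A (τ.quP i) (τ.puP i) (τ.quM i))
    (hsize : M.size ≤ 1) {n : ℕ} (hk : k = n + 1)
    (hu : InSob M.elements (k + 1) B u) (hq : ∀ i, IsPrim (M.xl i) (M.xr i) u q)
    (cq : ContElem M q) :
    ∑ i, (M.xr i - M.xl i) ^ 2 * fluxα M k τ u q i ^ 2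
      ≤ 4 * ((((k + 1 : ℕ) : ℝ) ^ 2 + 1) ^ 2 * M.size ^ (2 * k + 1) * B ^ 2) := by
  have cu : ContElem M u := fun i => (hq i).continuousOn (M.xl_lt_xr i).le
  obtain ⟨u1, -⟩ := hu.sum_resid_sq_le cu le_rfl
  have hq' : InSob M.elements (n + 1) B q := hk ▸ hu.deriv_of_isPrim hq
  obtain ⟨q1, -⟩ := hq'.sum_resid_sq_le (N := k + 1) cq (by omega)
  have hstep : ∀ i, (M.xr i - M.xl i) ^ 2 * fluxα M k τ u q i ^ 2
      ≤ 2 * M.size ^ 2 * residL (k + 1) (M.xl i) (M.xr i) q ^ 2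
        + 2 * residL (k + 1) (M.xl i) (M.xr i) u ^ 2 := by
    intro i
    obtain ⟨-, -, -, -, h5, h6, -, -⟩ := hs i
    have hh := M.len_le_size i
    have h0 := M.len_pos i
    unfold fluxα
    set ql := residL (k + 1) (M.xl i) (M.xr i) q
    set ul := residL (k + 1) (M.xl i) (M.xr i) u
    have a1 : (ql + τ.quP i * ul) ^ 2 ≤ 2 * ql ^ 2 + 2 * (τ.quP i * ul) ^ 2 := by
      nlinarith [sq_nonneg (ql - τ.quP i * ul)]
    have e1 : (τ.quP i * ul) ^ 2 ≤ ul ^ 2 := by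
      rw [mul_pow]; exact mul_le_of_le_one_left (sq_nonneg _) (by nlinarith)
    have b1 : (M.xr i - M.xl i) ^ 2 ≤ M.size ^ 2 := pow_le_pow_left₀ h0.le hh 2
    have b2 : (M.xr i - M.xl i) ^ 2 ≤ 1 := pow_le_one₀ h0.le (hh.trans hsize)
    calc _ ≤ (M.xr i - M.xl i) ^ 2 * (2 * ql ^ 2 + 2 * ul ^ 2) :=
          mul_le_mul_of_nonneg_left (by linarith) (sq_nonneg _)
      _ = 2 * ((M.xr i - M.xl i) ^ 2 * ql ^ 2) + 2 * ((M.xr i - M.xl i) ^ 2 * ul ^ 2) := by ring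
      _ ≤ 2 * (M.size ^ 2 * ql ^ 2) + 2 * (1 * ul ^ 2) := by gcongr
      _ = _ := by ring
  refine (Finset.sum_le_sum fun i _ => hstep i).trans ?_
  rw [Finset.sum_add_distrib, ← Finset.mul_sum, ← Finset.mul_sum]
  have e : M.size ^ 2 * ((((k + 1 : ℕ) : ℝ) ^ 2 + 1) ^ 2 * M.size ^ (2 * n + 1) * B ^ 2)
      = (((k + 1 : ℕ) : ℝ) ^ 2 + 1) ^ 2 * M.size ^ (2 * k + 1) * B ^ 2 := by
    rw [hk]; ring
  have := mul_le_mul_of_nonneg_left q1 (sq_nonneg M.size)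
  rw [e] at this
  linarith

end

/-! ### Limits of difference quotients -/

theorem sum_deriv_sq_le {N : ℕ} {S : Set ℝ} {t B : ℝ} (hS : UniqueDiffWithinAt ℝ S t)
    {f : ℝ → Fin N → ℝ} {f' : Fin N → ℝ}
    (hf : ∀ i, HasDerivWithinAt (fun s => f s i) (f' i) S t)
    (h : ∀ s ∈ S, ∑ i, (f s i - f t i) ^ 2 ≤ B * (s - t) ^ 2) : ∑ i, f' i ^ 2 ≤ B := by
  have hne : (𝓝[S \ {t}] t).NeBot := by
    have := hS.accPt
    rwa [accPt_principal_iff_nhdsWithin] at this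
  refine le_of_tendsto (tendsto_finsetSum _ fun i _ =>
    (hasDerivWithinAt_iff_tendsto_slope.1 (hf i)).pow 2) ?_
  filter_upwards [self_mem_nhdsWithin] with s hs
  have hst : 0 < (s - t) ^ 2 := by
    have := sub_ne_zero.2 hs.2
    positivity
  have : ∑ i, slope (fun s => f s i) t s ^ 2 = (∑ i, (f s i - f t i) ^ 2) / (s - t) ^ 2 := by
    rw [Finset.sum_div]
    exact Finset.sum_congr rfl fun i _ => by rw [slope_def_field, div_pow]
  rw [this, div_le_iff₀ hst]
  exact h s hs.1

theorem sum_mul_deriv_sub_sq_le {N : ℕ} {s t B : ℝ} {c : Fin N → ℝ} {f : ℝ → Fin N → ℝ}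
    {fs ft : Fin N → ℝ} (hs : ∀ i, HasDerivAt (fun x => f x i) (fs i) s)
    (ht : ∀ i, HasDerivAt (fun x => f x i) (ft i) t)
    (h : ∀ᶠ d in 𝓝[>] (0 : ℝ),
      ∑ i, c i * (f (t + d) i - f t i - (f (s + d) i - f s i)) ^ 2 ≤ B * d ^ 2) :
    ∑ i, c i * (ft i - fs i) ^ 2 ≤ B := by
  have hlt : (𝓝[>] (0 : ℝ)) ≤ 𝓝[≠] 0 := nhdsWithin_mono _ fun x hx => ne_of_gt hx
  refine le_of_tendsto (tendsto_finsetSum _ fun i _ => ((((hasDerivAt_iff_tendsto_slope_zero.1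
    (ht i)).mono_left hlt).sub ((hasDerivAt_iff_tendsto_slope_zero.1 (hs i)).mono_left hlt)).pow
      2).const_mul (c i)) ?_
  filter_upwards [h, self_mem_nhdsWithin] with d hd hd0
  have hd2 : 0 < d ^ 2 := pow_pos hd0 2
  have hdn : d ≠ 0 := ne_of_gt hd0
  have : ∑ i, c i * (d⁻¹ • (f (t + d) i - f t i) - d⁻¹ • (f (s + d) i - f s i)) ^ 2
      = (∑ i, c i * (f (t + d) i - f t i - (f (s + d) i - f s i)) ^ 2) / d ^ 2 := by
    rw [Finset.sum_div]
    refine Finset.sum_congr rfl fun i _ => ?_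
    simp only [smul_eq_mul]; field_simp
  rw [this, div_le_iff₀ hd2]
  exact hd

end KdVHDG

end

noncomputable section

namespace KdVHDG

open Filter Topology MeshSys

/-! ### The error of the semi-discrete method -/

theorem Stabilization.Admissible.stabBound {N : ℕ} {τ : Stabilization N} (h : τ.Admissible)
    {τmin τmax A : ℝ} (hmin : 0 < τmin) (hτ : ∀ i, τ.quM i ∈ Icc τmin τmax) (hA : 1 ≤ A)
    (hA1 : τmax ≤ A) (hA2 : τmin⁻¹ ≤ A) (i : Fin N) :
    StabBound A (τ.quP i) (τ.puP i) (τ.quM i) where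
  one_le := hA
  pos := (h i).1
  le := (hτ i).2.trans hA1
  inv_le := (inv_anti₀ hmin (hτ i).1).trans hA2
  tp_nonneg := (h i).2.2.1.1
  tp_le := (h i).2.2.1.2
  sig_ge := by
    have h1 := (h i).2.2.2.1
    have h2 : Real.sqrt (1 - τ.quP i ^ 2) ≤ 1 := Real.sqrt_le_one.2 (by nlinarith)
    linarith
  sig_le := (h i).2.2.2.2

variable {a b : ℝ} {M : Mesh a b} {k : ℕ} {T L A : ℝ} {f : ℝ → ℝ → ℝ} {u0 uDa uDb qN : ℝ → ℝ}
  {u q p ut : ℝ → ℝ → ℝ} {τ : Stabilization M.N} {s : ℝ → State M} {uht : ℝ → M.PW}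

theorem IsHDGSolution.mem_u (hh : IsHDGSolution M k τ T f u0 uDa uDb qN s uht) {t : ℝ}
    (ht : t ∈ Icc 0 T) : (s t).u ∈ M.W k := by
  rcases ht.1.eq_or_lt with rfl | h0
  · exact hh.initial.mem_u
  · exact (hh.evolution t ⟨h0, ht.2⟩).mem_u

/-- Coefficients beyond degree `k` vanish at all times, hence so do their derivatives. -/
theorem IsHDGSolution.mem_uht (hh : IsHDGSolution M k τ T f u0 uDa uDb qN s uht) (hT : 0 < T)
    {t : ℝ} (ht : t ∈ Icc 0 T) : uht t ∈ M.W k := by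
  intro i
  rw [mem_degreeLE_iff, natDegree_le_iff_coeff_eq_zero]
  intro n hn
  have h0 : ∀ t ∈ Icc 0 T, ((s t).u i).coeff n = 0 := fun t ht =>
    coeff_eq_zero_of_natDegree_lt ((mem_degreeLE_iff.1 (hh.mem_u ht i)).trans_lt hn)
  exact (uniqueDiffOn_Icc hT t ht).eq_deriv _ (hh.hasTimeDeriv t ht i n)
    ((hasDerivWithinAt_const t _ (0 : ℝ)).congr h0 (h0 t ht))

/-- The difference of the `L²` projection of the exact solution and the discrete solution as a
function of time. -/
def errPath (M : Mesh a b) (k : ℕ) (τ : Stabilization M.N) (u q p ut : ℝ → ℝ → ℝ)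
    (s : ℝ → State M) (uht : ℝ → M.PW) (t : ℝ) : Fin M.N → ElemData :=
  errData M k τ (u t) (q t) (p t) (if t = 0 then u t else ut t)
    (if t = 0 then (s t).u else uht t) (s t)

theorem diff_residL {w : ℝ → ℝ → ℝ} {t : ℝ} (i : Fin M.N)
    (h1 : DifferentiableWithinAt ℝ (fun s => w s (M.xl i)) (Icc 0 T) t)
    (h2 : ∀ v : ℝ[X], DifferentiableWithinAt ℝ
      (fun s => ∫ x in (M.xl i)..(M.xr i), w s x * v.eval x) (Icc 0 T) t) (n : ℕ) :
    DifferentiableWithinAt ℝ (fun s => residL n (M.xl i) (M.xr i) (w s)) (Icc 0 T) t :=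
  h1.sub (differentiableWithinAt_legProj_eval h2 _)

theorem diff_residR {w : ℝ → ℝ → ℝ} {t : ℝ} (i : Fin M.N)
    (h1 : DifferentiableWithinAt ℝ (fun s => w s (M.xr i)) (Icc 0 T) t)
    (h2 : ∀ v : ℝ[X], DifferentiableWithinAt ℝ
      (fun s => ∫ x in (M.xl i)..(M.xr i), w s x * v.eval x) (Icc 0 T) t) (n : ℕ) :
    DifferentiableWithinAt ℝ (fun s => residR n (M.xl i) (M.xr i) (w s)) (Icc 0 T) t :=
  h1.sub (differentiableWithinAt_legProj_eval h2 _)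

namespace RegSol

variable (h : RegSol M k T L f u0 uDa uDb qN u q p ut)

include h

theorem hasDeriv_err_u (hh : IsHDGSolution M k τ T f u0 uDa uDb qN s uht) {t : ℝ}
    (ht : t ∈ Icc 0 T) (i : Fin M.N) (j : ℕ) :
    HasDerivWithinAt (fun r => (errPath M k τ u q p ut s uht r i).u.coeff j)
      ((legProj (k + 1) (M.xl i) (M.xr i) (ut t) - uht t i).coeff j) (Icc 0 T) t := by
  simp only [errPath, errData, coeff_sub]
  exact (hasDerivWithinAt_legProj_coeff (fun v => h.deriv_moment_u ht i v) j).sub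
    (hh.hasTimeDeriv t ht i j)

theorem diff_fluxes (τ : Stabilization M.N) {t : ℝ} (ht : t ∈ Icc 0 T) (i : Fin M.N) :
    DifferentiableWithinAt ℝ (fun s => fluxα M k τ (u s) (q s) i) (Icc 0 T) t ∧
    DifferentiableWithinAt ℝ (fun s => fluxβ M k τ (u s) (p s) i) (Icc 0 T) t ∧
    DifferentiableWithinAt ℝ (fun s => fluxγ M k τ (u s) (q s) (p s) i) (Icc 0 T) t := by
  have hl := left_mem_Icc.2 (M.xl_lt_xr i).le
  have hr := right_mem_Icc.2 (M.xl_lt_xr i).le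
  have mu := fun v => (h.deriv_moment_u ht i v).differentiableWithinAt
  have mq := h.diff_moment_q ht i
  have mp := h.diff_moment_p ht i
  have ul := diff_residL i (h.diff_u ht i hl) mu (k + 1)
  have ur := diff_residR i (h.diff_u ht i hr) mu (k + 1)
  have ql := diff_residL i (h.diff_q ht i hl) mq (k + 1)
  have qr := diff_residR i (h.diff_q ht i hr) mq (k + 1)
  have pl := diff_residL i (h.diff_p ht i hl) mp (k + 1)
  have pr := diff_residR i (h.diff_p ht i hr) mp (k + 1)
  exact ⟨ql.add (ul.const_mul _), pl.add (ul.const_mul _),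
    (qr.sub (ur.const_mul _)).sub (pr.const_mul _)⟩

theorem meshSys (hab : a < b) (hτ : τ.Admissible)
    (hh : IsHDGSolution M k τ T f u0 uDa uDb qN s uht) {t : ℝ} (ht : t ∈ Icc 0 T) :
    MeshSys M k τ (errPath M k τ u q p ut s uht t) := by
  unfold errPath
  rcases ht.1.eq_or_lt with rfl | h0
  · rw [if_pos rfl, if_pos rfl]
    exact hh.initial.meshSys_errData hab hτ hh.initial.mem_u (h.prim_u ht) (h.prim_q ht)
      (h.cont_p ht) (fun i => (h.cont_u ht i).intervalIntegrable_of_Icc (M.xl_lt_xr i).le)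
      h.integral_initial_mul (h.exact.bdry_a 0 ht) (h.exact.bdry_b 0 ht) (h.exact.bdry_q 0 ht)
  · rw [if_neg h0.ne', if_neg h0.ne']
    have ht' : t ∈ Ioc 0 T := ⟨h0, ht.2⟩
    exact (hh.evolution t ht').meshSys_errData hab hτ (hh.mem_uht h.pos ht) (h.prim_u ht)
      (h.prim_q ht) (h.cont_p ht) (h.integrable_ut ht) (h.integral_f_mul ht')
      (h.exact.bdry_a t ht) (h.exact.bdry_b t ht) (h.exact.bdry_q t ht)

/-- The discrete error solves the error equations, with residuals of order `h^{k+1/2}`. -/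
theorem errFlow {n : ℕ} (hk : k = n + 1) (hab : a < b) (hsize : M.size ≤ 1) (hτ : τ.Admissible)
    (hA : 1 ≤ A) (hs : ∀ i, StabBound A (τ.quP i) (τ.puP i) (τ.quM i))
    (hh : IsHDGSolution M k τ T f u0 uDa uDb qN s uht) :
    ErrFlow M k τ T
      (5 * A * ((((k + 1 : ℕ) : ℝ) ^ 2 + 1) * Real.sqrt (M.size ^ (2 * k + 1)) * L))
      (errPath M k τ u q p ut s uht)
      (fun i => legProj (k + 1) (M.xl i) (M.xr i) (ut 0) - uht 0 i)
      (fun t i => derivWithin (fun s => fluxα M k τ (u s) (q s) i) (Icc 0 T) t)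
      (fun t i => derivWithin (fun s => fluxβ M k τ (u s) (p s) i) (Icc 0 T) t)
      (fun t i => derivWithin (fun s => fluxγ M k τ (u s) (q s) (p s) i) (Icc 0 T) t) := by
  have h0 : (0 : ℝ) ∈ Icc 0 T := left_mem_Icc.2 h.pos.le
  have hL := h.reg_u.nonneg
  have hp := pow_nonneg M.size_nonneg (2 * k + 1)
  have hδ : (5 * A * ((((k + 1 : ℕ) : ℝ) ^ 2 + 1) * Real.sqrt (M.size ^ (2 * k + 1)) * L)) ^ 2
      = 25 * A ^ 2 * ((((k + 1 : ℕ) : ℝ) ^ 2 + 1) ^ 2 * M.size ^ (2 * k + 1) * L ^ 2) := by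
    rw [mul_pow, mul_pow, mul_pow, mul_pow, Real.sq_sqrt hp]; norm_num
  constructor
  · exact fun t ht => h.meshSys hab hτ hh ht
  · exact fun t _ i => rfl
  · exact fun t _ i => rfl
  · intro i; simp [errPath, errData]
  · intro t ht i j
    have := h.hasDeriv_err_u hh (Ioc_subset_Icc_self ht) i j
    simpa [errPath, errData, ht.1.ne'] using this
  · intro i
    exact (natDegree_sub_le_of_le (natDegree_legProj_le k _ _ _)
      (mem_degreeLE_iff.1 (hh.mem_uht h.pos h0 i))).trans (max_self k).le
  · exact fun i j => h.hasDeriv_err_u hh h0 i j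
  · exact fun t ht i => (h.diff_fluxes τ ht i).1.hasDerivWithinAt
  · exact fun t ht i => (h.diff_fluxes τ ht i).2.1.hasDerivWithinAt
  · exact fun t ht i => (h.diff_fluxes τ ht i).2.2.hasDerivWithinAt
  · positivity
  · intro t ht
    rw [hδ]
    exact sum_flux_sq_le hs (h.reg_u.bound t ht) (h.reg_q.bound t ht) (h.reg_p.bound t ht)
      (h.cont_u ht) (h.cont_q ht) (h.cont_p ht)
  · intro r hr t ht
    have := sum_flux_sq_le hs (h.reg_u.lip r hr t ht) (h.reg_q.lip r hr t ht)
      (h.reg_p.lip r hr t ht) (ContElem.sub (h.cont_u ht) (h.cont_u hr))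
      (ContElem.sub (h.cont_q ht) (h.cont_q hr)) (ContElem.sub (h.cont_p ht) (h.cont_p hr))
    simp only [fluxα_sub (h.cont_u ht) (h.cont_u hr) (h.cont_q ht) (h.cont_q hr),
      fluxβ_sub (h.cont_u ht) (h.cont_u hr) (h.cont_p ht) (h.cont_p hr),
      fluxγ_sub (h.cont_u ht) (h.cont_u hr) (h.cont_q ht) (h.cont_q hr) (h.cont_p ht)
        (h.cont_p hr)] at this
    rw [hδ]
    refine this.trans (le_of_eq ?_)
    rw [mul_pow L, sq_abs]; ring
  · intro r hr t ht
    rw [hδ]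
    have hr' := Ioo_subset_Icc_self hr
    have ht' := Ioo_subset_Icc_self ht
    refine sum_mul_deriv_sub_sq_le (f := fun s i => fluxα M k τ (u s) (q s) i)
      (fun i => ((h.diff_fluxes τ hr' i).1.hasDerivWithinAt).hasDerivAt (Icc_mem_nhds hr.1 hr.2))
      (fun i => ((h.diff_fluxes τ ht' i).1.hasDerivWithinAt).hasDerivAt (Icc_mem_nhds ht.1 ht.2)) ?_
    have hpos : 0 < min (T - r) (T - t) := lt_min (sub_pos.2 hr.2) (sub_pos.2 ht.2)
    filter_upwards [Ioo_mem_nhdsGT hpos] with d hd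
    have hd1 : d < T - r := hd.2.trans_le (min_le_left _ _)
    have hd2 : d < T - t := hd.2.trans_le (min_le_right _ _)
    have hrd : r + d ∈ Icc 0 T := ⟨by linarith [hr.1, hd.1], by linarith⟩
    have htd : t + d ∈ Icc 0 T := ⟨by linarith [ht.1, hd.1], by linarith⟩
    -- The estimate is applied to the second difference in time of `u`; its spatial derivative is
    -- the second difference of `q`.
    have key := sum_sq_mul_fluxα_sq_le hs hsize hk
      (h.reg_u₂ r t d hd.1.le hr' ht' hrd htd)
      (q := fun x => q (t + d) x - q t x - (q (r + d) x - q r x))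
      (fun i => isPrim_of_hasDerivWithinAt
        (((h.cont_q htd i).sub (h.cont_q ht' i)).sub ((h.cont_q hrd i).sub (h.cont_q hr' i)))
        (fun x hx => ((h.deriv_u htd i hx).sub (h.deriv_u ht' i hx)).sub
          ((h.deriv_u hrd i hx).sub (h.deriv_u hr' i hx))) (M.xl_lt_xr i).le)
      (ContElem.sub (ContElem.sub (h.cont_q htd) (h.cont_q ht'))
        (ContElem.sub (h.cont_q hrd) (h.cont_q hr')))
    simp only [fluxα_sub (ContElem.sub (h.cont_u htd) (h.cont_u ht'))
        (ContElem.sub (h.cont_u hrd) (h.cont_u hr'))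
        (ContElem.sub (h.cont_q htd) (h.cont_q ht')) (ContElem.sub (h.cont_q hrd) (h.cont_q hr')),
      fluxα_sub (h.cont_u htd) (h.cont_u ht') (h.cont_q htd) (h.cont_q ht'),
      fluxα_sub (h.cont_u hrd) (h.cont_u hr') (h.cont_q hrd) (h.cont_q hr')] at key
    refine key.trans ?_
    have e : (L * |t - r| * d) ^ 2 = L ^ 2 * (t - r) ^ 2 * d ^ 2 := by
      rw [mul_pow, mul_pow, sq_abs]
    rw [e]
    have hX : 0 ≤ (((k + 1 : ℕ) : ℝ) ^ 2 + 1) ^ 2 * M.size ^ (2 * k + 1)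
        * (L ^ 2 * (t - r) ^ 2 * d ^ 2) := by positivity
    have hA2 : 1 ≤ A ^ 2 := one_le_pow₀ hA
    nlinarith [mul_le_mul_of_nonneg_right hA2 hX]

end RegSol

end KdVHDG

end

noncomputable section

namespace KdVHDG

open Filter Topology MeshSys

/-! ### The projection -/

section

variable {a b : ℝ} (M : Mesh a b) (k : ℕ) (τ : Stabilization M.N) (u q p : ℝ → ℝ)

/-- The coefficients of `L_k` in `P_k u - Π u`, where `P_k` is the `L²` projection. -/
def projCoeff (i : Fin M.N) : ℝ :=
  relCu k (τ.quP i) (τ.puP i) (τ.quM i) (fluxα M k τ u q i) (fluxβ M k τ u p i)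
    (fluxγ M k τ u q p i)

def projU : M.PW := fun i => legProj (k + 1) (M.xl i) (M.xr i) u
  - C (projCoeff M k τ u q p i) * leg k (M.xl i) (M.xr i)

def projQ : M.PW := fun i => legProj (k + 1) (M.xl i) (M.xr i) q
  - C (relCq k (τ.quP i) (fluxα M k τ u q i) (projCoeff M k τ u q p i)) * leg k (M.xl i) (M.xr i)

def projP : M.PW := fun i => legProj (k + 1) (M.xl i) (M.xr i) p
  - C (relCp k (τ.quP i) (τ.quM i) (fluxα M k τ u q i) (fluxγ M k τ u q p i)
    (projCoeff M k τ u q p i)) * leg k (M.xl i) (M.xr i)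

variable {M k τ u q p} {A : ℝ}

/-- The algebra of `relShift` involves only the flux residuals, so it is read off from dummy data on
`[0, 1]`. -/
theorem rel_flux_eqs {τp σ t : ℝ} (hs : StabBound A τp σ t) (k : ℕ) (α β γ : ℝ) :
    α + (-1) ^ k * relCq k τp α (relCu k τp σ t α β γ) + τp * (-1) ^ k * relCu k τp σ t α β γ = 0 ∧
    β + (-1) ^ k * relCp k τp t α γ (relCu k τp σ t α β γ)
      + σ * (-1) ^ k * relCu k τp σ t α β γ = 0 ∧
    γ + relCq k τp α (relCu k τp σ t α β γ) - t * relCu k τp σ t α β γ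
      - t⁻¹ * relCp k τp t α γ (relCu k τp σ t α β γ) = 0 := by
  have key : ∀ c, _ ∧ _ := fun c =>
    ⟨ElemData.relShift_α k 0 1 τp σ t c ⟨0, 0, 0, 0, 0, 0, 0, 0, 0, 0, 0, 0, α, β, γ⟩,
      ElemData.relShift_γ k 0 1 τp σ t c hs.pos.ne' ⟨0, 0, 0, 0, 0, 0, 0, 0, 0, 0, 0, 0, α, β, γ⟩⟩
  have hβ := ElemData.relShift_β k 0 1 (relCu k τp σ t α β γ) hs
    ⟨0, 0, 0, 0, 0, 0, 0, 0, 0, 0, 0, 0, α, β, γ⟩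
  rw [sub_self, mul_zero, mul_zero] at hβ
  exact ⟨(key _).1, hβ, (key _).2⟩

theorem integral_sub_legProj_mul {i : Fin M.N}
    (hw : IntervalIntegrable u volume (M.xl i) (M.xr i)) (c : ℝ)
    {v : ℝ[X]} (hv : v ∈ degreeLT ℝ k) :
    ∫ x in (M.xl i)..(M.xr i), (u x - (legProj (k + 1) (M.xl i) (M.xr i) u
      - C c * leg k (M.xl i) (M.xr i)).eval x) * v.eval x = 0 := by
  have e1 := integral_mul_eq_itg_legProj (M.xl_lt_xr i) hw (k + 1) v
    (degreeLT_mono (Nat.le_succ k) hv)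
  have e2 : itg (M.xl i) (M.xr i) (leg k (M.xl i) (M.xr i) * v) = 0 :=
    itg_leg_mul_eq_zero_of_mem _ _ hv
  set P := legProj (k + 1) (M.xl i) (M.xr i) u - C c * leg k (M.xl i) (M.xr i) with hP
  have e3 : itg (M.xl i) (M.xr i) (P * v)
      = itg (M.xl i) (M.xr i) (legProj (k + 1) (M.xl i) (M.xr i) u * v) := by
    rw [hP, sub_mul, map_sub, mul_assoc, itg_C_mul, e2, mul_zero, sub_zero]
  simp only [sub_mul]
  rw [intervalIntegral.integral_sub (intervalIntegrable_mul_eval hw v)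
    (intervalIntegrable_mul_eval (P.continuous.intervalIntegrable _ _) v), e1, ← e3, itg_apply]
  simp

theorem sub_C_mul_leg_mem (w : ℝ → ℝ) (c : Fin M.N → ℝ) :
    (fun i => legProj (k + 1) (M.xl i) (M.xr i) w - C (c i) * leg k (M.xl i) (M.xr i) : M.PW)
      ∈ M.W k := fun _ => mem_degreeLE_iff.2 <|
  (natDegree_sub_le_of_le (natDegree_legProj_le k _ _ _)
    ((natDegree_C_mul_le _ _).trans (natDegree_leg_le k _ _))).trans (max_self k).le

theorem isProjection_proj (hτ : τ.Admissible)
    (hs : ∀ i, StabBound A (τ.quP i) (τ.puP i) (τ.quM i))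
    (cu : ContElem M u) (cq : ContElem M q) (cp : ContElem M p) :
    IsProjection M k τ u q p (projU M k τ u q p) (projQ M k τ u q p) (projP M k τ u q p) where
  mem_u := sub_C_mul_leg_mem _ _
  mem_q := sub_C_mul_leg_mem _ _
  mem_p := sub_C_mul_leg_mem _ _
  orth_u i _ hv := integral_sub_legProj_mul (cu.integrable i) _ hv
  orth_q i _ hv := integral_sub_legProj_mul (cq.integrable i) _ hv
  orth_p i _ hv := integral_sub_legProj_mul (cp.integrable i) _ hv
  left_p i := by
    have := (rel_flux_eqs (hs i) k (fluxα M k τ u q i) (fluxβ M k τ u p i)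
      (fluxγ M k τ u q p i)).2.1
    rw [← projCoeff] at this
    simp only [Mesh.trp, projU, projP, eval_sub, eval_mul, eval_C, eval_leg_left k (M.xl_lt_xr i)]
    rw [fluxβ, residL, residL] at this
    linarith
  left_q i := by
    have := (rel_flux_eqs (hs i) k (fluxα M k τ u q i) (fluxβ M k τ u p i)
      (fluxγ M k τ u q p i)).1
    rw [← projCoeff] at this
    simp only [Mesh.trp, projU, projQ, eval_sub, eval_mul, eval_C, eval_leg_left k (M.xl_lt_xr i)]
    nth_rewrite 1 [fluxα] at this
    rw [residL, residL] at this
    linarith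
  right_q i := by
    have hqp : τ.qpM i = (τ.quM i)⁻¹ := by
      have := (hτ i).2.1
      rw [mul_comm] at this
      exact eq_inv_of_mul_eq_one_left this
    have := (rel_flux_eqs (hs i) k (fluxα M k τ u q i) (fluxβ M k τ u p i)
      (fluxγ M k τ u q p i)).2.2
    rw [← projCoeff] at this
    simp only [Mesh.trm, projU, projQ, projP, eval_sub, eval_mul, eval_C,
      eval_leg_right k (M.xl_lt_xr i), hqp]
    nth_rewrite 1 [fluxγ] at this
    rw [residR, residR, residR] at this
    linarith

theorem exists_sub_eq_leg {P Q : M.PW} (hP : P ∈ M.W k) (hQ : Q ∈ M.W k) (i : Fin M.N)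
    (hw : IntervalIntegrable u volume (M.xl i) (M.xr i))
    (oP : ∀ v ∈ degreeLT ℝ k, ∫ x in (M.xl i)..(M.xr i), (u x - (P i).eval x) * v.eval x = 0)
    (oQ : ∀ v ∈ degreeLT ℝ k, ∫ x in (M.xl i)..(M.xr i), (u x - (Q i).eval x) * v.eval x = 0) :
    ∃ c : ℝ, Q i - P i = C c * leg k (M.xl i) (M.xr i) := by
  refine ⟨_, eq_C_mul_leg (M.xl_lt_xr i) ((natDegree_sub_le_of_le (mem_degreeLE_iff.1 (hQ i))
    (mem_degreeLE_iff.1 (hP i))).trans (max_self k).le) fun v hv => ?_⟩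
  have hi : ∀ z : ℝ[X], IntervalIntegrable (fun x => (u x - z.eval x) * v.eval x) volume
      (M.xl i) (M.xr i) := fun z =>
    intervalIntegrable_mul_eval (hw.sub (z.continuous.intervalIntegrable _ _)) v
  have e : itg (M.xl i) (M.xr i) ((Q i - P i) * v)
      = (∫ x in (M.xl i)..(M.xr i), (u x - (P i).eval x) * v.eval x)
        - ∫ x in (M.xl i)..(M.xr i), (u x - (Q i).eval x) * v.eval x := by
    rw [← intervalIntegral.integral_sub (hi _) (hi _), itg_apply]
    refine intervalIntegral.integral_congr fun x _ => ?_
    simp only [eval_mul, eval_sub]; ring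
  rw [e, oP v hv, oQ v hv, sub_zero]

/-- Orthogonality leaves differences `c L_k`, `d L_k`, `e L_k`. The end conditions are a homogeneous
system for `c`, `d`, `e`; elimination gives `relRate * c = 0`. -/
theorem IsProjection.unique (hτ : τ.Admissible)
    (hs : ∀ i, StabBound A (τ.quP i) (τ.puP i) (τ.quM i))
    (cu : ContElem M u) (cq : ContElem M q) (cp : ContElem M p) {Pu Pq Pp Qu Qq Qp : M.PW}
    (hP : IsProjection M k τ u q p Pu Pq Pp) (hQ : IsProjection M k τ u q p Qu Qq Qp) :
    Qu = Pu ∧ Qq = Pq ∧ Qp = Pp := by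
  have key : ∀ i, Qu i = Pu i ∧ Qq i = Pq i ∧ Qp i = Pp i := by
    intro i
    have hlr := M.xl_lt_xr i
    obtain ⟨c, hc⟩ := exists_sub_eq_leg hP.mem_u hQ.mem_u i (cu.integrable i) (hP.orth_u i)
      (hQ.orth_u i)
    obtain ⟨d, hd⟩ := exists_sub_eq_leg hP.mem_q hQ.mem_q i (cq.integrable i) (hP.orth_q i)
      (hQ.orth_q i)
    obtain ⟨e, he⟩ := exists_sub_eq_leg hP.mem_p hQ.mem_p i (cp.integrable i) (hP.orth_p i)
      (hQ.orth_p i)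
    have evl : ∀ {P Q : M.PW} {c : ℝ}, Q i - P i = C c * leg k (M.xl i) (M.xr i) →
        M.trp Q i - M.trp P i = c * (-1) ^ k := fun {P Q c} hh => by
      have := congrArg (eval (M.xl i)) hh
      rwa [eval_sub, eval_mul, eval_C, eval_leg_left k hlr] at this
    have evr : ∀ {P Q : M.PW} {c : ℝ}, Q i - P i = C c * leg k (M.xl i) (M.xr i) →
        M.trm Q i - M.trm P i = c := fun {P Q c} hh => by
      have := congrArg (eval (M.xr i)) hh
      rwa [eval_sub, eval_mul, eval_C, eval_leg_right k hlr, mul_one] at this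
    have s2 : ((-1 : ℝ) ^ k) * (-1) ^ k = 1 := by rw [← mul_pow]; norm_num
    have f1 : e + τ.puP i * c = 0 := by
      linear_combination (-1) ^ k * (hP.left_p i - hQ.left_p i) - (-1) ^ k * evl he
        - (-1) ^ k * τ.puP i * evl hc - (e + τ.puP i * c) * s2
    have f2 : d + τ.quP i * c = 0 := by
      linear_combination (-1) ^ k * (hP.left_q i - hQ.left_q i) - (-1) ^ k * evl hd
        - (-1) ^ k * τ.quP i * evl hc - (d + τ.quP i * c) * s2
    have f3 : d - τ.quM i * c - τ.qpM i * e = 0 := by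
      linear_combination (hP.right_q i - hQ.right_q i) - evr hd + τ.quM i * evr hc
        + τ.qpM i * evr he
    have hr := half_le_relRate (hs i)
    have f4 : relRate (τ.quP i) (τ.puP i) (τ.quM i) * c = 0 := by
      unfold relRate
      linear_combination τ.quM i * f2 - τ.quM i * f3 - f1 - e * (hτ i).2.1
    have c0 : c = 0 := (mul_eq_zero.1 f4).resolve_left (by linarith)
    have e0 : e = 0 := by simpa [c0] using f1
    have d0 : d = 0 := by simpa [c0] using f2
    rw [c0, C_0, zero_mul] at hc
    rw [d0, C_0, zero_mul] at hd
    rw [e0, C_0, zero_mul] at he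
    exact ⟨sub_eq_zero.1 hc, sub_eq_zero.1 hd, sub_eq_zero.1 he⟩
  exact ⟨funext fun i => (key i).1, funext fun i => (key i).2.1, funext fun i => (key i).2.2⟩

end

theorem relCu_sub (k : ℕ) (τp σ t α β γ α' β' γ' : ℝ) :
    relCu k τp σ t (α - α') (β - β') (γ - γ')
      = relCu k τp σ t α β γ - relCu k τp σ t α' β' γ' := by
  unfold relCu; ring

theorem hasDerivWithinAt_relCu (k : ℕ) (τp σ t : ℝ) {α β γ : ℝ → ℝ} {α' β' γ' s : ℝ} {S : Set ℝ}
    (hα : HasDerivWithinAt α α' S s) (hβ : HasDerivWithinAt β β' S s)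
    (hγ : HasDerivWithinAt γ γ' S s) :
    HasDerivWithinAt (fun r => relCu k τp σ t (α r) (β r) (γ r)) (relCu k τp σ t α' β' γ') S s :=
  ((hβ.const_mul _).add ((hγ.sub (hα.const_mul _)).const_mul _)).div_const _

namespace RegSol

variable {a b : ℝ} {M : Mesh a b} {k : ℕ} {T L A : ℝ} {f : ℝ → ℝ → ℝ} {u0 uDa uDb qN : ℝ → ℝ}
  {u q p ut : ℝ → ℝ → ℝ} {τ : Stabilization M.N} {s : ℝ → State M} {uht : ℝ → M.PW}

/-- The constant in the error estimate. -/
def errConst (n : ℕ) (A D T L : ℝ) : ℝ :=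
  (flowConst n A D T + 4 * A) * (5 * A * ((((n + 1 + 1 : ℕ) : ℝ) ^ 2 + 1) * L))

theorem error_le {n : ℕ} (h : RegSol M (n + 1) T L f u0 uDa uDb qN u q p ut) (hab : a < b)
    (hsize : M.size ≤ 1) (hτ : τ.Admissible) (hA : 1 ≤ A)
    (hs : ∀ i, StabBound A (τ.quP i) (τ.puP i) (τ.quM i))
    (hh : IsHDGSolution M (n + 1) τ T f u0 uDa uDb qN s uht) :
    ∃ Pu Pq Pp Put : ℝ → M.PW,
      (∀ t ∈ Icc 0 T, IsProjection M (n + 1) τ (u t) (q t) (p t) (Pu t) (Pq t) (Pp t) ∧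
        ∀ Qu Qq Qp : M.PW, IsProjection M (n + 1) τ (u t) (q t) (p t) Qu Qq Qp →
          Qu = Pu t ∧ Qq = Pq t ∧ Qp = Pp t) ∧
      HasTimeDeriv M T Pu Put ∧
      ∀ t ∈ Icc 0 T,
        M.norm (Pu t - (s t).u) + M.norm (Pq t - (s t).q) + M.norm (Pp t - (s t).p)
          + M.norm (Put t - uht t) ≤ errConst n A (b - a) T L * M.size ^ (n + 1 + 1) := by
  have flow := h.errFlow rfl hab hsize hτ hA hs hh
  set k := n + 1 with hk
  set δ := 5 * A * ((((k + 1 : ℕ) : ℝ) ^ 2 + 1) * Real.sqrt (M.size ^ (2 * k + 1)) * L) with hδ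
  set dα : ℝ → Fin M.N → ℝ := fun t i =>
    derivWithin (fun s => fluxα M k τ (u s) (q s) i) (Icc 0 T) t with hdα
  set dβ : ℝ → Fin M.N → ℝ := fun t i =>
    derivWithin (fun s => fluxβ M k τ (u s) (p s) i) (Icc 0 T) t with hdβ
  set dγ : ℝ → Fin M.N → ℝ := fun t i =>
    derivWithin (fun s => fluxγ M k τ (u s) (q s) (p s) i) (Icc 0 T) t with hdγ
  -- For the projection itself one time derivative of the fluxes suffices, so no relaxation is
  -- needed here.
  set c' : ℝ → Fin M.N → ℝ := fun t i =>
    relCu k (τ.quP i) (τ.puP i) (τ.quM i) (dα t i) (dβ t i) (dγ t i) with hc'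
  have hc : ∀ t ∈ Icc 0 T, ∀ i, HasDerivWithinAt
      (fun r => projCoeff M k τ (u r) (q r) (p r) i) (c' t i) (Icc 0 T) t := fun t ht i =>
    hasDerivWithinAt_relCu _ _ _ _ (flow.deriv_α t ht i) (flow.deriv_β t ht i)
      (flow.deriv_γ t ht i)
  refine ⟨fun t => projU M k τ (u t) (q t) (p t), fun t => projQ M k τ (u t) (q t) (p t),
    fun t => projP M k τ (u t) (q t) (p t), fun t i => legProj (k + 1) (M.xl i) (M.xr i) (ut t)
      - C (c' t i) * leg k (M.xl i) (M.xr i), fun t ht => ?_, ?_, fun t ht => ?_⟩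
  · have hP := isProjection_proj (k := k) hτ hs (h.cont_u ht) (h.cont_q ht) (h.cont_p ht)
    exact ⟨hP, fun Qu Qq Qp hQ => hP.unique hτ hs (h.cont_u ht) (h.cont_q ht) (h.cont_p ht) hQ⟩
  · intro t ht i j
    simp only [projU, coeff_sub, coeff_C_mul]
    exact (hasDerivWithinAt_legProj_coeff (fun v => h.deriv_moment_u ht i v) j).sub
      ((hc t ht i).mul_const _)
  · have e1 := flow.error_le hab h.pos hA hs ht
    have u1 : pu (ErrFlow.projErr k τ (errPath M k τ u q p ut s uht t))
        = projU M k τ (u t) (q t) (p t) - (s t).u := funext fun i => sub_right_comm _ _ _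
    have u2 : pq (ErrFlow.projErr k τ (errPath M k τ u q p ut s uht t))
        = projQ M k τ (u t) (q t) (p t) - (s t).q := funext fun i => sub_right_comm _ _ _
    have u3 : pp (ErrFlow.projErr k τ (errPath M k τ u q p ut s uht t))
        = projP M k τ (u t) (q t) (p t) - (s t).p := funext fun i => sub_right_comm _ _ _
    have u4 : (fun i => legProj (k + 1) (M.xl i) (M.xr i) (ut t)
        - C (c' t i) * leg k (M.xl i) (M.xr i)) - uht t
        = ErrFlow.ut (errPath M k τ u q p ut s uht)
          (fun i => legProj (k + 1) (M.xl i) (M.xr i) (ut 0) - uht 0 i) t - M.legs k (c' t) := by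
      funext i
      unfold ErrFlow.ut
      split_ifs with h0
      · rw [h0]; exact sub_right_comm _ _ _
      · simp only [errPath, if_neg h0]; exact sub_right_comm _ _ _
    rw [u1, u2, u3] at e1
    simp only [u4]
    -- `relCu` is linear in the fluxes; the Lipschitz bound of the fluxes bounds its difference
    -- quotients, and the bound passes to the limit.
    have e2 : ∑ i, c' t i ^ 2 ≤ 12 * A ^ 2 * δ ^ 2 := by
      refine sum_deriv_sq_le (uniqueDiffOn_Icc h.pos t ht) (hc t ht) fun r hr => ?_
      refine (Finset.sum_le_sum (g := fun i => 12 * A ^ 2 *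
        (((errPath M k τ u q p ut s uht r i).α - (errPath M k τ u q p ut s uht t i).α) ^ 2
        + ((errPath M k τ u q p ut s uht r i).β - (errPath M k τ u q p ut s uht t i).β) ^ 2
        + ((errPath M k τ u q p ut s uht r i).γ - (errPath M k τ u q p ut s uht t i).γ) ^ 2))
        fun i _ => ?_).trans ?_
      · rw [projCoeff, projCoeff, ← relCu_sub]
        exact relCu_sq_le (hs i) k _ _ _
      · rw [← Finset.mul_sum, mul_assoc (12 * A ^ 2)]
        exact mul_le_mul_of_nonneg_left (flow.lip t ht r hr) (by positivity)
    have e3 : M.wnorm (c' t) ≤ 4 * A * (Real.sqrt M.size * δ) := by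
      refine ErrFlow.le_mul_of_sq_le_sq (by linarith)
        (mul_nonneg (Real.sqrt_nonneg _) flow.δ_nonneg) ?_
      rw [mul_pow (Real.sqrt _), Real.sq_sqrt M.size_nonneg]
      refine (M.wnorm_sq_le e2).trans ?_
      have : 0 ≤ M.size * δ ^ 2 := mul_nonneg M.size_nonneg (sq_nonneg _)
      nlinarith [mul_nonneg (sq_nonneg A) this]
    have e4 := (M.norm_sub_le (ErrFlow.ut (errPath M k τ u q p ut s uht)
      (fun i => legProj (k + 1) (M.xl i) (M.xr i) (ut 0) - uht 0 i) t) (M.legs k (c' t))).trans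
      (add_le_add_right ((M.norm_legs_le k _).trans e3) _)
    -- The residuals are of order `h^(k+1/2)` in `ℓ²`; the factor `√h` from the length of the
    -- elements completes the power.
    have e5 : Real.sqrt M.size * δ
        = 5 * A * ((((k + 1 : ℕ) : ℝ) ^ 2 + 1) * L) * M.size ^ (k + 1) := by
      have : Real.sqrt M.size * Real.sqrt (M.size ^ (2 * k + 1)) = M.size ^ (k + 1) := by
        rw [← Real.sqrt_mul M.size_nonneg, ← pow_succ',
          show 2 * k + 1 + 1 = (k + 1) * 2 by ring, pow_mul]
        exact Real.sqrt_sq (pow_nonneg M.size_nonneg _)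
      rw [hδ, ← this]; ring
    have e6 : errConst n A (b - a) T L * M.size ^ (k + 1)
        = flowConst n A (b - a) T * (Real.sqrt M.size * δ) + 4 * A * (Real.sqrt M.size * δ) := by
      rw [errConst, e5]; ring
    rw [e6]
    linarith

end RegSol

/-- The regularity bound is taken from one mesh `M₀`. On another mesh the weak derivatives exist by
hypothesis and agree almost everywhere with those on `M₀`, so the same `L` serves all meshes. -/
theorem exists_regSol {a b T : ℝ} {k : ℕ} (hT : 0 < T) {f : ℝ → ℝ → ℝ}
    {u0 uDa uDb qN : ℝ → ℝ} {u q p ut : ℝ → ℝ → ℝ}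
    (hexact : IsExactSolution a b T f u0 uDa uDb qN u q p ut) {M₀ : Mesh a b}
    (h₀u : MemWInftySobolev 2 T (k + 1) M₀.elements u)
    (h₀q : MemWInftySobolev 1 T (k + 1) M₀.elements q)
    (h₀p : MemWInftySobolev 1 T (k + 1) M₀.elements p) :
    ∃ L, ∀ M : Mesh a b, MemWInftySobolev 2 T (k + 1) M.elements u →
      MemWInftySobolev 1 T (k + 1) M.elements q → MemWInftySobolev 1 T (k + 1) M.elements p →
      RegSol M k T L f u0 uDa uDb qN u q p ut := by
  obtain ⟨Lu, ru⟩ := h₀u.exists_timeReg one_le_two hT.le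
  obtain ⟨Lq, rq⟩ := h₀q.exists_timeReg le_rfl hT.le
  obtain ⟨Lp, rp⟩ := h₀p.exists_timeReg le_rfl hT.le
  obtain ⟨L₂, hL₂, r₂⟩ := h₀u.exists_timeReg₂ le_rfl hT.le
  refine ⟨max (max Lu Lq) (max Lp L₂), fun M hu hq hp => ?_⟩
  have he : M.elements =ᵐ[volume] M₀.elements := M.elements_ae_eq.trans M₀.elements_ae_eq.symm
  obtain ⟨Lu', ru'⟩ := hu.exists_timeReg one_le_two hT.le
  obtain ⟨Lq', rq'⟩ := hq.exists_timeReg le_rfl hT.le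
  obtain ⟨Lp', rp'⟩ := hp.exists_timeReg le_rfl hT.le
  obtain ⟨L₂', -, r₂'⟩ := hu.exists_timeReg₂ le_rfl hT.le
  exact ⟨hexact, hT,
    (ru.transfer M.isOpen_elements M₀.isOpen_elements he ru').mono
      ((le_max_left _ _).trans (le_max_left _ _)),
    (rq.transfer M.isOpen_elements M₀.isOpen_elements he rq').mono
      ((le_max_right _ _).trans (le_max_left _ _)),
    (rp.transfer M.isOpen_elements M₀.isOpen_elements he rp').mono
      ((le_max_left _ _).trans (le_max_right _ _)),
    (r₂.transfer M.isOpen_elements M₀.isOpen_elements he r₂').mono hL₂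
      ((le_max_right _ _).trans (le_max_right _ _))⟩

end KdVHDG

end
theorem theorem2p3 (k : ℕ) (hk : 0 < k) (a b T : ℝ) (hab : a < b) (hT : 0 < T)
    (f : ℝ → ℝ → ℝ) (u0 uDa uDb qN : ℝ → ℝ) (u q p ut : ℝ → ℝ → ℝ)
    (hexact : KdVHDG.IsExactSolution a b T f u0 uDa uDb qN u q p ut)
    (τmin τmax : ℝ) (hτmin : 0 < τmin) :
    ∃ C > (0 : ℝ), ∃ h₀ > (0 : ℝ),
      ∀ M : KdVHDG.Mesh a b, M.size ≤ h₀ →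
      KdVHDG.MemWInftySobolev 2 T (k + 1) M.elements u →
      KdVHDG.MemWInftySobolev 1 T (k + 1) M.elements q →
      KdVHDG.MemWInftySobolev 1 T (k + 1) M.elements p →
      ∀ τ : KdVHDG.Stabilization M.N, τ.Admissible →
      (∀ i, τ.quM i ∈ Set.Icc τmin τmax) →
      ∀ (s : ℝ → KdVHDG.State M) (uht : ℝ → M.PW),
      KdVHDG.IsHDGSolution M k τ T f u0 uDa uDb qN s uht →
      ∃ Pu Pq Pp Put : ℝ → M.PW,
        (∀ t ∈ Set.Icc 0 T,
          KdVHDG.IsProjection M k τ (u t) (q t) (p t) (Pu t) (Pq t) (Pp t) ∧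
          ∀ Qu Qq Qp : M.PW, KdVHDG.IsProjection M k τ (u t) (q t) (p t) Qu Qq Qp →
            Qu = Pu t ∧ Qq = Pq t ∧ Qp = Pp t) ∧
        KdVHDG.HasTimeDeriv M T Pu Put ∧
        ∀ t ∈ Set.Icc 0 T,
          M.norm (Pu t - (s t).u) + M.norm (Pq t - (s t).q) + M.norm (Pp t - (s t).p)
            + M.norm (Put t - uht t) ≤ C * M.size ^ (k + 1) := by
  obtain ⟨n, rfl⟩ := Nat.exists_eq_add_of_le' hk
  -- The constants are chosen before the mesh while regularity is assumed on the mesh. If some mesh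
  -- admits the regularity, its bound supplies `C` for all; otherwise the claim is vacuous.
  by_cases hreg : ∃ M₀ : KdVHDG.Mesh a b,
      KdVHDG.MemWInftySobolev 2 T (n + 1 + 1) M₀.elements u ∧
      KdVHDG.MemWInftySobolev 1 T (n + 1 + 1) M₀.elements q ∧
      KdVHDG.MemWInftySobolev 1 T (n + 1 + 1) M₀.elements p
  · obtain ⟨M₀, h₀u, h₀q, h₀p⟩ := hreg
    obtain ⟨L, hL⟩ := KdVHDG.exists_regSol hT hexact h₀u h₀q h₀p
    set A := max 1 (max τmax τmin⁻¹)
    have hA : 1 ≤ A := le_max_left _ _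
    refine ⟨|KdVHDG.RegSol.errConst n A (b - a) T L| + 1, by positivity, 1, one_pos,
      fun M hM hu hq hp τ hτ hτI s uht hh => ?_⟩
    obtain ⟨Pu, Pq, Pp, Put, h1, h2, h3⟩ := (hL M hu hq hp).error_le hab hM hτ hA
      (hτ.stabBound hτmin hτI hA ((le_max_left _ _).trans (le_max_right _ _))
        ((le_max_right _ _).trans (le_max_right _ _))) hh
    refine ⟨Pu, Pq, Pp, Put, h1, h2, fun t ht => (h3 t ht).trans
      (mul_le_mul_of_nonneg_right ?_ (pow_nonneg M.size_nonneg _))⟩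
    linarith [le_abs_self (KdVHDG.RegSol.errConst n A (b - a) T L)]
  · exact ⟨1, one_pos, 1, one_pos, fun M _ hu hq hp => absurd ⟨M, hu, hq, hp⟩ hreg⟩
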